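/- Let $n\ge 0$. For $\tau$ in the upper half-plane $\mathbb H$ put $\Lambda_\tau=\mathbb Z+\mathbb Z\tau$, $E_\tau=\mathbb C/\Lambda_\tau$, $d^2z=\frac i2\,dz\wedge d\bar z$, and let $\Delta\subset E_\tau^n$ be the union of the diagonals $\{z_i=z_j\}$, $i\ne j$. Let $\Phi(z_1,\dots,z_n;\tau)$ be a meromorphic function on $\mathbb C^n\times\mathbb H$ that is elliptic, i.e. $\Phi(z+\lambda;\tau)=\Phi(z;\tau)$ for all $\lambda\in\Lambda_\tau^n$, and holomorphic away from the diagonals, i.e. its poles lie on the divisors $z_i-z_j-\lambda=0$ with $i\neq j$ and $\lambda\in\Lambda_\tau$. Let $\mathcal A^{p,q}(\star\Delta)$ be the smooth $(p,q)$-forms on $E_\tau^n\setminus\Delta$ that are locally a smooth form divided by a product of powers of the local equations $z_i-z_j$ of the diagonals, and let $\mathcal A^{2n}(\log\Delta)$ be the $2n$-forms that are locally combinations, with smooth coefficients, of products of the forms $dz_k$, $d\bar z_k$ and $\frac{d(z_i-z_j)}{z_i-z_j}$. For a $2n$-form $\omega\in\mathcal A^{n,n}(\star\Delta)$ the regularized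 integral is $$\operatorname{reg}\!\!\int_{E_\tau^n}\omega:=\int_{E_\tau^n}\alpha,\qquad \omega=\alpha+\partial\beta,\quad \alpha\in\mathcal A^{2n}(\log\Delta),\ \beta\in\mathcal A^{n-1,n}(\star\Delta).$$ Let $\mathcal O_{\mathbb H}[\frac1{\operatorname{Im}\tau}]$ be the space of functions $f=\sum_{i=0}^N f_i(\tau)/(\operatorname{Im}\tau)^i$ on $\mathbb H$ with all $f_i$ holomorphic; the holomorphic limit of $f$ is $\lim_{\bar\tau\to\infty}f:=f_0$. (0) For every $\tau$, the form $\omega_\tau=\Big(\prod_{i=1}^n\frac{d^2z_i}{\operatorname{Im}\tau}\Big)\Phi(z_1,\dots,z_n;\tau)$ has a decomposition $\omega_\tau=\alpha+\partial\beta$ as above; for each such decomposition $\int_{E_\tau^n}\alpha$ converges absolutely, and its value does not depend on the decomposition. So $$I(\tau):=\operatorname{reg}\!\!\int_{E_\tau^n}\Big(\prod_{i=1}^n\frac{d^2z_i}{\operatorname{Im}\tau}\Big)\Phi(z_1,\dots,z_n;\tau)$$ is well defined. (1) $I\in\mathcal O_{\mathbb H}[\frac1{\operatorname{Im}\tau}]$.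 (2) For each $\tau$ let $A_1,\dots,A_n$ be pairwise disjoint closed $C^1$ curves on $E_\tau$ representing the $A$-cycle class, i.e. the class of the image of the segment from $\tau$ to $\tau+1$ (for example, the images of the segments from $\epsilon_i\tau$ to $\epsilon_i\tau+1$ with $0<\epsilon_1<\dots<\epsilon_n<1$, which give the ordered $A$-cycle integrals). Then $$\lim_{\bar\tau\to\infty}I(\tau)=\frac1{n!}\sum_{\sigma\in S_n}\int_{A_1}dz_{\sigma(1)}\cdots\int_{A_n}dz_{\sigma(n)}\,\Phi(z_1,\dots,z_n;\tau).$$ (3) Suppose that $\Phi$ is modular of weight $m\in\mathbb Z$, i.e. $\Phi\big(\frac{z_1}{c\tau+d},\dots,\frac{z_n}{c\tau+d};\frac{a\tau+b}{c\tau+d}\big)=(c\tau+d)^m\,\Phi(z_1,\dots,z_n;\tau)$ for all $\begin{pmatrix}a&b\\c&d\end{pmatrix}\in\mathrm{SL}_2(\mathbb Z)$. Then $I\big(\frac{a\tau+b}{c\tau+d}\big)=(c\tau+d)^mI(\tau)$ for all these matrices. Consequently the right-hand side $f$ of (2) is quasi-modular of weight $m$: it is holomorphic on $\mathbb H$, and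 there are $\ell\geq 0$ and holomorphic functions $f_1,\dots,f_\ell$ on $\mathbb H$ with $$f\Big(\frac{a\tau+b}{c\tau+d}\Big)=(c\tau+d)^mf(\tau)+\sum_{i=1}^{\ell}c^i(c\tau+d)^{m-i}f_i(\tau)\qquad\text{for all }\begin{pmatrix}a&b\\c&d\end{pmatrix}\in\mathrm{SL}_2(\mathbb Z).$$ -/

import Mathlib

open scoped UpperHalfPlane MatrixGroups Manifold ContDiff Topology
open MeasureTheory

noncomputable section

namespace EllipticConfig

/-! ### Functions on `ℂⁿ × ℍ` -/

/-- The lattice `Λ_τ = ℤ + ℤ τ`. -/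
def lattice (τ : ℂ) : Set ℂ := {w | ∃ k l : ℤ, w = k + l * τ}

/-- The preimage in `ℂⁿ` of the big diagonal of `E_τⁿ`. -/
def bigDiagonal (n : ℕ) (τ : ℂ) : Set (Fin n → ℂ) :=
  {z | ∃ i j, i ≠ j ∧ z i - z j ∈ lattice τ}

/-- A function that is meromorphic at every point of `U`: locally a quotient `f / g` of holomorphic
functions with `g` not identically zero. Its values where the denominator vanishes are not
constrained. -/
def IsMeromorphicOn {E : Type*} [NormedAddCommGroup E] [NormedSpace ℂ E]
    (Φ : E → ℂ) (U : Set E) : Prop :=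
  ∀ x ∈ U, ∃ f g : E → ℂ, AnalyticAt ℂ f x ∧ AnalyticAt ℂ g x ∧ (∃ᶠ y in 𝓝 x, g y ≠ 0) ∧
    ∀ᶠ y in 𝓝 x, g y ≠ 0 → Φ y = f y / g y

/-- All poles lie on the divisors `z_i - z_j - λ = 0`, `i ≠ j`, `λ ∈ Λ_τ`. -/
def IsHolomorphicAwayFromDiagonals {n : ℕ} (Φ : (Fin n → ℂ) × ℂ → ℂ) : Prop :=
  AnalyticOnNhd ℂ Φ {x | 0 < x.2.im ∧ x.1 ∉ bigDiagonal n x.2}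

/-- Invariance of a function on `ℂⁿ`, off the diagonals, under translations by `Λ_τⁿ`, that is,
the function comes from the complement of the big diagonal in `E_τⁿ`. -/
def IsPeriodic {n : ℕ} (τ : ℍ) (F : (Fin n → ℂ) → ℂ) : Prop :=
  ∀ z ∉ bigDiagonal n τ, ∀ l : Fin n → ℂ, (∀ i, l i ∈ lattice τ) → F (z + l) = F z

def IsElliptic {n : ℕ} (Φ : (Fin n → ℂ) × ℂ → ℂ) : Prop :=
  ∀ τ : ℍ, IsPeriodic τ fun z => Φ (z, τ)

/-- The automorphy factor `c τ + d`. -/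
def autFactor (γ : SL(2, ℤ)) (τ : ℍ) : ℂ := (γ 1 0 : ℂ) * τ + (γ 1 1 : ℂ)

/-- Modularity of weight `m` on `ℂⁿ × ℍ` (an identity of meromorphic functions, hence required
only off the diagonals). -/
def IsModularOfWeight {n : ℕ} (m : ℤ) (Φ : (Fin n → ℂ) × ℂ → ℂ) : Prop :=
  ∀ (γ : SL(2, ℤ)) (τ : ℍ), ∀ z ∉ bigDiagonal n τ,
    Φ (fun i => z i / autFactor γ τ, (γ • τ : ℍ)) = autFactor γ τ ^ m * Φ (z, τ)

/-! ### Functions on `ℍ` -/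

def IsModularFunctionOfWeight (m : ℤ) (f : ℍ → ℂ) : Prop :=
  ∀ (γ : SL(2, ℤ)) (τ : ℍ), f (γ • τ) = autFactor γ τ ^ m * f τ

/-- `f` is quasi-modular of weight `m` and holomorphic on `ℍ`. -/
def IsQuasiModularOfWeight (m : ℤ) (f : ℍ → ℂ) : Prop :=
  MDifferentiable 𝓘(ℂ) 𝓘(ℂ) f ∧ ∃ (d : ℕ) (c : ℕ → ℍ → ℂ), (∀ i, MDifferentiable 𝓘(ℂ) 𝓘(ℂ) (c i)) ∧
    ∀ (γ : SL(2, ℤ)) (τ : ℍ), f (γ • τ) = autFactor γ τ ^ m * f τ +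
      ∑ i ∈ Finset.Icc 1 d, (γ 1 0 : ℂ) ^ i * autFactor γ τ ^ (m - i) * c i τ

/-- `f = ∑_{i ≤ N} c_i / (im τ)^i` with all `c_i` holomorphic on `ℍ`. -/
def IsAlmostHolomorphicExpansion (f : ℍ → ℂ) (N : ℕ) (c : ℕ → ℍ → ℂ) : Prop :=
  (∀ i, MDifferentiable 𝓘(ℂ) 𝓘(ℂ) (c i)) ∧
    ∀ τ : ℍ, f τ = ∑ i ∈ Finset.range (N + 1), c i τ / (τ.im : ℂ) ^ i

/-- `f ∈ 𝒪_ℍ[1 / im τ]`. -/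
def IsAlmostHolomorphic (f : ℍ → ℂ) : Prop :=
  ∃ N c, IsAlmostHolomorphicExpansion f N c

/-- `f ∈ 𝒪_ℍ[1 / im τ]`, and its holomorphic limit, the coefficient of `(1 / im τ)^0`, is `f₀`. -/
def HasHolomorphicLimit (f f₀ : ℍ → ℂ) : Prop :=
  ∃ N c, IsAlmostHolomorphicExpansion f N c ∧ c 0 = f₀

/-! ### Regularized integrals on `E_τⁿ`

Functions and forms on `E_τⁿ` are written as `Λ_τⁿ`-periodic objects on `ℂⁿ`. A form of degree `2n`
is given by its coefficient with respect to `d²z_1 ⋯ d²z_n`, where `d²z = (i/2) dz ∧ dz̄` is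
Lebesgue measure on `ℂ`. -/

/-- The pairs `(i, j)` whose diagonal passes through (the image of) `p`. -/
def diagonalThrough {n : ℕ} (τ : ℍ) (p : Fin n → ℂ) (e : Fin n × Fin n) : Prop :=
  e.1 ≠ e.2 ∧ p e.1 - p e.2 ∈ lattice τ

/-- The local equation `z_i - z_j - λ`, `λ = p_i - p_j`, of a diagonal through `p`. -/
def localEquation {n : ℕ} (p : Fin n → ℂ) (e : Fin n × Fin n) (z : Fin n → ℂ) : ℂ :=
  (z e.1 - z e.2) - (p e.1 - p e.2)

open scoped Classical in
/-- Smooth functions on `E_τⁿ` minus the big diagonal with holomorphic poles of arbitrary order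
along the big diagonal: near each point, a smooth function divided by a power of the product of the
local equations of the diagonals. -/
def HasHolomorphicPoles {n : ℕ} (τ : ℍ) (G : (Fin n → ℂ) → ℂ) : Prop :=
  IsPeriodic τ G ∧ ∀ p : Fin n → ℂ, ∃ (U : Set (Fin n → ℂ)) (N : ℕ) (h : (Fin n → ℂ) → ℂ),
    IsOpen U ∧ p ∈ U ∧ ContDiffOn ℝ ∞ h U ∧ ∀ z ∈ U, z ∉ bigDiagonal n τ →
      G z = h z / (∏ e : Fin n × Fin n with diagonalThrough τ p e, localEquation p e z) ^ N

open scoped Classical in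
/-- Near `p`, the generators in degree one of the algebra of logarithmic forms: `Sum.inl j` stands
for `dz_j`, and `Sum.inr (i, j)` for `d(z_i - z_j) / (z_i - z_j - λ)` if the diagonal of `(i, j)`
passes through `p` (and for `0` otherwise). The value is the vector of coefficients with respect to
`dz_1, …, dz_n` at the point `z`. -/
def logGenerator {n : ℕ} (τ : ℍ) (p z : Fin n → ℂ) :
    Fin n ⊕ (Fin n × Fin n) → Fin n → ℂ
  | Sum.inl j => Pi.single j 1
  | Sum.inr e =>
    if diagonalThrough τ p e then
      (localEquation p e z)⁻¹ • (Pi.single e.1 1 - Pi.single e.2 1)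
    else 0

/-- The coefficient of a form of degree `2n` on `E_τⁿ` that is logarithmic along the big diagonal:
near each point the form is a combination, with smooth coefficients, of `n`-fold wedge products of
the generators (times `dz̄_1 ⋯ dz̄_n`); the coefficient of such a wedge product with respect to
`dz_1 ∧ ⋯ ∧ dz_n` is a determinant. -/
def IsLogarithmic {n : ℕ} (τ : ℍ) (a : (Fin n → ℂ) → ℂ) : Prop :=
  IsPeriodic τ a ∧ ∀ p : Fin n → ℂ, ∃ (U : Set (Fin n → ℂ))
      (c : (Fin n → Fin n ⊕ (Fin n × Fin n)) → (Fin n → ℂ) → ℂ),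
    IsOpen U ∧ p ∈ U ∧ (∀ r, ContDiffOn ℝ ∞ (c r) U) ∧ ∀ z ∈ U, z ∉ bigDiagonal n τ →
      a z = ∑ r, c r z * Matrix.det (Matrix.of fun k => logGenerator τ p z (r k))

/-- The Wirtinger derivative `∂/∂z_i = (∂/∂x_i - i ∂/∂y_i) / 2`. -/
def wirtinger {n : ℕ} (i : Fin n) (g : (Fin n → ℂ) → ℂ) (z : Fin n → ℂ) : ℂ :=
  (1 / 2) * (fderiv ℝ g z (Pi.single i 1) - Complex.I * fderiv ℝ g z (Pi.single i Complex.I))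

/-- A decomposition `ω = α + ∂β` of the form `ω = F d²z_1 ⋯ d²z_n`, with `α = a d²z_1 ⋯ d²z_n`
logarithmic and `β` of type `(n-1, n)` with holomorphic poles. Up to signs and powers of `i/2`,
`g i` is the coefficient of `β` at the product of all `dz_k`, `k ≠ i`, and all `dz̄_k`, normalized so
that `∂β = (∑ i, ∂(g i)/∂z_i) d²z_1 ⋯ d²z_n`. -/
def IsDecomposition {n : ℕ} (τ : ℍ) (F a : (Fin n → ℂ) → ℂ) (g : Fin n → (Fin n → ℂ) → ℂ) : Prop :=
  IsLogarithmic τ a ∧ (∀ i, HasHolomorphicPoles τ (g i)) ∧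
    ∀ z ∉ bigDiagonal n τ, F z = a z + ∑ i, wirtinger i (g i) z

/-- The `n`-th power of the parallelogram with vertices `0, 1, 1 + τ, τ`, a fundamental domain
for `E_τⁿ`. -/
def fundamentalDomain (n : ℕ) (τ : ℍ) : Set (Fin n → ℂ) :=
  {z | ∀ i, ∃ s ∈ Set.Ico (0 : ℝ) 1, ∃ t ∈ Set.Ico (0 : ℝ) 1, z i = s + t * (τ : ℂ)}

open scoped Classical in
/-- The regularized integral over `E_τⁿ` of `F d²z_1 ⋯ d²z_n`: the integral of `α` for a
decomposition `ω = α + ∂β`. -/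
def regularizedIntegral {n : ℕ} (τ : ℍ) (F : (Fin n → ℂ) → ℂ) : ℂ :=
  if h : ∃ a g, IsDecomposition τ F a g then ∫ z in fundamentalDomain n τ, h.choose z else 0

/-- A decomposition exists, and for every decomposition the integral of `α` converges absolutely
and has the same value. -/
def RegularizedIntegralWellDefined {n : ℕ} (τ : ℍ) (F : (Fin n → ℂ) → ℂ) : Prop :=
  (∃ a g, IsDecomposition τ F a g) ∧ ∀ a g, IsDecomposition τ F a g →
    IntegrableOn a (fundamentalDomain n τ) ∧
      ∫ z in fundamentalDomain n τ, a z = regularizedIntegral τ F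

/-- The integrand `∏ d²z_i / im τ · Φ` at `τ`. -/
def normalizedIntegrand {n : ℕ} (Φ : (Fin n → ℂ) × ℂ → ℂ) (τ : ℍ) (z : Fin n → ℂ) : ℂ :=
  (∏ _i : Fin n, 1 / (τ.im : ℂ)) * Φ (z, τ)

/-! ### Integrals over `A`-cycles -/

/-- `n` pairwise disjoint closed curves on `E_τ` representing the class of the `A`-cycle. A closed
curve is given by a lift to `ℂ`, parametrized by `ℝ` with period one; it is in the class of `A`, the
class of the segment from `τ` to `τ + 1`, exactly if the lift increases by `1` over a period. -/
def IsDisjointACycles {n : ℕ} (τ : ℍ) (A : Fin n → ℝ → ℂ) : Prop :=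
  (∀ i, ContDiff ℝ 1 (A i) ∧ ∀ t, A i (t + 1) = A i t + 1) ∧
    ∀ i j, i ≠ j → ∀ s t, A i s - A j t ∉ lattice τ

/-- `∫_{A_1} dz_{σ(1)} ⋯ ∫_{A_n} dz_{σ(n)} F`, where `z_{σ(i)} = A_i(t_i)` runs through `A_i`. -/
def aCycleIntegral {n : ℕ} (A : Fin n → ℝ → ℂ) (σ : Equiv.Perm (Fin n))
    (F : (Fin n → ℂ) → ℂ) : ℂ :=
  ∫ t in Set.Icc (0 : Fin n → ℝ) 1,
    (∏ i, deriv (A i) (t i)) * F fun k => A (σ.symm k) (t (σ.symm k))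

/-- The average of the `A`-cycle integrals over all orderings of the variables. -/
def averagedACycleIntegral {n : ℕ} (A : Fin n → ℝ → ℂ) (F : (Fin n → ℂ) → ℂ) : ℂ :=
  1 / (n.factorial : ℂ) * ∑ σ : Equiv.Perm (Fin n), aCycleIntegral A σ F

end EllipticConfig

end

open EllipticConfig

open scoped ComplexConjugate
open Complex (I I_ne_zero I_sq add_im continuous_im exp_ne_zero imCLM intCast_im mul_conj normSq normSq_pos norm_real ofRealCLM ofReal_intCast re_add_im real_smul slitPlane two_pi_I_ne_zero)
open ContinuousLinearMap (coe_restrictScalars' fst id_apply inl inr proj snd)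
open Filter (Eventually Tendsto atTop eventually_all inter_mem univ_mem)
open Finset (HasAntidiagonal mem_filter mem_insert mem_range mem_singleton mem_univ mul_sum prod_congr prod_eq_zero range subset_union_left subset_union_right sum_add_distrib sum_congr sum_div sum_eq_zero sum_image sum_insert sum_mul sum_singleton sum_subset)
open Function (Injective Periodic comp_def iterate_one iterate_succ_apply iterate_succ_apply' update)
open Metric (ball ball_mem_nhds closedBall isOpen_ball mem_ball_self mem_closedBall)
open Real (norm_eq_abs pi pi_pos smoothTransition two_pi_pos)
open Set (Icc Ico Iio Ioi Ioo indicator indicator_of_mem inter_subset_left mem_iUnion mem_ofPred_eq mem_preimage range)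

noncomputable section

namespace EllipticConfig

/-- Complex coordinate space. -/
local notation:max "ℂ^" n:max => Fin n → ℂ

/-- Real coordinate space. -/
local notation:max "ℝ^" n:max => Fin n → ℝ

/-- Smoothness over the reals. -/
local notation "Smooth" => ContDiff ℝ ∞
local notation "SmoothOn" => ContDiffOn ℝ ∞
local notation "SmoothAt" => ContDiffAt ℝ ∞

local notation:10000 n "!" => Nat.factorial n

variable {ι E : Type*} [NormedAddCommGroup E] [NormedSpace ℂ E] {n N : ℕ} {τ : ℍ} {f g h : ℂ → ℂ} {c v w : ℂ}
  {z : ℂ^n} {F D : ℂ^n → ℂ} {Φ : ℂ^n × ℂ → ℂ}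

/-! Well-definedness. In one variable, `h / w ^ (N + 1)` with `h` smooth of compact support gets the
regularized integral `Lf N h`, which is `∫ ∂^N h / w` divided by `N!`. This value is compatible with
cancelling powers of `w` (`Lf_raise`) and equals the Lebesgue integral whenever that converges
absolutely (`Lf_of_integrable`), so it depends only on the function and not on its presentation
(`HasPV.unique`). By partial fractions, test functions divided by equations of diagonals form a
class that is stable under integrating out one variable (`IsK.pvAt_spec`). Iteration gives a linear
functional `ℓ` on this class that kills holomorphic derivatives, is invariant under `Λⁿ` and extends
the integral (`IsReg`, `isReg_regC`). If `χ` is a cutoff function whose lattice translates add up to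
one, then `∫ α = ℓ (χ ω)` for every decomposition `ω = α + ∂β` (`IsDecomposition.integral_eq`),
which proves independence. A decomposition exists because `χ ω` can be reduced to simple poles
modulo exact terms, one variable at a time (`hasReduction`), and the result can be summed over the
lattice (`exists_isDecomposition`).

Expansion in `1 / im τ`. A Cauchy integral shows that `Φ` is locally a holomorphic function divided
by equations of diagonals (`isFam_of_isMeromorphicOn`), and its Laurent coefficients along a
diagonal are functions of the same kind in one variable less (`IsFam.exists_laurent`). For a
periodic weight `ρ` in the heights `y_i = im z_i / im τ`, let `wreg Φ ρ` be the normalized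
regularized integral of `ρ(y) Φ`. Since `Φ` is holomorphic, `∂̄_i (V(y) Φ)` is `i / (2 im τ)` times
`∂V/∂y_i · Φ`, and the residue formula (`regularizedIntegral_dzbar`) expresses `wreg Φ (∂V/∂y_i)` by
integrals over `n - 1` variables, with powers of `1 / im τ` coming from the Taylor expansion of `V`
(`wreg_pd`). This handles all weights of mean zero in `y_i`. Weights that vanish near the walls `y_i
- y_j ∈ ℤ` need no regularization and give functions holomorphic in `τ` (`wreg_eq_integral`); one of
them with nonzero mean settles the constant weight. By induction on `n` all weights have expansions
(`hasBound_wreg`).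

Holomorphic limit. Terms divided by a positive power of `im τ` have limit zero. Hence the leading
coefficient involves only the primitive `V` and not its derivatives, and it is bounded by the
`L¹`-norm of the weight. So the constant weight may be approximated in `L¹` by symmetric weights
vanishing near the walls, for which the leading coefficient is an average of integrals over
horizontal lines (`hasHolomorphicLimit_wreg`).

Independence of the cycles. Under `z ↦ exp(2πiz)` the curves become closed curves in the plane. An
integral over one of them is an integral over the plane against `∂̄` of a cutoff function, so it
depends only on winding numbers and extends holomorphically in the other variables
(`integral_loop_eq`, `exists_push`). Therefore the iterated integral depends only on the relative
position of the curves (`exists_integral_eq`), every system of disjoint curves is positioned like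
horizontal lines (`isSystem`), and averaging over the symmetric group removes the remaining
dependence on the heights (`sum_lineInt_eq`).

Modularity follows by scaling the variables by `cτ + d`. Quasi-modularity of the limit follows from
`1 / im (γτ) = (cτ + d)² / im τ - 2ic (cτ + d)` and the uniqueness of the coefficients of an
expansion (`IsAlmostHolomorphicExpansion.eq_zero`). -/

lemma sum_rel {X B : Type*} [AddCommMonoid B] {R : (X → ℂ) → B → Prop} (h0 : R (fun _ => 0) 0)
    (ha : ∀ {f g b c}, R f b → R g c → R (fun x => f x + g x) (b + c)) (s : Finset ι)
    {f : ι → X → ℂ} {b : ι → B} (h : ∀ i ∈ s, R (f i) (b i)) : R (fun x => ∑ i ∈ s, f i x) (∑ i ∈ s, b i) := by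
  classical
  induction s using Finset.induction_on with
  | empty => simpa using h0
  | insert a s ha' ih =>
    simp only [sum_insert ha']
    exact ha (h a (by simp)) (ih fun i hi => h i (by simp [hi]))

lemma sum_prop {X : Type*} {P : (X → ℂ) → Prop} (h0 : P fun _ => 0)
    (ha : ∀ {f g}, P f → P g → P fun x => f x + g x) (s : Finset ι) {f : ι → X → ℂ}
    (h : ∀ i ∈ s, P (f i)) : P fun x => ∑ i ∈ s, f i x :=
  sum_rel (R := fun f _ => P f) (b := fun _ => (0 : ℕ)) h0 ha s h

lemma eventually_nhds_of_ne {X : Type*} [TopologicalSpace X] {a : X} {p : X → Prop}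
    (h : ∀ᶠ x in 𝓝[≠] a, p x) (ha : p a) : ∀ᶠ x in 𝓝 a, p x := by
  filter_upwards [eventually_nhdsWithin_iff.1 h] with x hx
  by_cases e : x = a
  exacts [e ▸ ha, hx e]

/-! ### Wirtinger derivatives -/

section Wirtinger

variable {F : Type*} [NormedAddCommGroup F] [NormedSpace ℂ F]

/-- The holomorphic derivative `∂_v g = (D g v - i D g (i v)) / 2` in the direction `v`. -/
def dz (v : E) (g : E → ℂ) (x : E) : ℂ := (1 / 2) * (fderiv ℝ g x v - I * fderiv ℝ g x (I • v))

/-- The antiholomorphic derivative in the direction `v`. -/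
def dzbar (v : E) (g : E → ℂ) (x : E) : ℂ := (1 / 2) * (fderiv ℝ g x v + I * fderiv ℝ g x (I • v))

lemma wirtinger_eq_dz (i : Fin n) (g : ℂ^n → ℂ) : wirtinger i g = dz (Pi.single i 1) g := by
  funext z
  have : (I • (Pi.single i 1 : ℂ^n)) = Pi.single i I := by rw [← Pi.single_smul]; simp
  simp [wirtinger, dz, this]

variable {g h : E → ℂ} {x : E}

lemma dz_congr (v : E) (hg : g =ᶠ[𝓝 x] h) : dz v g x = dz v h x := by simp [dz, hg.fderiv_eq]

lemma dzbar_congr (v : E) (hg : g =ᶠ[𝓝 x] h) : dzbar v g x = dzbar v h x := by simp [dzbar, hg.fderiv_eq]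

lemma dz_eventuallyEq (v : E) (hg : g =ᶠ[𝓝 x] h) : dz v g =ᶠ[𝓝 x] dz v h :=
  hg.eventuallyEq_nhds.mono fun _ hy => dz_congr v hy

lemma dz_const (v : E) (c : ℂ) : dz v (fun _ => c) x = 0 := by simp [dz]

lemma dzbar_const (v : E) (c : ℂ) : dzbar v (fun _ => c) x = 0 := by simp [dzbar]

lemma dz_add (v : E) (hg : DifferentiableAt ℝ g x) (hh : DifferentiableAt ℝ h x) :
    dz v (fun y => g y + h y) x = dz v g x + dz v h x := by
  simp only [dz, fderiv_fun_add hg hh, add_apply]; ring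

lemma dzbar_add (v : E) (hg : DifferentiableAt ℝ g x) (hh : DifferentiableAt ℝ h x) :
    dzbar v (fun y => g y + h y) x = dzbar v g x + dzbar v h x := by
  simp only [dzbar, fderiv_fun_add hg hh, add_apply]; ring

lemma dz_sum (s : Finset ι) (v : E) {G : ι → E → ℂ} (hG : ∀ i ∈ s, DifferentiableAt ℝ (G i) x) :
    dz v (fun y => ∑ i ∈ s, G i y) x = ∑ i ∈ s, dz v (G i) x := by
  simp only [dz, fderiv_fun_sum hG, sum_apply, mul_sum, ← Finset.sum_sub_distrib]

lemma dzbar_sum (s : Finset ι) (v : E) {G : ι → E → ℂ} (hG : ∀ i ∈ s, DifferentiableAt ℝ (G i) x) :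
    dzbar v (fun y => ∑ i ∈ s, G i y) x = ∑ i ∈ s, dzbar v (G i) x := by
  simp only [dzbar, fderiv_fun_sum hG, sum_apply, mul_sum, ← sum_add_distrib]

lemma dz_mul (v : E) (hg : DifferentiableAt ℝ g x) (hh : DifferentiableAt ℝ h x) :
    dz v (fun y => g y * h y) x = dz v g x * h x + g x * dz v h x := by
  simp only [dz, fderiv_fun_mul hg hh, add_apply, smul_apply, smul_eq_mul]; ring

lemma dzbar_mul (v : E) (hg : DifferentiableAt ℝ g x) (hh : DifferentiableAt ℝ h x) :
    dzbar v (fun y => g y * h y) x = dzbar v g x * h x + g x * dzbar v h x := by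
  simp only [dzbar, fderiv_fun_mul hg hh, add_apply, smul_apply, smul_eq_mul]; ring

lemma dz_const_mul (v : E) (c : ℂ) (hg : DifferentiableAt ℝ g x) :
    dz v (fun y => c * g y) x = c * dz v g x := by
  rw [dz_mul v (differentiableAt_const c) hg, dz_const]; ring

lemma dzbar_const_mul (v : E) (c : ℂ) (hg : DifferentiableAt ℝ g x) :
    dzbar v (fun y => c * g y) x = c * dzbar v g x := by
  rw [dzbar_mul v (differentiableAt_const c) hg, dzbar_const]; ring

lemma dz_add_dir (v w : E) (g : E → ℂ) (x : E) : dz (v + w) g x = dz v g x + dz w g x := by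
  simp only [dz, smul_add, map_add]; ring

/-- `dz v g` evaluates the `ℂ`-linear part of the real differential at `v`. Hence complex scalars
come out of the direction, although the differential itself is only real linear. -/
lemma dz_smul_dir (c : ℂ) (v : E) (g : E → ℂ) (x : E) : dz (c • v) g x = c * dz v g x := by
  have h1 : c • v = c.re • v + c.im • (I • v) := by
    conv_lhs => rw [← re_add_im c, add_smul, mul_smul]
    simp [Complex.coe_smul]
  have h2 : I • (c • v) = c.re • (I • v) - c.im • v := by
    rw [h1, smul_add, smul_comm I c.re, smul_comm I c.im, smul_smul I, Complex.I_mul_I]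
    simp [sub_eq_add_neg]
  simp only [dz, h2]
  rw [h1]
  simp only [map_add, map_sub, map_smul, real_smul]
  conv_rhs => rw [← re_add_im c]
  linear_combination (1/2 : ℂ) * (c.im : ℂ) * fderiv ℝ g x (I • v) * I_sq

lemma dz_zero_dir (g : E → ℂ) (x : E) : dz (0 : E) g x = 0 := by simp [dz]

lemma dz_comp {φ : F → E} {A : F →L[ℂ] E} {y : F} (v : F) (hg : DifferentiableAt ℝ g (φ y))
    (hφ : HasFDerivAt φ A y) : dz v (fun t => g (φ t)) y = dz (A v) g (φ y) := by
  have h1 : HasFDerivAt (fun t => g (φ t)) ((fderiv ℝ g (φ y)).comp (A.restrictScalars ℝ)) y :=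
    hg.hasFDerivAt.comp y (hφ.restrictScalars ℝ)
  simp [dz, h1.fderiv]

lemma dzbar_comp {φ : F → E} {A : F →L[ℂ] E} {y : F} (v : F) (hg : DifferentiableAt ℝ g (φ y))
    (hφ : HasFDerivAt φ A y) : dzbar v (fun t => g (φ t)) y = dzbar (A v) g (φ y) := by
  have h1 : HasFDerivAt (fun t => g (φ t)) ((fderiv ℝ g (φ y)).comp (A.restrictScalars ℝ)) y :=
    hg.hasFDerivAt.comp y (hφ.restrictScalars ℝ)
  simp [dzbar, h1.fderiv]

lemma dz_of_holomorphic (v : E) (hg : DifferentiableAt ℂ g x) : dz v g x = fderiv ℂ g x v := by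
  have := hg.fderiv_restrictScalars ℝ
  simp only [dz, this, coe_restrictScalars', map_smul, smul_eq_mul]
  linear_combination (-1/2 : ℂ) * fderiv ℂ g x v * I_sq

lemma dzbar_of_holomorphic (v : E) (hg : DifferentiableAt ℂ g x) : dzbar v g x = 0 := by
  have := hg.fderiv_restrictScalars ℝ
  simp only [dzbar, this, coe_restrictScalars', map_smul, smul_eq_mul]
  linear_combination (1/2 : ℂ) * fderiv ℂ g x v * I_sq

lemma contDiffAt_dz (v : E) (hg : SmoothAt g x) : SmoothAt (dz v g) x := by
  have h1 : SmoothAt (fderiv ℝ g) x := hg.fderiv_right (by simp)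
  unfold dz
  exact contDiffAt_const.mul ((h1.clm_apply contDiffAt_const).sub
    (contDiffAt_const.mul (h1.clm_apply contDiffAt_const)))

lemma contDiffAt_dzbar (v : E) (hg : SmoothAt g x) : SmoothAt (dzbar v g) x := by
  have h1 : SmoothAt (fderiv ℝ g) x := hg.fderiv_right (by simp)
  unfold dzbar
  exact contDiffAt_const.mul ((h1.clm_apply contDiffAt_const).add
    (contDiffAt_const.mul (h1.clm_apply contDiffAt_const)))

lemma contDiff_dz (v : E) (hg : Smooth g) : Smooth (dz v g) :=
  contDiff_iff_contDiffAt.2 fun _ => contDiffAt_dz v hg.contDiffAt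

lemma contDiff_dzbar (v : E) (hg : Smooth g) : Smooth (dzbar v g) :=
  contDiff_iff_contDiffAt.2 fun _ => contDiffAt_dzbar v hg.contDiffAt

lemma contDiff_dz_iterate (v : E) (hg : Smooth g) (N : ℕ) : Smooth ((dz v)^[N] g) := by
  induction N with
  | zero => exact hg
  | succ N ih => rw [iterate_succ_apply']; exact contDiff_dz v ih

lemma _root_.ContDiffAt.diffAt (hg : SmoothAt g x) : DifferentiableAt ℝ g x := hg.differentiableAt (by simp)

lemma _root_.ContDiff.diffAt (hg : Smooth g) (x : E) : DifferentiableAt ℝ g x :=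
  hg.contDiffAt.differentiableAt (by simp)

/-- Serves both Wirtinger operators: `s = -I` gives `dz` and `s = I` gives `dzbar`. -/
lemma fderiv_half_add (s : ℂ) (v w : E) (hg : SmoothAt g x) :
    fderiv ℝ (fun y => (1 / 2) * (fderiv ℝ g y v + s * fderiv ℝ g y (I • v))) x w = (1 / 2) *
      (fderiv ℝ (fderiv ℝ g) x w v + s * fderiv ℝ (fderiv ℝ g) x w (I • v)) := by
  have h1 : DifferentiableAt ℝ (fderiv ℝ g) x := (hg.fderiv_right (m := ∞) (by simp)).differentiableAt (by simp)
  have h2 : ∀ u : E, HasFDerivAt (fun y => fderiv ℝ g y u) ((fderiv ℝ (fderiv ℝ g) x).flip u) x :=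
    fun u => by simpa using h1.hasFDerivAt.clm_apply (hasFDerivAt_const u x)
  rw [(((h2 v).fun_add ((h2 (I • v)).const_mul s)).const_mul (1 / 2 : ℂ)).fderiv]
  simp [mul_add]

lemma fderiv_dz (v w : E) (hg : SmoothAt g x) : fderiv ℝ (dz v g) x w = (1 / 2) * (fderiv ℝ (fderiv ℝ g) x w v -
      I * fderiv ℝ (fderiv ℝ g) x w (I • v)) := by
  have := fderiv_half_add (-I) v w hg
  simp only [neg_mul, ← sub_eq_add_neg] at this
  exact this

lemma dz_dz_comm (v w : E) (hg : SmoothAt g x) : dz v (dz w g) x = dz w (dz v g) x := by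
  have hs := (hg.isSymmSndFDerivAt (by simpa using WithTop.coe_le_coe.2 (le_top : (2 : ℕ∞) ≤ ⊤))).eq
  rw [dz, dz, fderiv_dz _ _ hg, fderiv_dz _ _ hg, fderiv_dz _ _ hg, fderiv_dz _ _ hg,
    hs v w, hs v (I • w), hs (I • v) w, hs (I • v) (I • w)]
  ring

lemma dz_dzbar_comm (v w : E) (hg : SmoothAt g x) : dz v (dzbar w g) x = dzbar w (dz v g) x := by
  have hs := (hg.isSymmSndFDerivAt (by simpa using WithTop.coe_le_coe.2 (le_top : (2 : ℕ∞) ≤ ⊤))).eq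
  have hb : ∀ u, fderiv ℝ (dzbar w g) x u = _ := fun u => fderiv_half_add I w u hg
  rw [dz, dzbar, fderiv_dz _ _ hg, fderiv_dz _ _ hg, hb, hb,
    hs v w, hs v (I • w), hs (I • v) w, hs (I • v) (I • w)]
  ring

lemma dz_iterate_dz_comm (v w : E) (hg : Smooth g) (N : ℕ) : (dz v)^[N] (dz w g) = dz w ((dz v)^[N] g) := by
  induction N with
  | zero => rfl
  | succ N ih =>
    rw [iterate_succ_apply', ih, iterate_succ_apply']
    funext x
    exact dz_dz_comm v w (contDiff_dz_iterate v hg N).contDiffAt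

lemma dz_iterate_dzbar_comm (v w : E) (hg : Smooth g) (N : ℕ) :
    (dz v)^[N] (dzbar w g) = dzbar w ((dz v)^[N] g) := by
  induction N with
  | zero => rfl
  | succ N ih =>
    rw [iterate_succ_apply', ih, iterate_succ_apply']
    funext x
    exact dz_dzbar_comm v w (contDiff_dz_iterate v hg N).contDiffAt

lemma dz_iterate_eventuallyEq (v : E) (N : ℕ) (hg : g =ᶠ[𝓝 x] h) : (dz v)^[N] g =ᶠ[𝓝 x] (dz v)^[N] h := by
  induction N with
  | zero => exact hg
  | succ N ih => simpa only [iterate_succ_apply'] using dz_eventuallyEq v ih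

/-! ### Test functions -/

/-- Smooth functions with compact support. -/
def IsTest (h : E → ℂ) : Prop := Smooth h ∧ HasCompactSupport h

lemma IsTest.zero : IsTest (fun _ : E => 0) := ⟨contDiff_const, HasCompactSupport.zero⟩

lemma IsTest.add (hg : IsTest g) (hh : IsTest h) : IsTest fun x => g x + h x := ⟨hg.1.add hh.1, hg.2.add hh.2⟩

lemma IsTest.smooth_mul (hg : Smooth g) (hh : IsTest h) : IsTest fun x => g x * h x :=
  ⟨hg.mul hh.1, hh.2.mul_left⟩

lemma IsTest.mul_smooth (hg : IsTest g) (hh : Smooth h) : IsTest fun x => g x * h x :=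
  ⟨hg.1.mul hh, hg.2.mul_right⟩

lemma IsTest.const_mul (c : ℂ) (hh : IsTest h) : IsTest fun x => c * h x := IsTest.smooth_mul contDiff_const hh

lemma hasCompactSupport_dz (v : E) (hh : HasCompactSupport h) : HasCompactSupport (dz v h) := by
  refine hh.mono' fun x hx => by_contra fun hn => hx ?_
  rw [dz_congr v (notMem_tsupport_iff_eventuallyEq.1 hn)]
  exact dz_const v 0

lemma hasCompactSupport_dzbar (v : E) (hh : HasCompactSupport h) : HasCompactSupport (dzbar v h) := by
  refine hh.mono' fun x hx => by_contra fun hn => hx ?_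
  rw [dzbar_congr v (notMem_tsupport_iff_eventuallyEq.1 hn)]
  exact dzbar_const v 0

lemma IsTest.dz (v : E) (hh : IsTest h) : IsTest (dz v h) := ⟨contDiff_dz v hh.1, hasCompactSupport_dz v hh.2⟩

lemma IsTest.dzbar (v : E) (hh : IsTest h) : IsTest (dzbar v h) :=
  ⟨contDiff_dzbar v hh.1, hasCompactSupport_dzbar v hh.2⟩

lemma IsTest.dz_iterate (v : E) (hh : IsTest h) (N : ℕ) : IsTest ((EllipticConfig.dz v)^[N] h) := by
  induction N with
  | zero => exact hh
  | succ N ih => rw [iterate_succ_apply']; exact ih.dz v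

lemma IsTest.continuous (hh : IsTest h) : Continuous h := hh.1.continuous

lemma IsTest.integrable [MeasurableSpace E] [BorelSpace E] {μ : Measure E}
    [IsFiniteMeasureOnCompacts μ] (hh : IsTest h) : Integrable h μ :=
  hh.continuous.integrable_of_hasCompactSupport hh.2

/-- Precomposition with a homeomorphism that is smooth. -/
lemma IsTest.comp_homeomorph {F : Type*} [NormedAddCommGroup F] [NormedSpace ℂ F]
    (hh : IsTest h) (e : F ≃ₜ E) (he : Smooth e) : IsTest fun x => h (e x) :=
  ⟨hh.1.comp he, hh.2.comp_homeomorph e⟩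

lemma IsTest.comp_add (hh : IsTest h) (c : E) : IsTest fun x => h (x + c) :=
  hh.comp_homeomorph (Homeomorph.addRight c) (contDiff_id.add contDiff_const)

/-- Integration by parts against the constant function `1`. -/
lemma integral_dz_eq_zero [MeasurableSpace E] [BorelSpace E] [FiniteDimensional ℝ E]
    {μ : Measure E} [μ.IsAddHaarMeasure] (v : E) (hh : IsTest h) : ∫ x, dz v h x ∂μ = 0 := by
  have key : ∀ w : E, Integrable (fun x => fderiv ℝ h x w) μ ∧ ∫ x, fderiv ℝ h x w ∂μ = 0 := by
    intro w
    have hi : Integrable (fun x => fderiv ℝ h x w) μ := by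
      refine Continuous.integrable_of_hasCompactSupport ?_ ?_
      · exact (hh.1.continuous_fderiv (by simp)).clm_apply continuous_const
      · exact (hh.2.fderiv (𝕜 := ℝ)).mono fun x hx h0 => hx (by simp [h0])
    refine ⟨hi, ?_⟩
    have := integral_mul_fderiv_eq_neg_fderiv_mul_of_integrable (μ := μ) (f := fun _ : E => (1 : ℂ))
      (g := h) (v := w) (by simp) (by simpa using hi) (by simpa using hh.integrable)
      (fun _ _ => differentiableAt_const _) (fun x _ => hh.1.diffAt x)
    simpa using this
  unfold dz
  rw [integral_const_mul, integral_sub (key v).1 ((key _).1.const_mul _), integral_const_mul,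
    (key v).2, (key _).2]
  simp

end Wirtinger

/-! ### The distributions `1 / w ^ (N + 1)` on `ℂ` -/

lemma ae_ne (c : ℂ) : ∀ᵐ w : ℂ, w ≠ c := by rw [ae_iff]; simp

/-- In polar coordinates the factor `r` of the area element cancels `1 / r`, so over a disc the
radial integrand is the constant `1`. -/
lemma locallyIntegrable_inv : LocallyIntegrable (fun w : ℂ => w⁻¹) volume := by
  rw [MeasureTheory.locallyIntegrable_iff]
  intro k hk
  obtain ⟨R, hR⟩ := hk.isBounded.subset_ball (0 : ℂ)
  refine IntegrableOn.mono_set ?_ hR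
  have h1 : Integrable (fun w : ℂ => (Iio R).indicator (fun r : ℝ => r⁻¹) ‖w‖) volume := by
    rw [integrable_fun_norm_addHaar volume (f := (Iio R).indicator (fun r : ℝ => r⁻¹))]
    simp only [Complex.finrank_real_complex]
    have : IntegrableOn (fun _ : ℝ => (1 : ℝ)) (Ioo 0 R) volume := by simp
    refine (this.integrable_indicator measurableSet_Ioo).integrableOn.congr_fun ?_ measurableSet_Ioi
    intro y hy
    have hy' : (0 : ℝ) < y := hy
    by_cases hyR : y < R
    · simp [indicator, hy', hyR, hy'.ne']
    · simp [indicator, hyR]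
  have h2 := h1.integrableOn (s := ball (0 : ℂ) R)
  refine Integrable.mono' h2 (by fun_prop) ?_
  filter_upwards [ae_restrict_mem measurableSet_ball] with w hw
  have : ‖w‖ < R := by simpa using hw
  simp [indicator, this]

lemma IsTest.integrable_div (hh : IsTest h) : Integrable (fun w => h w / w) := by
  have := locallyIntegrable_inv.integrable_smul_left_of_hasCompactSupport hh.continuous hh.2
  simpa [div_eq_mul_inv] using this

/-- The value on `h` of the distribution `1 / w ^ (N + 1)`, obtained from the locally integrable
function `1 / w` by integration by parts. -/
def Lf (N : ℕ) (h : ℂ → ℂ) : ℂ := (1 / (N ! : ℂ)) * ∫ w : ℂ, (dz 1)^[N] h w / w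

lemma dz_iterate_add (N : ℕ) (hg : Smooth g) (hh : Smooth h) :
    (dz v)^[N] (fun w => g w + h w) = fun w => (dz v)^[N] g w + (dz v)^[N] h w := by
  induction N with
  | zero => rfl
  | succ N ih =>
    simp only [iterate_succ_apply', ih]
    funext w
    exact dz_add v ((contDiff_dz_iterate v hg N).diffAt w) ((contDiff_dz_iterate v hh N).diffAt w)

lemma dz_iterate_const_mul (N : ℕ) (c : ℂ) (hh : Smooth h) :
    (dz v)^[N] (fun w => c * h w) = fun w => c * (dz v)^[N] h w := by
  induction N with
  | zero => rfl
  | succ N ih =>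
    simp only [iterate_succ_apply', ih]
    funext w
    exact dz_const_mul v c ((contDiff_dz_iterate v hh N).diffAt w)

lemma Lf_add (hg : IsTest g) (hh : IsTest h) : Lf N (fun w => g w + h w) = Lf N g + Lf N h := by
  simp only [Lf, dz_iterate_add N hg.1 hh.1, add_div]
  rw [integral_add (hg.dz_iterate 1 N).integrable_div (hh.dz_iterate 1 N).integrable_div]
  ring

lemma Lf_const_mul (c : ℂ) (hh : IsTest h) : Lf N (fun w => c * h w) = c * Lf N h := by
  simp only [Lf, dz_iterate_const_mul N c hh.1, mul_div_assoc, integral_const_mul]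
  ring

lemma Lf_zero (N : ℕ) : Lf N (fun _ => 0) = 0 := by
  simpa using Lf_const_mul (N := N) (h := fun _ => 0) 0 IsTest.zero

lemma dz_id (w : ℂ) : dz 1 (fun w : ℂ => w) w = 1 := by rw [dz_of_holomorphic 1 differentiableAt_fun_id]; simp

lemma dz_iterate_id_mul (N : ℕ) (hh : Smooth h) : (dz 1)^[N + 1] (fun w => w * h w) =
      fun w => w * (dz 1)^[N + 1] h w + (N + 1) * (dz 1)^[N] h w := by
  have hid : ∀ w, DifferentiableAt ℝ (fun w : ℂ => w) w := fun w => differentiableAt_id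
  induction N with
  | zero =>
    funext w
    simp only [zero_add, iterate_one, Function.iterate_zero, id]
    rw [dz_mul 1 (hid w) (hh.diffAt w), dz_id]
    push_cast; ring
  | succ N ih =>
    rw [iterate_succ_apply', ih]
    funext w
    have h1 := contDiff_dz_iterate (1 : ℂ) hh (N + 1)
    have h2 := contDiff_dz_iterate (1 : ℂ) hh N
    rw [dz_add 1 ((hid w).fun_mul (h1.diffAt w)) ((h2.diffAt w).const_mul _),
      dz_mul 1 (hid w) (h1.diffAt w), dz_const_mul 1 _ (h2.diffAt w), dz_id]
    simp only [iterate_succ_apply']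
    push_cast; ring

/-- Expanding the fraction by `w` must not change the regularized integral. By the Leibniz rule
`∂^(N+1) (w h) / w = ∂^(N+1) h + (N+1) ∂^N h / w`; the first term is exact and integrates to zero,
and the factor `N + 1` is absorbed by the factorial. -/
lemma Lf_raise (hh : IsTest h) : Lf (N + 1) (fun w => w * h w) = Lf N h := by
  simp only [Lf, dz_iterate_id_mul N hh.1]
  have h0 : ∫ w : ℂ, (dz 1)^[N + 1] h w = 0 := by
    simp only [iterate_succ_apply']
    exact integral_dz_eq_zero 1 (hh.dz_iterate 1 N)
  have : ∫ w : ℂ, (w * (dz 1)^[N + 1] h w + (N + 1) * (dz 1)^[N] h w) / w =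
      ∫ w : ℂ, ((dz 1)^[N + 1] h w + (N + 1) * ((dz 1)^[N] h w / w)) := by
    refine integral_congr_ae ?_
    filter_upwards [ae_ne 0] with w hw
    field_simp
  rw [this, integral_add (hh.dz_iterate 1 (N + 1)).integrable
    ((hh.dz_iterate 1 N).integrable_div.const_mul _), h0, integral_const_mul, Nat.factorial_succ]
  have : ((N : ℂ) + 1) ≠ 0 := by exact_mod_cast Nat.succ_ne_zero N
  push_cast
  field_simp
  ring

/-- Cancelling powers of `w` with `Lf_raise` until no pole is left. -/
lemma Lf_of_smooth {k : ℂ → ℂ} (hk : IsTest k) : Lf N (fun w => w ^ (N + 1) * k w) = ∫ w, k w := by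
  induction N with
  | zero =>
    simp only [Lf, Function.iterate_zero, id, zero_add, pow_one, Nat.factorial_zero]
    rw [Nat.cast_one, div_one, one_mul]
    refine integral_congr_ae ?_
    filter_upwards [ae_ne 0] with w hw
    field_simp
  | succ N ih =>
    rw [← ih]
    have h1 : IsTest fun w : ℂ => w ^ (N + 1) * k w := IsTest.smooth_mul (by fun_prop) hk
    rw [← Lf_raise h1]
    congr 1; funext w; ring

/-- The rule `∂ (w ^ (-N-1)) = -(N+1) w ^ (-N-2)` for distributions, immediate from the definition
by integration by parts. -/
lemma Lf_dz (h : ℂ → ℂ) : Lf N (dz 1 h) = (N + 1) * Lf (N + 1) h := by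
  simp only [Lf, Nat.factorial_succ, ← iterate_succ_apply]
  have : ((N : ℂ) + 1) ≠ 0 := by exact_mod_cast Nat.succ_ne_zero N
  push_cast
  field_simp

/-- `∫ ∂̄h / w = -π h(0)`. -/
lemma integral_dzbar_div (hh : IsTest h) : ∫ w, dzbar 1 h w / w = -(pi : ℂ) * h 0 := by
  set e : ℝ → ℂ := fun θ => Real.cos θ + Real.sin θ * I with he
  have hee : ∀ θ, e θ = Complex.exp (θ * I) := fun θ => by simp [he, Complex.exp_mul_I]
  have hece : Continuous e := by fun_prop
  have hen : ∀ θ, ‖e θ‖ = 1 := fun θ => by rw [hee, Complex.norm_exp_ofReal_mul_I]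
  obtain ⟨R, hR⟩ := hh.2.isCompact.isBounded.subset_ball (0 : ℂ)
  set D := fderiv ℝ h with hD
  have hDc : Continuous D := hh.1.continuous_fderiv (by simp)
  have hD0 : ∀ w, R ≤ ‖w‖ → D w = 0 := by
    intro w hw
    have : w ∉ tsupport h := fun hw' => by have := hR hw'; simp at this; linarith
    by_contra hne
    exact this (support_fderiv_subset ℝ hne)
  -- At `r e(θ)`, `G1` is the radial derivative of `h` and `r G2` the angular one, and `r · ∂̄h / (r
  -- e(θ)) = (G1 + i G2) / 2`. The radial part integrates to `-h 0` along every ray, the angular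
  -- part to zero over every circle.
  set G1 : ℝ × ℝ → ℂ := fun p => D (p.1 * e p.2) (e p.2) with hG1
  set G2 : ℝ × ℝ → ℂ := fun p => D (p.1 * e p.2) (I * e p.2) with hG2
  have hG1c : Continuous G1 := (hDc.comp (by fun_prop)).clm_apply (by fun_prop)
  have hG2c : Continuous G2 := (hDc.comp (by fun_prop)).clm_apply (by fun_prop)
  have hint : ∀ G : ℝ × ℝ → ℂ, Continuous G → (∀ p : ℝ × ℝ, R ≤ |p.1| → G p = 0) →
      IntegrableOn G (Ioi 0 ×ˢ Ioo (-pi) pi) volume := by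
    intro G hGc hG0
    have h1 : IntegrableOn G (Icc 0 R ×ˢ Icc (-pi) pi) volume :=
      hGc.continuousOn.integrableOn_compact (isCompact_Icc.prod isCompact_Icc)
    refine h1.of_forall_sdiff_eq_zero (measurableSet_Ioi.prod measurableSet_Ioo) ?_
    rintro ⟨r, θ⟩ ⟨⟨h1, h2⟩, h3⟩
    apply hG0
    by_contra hlt
    apply h3
    have hr : (0 : ℝ) < r := h1
    simp only [not_le, abs_of_pos hr] at hlt
    exact ⟨⟨hr.le, hlt.le⟩, ⟨h2.1.le, h2.2.le⟩⟩
  have hz : ∀ p : ℝ × ℝ, R ≤ |p.1| → D (p.1 * e p.2) = 0 := fun p hp => hD0 _ (by simpa [hen] using hp)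
  have hi1 := hint G1 hG1c fun p hp => by simp [hG1, hz p hp]
  have hi2 := hint G2 hG2c fun p hp => by simp [hG2, hz p hp]
  rw [← Complex.integral_comp_polarCoord_symm]
  have hpt : ∀ p ∈ polarCoord.target, p.1 • (fun w => dzbar 1 h w / w) (Complex.polarCoord.symm p) =
      (1 / 2 : ℂ) * G1 p + (I / 2) * G2 p := by
    rintro ⟨r, θ⟩ ⟨hr, -⟩
    have hr : (0 : ℝ) < r := hr
    have hrc : (r : ℂ) ≠ 0 := by exact_mod_cast hr.ne'
    have hene : e θ ≠ 0 := by rw [hee]; exact exp_ne_zero _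
    have e1 : e θ = Real.cos θ • (1 : ℂ) + Real.sin θ • I := by simp [he]
    have e2 : I * e θ = Real.cos θ • I - Real.sin θ • (1 : ℂ) := by
      simp only [he, real_smul]; linear_combination (Real.sin θ : ℂ) * I_sq
    have hsq : (Real.cos θ : ℂ) ^ 2 + (Real.sin θ : ℂ) ^ 2 = 1 := by exact_mod_cast Real.cos_sq_add_sin_sq θ
    have e3 : (e θ)⁻¹ = Real.cos θ - Real.sin θ * I := by
      refine inv_eq_of_mul_eq_one_right ?_
      simp only [he]
      linear_combination hsq - (Real.sin θ : ℂ) ^ 2 * I_sq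
    simp only [Complex.polarCoord_symm_apply, hG1, hG2, real_smul]
    change (r : ℂ) * (dzbar 1 h (r * e θ) / (r * e θ)) = _
    have : (r : ℂ) * (dzbar 1 h (r * e θ) / (r * e θ)) = dzbar 1 h (r * e θ) * (e θ)⁻¹ := by field_simp
    rw [this, e3, e2]
    simp only [dzbar, smul_eq_mul, mul_one, ← hD]
    generalize D (r * e θ) = X
    have hX : X (e θ) = Real.cos θ * X 1 + Real.sin θ * X I := by rw [e1, map_add, map_smul, map_smul]; simp
    rw [hX, map_sub, map_smul, map_smul, real_smul, real_smul]
    linear_combination (-1/2 : ℂ) * (Real.sin θ : ℂ) * X I * I_sq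
  rw [setIntegral_congr_fun polarCoord.open_target.measurableSet hpt]
  change ∫ p in Ioi (0 : ℝ) ×ˢ Ioo (-pi) pi, _ = _
  rw [integral_add (hi1.const_mul _) (hi2.const_mul _), integral_const_mul, integral_const_mul]
  have I1 : ∫ p in Ioi (0 : ℝ) ×ˢ Ioo (-pi) pi, G1 p = -(2 * pi : ℂ) * h 0 := by
    rw [Measure.volume_eq_prod, ← Measure.prod_restrict, integral_prod_symm]
    · have : ∀ θ : ℝ, ∫ r in Ioi (0 : ℝ), G1 (r, θ) = -h 0 := by
        intro θ
        have hd : ∀ r : ℝ, HasDerivAt (fun r : ℝ => h (r * e θ)) (G1 (r, θ)) r := by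
          intro r
          have h1 : HasDerivAt (fun r : ℝ => (r : ℂ) * e θ) (e θ) r := by
            simpa using (ofRealCLM.hasDerivAt (x := r)).mul_const (e θ)
          exact (hh.1.diffAt _).hasFDerivAt.comp_hasDerivAt r h1
        have := MeasureTheory.integral_Ioi_of_hasDerivAt_of_tendsto (a := (0 : ℝ)) (m := (0 : ℂ))
          (f := fun r : ℝ => h (r * e θ)) (f' := fun r => G1 (r, θ))
          (hd 0).continuousAt.continuousWithinAt (fun r _ => hd r) ?_ ?_
        · simpa using this
        · have hc : Continuous fun r : ℝ => G1 (r, θ) := hG1c.comp (by fun_prop)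
          have h1 : IntegrableOn (fun r : ℝ => G1 (r, θ)) (Icc 0 R) volume :=
            hc.continuousOn.integrableOn_compact isCompact_Icc
          refine h1.of_forall_sdiff_eq_zero measurableSet_Ioi ?_
          rintro r ⟨hr, hr'⟩
          have hr : (0 : ℝ) < r := hr
          have : R ≤ |r| := by
            by_contra hlt
            rw [not_le, abs_of_pos hr] at hlt
            exact hr' ⟨hr.le, hlt.le⟩
          simp [hG1, hz (r, θ) this]
        · refine tendsto_const_nhds.congr' ?_
          filter_upwards [Filter.eventually_ge_atTop (max R 0)] with r hr
          have hr1 : R ≤ r := (le_max_left _ _).trans hr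
          have hr0 : 0 ≤ r := (le_max_right _ _).trans hr
          have : (r : ℂ) * e θ ∉ tsupport h := fun hw' => by
            have := hR hw'
            simp [hen, abs_of_nonneg hr0] at this; linarith
          exact (image_eq_zero_of_notMem_tsupport this).symm
      simp only [this]
      simp only [integral_const, measureReal_restrict_apply_univ, Real.volume_real_Ioo, sub_neg_eq_add]
      rw [max_eq_left (by positivity)]
      simp only [real_smul]; push_cast; ring
    · rw [Measure.prod_restrict, ← Measure.volume_eq_prod]; exact hi1
  have I2 : ∫ p in Ioi (0 : ℝ) ×ˢ Ioo (-pi) pi, G2 p = 0 := by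
    rw [Measure.volume_eq_prod, ← Measure.prod_restrict, integral_prod]
    · have : ∀ r ∈ Ioi (0 : ℝ), ∫ θ in Ioo (-pi) pi, G2 (r, θ) = 0 := by
        intro r hr
        have hr : (0 : ℝ) < r := hr
        have hd : ∀ θ : ℝ, HasDerivAt (fun θ : ℝ => h (r * e θ)) (r * G2 (r, θ)) θ := by
          intro θ
          have h0 : HasDerivAt e (I * e θ) θ := by
            have : e = fun θ : ℝ => Complex.exp (θ * I) := funext hee
            rw [this]
            have := ((ofRealCLM.hasDerivAt (x := θ)).mul_const I).cexp
            simpa [mul_comm] using this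
          have h1 : HasDerivAt (fun θ : ℝ => (r : ℂ) * e θ) (r • (I * e θ)) θ := by
            simpa using h0.const_mul (r : ℂ)
          have := (hh.1.diffAt (r * e θ)).hasFDerivAt.comp_hasDerivAt θ h1
          rw [map_smul, real_smul] at this
          exact this
        have hc : Continuous fun θ : ℝ => (r : ℂ) * G2 (r, θ) := by fun_prop
        have h2 := intervalIntegral.integral_eq_sub_of_hasDerivAt (a := -pi) (b := pi)
          (fun θ _ => hd θ) (hc.intervalIntegrable _ _)
        have h3 : e pi = e (-pi) := by simp [he]
        rw [h3, sub_self, intervalIntegral.integral_const_mul,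
          intervalIntegral.integral_of_le (by linarith [pi_pos])] at h2
        have hrc : (r : ℂ) ≠ 0 := by exact_mod_cast hr.ne'
        rw [← integral_Ioc_eq_integral_Ioo]
        simpa [hrc] using h2
      rw [setIntegral_congr_fun measurableSet_Ioi this]; simp
    · rw [Measure.prod_restrict, ← Measure.volume_eq_prod]; exact hi2
  rw [I1, I2]; ring

lemma Lf_dzbar (hh : IsTest h) : Lf N (dzbar 1 h) = -(pi : ℂ) * ((1 / (N ! : ℂ)) * (dz 1)^[N] h 0) := by
  rw [Lf, dz_iterate_dzbar_comm 1 1 hh.1, integral_dzbar_div (hh.dz_iterate 1 N)]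
  ring

lemma contDiffAt_div {E : Type*} [NormedAddCommGroup E] [NormedSpace ℝ E] {f g : E → ℂ} {x : E}
    (hf : SmoothAt f x) (hg : SmoothAt g x) (h0 : g x ≠ 0) : SmoothAt (fun y => f y / g y) x := by
  simp only [div_eq_mul_inv]
  exact hf.mul (hg.inv h0)

lemma contDiff_sub_pow (c : ℂ) (N : ℕ) : Smooth fun w : ℂ => (w - c) ^ N := by fun_prop

lemma IsTest.div_pow_of_vanishing (hh : IsTest h)
    (h0 : ∀ᶠ w in 𝓝 c, h w = 0) : IsTest fun w => h w / (w - c) ^ N := by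
  refine ⟨contDiff_iff_contDiffAt.2 fun w => ?_, by simp only [div_eq_mul_inv]; exact hh.2.mul_right⟩
  by_cases hw : w = c
  · subst hw
    exact (contDiffAt_const (c := (0 : ℂ))).congr_of_eventuallyEq (h0.mono fun u hu => by simp [hu])
  · exact contDiffAt_div hh.1.contDiffAt (contDiff_sub_pow c N).contDiffAt (pow_ne_zero _ (sub_ne_zero.2 hw))

/-! ### Comparison of `1 / w ^ (N + 1)` with absolutely convergent integrals -/

lemma fderiv_eq_dz_dzbar (g : ℂ → ℂ) (x w : ℂ) : fderiv ℝ g x w = w * dz 1 g x + conj w * dzbar 1 g x := by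
  have h1 : w = w.re • (1 : ℂ) + w.im • I := by simp
  have h2 : conj w = w.re - w.im * I := by apply Complex.ext <;> simp
  conv_lhs => rw [h1]
  rw [map_add, map_smul, map_smul, real_smul, real_smul, h2]
  conv_rhs => enter [1, 1]; rw [← re_add_im w]
  simp only [dz, dzbar, smul_eq_mul, mul_one]
  linear_combination (w.im : ℂ) * fderiv ℝ g x I * I_sq

lemma continuous_annular {ρ q : ℂ → ℂ} (hρ : Continuous ρ) (hρ0 : ∀ w, ‖w‖ < 1 → ρ w = 0)
    (hq : ∀ w, w ≠ 0 → ContinuousAt q w) : Continuous fun w => ρ w * q w := by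
  refine continuous_iff_continuousAt.2 fun w => ?_
  by_cases hw : ‖w‖ < 1
  · refine (continuousAt_const (y := (0 : ℂ))).congr ?_
    filter_upwards [(continuous_norm.tendsto w).eventually_lt_const hw] with u hu
    simp [hρ0 u hu]
  · exact hρ.continuousAt.mul (hq w fun h => by simp [h] at hw)

/-- The factor `w^a w̄^b / w^N` has angular frequency `a - b - N = -m` with `m > 0`, so it averages
to zero over circles. A single rotation shows this: turning by the angle `π / m` changes the sign of
the integrand. -/
lemma integral_radial_eq_zero {ρ : ℂ → ℂ} (hrot : ∀ c w : ℂ, ‖c‖ = 1 → ρ (c * w) = ρ w)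
    {a b : ℕ} (hab : a + b < N) : ∫ w, ρ w * (w ^ a * conj w ^ b / w ^ N) = 0 := by
  set m : ℕ := N + b - a with hm
  have hm0 : 0 < m := by omega
  set c : ℂ := Complex.exp ((pi / m : ℝ) * I) with hc
  have hcn : ‖c‖ = 1 := Complex.norm_exp_ofReal_mul_I _
  have hcm : c ^ m = -1 := by
    rw [hc, ← Complex.exp_nat_mul, ← Complex.exp_pi_mul_I]
    congr 1
    have : (m : ℂ) ≠ 0 := by exact_mod_cast hm0.ne'
    push_cast; field_simp
  have hc0 : c ≠ 0 := exp_ne_zero _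
  have hcc : conj c = c⁻¹ := by
    rw [eq_comm, inv_eq_of_mul_eq_one_right]
    rw [mul_conj, Complex.normSq_eq_norm_sq, hcn]; simp
  have hfac : c ^ a * (c⁻¹) ^ b / c ^ N = -1 := by
    have : c ^ N * c ^ b = c ^ m * c ^ a := by rw [← pow_add, ← pow_add]; congr 1; omega
    rw [inv_pow, div_eq_iff (pow_ne_zero _ hc0), mul_inv_eq_iff_eq_mul₀ (pow_ne_zero _ hc0)]
    rw [hcm] at this
    linear_combination this
  have h1 : ∫ w, ρ (c * w) * ((c * w) ^ a * conj (c * w) ^ b / (c * w) ^ N) =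
      ∫ w, ρ w * (w ^ a * conj w ^ b / w ^ N) := by
    set cc : Circle := ⟨c, by simpa [Submonoid.unitSphere] using hcn⟩
    have := (rotation cc).measurePreserving.integral_comp (rotation cc).toHomeomorph.measurableEmbedding
      (fun w => ρ w * (w ^ a * conj w ^ b / w ^ N))
    exact this
  have h2 : ∀ w, ρ (c * w) * ((c * w) ^ a * conj (c * w) ^ b / (c * w) ^ N) =
      -(ρ w * (w ^ a * conj w ^ b / w ^ N)) := by
    intro w
    rw [hrot c w hcn, map_mul, hcc, mul_pow, mul_pow, mul_pow]
    have : c ^ a * w ^ a * (c⁻¹ ^ b * conj w ^ b) / (c ^ N * w ^ N) =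
      (c ^ a * (c⁻¹) ^ b / c ^ N) * (w ^ a * conj w ^ b / w ^ N) := by
      field_simp
    rw [this, hfac]; ring
  simp only [h2, integral_neg] at h1
  have h3 : (2 : ℂ) * ∫ w, ρ w * (w ^ a * conj w ^ b / w ^ N) = 0 := by linear_combination -h1
  simpa using h3

/-- The angular integration kills all Taylor monomials of `h` of degree less than `m`, so only a
remainder of order `ε ^ m` survives. The induction on `m` replaces Taylor's formula: the integral
vanishes at `ε = 0`, its derivative in `ε` has the same form with `∂h` or `∂̄h` in place of `h` and
`a` or `b` increased by one, and the mean value inequality gains one power of `ε`. -/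
lemma radial_estimate {ρ : ℂ → ℂ} (hρ : Continuous ρ) (hρ0 : ∀ w, ‖w‖ < 1 → ρ w = 0)
    (hρ2 : ∀ w, 2 < ‖w‖ → ρ w = 0) (hrot : ∀ c w : ℂ, ‖c‖ = 1 → ρ (c * w) = ρ w) (N m : ℕ) :
    ∀ a b : ℕ, a + b + m = N → ∀ h : ℂ → ℂ, Smooth h → ∃ C : ℝ, ∀ ε ∈ Icc (0 : ℝ) 1,
      ‖∫ w, ρ w * (w ^ a * conj w ^ b / w ^ N) * h (ε * w)‖ ≤ C * ε ^ m := by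
  have hk : ∀ a b : ℕ, Continuous fun w => ρ w * (w ^ a * conj w ^ b / w ^ N) := by
    intro a b
    refine continuous_annular hρ hρ0 fun w hw => ?_
    exact ContinuousAt.div (by fun_prop) (by fun_prop) (pow_ne_zero _ hw)
  have hks : ∀ a b : ℕ, HasCompactSupport fun w => ρ w * (w ^ a * conj w ^ b / w ^ N) := by
    intro a b
    refine HasCompactSupport.intro (isCompact_closedBall (0 : ℂ) 2) fun w hw => ?_
    rw [hρ2 w (by simpa using hw), zero_mul]
  have hki := fun a b => (hk a b).integrable_of_hasCompactSupport (μ := volume) (hks a b)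
  have hbound : ∀ (h : ℂ → ℂ), Continuous h → ∀ r : ℝ, ∃ C, 0 ≤ C ∧
      ∀ ε : ℝ, |ε| ≤ r → ∀ w : ℂ, ‖w‖ ≤ 2 → ‖h (ε * w)‖ ≤ C := by
    intro h hh r
    obtain ⟨C, hC⟩ := (isCompact_closedBall (0 : ℂ) (r * 2)).exists_bound_of_continuousOn hh.continuousOn
    refine ⟨max C 0, le_max_right _ _, fun ε hε w hw => (hC _ ?_).trans (le_max_left _ _)⟩
    simp only [mem_closedBall_zero_iff, norm_mul, norm_real, norm_eq_abs]
    exact mul_le_mul hε hw (norm_nonneg _) ((abs_nonneg _).trans hε)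
  have hmul : ∀ (a b : ℕ) (h : ℂ → ℂ), Continuous h → ∀ ε : ℝ, Integrable fun w =>
      ρ w * (w ^ a * conj w ^ b / w ^ N) * h (ε * w) := by
    intro a b h hh ε
    exact ((hk a b).mul (hh.comp (by fun_prop))).integrable_of_hasCompactSupport (hks a b).mul_right
  induction m with
  | zero =>
    intro a b _ h hh
    obtain ⟨C, hC0, hC⟩ := hbound h hh.continuous 1
    refine ⟨∫ w, ‖ρ w * (w ^ a * conj w ^ b / w ^ N)‖ * C, fun ε hε => ?_⟩
    rw [pow_zero, mul_one]
    refine norm_integral_le_of_norm_le ((hki a b).norm.mul_const C) (.of_forall ?_)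
    intro w
    rw [norm_mul]
    by_cases hw : ‖w‖ ≤ 2
    · exact mul_le_mul_of_nonneg_left (hC ε (by rw [abs_of_nonneg hε.1]; exact hε.2) w hw) (norm_nonneg _)
    · rw [hρ2 w (not_le.1 hw)]; simp
  | succ m ih =>
    intro a b hab h hh
    obtain ⟨C1, hC1⟩ := ih (a + 1) b (by omega) (dz 1 h) (contDiff_dz 1 hh)
    obtain ⟨C2, hC2⟩ := ih a (b + 1) (by omega) (dzbar 1 h) (contDiff_dzbar 1 hh)
    set k : ℂ → ℂ := fun w => ρ w * (w ^ a * conj w ^ b / w ^ N) with hkdef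
    have hder : ∀ ε : ℝ, HasDerivAt (fun ε : ℝ => ∫ w, k w * h (ε * w))
        (∫ w, k w * fderiv ℝ h (ε * w) w) ε := by
      intro ε
      obtain ⟨C, hC0, hC⟩ := hbound (fun x => dz 1 h x) (contDiff_dz 1 hh).continuous (|ε| + 1)
      obtain ⟨C', hC0', hC'⟩ := hbound (fun x => dzbar 1 h x) (contDiff_dzbar 1 hh).continuous (|ε| + 1)
      refine (hasDerivAt_integral_of_dominated_loc_of_deriv_le (s := ball ε 1)
        (F := fun (e : ℝ) w => k w * h (e * w)) (F' := fun (e : ℝ) w => k w * fderiv ℝ h (e * w) w)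
        (bound := fun w => ‖k w‖ * (2 * C + 2 * C')) (ball_mem_nhds _ one_pos)
        (.of_forall fun e => (hmul a b h hh.continuous e).aestronglyMeasurable)
        (hmul a b h hh.continuous ε) ?_ ?_ ((hki a b).norm.mul_const _) ?_).2
      · refine Continuous.aestronglyMeasurable ((hk a b).mul ?_)
        exact ((hh.continuous_fderiv (by simp)).comp (by fun_prop)).clm_apply continuous_id
      · refine .of_forall fun w e he => ?_
        rw [norm_mul]
        by_cases hw : ‖w‖ ≤ 2
        · refine mul_le_mul_of_nonneg_left ?_ (norm_nonneg _)
          have hee : |e| ≤ |ε| + 1 := by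
            have : |e - ε| < 1 := by simpa [Real.dist_eq] using he
            have := abs_add_le (e - ε) ε
            simp at this; linarith
          rw [fderiv_eq_dz_dzbar]
          refine (norm_add_le _ _).trans (add_le_add ?_ ?_)
          · rw [norm_mul]
            exact mul_le_mul hw (hC e hee w hw) (norm_nonneg _) (by norm_num)
          · rw [norm_mul, RCLike.norm_conj]
            exact mul_le_mul hw (hC' e hee w hw) (norm_nonneg _) (by norm_num)
        · simp [hkdef, hρ2 w (not_le.1 hw)]
      · refine .of_forall fun w e _ => ?_
        have h1 : HasDerivAt (fun r : ℝ => (r : ℂ) * w) w e := by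
          simpa using (ofRealCLM.hasDerivAt (x := e)).mul_const w
        exact ((hh.diffAt _).hasFDerivAt.comp_hasDerivAt e h1).const_mul _
    have hsplit : ∀ ε : ℝ, ∫ w, k w * fderiv ℝ h (ε * w) w =
        (∫ w, ρ w * (w ^ (a + 1) * conj w ^ b / w ^ N) * dz 1 h (ε * w)) +
        ∫ w, ρ w * (w ^ a * conj w ^ (b + 1) / w ^ N) * dzbar 1 h (ε * w) := by
      intro ε
      rw [← integral_add (hmul _ _ _ (contDiff_dz 1 hh).continuous ε)
        (hmul _ _ _ (contDiff_dzbar 1 hh).continuous ε)]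
      congr 1; funext w
      rw [fderiv_eq_dz_dzbar, hkdef]; ring
    have h0 : ∫ w, k w * h ((0 : ℝ) * w) = 0 := by
      simp only [Complex.ofReal_zero, zero_mul]
      rw [integral_mul_const, integral_radial_eq_zero hrot (by omega), zero_mul]
    refine ⟨C1 + C2, fun ε hε => ?_⟩
    have hmv := norm_image_sub_le_of_norm_deriv_le_segment' (f := fun ε : ℝ => ∫ w, k w * h (ε * w))
      (f' := fun ε : ℝ => ∫ w, k w * fderiv ℝ h (ε * w) w) (a := 0) (b := ε) (C := (C1 + C2) * ε ^ m)
      (fun x _ => (hder x).hasDerivWithinAt) (fun x hx => ?_) ε (Set.right_mem_Icc.2 hε.1)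
    · rw [h0, sub_zero, sub_zero] at hmv
      rw [pow_succ, ← mul_assoc]; exact hmv
    · have hx1 : x ∈ Icc (0 : ℝ) 1 := ⟨hx.1, hx.2.le.trans hε.2⟩
      have hA := hC1 x hx1
      have hB := hC2 x hx1
      rw [hsplit]
      have hxm : x ^ m ≤ ε ^ m := pow_le_pow_left₀ hx.1 hx.2.le m
      have hpos : 0 ≤ C1 + C2 := by
        have h1 := (norm_nonneg _).trans (hC1 1 (by simp))
        have h2 := (norm_nonneg _).trans (hC2 1 (by simp))
        simp only [one_pow, mul_one] at h1 h2; linarith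
      calc _ ≤ C1 * x ^ m + C2 * x ^ m := (norm_add_le _ _).trans (add_le_add hA hB)
        _ = (C1 + C2) * x ^ m := by ring
        _ ≤ _ := mul_le_mul_of_nonneg_left hxm hpos

/-- A radial cutoff function around the origin. -/
def radialBump (w : ℂ) : ℂ := (smoothTransition (2 - ‖w‖ ^ 2) : ℝ)

lemma contDiff_radialBump : Smooth radialBump := by
  unfold radialBump
  exact ofRealCLM.contDiff.comp (smoothTransition.contDiff.comp (contDiff_const.sub (contDiff_norm_sq ℝ)))

lemma radialBump_rotate (c w : ℂ) (hc : ‖c‖ = 1) : radialBump (c * w) = radialBump w := by simp [radialBump, hc]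

lemma radialBump_eq_one (hw : ‖w‖ ≤ 1) : radialBump w = 1 := by
  have : (1 : ℝ) ≤ 2 - ‖w‖ ^ 2 := by nlinarith [norm_nonneg w]
  simp [radialBump, smoothTransition.one_of_one_le this]

lemma radialBump_eq_zero (hw : 2 ≤ ‖w‖) : radialBump w = 0 := by
  have : 2 - ‖w‖ ^ 2 ≤ 0 := by nlinarith [norm_nonneg w]
  simp [radialBump, smoothTransition.zero_of_nonpos this]

lemma norm_radialBump_le (w : ℂ) : ‖radialBump w‖ ≤ 1 := by
  rw [radialBump, norm_real, norm_eq_abs, abs_of_nonneg (smoothTransition.nonneg _)]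
  exact smoothTransition.le_one _

lemma contDiff_radialBump_div (ε : ℝ) : Smooth fun w : ℂ => radialBump (w / ε) :=
  contDiff_radialBump.comp (by fun_prop)

lemma norm_div_ofReal {ε : ℝ} (hε : 0 < ε) (w : ℂ) : ‖w / ε‖ = ‖w‖ / ε := by
  rw [norm_div, norm_real, norm_eq_abs, abs_of_pos hε]

lemma tendsto_integral_cutoff (hg : Integrable g) :
    Tendsto (fun ε : ℝ => ∫ w, radialBump (w / ε) * g w) (𝓝[>] 0) (𝓝 0) := by
  rw [← integral_zero ℂ ℂ (μ := volume)]
  refine tendsto_integral_filter_of_dominated_convergence (fun w => ‖g w‖)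
    (.of_forall fun ε => (contDiff_radialBump_div ε).continuous.aestronglyMeasurable.mul
      hg.aestronglyMeasurable) (.of_forall fun ε => .of_forall fun w => ?_) hg.norm ?_
  · rw [norm_mul]
    exact mul_le_of_le_one_left (norm_nonneg _) (norm_radialBump_le _)
  · filter_upwards [ae_ne 0] with w hw
    refine tendsto_const_nhds.congr' ?_
    filter_upwards [Ioo_mem_nhdsGT (half_pos (norm_pos_iff.2 hw))] with ε hε
    rw [radialBump_eq_zero, zero_mul]
    rw [norm_div_ofReal hε.1, le_div_iff₀ hε.1]
    linarith [hε.2]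

/-- Away from the pole the quotient is itself a test function, so `Lf_of_smooth` applies to it. -/
lemma Lf_of_vanishing (hh : IsTest h) (h0 : ∀ᶠ w in 𝓝 (0 : ℂ), h w = 0) : Lf N h = ∫ w, h w / w ^ (N + 1) := by
  have hk : IsTest fun w => h w / w ^ (N + 1) := by simpa using hh.div_pow_of_vanishing (N := N + 1) h0
  rw [← Lf_of_smooth (N := N) hk]
  congr 1; funext w
  by_cases hw : w = 0
  · subst hw; simp [h0.self_of_nhds]
  · field_simp

lemma dz_radialBump_scaled (ε : ℝ) (w : ℂ) :
    dz 1 (fun w => radialBump (w / ε)) w = dz 1 radialBump (w / ε) / ε := by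
  have h1 : HasFDerivAt (fun w : ℂ => w / ε) ((ε : ℂ)⁻¹ • ContinuousLinearMap.id ℂ ℂ) w := by
    simp only [div_eq_inv_mul]
    exact ((ε : ℂ)⁻¹ • ContinuousLinearMap.id ℂ ℂ).hasFDerivAt
  rw [dz_comp 1 (contDiff_radialBump.diffAt _) h1]
  simp only [smul_apply, id_apply]
  rw [dz_smul_dir]; field_simp

/-- After one integration by parts, the critical term is supported in an annulus of size `ε`.
Rescaled, it is `ε ^ (-N)` times an integral that `radial_estimate` bounds by a multiple of `ε ^ (N
+ 2)`. The rotational symmetry of the cutoff is what makes the limit vanish. -/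
lemma Lf_cutoff_tendsto (N : ℕ) : ∀ h : ℂ → ℂ, IsTest h →
    Tendsto (fun ε : ℝ => Lf N fun w => radialBump (w / ε) * h w) (𝓝[>] 0) (𝓝 0) := by
  induction N with
  | zero =>
    intro h hh
    simpa [Lf, mul_div_assoc] using tendsto_integral_cutoff hh.integrable_div
  | succ N ih =>
    intro h hh
    have hNne : ((N : ℂ) + 1) ≠ 0 := by exact_mod_cast Nat.succ_ne_zero N
    -- In contrast to `∂χ`, the product `w ∂χ` is invariant under rotations; the additional factor
    -- `w` turns the exponent `N + 1` of the denominator into `N + 2`.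
    set ρ : ℂ → ℂ := fun w => w * dz 1 radialBump w with hρ
    have hρc : Continuous ρ := continuous_id.mul (contDiff_dz 1 contDiff_radialBump).continuous
    have hd0 : ∀ w, ‖w‖ < 1 → dz 1 radialBump w = 0 := fun w hw => by
      rw [dz_congr 1 (((continuous_norm.tendsto w).eventually_lt_const hw).mono fun u hu =>
        radialBump_eq_one (le_of_lt hu)), dz_const]
    have hd2 : ∀ w, 2 < ‖w‖ → dz 1 radialBump w = 0 := fun w hw => by
      rw [dz_congr 1 (((continuous_norm.tendsto w).eventually_const_lt hw).mono fun u hu =>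
        radialBump_eq_zero (le_of_lt hu)), dz_const]
    have hrot : ∀ c w : ℂ, ‖c‖ = 1 → ρ (c * w) = ρ w := by
      intro c w hc
      have h1 : HasFDerivAt (fun w : ℂ => c * w) (c • ContinuousLinearMap.id ℂ ℂ) w :=
        (c • ContinuousLinearMap.id ℂ ℂ).hasFDerivAt
      have h2 := dz_comp (g := radialBump) 1 (contDiff_radialBump.diffAt (c * w)) h1
      simp only [radialBump_rotate c _ hc, smul_apply, id_apply, dz_smul_dir] at h2
      simp only [hρ, show dz 1 radialBump w = _ from h2]
      ring
    obtain ⟨C, hC⟩ := radial_estimate hρc (fun w hw => by simp [hρ, hd0 w hw])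
      (fun w hw => by simp [hρ, hd2 w hw]) hrot (N + 2) (N + 2) 0 0 (by omega) h hh.1
    have key : ∀ ε : ℝ, 0 < ε → (Lf (N + 1) fun w => radialBump (w / ε) * h w) =
        (1 / ((N : ℂ) + 1)) * ((Lf N fun w => radialBump (w / ε) * dz 1 h w) +
          (1 / (ε : ℂ) ^ N) * ∫ w, ρ w * (w ^ 0 * conj w ^ 0 / w ^ (N + 2)) * h (ε * w)) := by
      intro ε hε
      have hεc : (ε : ℂ) ≠ 0 := by exact_mod_cast hε.ne'
      have h1 : (Lf (N + 1) fun w => radialBump (w / ε) * h w) =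
          (1 / ((N : ℂ) + 1)) * Lf N (dz 1 fun w => radialBump (w / ε) * h w) := by
        rw [Lf_dz]; field_simp
      rw [h1]
      congr 1
      have h2 : (dz 1 fun w => radialBump (w / ε) * h w) = fun w =>
          radialBump (w / ε) * dz 1 h w + dz 1 (fun w => radialBump (w / ε)) w * h w := by
        funext w
        rw [dz_mul 1 ((contDiff_radialBump_div ε).diffAt w) (hh.1.diffAt w)]; ring
      have ht : IsTest fun w => dz 1 (fun w => radialBump (w / ε)) w * h w :=
        IsTest.smooth_mul (contDiff_dz 1 (contDiff_radialBump_div ε)) hh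
      rw [h2, Lf_add (IsTest.smooth_mul (contDiff_radialBump_div ε) (hh.dz 1)) ht]
      congr 1
      rw [Lf_of_vanishing ht]
      · have hcv := Measure.integral_comp_smul (μ := (volume : Measure ℂ))
          (fun w => dz 1 (fun w => radialBump (w / ε)) w * h w / w ^ (N + 1)) ε
        rw [Complex.finrank_real_complex, abs_of_pos (by positivity)] at hcv
        rw [eq_comm, inv_smul_eq_iff₀ (by positivity), real_smul, Complex.ofReal_pow] at hcv
        rw [hcv, ← integral_const_mul, ← integral_const_mul]
        congr 1; funext w
        rw [dz_radialBump_scaled, real_smul, mul_div_cancel_left₀ _ hεc]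
        by_cases hw : w = 0
        · subst hw; simp [hρ]
        · simp only [hρ]; field_simp; ring
      · filter_upwards [ball_mem_nhds 0 hε] with w hw
        rw [dz_radialBump_scaled, hd0, zero_div, zero_mul]
        rw [norm_div_ofReal hε, div_lt_one hε]
        simpa using hw
    have hlim : Tendsto (fun ε : ℝ => (1 / (ε : ℂ) ^ N) * ∫ w,
        ρ w * (w ^ 0 * conj w ^ 0 / w ^ (N + 2)) * h (ε * w)) (𝓝[>] 0) (𝓝 0) := by
      refine squeeze_zero_norm' (a := fun ε : ℝ => C * ε ^ 2) ?_ ?_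
      · filter_upwards [Ioo_mem_nhdsGT (show (0 : ℝ) < 1 by norm_num)] with ε hε
        rw [norm_mul, norm_div, norm_one, norm_pow, norm_real, norm_eq_abs, abs_of_pos hε.1]
        rw [one_div, inv_mul_le_iff₀ (pow_pos hε.1 N)]
        exact (hC ε ⟨hε.1.le, hε.2.le⟩).trans_eq (by ring)
      · have : Tendsto (fun ε : ℝ => C * ε ^ 2) (𝓝 0) (𝓝 (C * 0 ^ 2)) := (Continuous.tendsto (by fun_prop) 0)
        simpa using this.mono_left nhdsWithin_le_nhds
    have := ((ih (dz 1 h) (hh.dz 1)).add hlim).const_mul (1 / ((N : ℂ) + 1))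
    rw [add_zero, mul_zero] at this
    refine this.congr' ?_
    filter_upwards [self_mem_nhdsWithin] with ε hε
    exact (key ε hε).symm

/-- If `h / w ^ (N + 1)` is absolutely integrable, then its integral is the value of the
distribution `1 / w ^ (N + 1)` on `h`. -/
lemma Lf_of_integrable (hh : IsTest h)
    (hi : Integrable fun w => h w / w ^ (N + 1)) : Lf N h = ∫ w, h w / w ^ (N + 1) := by
  -- Both sides agree on `(1 - χ_ε) h`, which vanishes near the pole. The contributions of `χ_ε h`
  -- tend to zero on either side, on one by `Lf_cutoff_tendsto` and on the other by dominated
  -- convergence.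
  have h3 := (Lf_cutoff_tendsto N h hh).add ((tendsto_integral_cutoff hi).const_sub (∫ w, h w / w ^ (N + 1)))
  rw [zero_add, sub_zero] at h3
  refine tendsto_nhds_unique (tendsto_const_nhds.congr' ?_) h3
  filter_upwards [self_mem_nhdsWithin] with ε (hε : 0 < ε)
  have hs := contDiff_radialBump_div ε
  have ht : IsTest fun w => (1 - radialBump (w / ε)) * h w := IsTest.smooth_mul (contDiff_const.sub hs) hh
  rw [← integral_sub hi (hi.bdd_mul hs.continuous.aestronglyMeasurable
    (.of_forall fun w => norm_radialBump_le _))]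
  have h1 := Lf_of_vanishing (N := N) ht ?_
  · simp only [mul_div_assoc, sub_mul, one_mul, sub_div] at h1
    rw [← h1, ← Lf_add (IsTest.smooth_mul hs hh) (by simpa only [sub_mul, one_mul] using ht)]
    congr 1; funext w; ring
  · filter_upwards [ball_mem_nhds (0 : ℂ) hε] with w hw
    rw [radialBump_eq_one, sub_self, zero_mul]
    rw [norm_div_ofReal hε, div_le_one hε]
    exact le_of_lt (by simpa using hw)

/-! ### Regularized integrals over `ℂ` -/

/-- `f` is almost everywhere a sum of functions `h / (w - c) ^ (N + 1)` with `h` smooth and of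
compact support, and `v` is the sum of the values of the distributions `1 / (w - c) ^ (N + 1)` on
the functions `h`. -/
def HasPV (f : ℂ → ℂ) (v : ℂ) : Prop := ∃ (s : Finset ℂ) (N : ℕ) (h : ℂ → ℂ → ℂ), (∀ c, IsTest (h c)) ∧
    f =ᵐ[volume] (fun w => ∑ c ∈ s, h c w / (w - c) ^ (N + 1)) ∧ v = ∑ c ∈ s, Lf N fun w => h c (w + c)

lemma HasPV.congr (hf : HasPV f v) (h : f =ᵐ[volume] g) : HasPV g v := by
  obtain ⟨s, N, k, hk, h1, h2⟩ := hf
  exact ⟨s, N, k, hk, h.symm.trans h1, h2⟩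

lemma HasPV.single (hh : IsTest h) (c : ℂ) (N : ℕ) :
    HasPV (fun w => h w / (w - c) ^ (N + 1)) (Lf N fun w => h (w + c)) :=
  ⟨{c}, N, fun _ => h, fun _ => hh, by simp, by simp⟩

lemma HasPV.zero : HasPV (fun _ => 0) 0 := ⟨∅, 0, fun _ _ => 0, fun _ => IsTest.zero, by simp, by simp⟩

lemma Lf_raise_pow (M : ℕ) (hh : IsTest h) : Lf (N + M) (fun w => w ^ M * h w) = Lf N h := by
  induction M with
  | zero => simp
  | succ M ih =>
    rw [← ih, ← add_assoc, ← Lf_raise (N := N + M) (IsTest.smooth_mul (by fun_prop) hh)]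
    congr 1; funext w; ring

/-- The exponent in a presentation can be increased and the set of poles enlarged. -/
lemma exists_raise {s : Finset ℂ} {h : ℂ → ℂ → ℂ} (hh : ∀ c, IsTest (h c)) {t : Finset ℂ}
    {M : ℕ} (hst : s ⊆ t) (hNM : N ≤ M) : ∃ h' : ℂ → ℂ → ℂ, (∀ c, IsTest (h' c)) ∧
      (∀ w ∉ s, ∑ c ∈ s, h c w / (w - c) ^ (N + 1) = ∑ c ∈ t, h' c w / (w - c) ^ (M + 1)) ∧
      ∑ c ∈ s, Lf N (fun w => h c (w + c)) = ∑ c ∈ t, Lf M fun w => h' c (w + c) := by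
  classical
  refine ⟨fun c w => if c ∈ s then (w - c) ^ (M - N) * h c w else 0, fun c => ?_, ?_, ?_⟩
  · by_cases hc : c ∈ s
    · simpa [hc] using IsTest.smooth_mul (contDiff_sub_pow c (M - N)) (hh c)
    · simpa [hc] using IsTest.zero
  · intro w hw
    rw [← sum_subset hst]
    · refine sum_congr rfl fun c hc => ?_
      have : w - c ≠ 0 := sub_ne_zero.2 fun h => hw (by rwa [h])
      simp only [if_pos hc]
      rw [show M + 1 = (M - N) + (N + 1) by omega, pow_add _ (M - N), mul_div_mul_left _ _ (pow_ne_zero _ this)]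
    · intro c _ hc
      simp [hc]
  · rw [← sum_subset hst]
    · refine sum_congr rfl fun c hc => ?_
      simp only [hc, if_true, add_sub_cancel_right]
      rw [show M = N + (M - N) by omega, Nat.add_sub_cancel_left]
      exact (Lf_raise_pow (M - N) ((hh c).comp_add c)).symm
    · intro c _ hc
      simp [hc, Lf_zero]

lemma ae_notMem_finset (s : Finset ℂ) : ∀ᵐ w : ℂ, w ∉ s := s.countable_toSet.ae_notMem volume

lemma HasPV.exists_rep (hf : HasPV f v) : ∃ (s : Finset ℂ) (N : ℕ), ∀ (t : Finset ℂ) (M : ℕ), s ⊆ t → N ≤ M →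
      ∃ h : ℂ → ℂ → ℂ, (∀ c, IsTest (h c)) ∧ f =ᵐ[volume] (fun w => ∑ c ∈ t, h c w / (w - c) ^ (M + 1)) ∧
        v = ∑ c ∈ t, Lf M fun w => h c (w + c) := by
  obtain ⟨s, N, h, hh, h1, h2⟩ := hf
  refine ⟨s, N, fun t M hst hNM => ?_⟩
  obtain ⟨h', hh', e, e'⟩ := exists_raise hh hst hNM
  refine ⟨h', hh', ?_, h2.trans e'⟩
  filter_upwards [h1, ae_notMem_finset s] with w hw hws
  rw [hw, e w hws]

lemma HasPV.add {v' : ℂ} (hf : HasPV f v) (hg : HasPV g v') : HasPV (fun w => f w + g w) (v + v') := by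
  classical
  obtain ⟨s, N, H⟩ := hf.exists_rep
  obtain ⟨s', N', H'⟩ := hg.exists_rep
  obtain ⟨h, hh, h1, h2⟩ := H (s ∪ s') (max N N') subset_union_left (le_max_left _ _)
  obtain ⟨h', hh', h1', h2'⟩ := H' (s ∪ s') (max N N') subset_union_right (le_max_right _ _)
  refine ⟨s ∪ s', max N N', fun c w => h c w + h' c w, fun c => (hh c).add (hh' c), ?_, ?_⟩
  · filter_upwards [h1, h1'] with w hw hw'
    rw [hw, hw', ← sum_add_distrib]
    exact sum_congr rfl fun c _ => by ring
  · rw [h2, h2', ← sum_add_distrib]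
    refine sum_congr rfl fun c _ => ?_
    exact (Lf_add ((hh c).comp_add c) ((hh' c).comp_add c)).symm

lemma HasPV.const_mul (a : ℂ) (hf : HasPV f v) : HasPV (fun w => a * f w) (a * v) := by
  obtain ⟨s, N, h, hh, h1, h2⟩ := hf
  refine ⟨s, N, fun c w => a * h c w, fun c => (hh c).const_mul a, ?_, ?_⟩
  · filter_upwards [h1] with w hw
    rw [hw, mul_sum]
    exact sum_congr rfl fun c _ => by ring
  · rw [h2, mul_sum]
    exact sum_congr rfl fun c _ => (Lf_const_mul a ((hh c).comp_add c)).symm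

lemma HasPV.sum (t : Finset ι) {f : ι → ℂ → ℂ} {v : ι → ℂ}
    (hf : ∀ i ∈ t, HasPV (f i) (v i)) : HasPV (fun w => ∑ i ∈ t, f i w) (∑ i ∈ t, v i) :=
  sum_rel HasPV.zero HasPV.add t hf

lemma HasPV.comp_add (hf : HasPV f v) (a : ℂ) : HasPV (fun w => f (w + a)) v := by
  classical
  obtain ⟨s, N, h, hh, h1, h2⟩ := hf
  refine ⟨s.image fun c => c - a, N, fun c w => h (c + a) (w + a), fun c => (hh _).comp_add a, ?_, ?_⟩
  · have := (measurePreserving_add_right (volume : Measure ℂ) a).quasiMeasurePreserving.ae_eq_comp h1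
    filter_upwards [this] with w hw
    simp only [Function.comp] at hw
    rw [hw, sum_image fun x _ y _ hxy => by simpa using hxy]
    refine sum_congr rfl fun c _ => ?_
    rw [sub_add_cancel, show w - (c - a) = w + a - c by ring]
  · rw [h2, sum_image fun x _ y _ hxy => by simpa using hxy]
    refine sum_congr rfl fun c _ => ?_
    congr 1; funext w
    simp only [sub_add_cancel]
    rw [show w + (c - a) + a = w + c by ring]

lemma eventually_small_ball (s : Finset ℂ) (c : ℂ) : ∃ δ : ℝ, 0 < δ ∧ ∀ c' ∈ s, c' ≠ c → 3 * δ < ‖c' - c‖ := by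
  have : ∀ᶠ δ in 𝓝[>] (0 : ℝ), ∀ c' ∈ s, c' ≠ c → 3 * δ < ‖c' - c‖ := by
    rw [Finset.eventually_all]
    intro c' _
    by_cases h : c' = c
    · simp [h]
    · have hp : 0 < ‖c' - c‖ / 3 := by have := norm_pos_iff.2 (sub_ne_zero.2 h); positivity
      filter_upwards [Ioo_mem_nhdsGT hp] with δ hδ _
      linarith [hδ.2]
  obtain ⟨δ, h1, h2⟩ := (this.and self_mem_nhdsWithin).exists
  exact ⟨δ, h2, h1⟩

/-- A cutoff function that is `1` near `c` and vanishes near the other points of a finite set. -/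
lemma exists_cutoff (s : Finset ℂ) (c : ℂ) : ∃ ψ : ℂ → ℂ, IsTest ψ ∧ (∀ w, ‖ψ w‖ ≤ 1) ∧
    (∀ᶠ w in 𝓝 c, ψ w = 1) ∧ ∀ c' ∈ s, c' ≠ c → ∀ᶠ w in 𝓝 c', ψ w = 0 := by
  obtain ⟨δ, hδ, h⟩ := eventually_small_ball s c
  refine ⟨fun w => radialBump ((w - c) / δ), ⟨contDiff_radialBump.comp (by fun_prop), ?_⟩,
    fun w => norm_radialBump_le _, ?_, fun c' hc' hne => ?_⟩
  · refine HasCompactSupport.intro (isCompact_closedBall c (2 * δ)) fun w hw => ?_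
    apply radialBump_eq_zero
    rw [norm_div_ofReal hδ, le_div_iff₀ hδ]
    simp only [mem_closedBall, not_le, dist_eq_norm] at hw
    exact hw.le
  · filter_upwards [ball_mem_nhds c hδ] with w hw
    apply radialBump_eq_one
    rw [norm_div_ofReal hδ, div_le_one hδ]
    exact le_of_lt (by simpa [dist_eq_norm] using hw)
  · filter_upwards [ball_mem_nhds c' hδ] with w hw
    apply radialBump_eq_zero
    rw [norm_div_ofReal hδ, le_div_iff₀ hδ]
    have h1 : ‖w - c'‖ < δ := by simpa [dist_eq_norm] using hw
    have h2 := h c' hc' hne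
    have h3 : ‖c' - c‖ ≤ ‖w - c‖ + ‖w - c'‖ := by have := norm_sub_le (w - c) (w - c'); simpa using this
    linarith

/-- Near one of the poles the summands belonging to the other poles are smooth. So integrability of
the sum forces integrability of each summand, and `Lf_of_integrable` applies term by term. -/
lemma HasPV.eq_integral (hf : HasPV f v) (hi : Integrable f) : v = ∫ w, f w := by
  classical
  obtain ⟨s, N, h, hh, h1, h2⟩ := hf
  have hterm : ∀ c ∈ s, Integrable fun w => h c w / (w - c) ^ (N + 1) := by
    intro c hc
    obtain ⟨ψ, hψ, hψ1, hψc, hψ0⟩ := exists_cutoff s c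
    have i1 : Integrable fun w => ψ w * f w := hi.bdd_mul hψ.continuous.aestronglyMeasurable (.of_forall hψ1)
    have i2 : ∀ c' ∈ s.erase c, Integrable fun w => ψ w * h c' w / (w - c') ^ (N + 1) := by
      intro c' hc'
      refine (IsTest.div_pow_of_vanishing (IsTest.smooth_mul hψ.1 (hh c')) ?_).integrable
      filter_upwards [hψ0 c' (Finset.mem_of_mem_erase hc') (Finset.ne_of_mem_erase hc')] with w hw
      simp [hw]
    have i3 : Integrable fun w => (1 - ψ w) * h c w / (w - c) ^ (N + 1) := by
      refine (IsTest.div_pow_of_vanishing (IsTest.smooth_mul (contDiff_const.sub hψ.1) (hh c)) ?_).integrable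
      filter_upwards [hψc] with w hw
      simp [hw]
    refine ((i1.sub (integrable_finsetSum _ i2)).add i3).congr ?_
    filter_upwards [h1] with w hw
    simp only [Pi.add_apply, Pi.sub_apply]
    rw [hw, ← Finset.add_sum_erase s _ hc, mul_add, mul_sum]
    have : ∑ i ∈ s.erase c, ψ w * (h i w / (w - i) ^ (N + 1)) =
        ∑ i ∈ s.erase c, ψ w * h i w / (w - i) ^ (N + 1) := sum_congr rfl fun i _ => by ring
    rw [this]; ring
  rw [h2, integral_congr_ae h1, integral_finsetSum _ hterm]
  refine sum_congr rfl fun c hc => ?_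
  have e1 := integral_add_right_eq_self (μ := (volume : Measure ℂ)) (fun w => h c w / (w - c) ^ (N + 1)) c
  rw [← e1]
  simp only [add_sub_cancel_right]
  refine Lf_of_integrable ((hh c).comp_add c) ?_
  have := (hterm c hc).comp_add_right c
  simpa using this

lemma HasPV.eq_zero_of_ae (hf : HasPV f v) (h0 : f =ᵐ[volume] fun _ => 0) : v = 0 := by
  have hi : Integrable f := (integrable_zero ℂ ℂ volume).congr h0.symm
  rw [hf.eq_integral hi, integral_congr_ae h0]; simp

/-- The difference of two presentations of `f` presents the zero function, which is integrable. -/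
lemma HasPV.unique {v' : ℂ} (hf : HasPV f v) (hf' : HasPV f v') : v = v' := by
  have h := hf.add (hf'.const_mul (-1))
  have := h.eq_zero_of_ae (.of_forall fun w => by ring)
  linear_combination this

open scoped Classical in
/-- The regularized integral over `ℂ`. -/
def pvInt (f : ℂ → ℂ) : ℂ := if h : ∃ v, HasPV f v then h.choose else 0

lemma HasPV.pvInt_eq (hf : HasPV f v) : pvInt f = v := by
  have h : ∃ v, HasPV f v := ⟨v, hf⟩
  rw [pvInt, dif_pos h]
  exact h.choose_spec.unique hf

/-! ### Residues of smooth functions with holomorphic poles -/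

lemma IsTest.mul_of_tsupport_subset {φ h : E → ℂ} {U : Set E}
    (hφ : IsTest φ) (hU : IsOpen U) (hh : SmoothOn h U) (hs : tsupport φ ⊆ U) : IsTest fun z => φ z * h z := by
  refine ⟨contDiff_iff_contDiffAt.2 fun x => ?_, hφ.2.mul_right⟩
  by_cases hx : x ∈ tsupport φ
  · exact hφ.1.contDiffAt.mul (hh.contDiffAt (hU.mem_nhds (hs hx)))
  · refine (contDiffAt_const (c := (0 : ℂ))).congr_of_eventuallyEq ?_
    filter_upwards [notMem_tsupport_iff_eventuallyEq.1 hx] with y hy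
    simp [hy]

lemma exists_bump [FiniteDimensional ℝ E] {U : Set E} {p : E} (hU : U ∈ 𝓝 p) :
    ∃ b : E → ℂ, IsTest b ∧ tsupport b ⊆ U ∧ ∀ᶠ z in 𝓝 p, b z = 1 := by
  obtain ⟨ε, hε, hεU⟩ := Metric.nhds_basis_closedBall.mem_iff.1 hU
  let ψ : ContDiffBump p := ⟨ε / 2, ε, by positivity, by linarith⟩
  refine ⟨fun x => (ψ x : ℂ), ⟨ofRealCLM.contDiff.comp ψ.contDiff,
    ψ.hasCompactSupport.comp_left (g := fun r : ℝ => (r : ℂ)) (by simp)⟩,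
    (tsupport_comp_subset (g := fun r : ℝ => (r : ℂ)) (by simp) ψ).trans (ψ.tsupport_eq.trans_subset hεU),
    ψ.eventuallyEq_one.mono fun x hx => by simp [hx]⟩

lemma exists_isTest_eventuallyEq [FiniteDimensional ℝ E] {h : E → ℂ} {U : Set E} {c : E} (hU : U ∈ 𝓝 c)
    (hh : SmoothOn h U) : ∃ h', IsTest h' ∧ h' =ᶠ[𝓝 c] h := by
  obtain ⟨V, hVU, hVo, hcV⟩ := mem_nhds_iff.1 hU
  obtain ⟨b, hb, hbV, hb1⟩ := exists_bump (hVo.mem_nhds hcV)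
  exact ⟨_, hb.mul_of_tsupport_subset hVo (hh.mono hVU) hbV, hb1.mono fun x hx => by simp [hx]⟩

/-- Near `c`, the function `f` is `h / (w - c) ^ (N + 1)` with `h` smooth, and `r` is the
coefficient `∂ ^ N h (c) / N!` of `1 / (w - c)`. -/
def HasRes (f : ℂ → ℂ) (c r : ℂ) : Prop :=
  ∃ (N : ℕ) (h : ℂ → ℂ), Smooth h ∧ (∀ᶠ w in 𝓝[≠] c, f w = h w / (w - c) ^ (N + 1)) ∧
    r = (1 / (N ! : ℂ)) * (dz 1)^[N] h c

lemma dz_iterate_mul (hg : Smooth g) (hh : Smooth h) (N : ℕ) (w : ℂ) : (dz v)^[N] (fun w => g w * h w) w =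
      ∑ p ∈ HasAntidiagonal.antidiagonal N, (N.choose p.1 : ℂ) * ((dz v)^[p.1] g w * (dz v)^[p.2] h w) := by
  induction N generalizing w with
  | zero => simp
  | succ N ih =>
    rw [Finset.sum_antidiagonal_choose_succ_mul (fun i j => (dz v)^[i] g w * (dz v)^[j] h w),
      iterate_succ_apply', funext ih, dz_sum]
    · rw [← sum_add_distrib]
      refine sum_congr rfl fun p hp => ?_
      have hch : (N.choose p.2 : ℂ) = N.choose p.1 := by
        rw [Nat.choose_symm_of_eq_add (HasAntidiagonal.mem_antidiagonal.1 hp).symm]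
      have h1 := (contDiff_dz_iterate v hg p.1).diffAt w
      have h2 := (contDiff_dz_iterate v hh p.2).diffAt w
      rw [dz_const_mul _ _ (h1.fun_mul h2), dz_mul v h1 h2]
      simp only [iterate_succ_apply', hch]
      ring
    · intro p _
      exact (((contDiff_dz_iterate v hg p.1).diffAt w).fun_mul
        ((contDiff_dz_iterate v hh p.2).diffAt w)).const_mul _

lemma dz_iterate_sub_pow (c : ℂ) (M k : ℕ) :
    (dz 1)^[k] (fun w : ℂ => (w - c) ^ M) = fun w => (M.descFactorial k : ℂ) * (w - c) ^ (M - k) := by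
  induction k with
  | zero => simp
  | succ k ih =>
    rw [iterate_succ_apply', ih]
    funext w
    have hd : DifferentiableAt ℂ (fun w : ℂ => (w - c) ^ (M - k)) w := by fun_prop
    rw [dz_const_mul 1 _ (hd.restrictScalars ℝ), dz_of_holomorphic 1 hd]
    have : HasDerivAt (fun w : ℂ => (w - c) ^ (M - k)) ((M - k : ℕ) * (w - c) ^ (M - k - 1)) w := by
      simpa using ((hasDerivAt_id' w).sub_const c).fun_pow (M - k)
    rw [fderiv_apply_one_eq_deriv, this.deriv, Nat.descFactorial_succ, Nat.sub_sub]
    push_cast; ring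

/-- The `N`-th derivative at `c` of `(w - c) ^ M h`. -/
lemma dz_iterate_sub_pow_mul (hh : Smooth h) (c : ℂ) (N M : ℕ) :
    (1 / (N ! : ℂ)) * (dz 1)^[N] (fun w => (w - c) ^ M * h w) c =
      if M ≤ N then (1 / ((N - M)! : ℂ)) * (dz 1)^[N - M] h c else 0 := by
  rw [dz_iterate_mul (contDiff_sub_pow c M) hh]
  simp only [dz_iterate_sub_pow, sub_self]
  split_ifs with hMN
  · rw [Finset.sum_eq_single (M, N - M)]
    · simp only [Nat.sub_self, pow_zero, mul_one, Nat.descFactorial_self]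
      have h1 : (N.choose M : ℂ) * M ! * (N - M)! = N ! := by
        exact_mod_cast Nat.choose_mul_factorial_mul_factorial hMN
      have h2 : (N ! : ℂ) ≠ 0 := by exact_mod_cast N.factorial_ne_zero
      have h3 : ((N - M)! : ℂ) ≠ 0 := by exact_mod_cast (N - M).factorial_ne_zero
      field_simp
      linear_combination (dz 1)^[N - M] h c * h1
    · rintro ⟨a, b⟩ hab hne
      simp only [HasAntidiagonal.mem_antidiagonal] at hab
      have haM : a ≠ M := fun h => hne (by subst h; simp; omega)
      rcases lt_or_gt_of_ne haM with h | h
      · rw [zero_pow (by omega)]; ring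
      · rw [Nat.descFactorial_eq_zero_iff_lt.2 h]; simp
    · intro hn
      exact absurd (HasAntidiagonal.mem_antidiagonal.2 (by simp; omega)) hn
  · rw [sum_eq_zero, mul_zero]
    rintro ⟨a, b⟩ hab
    simp only [HasAntidiagonal.mem_antidiagonal] at hab
    rw [zero_pow (by omega)]; ring

lemma HasRes.raise (M : ℕ) (hh : Smooth h) (hf : ∀ᶠ w in 𝓝[≠] c, f w = h w / (w - c) ^ (N + 1)) :
    Smooth (fun w => (w - c) ^ M * h w) ∧ (∀ᶠ w in 𝓝[≠] c, f w = ((w - c) ^ M * h w) / (w - c) ^ (N + M + 1)) ∧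
    (1 / (N ! : ℂ)) * (dz 1)^[N] h c =
      (1 / ((N + M)! : ℂ)) * (dz 1)^[N + M] (fun w => (w - c) ^ M * h w) c := by
  refine ⟨(contDiff_sub_pow c M).mul hh, ?_, ?_⟩
  · filter_upwards [hf, self_mem_nhdsWithin] with w hw hne
    have : w - c ≠ 0 := sub_ne_zero.2 hne
    rw [hw, show N + M + 1 = M + (N + 1) by omega, pow_add _ M, mul_div_mul_left _ _ (pow_ne_zero _ this)]
  · rw [dz_iterate_sub_pow_mul hh, if_pos (by omega), Nat.add_sub_cancel]

/-- After raising both presentations to a common exponent, the two numerators agree in a punctured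
neighbourhood, hence at `c` by continuity, and so do their derivatives. -/
lemma HasRes.unique {r r' : ℂ} (hf : HasRes f c r) (hf' : HasRes f c r') : r = r' := by
  obtain ⟨N, h, hh, h1, h2⟩ := hf
  obtain ⟨N', h', hh', h1', h2'⟩ := hf'
  obtain ⟨a1, a2, a3⟩ := HasRes.raise N' hh h1
  obtain ⟨b1, b2, b3⟩ := HasRes.raise N hh' h1'
  rw [h2, h2', a3, b3, add_comm N' N]
  congr 1
  refine (dz_iterate_eventuallyEq 1 (N + N') ?_).eq_of_nhds
  have hp : ∀ᶠ w in 𝓝[≠] c, (w - c) ^ N' * h w = (w - c) ^ N * h' w := by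
    filter_upwards [a2, b2, self_mem_nhdsWithin] with w hw hw' hne
    rw [hw, add_comm N' N] at hw'
    exact (div_left_inj' (pow_ne_zero _ (sub_ne_zero.2 hne))).1 hw'
  have hc : (c - c) ^ N' * h c = (c - c) ^ N * h' c := by
    refine tendsto_nhds_unique_of_eventuallyEq (l := 𝓝[≠] c) ?_ ?_ hp
    · exact (a1.continuous.tendsto c).mono_left nhdsWithin_le_nhds
    · exact (b1.continuous.tendsto c).mono_left nhdsWithin_le_nhds
  exact eventually_nhds_of_ne hp hc

lemma HasRes.congr {r : ℂ} (hf : HasRes f c r) (h : ∀ᶠ w in 𝓝[≠] c, f w = g w) : HasRes g c r := by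
  obtain ⟨N, k, hk, h1, h2⟩ := hf
  refine ⟨N, k, hk, ?_, h2⟩
  filter_upwards [h, h1] with w hw hw'
  rw [← hw, hw']

lemma HasRes.add {r r' : ℂ} (hf : HasRes f c r) (hg : HasRes g c r') :
    HasRes (fun w => f w + g w) c (r + r') := by
  obtain ⟨N, h, hh, h1, h2⟩ := hf
  obtain ⟨N', h', hh', h1', h2'⟩ := hg
  obtain ⟨a1, a2, a3⟩ := HasRes.raise N' hh h1
  obtain ⟨b1, b2, b3⟩ := HasRes.raise N hh' h1'
  refine ⟨N + N', fun w => (w - c) ^ N' * h w + (w - c) ^ N * h' w, a1.add b1, ?_, ?_⟩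
  · filter_upwards [a2, b2] with w hw hw'
    rw [hw, hw', add_comm N' N]; ring
  · rw [h2, h2', a3, b3, add_comm N' N, dz_iterate_add _ a1 b1]; ring

lemma HasRes.const_mul {r : ℂ} (a : ℂ) (hf : HasRes f c r) : HasRes (fun w => a * f w) c (a * r) := by
  obtain ⟨N, h, hh, h1, h2⟩ := hf
  refine ⟨N, fun w => a * h w, contDiff_const.mul hh, ?_, ?_⟩
  · filter_upwards [h1] with w hw
    rw [hw]; ring
  · rw [h2, dz_iterate_const_mul _ _ hh]; ring

lemma HasRes.of_contDiff (hh : Smooth h) (hf : ∀ᶠ w in 𝓝[≠] c, f w = h w) : HasRes f c 0 := by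
  refine ⟨0, fun w => (w - c) * h w, (by fun_prop : Smooth fun w : ℂ => w - c).mul hh, ?_, ?_⟩
  · filter_upwards [hf, self_mem_nhdsWithin] with w hw hne
    have : w - c ≠ 0 := sub_ne_zero.2 hne
    rw [hw, zero_add, pow_one, mul_div_cancel_left₀ _ this]
  · simp

lemma HasRes.sum (t : Finset ι) {f : ι → ℂ → ℂ} {r : ι → ℂ}
    (hf : ∀ i ∈ t, HasRes (f i) c (r i)) : HasRes (fun w => ∑ i ∈ t, f i w) c (∑ i ∈ t, r i) :=
  sum_rel (R := fun f r => HasRes f c r)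
    (HasRes.of_contDiff contDiff_const (.of_forall fun _ => rfl)) HasRes.add t hf

lemma dz_iterate_comp_add (h : ℂ → ℂ) (a : ℂ) (M : ℕ) (w : ℂ) :
    (dz 1)^[M] (fun w => h (w + a)) w = (dz 1)^[M] h (w + a) := by
  induction M generalizing w with
  | zero => simp
  | succ M ih => simp only [iterate_succ_apply', funext ih, dz, fderiv_comp_add_right]

lemma tendsto_add_nhdsNE (c a : ℂ) : Tendsto (fun w => w + a) (𝓝[≠] c) (𝓝[≠] (c + a)) :=
  (Continuous.continuousWithinAt (by fun_prop)).tendsto_nhdsWithin fun w hw => by simpa using hw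

lemma HasRes.comp_add {r : ℂ} (a : ℂ) (hf : HasRes f (c + a) r) : HasRes (fun w => f (w + a)) c r := by
  obtain ⟨N, h, hh, h1, h2⟩ := hf
  refine ⟨N, fun w => h (w + a), hh.comp (by fun_prop), ?_, ?_⟩
  · filter_upwards [(tendsto_add_nhdsNE c a).eventually h1] with w hw
    rw [hw]; congr 2; ring
  · rw [h2, dz_iterate_comp_add]

/-- Residue of the product of a smooth function and a function with a pole. -/
lemma HasRes.smooth_mul {ρ : ℂ → ℂ} (hρ : Smooth ρ)
    (hh : Smooth h) (h1 : ∀ᶠ w in 𝓝[≠] c, f w = h w / (w - c) ^ (N + 1))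
    {a : ℕ → ℂ} (ha : ∀ k, HasRes (fun w => (w - c) ^ k * f w) c (a k)) {K : ℕ} (hK : ∀ k, K ≤ k → a k = 0) :
    HasRes (fun w => ρ w * f w) c (∑ k ∈ range K, (1 / (k ! : ℂ)) * (dz 1)^[k] ρ c * a k) := by
  -- The numbers `a k` are the Laurent coefficients of `f`, that is, normalized derivatives of `h`
  -- of order `N - k`; the assertion then is the Leibniz rule for `∂^N (ρ h)` at `c`.
  have hak : ∀ k, a k = if k ≤ N then (1 / ((N - k)! : ℂ)) * (dz 1)^[N - k] h c else 0 := by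
    intro k
    rw [← dz_iterate_sub_pow_mul hh]
    refine (ha k).unique ⟨N, fun w => (w - c) ^ k * h w, (contDiff_sub_pow c k).mul hh, ?_, rfl⟩
    filter_upwards [h1] with w hw
    rw [hw]; ring
  refine ⟨N, fun w => ρ w * h w, hρ.mul hh, ?_, ?_⟩
  · filter_upwards [h1] with w hw
    rw [hw]; ring
  -- `K` and the exponent `N` of the chosen presentation are unrelated, so both sums are extended by
  -- zero terms to a common range.
  · have e1 : ∑ k ∈ range K, (1 / (k ! : ℂ)) * (dz 1)^[k] ρ c * a k =
        ∑ k ∈ range (max K (N + 1)), (1 / (k ! : ℂ)) * (dz 1)^[k] ρ c * a k := by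
      refine sum_subset (by simp) fun k _ hk => ?_
      rw [hK k (by simpa using hk), mul_zero]
    have e2 : ∑ k ∈ range (N + 1), (1 / (k ! : ℂ)) * (dz 1)^[k] ρ c * a k =
        ∑ k ∈ range (max K (N + 1)), (1 / (k ! : ℂ)) * (dz 1)^[k] ρ c * a k := by
      refine sum_subset (by simp) fun k _ hk => ?_
      rw [hak k, if_neg (by simpa using hk), mul_zero]
    rw [e1, ← e2, dz_iterate_mul hρ hh, Finset.Nat.sum_antidiagonal_eq_sum_range_succ_mk, mul_sum]
    refine sum_congr rfl fun k hk => ?_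
    have hkN : k ≤ N := Nat.lt_succ_iff.1 (mem_range.1 hk)
    rw [hak k, if_pos hkN]
    have h1 : (N.choose k : ℂ) * k ! * (N - k)! = N ! := by
      exact_mod_cast Nat.choose_mul_factorial_mul_factorial hkN
    have h2 : (N ! : ℂ) ≠ 0 := by exact_mod_cast N.factorial_ne_zero
    have h3 : ((N - k)! : ℂ) ≠ 0 := by exact_mod_cast (N - k).factorial_ne_zero
    have h4 : (k ! : ℂ) ≠ 0 := by exact_mod_cast k.factorial_ne_zero
    field_simp
    linear_combination (-1 : ℂ) * (dz 1)^[k] ρ c * (dz 1)^[N - k] h c * h1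

/-- The regularized integral of `∂̄f` is `-π` times the sum of the residues. -/
lemma HasPV.dzbar {s : Finset ℂ} {h : ℂ → ℂ → ℂ} (hh : ∀ c, IsTest (h c))
    {T : Set ℂ} (hT : T.Countable) (hTd : ∀ p, ∀ᶠ w in 𝓝[≠] p, w ∉ T)
    (hf : ∀ w, w ∉ T → f w = ∑ c ∈ s, h c w / (w - c) ^ (N + 1))
    {r : ℂ → ℂ} (hr : ∀ c, HasRes f c (r c)) {S : Finset ℂ} (hS : ∀ c, c ∉ S → r c = 0) :
    HasPV (EllipticConfig.dzbar 1 f) (-(pi : ℂ) * ∑ c ∈ S, r c) := by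
  classical
  -- At each point only the summand with its pole there contributes a residue; uniqueness identifies
  -- it with the prescribed one.
  have hrc : ∀ c, r c = if c ∈ s then (1 / (N ! : ℂ)) * (dz 1)^[N] (h c) c else 0 := by
    intro p
    have hother : ∀ c ∈ s, c ≠ p → HasRes (fun w => h c w / (w - c) ^ (N + 1)) p 0 := by
      intro c _ hcp
      have hU : ({c}ᶜ : Set ℂ) ∈ 𝓝 p := isOpen_compl_singleton.mem_nhds (Ne.symm hcp)
      have hc : SmoothOn (fun w => h c w / (w - c) ^ (N + 1)) ({c}ᶜ : Set ℂ) := fun w hw =>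
        (contDiffAt_div (hh c).1.contDiffAt (contDiff_sub_pow c (N + 1)).contDiffAt
          (pow_ne_zero _ (sub_ne_zero.2 hw))).contDiffWithinAt
      obtain ⟨k, hk, hk'⟩ := exists_isTest_eventuallyEq hU hc
      exact HasRes.of_contDiff hk.1 (nhdsWithin_le_nhds (hk'.mono fun w hw => hw.symm))
    have hsum : HasRes (fun w => ∑ c ∈ s, h c w / (w - c) ^ (N + 1)) p
        (∑ c ∈ s, if c = p then (1 / (N ! : ℂ)) * (dz 1)^[N] (h c) c else 0) := by
      refine HasRes.sum s fun c hc => ?_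
      split_ifs with hcp
      · subst hcp
        exact ⟨N, h c, (hh c).1, .of_forall fun _ => rfl, rfl⟩
      · exact hother c hc hcp
    rw [Finset.sum_ite_eq'] at hsum
    refine (hr p).unique (hsum.congr ?_)
    filter_upwards [hTd p] with w hw
    exact (hf w hw).symm
  have hval : ∑ c ∈ S, r c = ∑ c ∈ s, (1 / (N ! : ℂ)) * (dz 1)^[N] (h c) c := by
    have e1 : ∑ c ∈ S, r c = ∑ c ∈ S ∪ s, r c := sum_subset subset_union_left fun c _ hc => hS c hc
    have e2 : ∑ c ∈ s, r c = ∑ c ∈ S ∪ s, r c :=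
      sum_subset subset_union_right fun c _ hc => by rw [hrc, if_neg hc]
    rw [e1, ← e2]
    exact sum_congr rfl fun c hc => by rw [hrc, if_pos hc]
  refine ⟨s, N, fun c => EllipticConfig.dzbar 1 (h c), fun c => (hh c).dzbar 1, ?_, ?_⟩
  · have hnull : ∀ᵐ w : ℂ, w ∉ T ∧ ∀ c ∈ s, w ≠ c := by
      refine (hT.ae_notMem _).and ?_
      exact (MeasureTheory.ae_ball_iff s.countable_toSet).2 fun c _ => ae_ne c
    filter_upwards [hnull] with w hw
    have hloc : f =ᶠ[𝓝 w] fun w => ∑ c ∈ s, h c w / (w - c) ^ (N + 1) :=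
      eventually_nhds_of_ne ((hTd w).mono hf) (hf w hw.1)
    have hsm : ∀ c ∈ s, DifferentiableAt ℂ (fun w : ℂ => ((w - c) ^ (N + 1))⁻¹) w := fun c hc =>
      DifferentiableAt.inv (by fun_prop) (pow_ne_zero _ (sub_ne_zero.2 (hw.2 c hc)))
    rw [dzbar_congr 1 hloc]
    simp only [div_eq_mul_inv]
    rw [dzbar_sum]
    · refine sum_congr rfl fun c hc => ?_
      rw [dzbar_mul 1 ((hh c).1.diffAt w) ((hsm c hc).restrictScalars ℝ), dzbar_of_holomorphic 1 (hsm c hc)]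
      ring
    · intro c hc
      exact ((hh c).1.diffAt w).fun_mul ((hsm c hc).restrictScalars ℝ)
  · rw [hval, mul_sum]
    refine sum_congr rfl fun c _ => ?_
    have e : (fun w => EllipticConfig.dzbar 1 (h c) (w + c)) = EllipticConfig.dzbar 1 fun w => h c (w + c) := by
      funext w
      simp only [EllipticConfig.dzbar, fderiv_comp_add_right]
    rw [e, Lf_dzbar ((hh c).comp_add c), dz_iterate_comp_add, zero_add]

/-! ### Dependence of the regularized integral on parameters -/

section Parameters

lemma IsTest.slice {H : ℂ × E → ℂ} (hH : IsTest H) (z : E) : IsTest fun w => H (w, z) := by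
  refine ⟨hH.1.comp (contDiff_id.prodMk contDiff_const), ?_⟩
  have : Topology.IsClosedEmbedding fun w : ℂ => (w, z) :=
    Topology.IsClosedEmbedding.of_continuous_injective_isClosedMap (by fun_prop)
      (fun a b h => (Prod.ext_iff.1 h).1) (fun s hs => by
        have : (fun w : ℂ => (w, z)) '' s = s ×ˢ {z} := by ext ⟨a, b⟩; simp [eq_comm]
        rw [this]; exact hs.prod isClosed_singleton)
  exact hH.2.comp_isClosedEmbedding this

lemma hasFDerivAt_integral_div [FiniteDimensional ℂ E] {H : ℂ × E → ℂ} (hH : IsTest H) (z : E) :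
    HasFDerivAt (fun z => ∫ w, H (w, z) / w) (∫ w : ℂ, w⁻¹ • (fderiv ℝ H (w, z)).comp (inr ℝ ℂ E)) z ∧
    Integrable fun w : ℂ => w⁻¹ • (fderiv ℝ H (w, z)).comp (inr ℝ ℂ E) := by
  have : FiniteDimensional ℝ E := FiniteDimensional.complexToReal E
  have hc : Continuous (fderiv ℝ H) := hH.1.continuous_fderiv (by simp)
  have hs : HasCompactSupport (fderiv ℝ H) := hH.2.fderiv ℝ
  obtain ⟨C, hC⟩ := hc.bounded_above_of_compact_support hs
  have hC0 : 0 ≤ C := (norm_nonneg _).trans (hC 0)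
  obtain ⟨R, hR⟩ := (hs.isCompact.image continuous_fst).isBounded.subset_closedBall (0 : ℂ)
  have hzero : ∀ w z, w ∉ closedBall (0 : ℂ) R → fderiv ℝ H (w, z) = 0 := by
    intro w z hw
    by_contra hne
    exact hw (hR ⟨(w, z), subset_tsupport _ hne, rfl⟩)
  set B : ℂ → ℝ := (closedBall (0 : ℂ) R).indicator fun w => ‖w⁻¹‖ * (C * ‖inr ℝ ℂ E‖) with hB
  have hBi : Integrable B := by
    rw [hB, integrable_indicator_iff measurableSet_closedBall]
    exact ((locallyIntegrable_inv.integrableOn_isCompact (isCompact_closedBall 0 R)).norm).mul_const _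
  have hbound : ∀ (w : ℂ) (z : E), ‖w⁻¹ • (fderiv ℝ H (w, z)).comp (inr ℝ ℂ E)‖ ≤ B w := by
    intro w z
    by_cases hw : w ∈ closedBall (0 : ℂ) R
    · rw [hB, indicator_of_mem hw, norm_smul]
      gcongr
      exact (ContinuousLinearMap.opNorm_comp_le _ _).trans (by gcongr; exact hC _)
    · rw [hB, Set.indicator_of_notMem hw, hzero w z hw, ContinuousLinearMap.zero_comp,
        norm_smul, norm_zero, mul_zero]
  have hmeas : AEStronglyMeasurable (fun w : ℂ => w⁻¹ • (fderiv ℝ H (w, z)).comp (inr ℝ ℂ E)) volume := by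
    refine AEStronglyMeasurable.smul (measurable_inv.aestronglyMeasurable) ?_
    refine Continuous.aestronglyMeasurable ?_
    exact (hc.comp (by fun_prop : Continuous fun w : ℂ => (w, z))).clm_comp continuous_const
  refine ⟨hasFDerivAt_integral_of_dominated_of_fderiv_le (bound := B) univ_mem
    (.of_forall fun z => (hH.slice z).integrable_div.aestronglyMeasurable)
    (hH.slice z).integrable_div hmeas (.of_forall fun w z _ => hbound w z) hBi (.of_forall fun w z _ => ?_),
    hBi.mono' hmeas (.of_forall fun w => hbound w z)⟩
  have h1 : HasFDerivAt (fun z => H (w, z)) ((fderiv ℝ H (w, z)).comp (inr ℝ ℂ E)) z :=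
    (hH.1.diffAt (w, z)).hasFDerivAt.comp z (hasFDerivAt_prodMk_right w z)
  have h2 := h1.const_smul (w⁻¹)
  refine h2.congr_of_eventuallyEq (.of_forall fun y => ?_)
  simp [div_eq_inv_mul]

lemma fderiv_integral_div [FiniteDimensional ℂ E] {H : ℂ × E → ℂ} (hH : IsTest H) (z v : E) :
    fderiv ℝ (fun z => ∫ w, H (w, z) / w) z v = ∫ w, fderiv ℝ H (w, z) (0, v) / w := by
  obtain ⟨h1, h2⟩ := hasFDerivAt_integral_div hH z
  rw [h1.fderiv, ContinuousLinearMap.integral_apply h2]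
  refine integral_congr_ae (.of_forall fun w => ?_)
  simp [div_eq_inv_mul]

lemma contDiff_integral_div [FiniteDimensional ℂ E] {H : ℂ × E → ℂ} (hH : IsTest H) :
    Smooth fun z => ∫ w, H (w, z) / w := by
  have : FiniteDimensional ℝ E := FiniteDimensional.complexToReal E
  rw [contDiff_infty]
  intro m
  induction m generalizing H with
  | zero =>
    exact contDiff_zero.2 (continuous_iff_continuousAt.2 fun z =>
      (hasFDerivAt_integral_div hH z).1.continuousAt)
  | succ m ih =>
    rw [Nat.cast_add, Nat.cast_one, contDiff_succ_iff_fderiv_apply]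
    refine ⟨fun z => (hasFDerivAt_integral_div hH z).1.differentiableAt, fun h => by simp at h, fun v => ?_⟩
    simp only [fderiv_integral_div hH]
    refine ih (H := fun p => fderiv ℝ H p (0, v))
      ⟨(hH.1.fderiv_right (m := ∞) (by simp)).clm_apply contDiff_const, ?_⟩
    exact (hH.2.fderiv ℝ).comp_left (g := fun A : ℂ × E →L[ℝ] ℂ => A (0, v)) (by simp)

lemma dz_integral_div [FiniteDimensional ℂ E] {H : ℂ × E → ℂ} (hH : IsTest H) (z v : E) :
    dz v (fun z => ∫ w, H (w, z) / w) z = ∫ w, dz (0, v) H (w, z) / w := by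
  have hi : ∀ u : E, Integrable fun w => fderiv ℝ H (w, z) (0, u) / w := by
    intro u
    have := (hasFDerivAt_integral_div hH z).2.apply_continuousLinearMap u
    refine this.congr (.of_forall fun w => ?_)
    simp [div_eq_inv_mul]
  rw [dz, fderiv_integral_div hH, fderiv_integral_div hH, ← integral_const_mul,
    ← integral_sub (hi v) ((hi _).const_mul _), ← integral_const_mul]
  refine integral_congr_ae (.of_forall fun w => ?_)
  simp only [dz, Prod.smul_mk, smul_zero]
  ring

lemma dz_slice {H : ℂ × E → ℂ} (hH : Smooth H) (z : E) (w : ℂ) :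
    dz 1 (fun w => H (w, z)) w = dz (1, 0) H (w, z) := by
  have := dz_comp (g := H) (φ := fun w : ℂ => (w, z)) (A := inl ℂ ℂ E)
    (y := w) 1 (hH.diffAt _) (hasFDerivAt_prodMk_left w z)
  simpa using this

lemma dz_iterate_slice {H : ℂ × E → ℂ} (hH : Smooth H) (z : E) (N : ℕ) :
    (dz 1)^[N] (fun w => H (w, z)) = fun w => (dz (1, 0))^[N] H (w, z) := by
  induction N with
  | zero => rfl
  | succ N ih =>
    rw [iterate_succ_apply', ih]
    funext w
    rw [dz_slice (contDiff_dz_iterate _ hH N), iterate_succ_apply']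

lemma Lf_slice {H : ℂ × E → ℂ} (hH : Smooth H) (N : ℕ) : (fun z => Lf N fun w => H (w, z)) =
      fun z => (1 / (N ! : ℂ)) * ∫ w, (dz (1, 0))^[N] H (w, z) / w := by
  funext z
  rw [Lf, dz_iterate_slice hH]

lemma isTest_Lf [FiniteDimensional ℂ E] {H : ℂ × E → ℂ} (hH : IsTest H) (N : ℕ) :
    IsTest fun z => Lf N fun w => H (w, z) := by
  refine ⟨?_, ?_⟩
  · rw [Lf_slice hH.1]
    exact contDiff_const.mul (contDiff_integral_div (hH.dz_iterate _ N))
  · refine HasCompactSupport.intro (hH.2.isCompact.image continuous_snd) fun z hz => ?_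
    have : (fun w => H (w, z)) = fun _ => 0 := by
      funext w
      by_contra hne
      exact hz ⟨(w, z), subset_tsupport _ hne, rfl⟩
    rw [this, Lf_zero]

lemma dz_Lf [FiniteDimensional ℂ E] {H : ℂ × E → ℂ} (hH : IsTest H) (N : ℕ) (v z : E) :
    dz v (fun z => Lf N fun w => H (w, z)) z = Lf N fun w => dz (0, v) H (w, z) := by
  have h1 := congrFun (Lf_slice (hH.dz (0, v)).1 N) z
  rw [h1, Lf_slice hH.1, dz_const_mul _ _ (ContDiff.diffAt
    (contDiff_integral_div (hH.dz_iterate _ N)) z), dz_integral_div (hH.dz_iterate _ N),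
    dz_iterate_dz_comm _ _ hH.1]

lemma hasFDerivAt_sub_add (L : E →L[ℂ] ℂ) (b : ℂ) (x : ℂ × E) :
    HasFDerivAt (fun p : ℂ × E => p.1 - (L p.2 + b)) (fst ℂ ℂ E - L.comp (snd ℂ ℂ E)) x :=
  hasFDerivAt_fst.sub ((L.comp (snd ℂ ℂ _)).hasFDerivAt.add_const b)

lemma dz_sub_add_pow (L : E →L[ℂ] ℂ) (b : ℂ) (x v : ℂ × E) : dz v (fun p : ℂ × E => (p.1 - (L p.2 + b)) ^ N) x =
      N * (x.1 - (L x.2 + b)) ^ (N - 1) * (v.1 - L v.2) := by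
  have h : HasFDerivAt (fun p : ℂ × E => (p.1 - (L p.2 + b)) ^ N) _ x := (hasFDerivAt_sub_add L b x).pow N
  rw [dz_of_holomorphic _ h.differentiableAt, h.fderiv]
  simp

/-- The shear `(w, z) ↦ (w + L z + b, z)`. -/
def shear (L : E →L[ℂ] ℂ) (b : ℂ) : ℂ × E ≃ₜ ℂ × E where
  toFun p := (p.1 + (L p.2 + b), p.2)
  invFun p := (p.1 - (L p.2 + b), p.2)
  left_inv p := by simp
  right_inv p := by simp
  continuous_toFun := by fun_prop
  continuous_invFun := by fun_prop

lemma contDiff_shear (L : E →L[ℂ] ℂ) (b : ℂ) : Smooth (shear L b) := by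
  have hL : Smooth L := (L.restrictScalars ℝ).contDiff
  show Smooth fun p : ℂ × E => (p.1 + (L p.2 + b), p.2)
  fun_prop

lemma dz_shear {H : ℂ × E → ℂ} (hH : Smooth H) (L : E →L[ℂ] ℂ) (b : ℂ) (v z : E) (w : ℂ) :
    dz (0, v) (fun p => H (shear L b p)) (w, z) =
      L v * dz (1, 0) H (w + (L z + b), z) + dz (0, v) H (w + (L z + b), z) := by
  have hφ : HasFDerivAt (shear L b : ℂ × E → ℂ × E) ((fst ℂ ℂ E + L.comp (snd ℂ ℂ E)).prod
        (snd ℂ ℂ E)) (w, z) := by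
    have h1 : HasFDerivAt (fun p : ℂ × E => p.1 + (L p.2 + b)) (fst ℂ ℂ E + L.comp (snd ℂ ℂ E)) (w, z) :=
      hasFDerivAt_fst.add ((L.comp (snd ℂ ℂ E)).hasFDerivAt.add_const b)
    exact h1.prodMk hasFDerivAt_snd
  rw [dz_comp _ (hH.diffAt _) hφ, ← dz_smul_dir, ← dz_add_dir]
  simp [shear]

end Parameters

/-! ### The lattice and the big diagonal -/

lemma zero_mem_lattice (τ : ℂ) : (0 : ℂ) ∈ lattice τ := ⟨0, 0, by simp⟩

lemma add_mem_lattice {τ a b : ℂ} (ha : a ∈ lattice τ) (hb : b ∈ lattice τ) : a + b ∈ lattice τ := by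
  obtain ⟨k, l, rfl⟩ := ha
  obtain ⟨k', l', rfl⟩ := hb
  exact ⟨k + k', l + l', by push_cast; ring⟩

lemma neg_mem_lattice {τ a : ℂ} (ha : a ∈ lattice τ) : -a ∈ lattice τ := by
  obtain ⟨k, l, rfl⟩ := ha
  exact ⟨-k, -l, by push_cast; ring⟩

lemma sub_mem_lattice {τ a b : ℂ} (ha : a ∈ lattice τ) (hb : b ∈ lattice τ) : a - b ∈ lattice τ := by
  rw [sub_eq_add_neg]; exact add_mem_lattice ha (neg_mem_lattice hb)

lemma neg_mem_lattice_iff {τ a : ℂ} : -a ∈ lattice τ ↔ a ∈ lattice τ :=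
  ⟨fun h => by simpa using neg_mem_lattice h, neg_mem_lattice⟩

lemma sub_mem_lattice_comm {τ a b : ℂ} : a - b ∈ lattice τ ↔ b - a ∈ lattice τ := by
  rw [← neg_mem_lattice_iff, neg_sub]

lemma add_mem_lattice_iff {τ a b : ℂ} (hb : b ∈ lattice τ) : a + b ∈ lattice τ ↔ a ∈ lattice τ :=
  ⟨fun h => by simpa using sub_mem_lattice h hb, fun h => add_mem_lattice h hb⟩

lemma lattice_eq_range (τ : ℂ) : lattice τ = range fun p : ℤ × ℤ => (p.1 : ℂ) + p.2 * τ := by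
  ext w
  constructor
  · rintro ⟨k, l, rfl⟩; exact ⟨(k, l), rfl⟩
  · rintro ⟨⟨k, l⟩, rfl⟩; exact ⟨k, l, rfl⟩

lemma countable_lattice (τ : ℂ) : (lattice τ).Countable := by rw [lattice_eq_range]; exact Set.countable_range _

lemma norm_lattice_ge (τ : ℍ) {a : ℂ} (ha : a ∈ lattice τ) (h0 : a ≠ 0) : min 1 τ.im ≤ ‖a‖ := by
  obtain ⟨k, l, rfl⟩ := ha
  by_cases hl : l = 0
  · subst hl
    simp only [Int.cast_zero, zero_mul, add_zero, ne_eq, Int.cast_eq_zero] at h0 ⊢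
    refine (min_le_left _ _).trans ?_
    rw [Complex.norm_intCast]
    exact_mod_cast Int.one_le_abs h0
  · refine (min_le_right _ _).trans ((?_ : τ.im ≤ |((k : ℂ) + l * τ).im|).trans (Complex.abs_im_le_norm _))
    have : ((k : ℂ) + l * τ).im = l * τ.im := by simp
    rw [this, abs_mul, abs_of_pos τ.im_pos]
    have : (1 : ℝ) ≤ |(l : ℝ)| := by exact_mod_cast Int.one_le_abs hl
    nlinarith [τ.im_pos]

lemma eventually_notMem_lattice (τ : ℍ) (p : ℂ) : ∀ᶠ w in 𝓝[≠] p, w ∉ lattice τ := by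
  have hδ : 0 < min 1 τ.im := lt_min one_pos τ.im_pos
  by_cases hex : ∃ q ∈ lattice τ, q ≠ p ∧ ‖q - p‖ < min 1 τ.im / 2
  · obtain ⟨q, hq, hqp, hqd⟩ := hex
    have h1 : ball p (min 1 τ.im / 2) ∩ {q}ᶜ ∈ 𝓝 p := inter_mem (ball_mem_nhds _ (by positivity))
        (isOpen_compl_singleton.mem_nhds (Ne.symm hqp))
    filter_upwards [nhdsWithin_le_nhds h1] with w hw hwl
    have h2 := norm_lattice_ge τ (sub_mem_lattice hwl hq) (sub_ne_zero.2 hw.2)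
    have h3 : ‖w - p‖ < min 1 τ.im / 2 := by simpa [dist_eq_norm] using hw.1
    have h4 : ‖w - q‖ ≤ ‖w - p‖ + ‖q - p‖ := by have := norm_sub_le (w - p) (q - p); simpa using this
    linarith
  · push Not at hex
    filter_upwards [nhdsWithin_le_nhds (ball_mem_nhds p (half_pos hδ)), self_mem_nhdsWithin] with w hw hne hwl
    have h3 : ‖w - p‖ < min 1 τ.im / 2 := by simpa [dist_eq_norm] using hw
    linarith [hex w hwl hne]

lemma isClosed_lattice (τ : ℍ) : IsClosed (lattice τ) := by
  rw [← isOpen_compl_iff, isOpen_iff_mem_nhds]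
  intro p hp
  exact eventually_nhds_of_ne (eventually_notMem_lattice τ p) hp

lemma bigDiagonal_eq_iUnion (n : ℕ) (τ : ℂ) : bigDiagonal n τ = ⋃ p : {p : Fin n × Fin n // p.1 ≠ p.2},
      (fun z : ℂ^n => z p.1.1 - z p.1.2) ⁻¹' lattice τ := by
  ext z
  simp only [bigDiagonal, mem_ofPred_eq, mem_iUnion, mem_preimage]
  constructor
  · rintro ⟨i, j, hij, h⟩; exact ⟨⟨(i, j), hij⟩, h⟩
  · rintro ⟨⟨⟨i, j⟩, hij⟩, h⟩; exact ⟨i, j, hij, h⟩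

lemma isClosed_bigDiagonal (n : ℕ) (τ : ℍ) : IsClosed (bigDiagonal n τ) := by
  rw [bigDiagonal_eq_iUnion]
  exact isClosed_iUnion_of_finite fun p => (isClosed_lattice τ).preimage (by fun_prop)

/-- Needed over `ℂ` for the diagonals and over `ℝ` for the walls between heights. -/
lemma volume_hyperplane {K : Type*} [NormedField K] [NormedSpace ℝ K] [MeasureSpace K] [BorelSpace K]
    [FiniteDimensional ℝ K] [(volume : Measure K).IsAddHaarMeasure] {i j : Fin n} (hij : i ≠ j) (l : K) :
    volume {z : Fin n → K | z i - z j = l} = 0 := by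
  let S : Submodule ℝ (Fin n → K) := LinearMap.ker ((LinearMap.proj i : (Fin n → K) →ₗ[ℝ] K) - LinearMap.proj j)
  have hS : S ≠ ⊤ := by
    intro h
    have h1 : (Pi.single i 1 : Fin n → K) ∈ S := by rw [h]; trivial
    simp [S, hij] at h1
  have h0 := Measure.addHaar_submodule volume S hS
  have : {z : Fin n → K | z i - z j = l} = (fun z => z + Pi.single i (-l)) ⁻¹' (S : Set (Fin n → K)) := by
    ext z
    simp only [mem_ofPred_eq, mem_preimage, SetLike.mem_coe, S, LinearMap.mem_ker,
      LinearMap.sub_apply, LinearMap.proj_apply, Pi.add_apply, Pi.single_eq_same,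
      Pi.single_eq_of_ne hij.symm, add_zero]
    constructor
    · intro h; linear_combination h
    · intro h; linear_combination h
  rw [this, measure_preimage_add_right, h0]

lemma volume_bigDiagonal (n : ℕ) (τ : ℂ) : volume (bigDiagonal n τ) = 0 := by
  rw [bigDiagonal_eq_iUnion, measure_iUnion_null_iff]
  rintro ⟨⟨i, j⟩, hij⟩
  have : (fun z : ℂ^n => z i - z j) ⁻¹' lattice τ = ⋃ l ∈ lattice τ, {z : ℂ^n | z i - z j = l} := by ext z; simp
  rw [this, measure_biUnion_null_iff (countable_lattice τ)]
  exact fun l _ => volume_hyperplane hij l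

lemma ae_notMem_bigDiagonal (n : ℕ) (τ : ℂ) : ∀ᵐ z : ℂ^n, z ∉ bigDiagonal n τ :=
  measure_eq_zero_iff_ae_notMem.1 (volume_bigDiagonal n τ)

lemma add_mem_bigDiagonal_iff {τ : ℂ} {l : ℂ^n} (hl : ∀ i, l i ∈ lattice τ) :
    z + l ∈ bigDiagonal n τ ↔ z ∈ bigDiagonal n τ := by
  simp only [bigDiagonal, mem_ofPred_eq, Pi.add_apply]
  have : ∀ i j, z i + l i - (z j + l j) ∈ lattice τ ↔ z i - z j ∈ lattice τ := by
    intro i j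
    rw [show z i + l i - (z j + l j) = (z i - z j) + (l i - l j) by ring]
    exact add_mem_lattice_iff (sub_mem_lattice (hl i) (hl j))
  simp only [this]

/-! ### Insertion of a coordinate -/

/-- The isomorphism `ℂ × ℂⁿ ≃ ℂⁿ⁺¹` that inserts a coordinate at position `i`. -/
def ins (i : Fin (n + 1)) : (ℂ × ℂ^n) ≃L[ℂ] ℂ^(n + 1) := LinearEquiv.toContinuousLinearEquiv
    { Fin.insertNthEquiv (fun _ => ℂ) i with
      map_add' := fun p q => by
        funext k
        refine Fin.succAboveCases i ?_ (fun k => ?_) k <;> simp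
      map_smul' := fun c p => by
        funext k
        refine Fin.succAboveCases i ?_ (fun k => ?_) k <;> simp }

section Insertion

variable (i : Fin (n + 1))

lemma ins_apply (p : ℂ × ℂ^n) : ins i p = Fin.insertNth (α := fun _ => ℂ) i p.1 p.2 := rfl

@[simp] lemma ins_same (p : ℂ × ℂ^n) : ins i p i = p.1 := by simp [ins_apply]

@[simp] lemma ins_succAbove (p : ℂ × ℂ^n) (k : Fin n) : ins i p (i.succAbove k) = p.2 k := by simp [ins_apply]

lemma ins_single_same : ins i ((1 : ℂ), (0 : ℂ^n)) = Pi.single i 1 := by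
  funext k
  refine Fin.succAboveCases i ?_ (fun k => ?_) k <;> simp

lemma ins_single_succAbove (k : Fin n) :
    ins i ((0 : ℂ), (Pi.single k 1 : ℂ^n)) = Pi.single (i.succAbove k) 1 := by
  funext m
  refine Fin.succAboveCases i ?_ (fun m => ?_) m
  · simp
  · simp [Pi.single_apply]

lemma ins_notMem_bigDiagonal {τ : ℂ} :
    ins i (w, z) ∉ bigDiagonal (n + 1) τ ↔ z ∉ bigDiagonal n τ ∧ ∀ j, w - z j ∉ lattice τ := by
  constructor
  · intro h
    refine ⟨fun ⟨a, b, hab, hl⟩ => h ⟨i.succAbove a, i.succAbove b, by simpa using hab, by simpa using hl⟩,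
      fun j hj => h ⟨i, i.succAbove j, (Fin.succAbove_ne i j).symm, by simpa using hj⟩⟩
  · rintro ⟨h1, h2⟩ ⟨a, b, hab, hl⟩
    revert hab hl
    refine Fin.succAboveCases i ?_ (fun a => ?_) a <;> refine Fin.succAboveCases i ?_ (fun b => ?_) b
    · intro h; exact absurd rfl h
    · intro _ hl; exact h2 b (by simpa using hl)
    · intro _ hl; exact h2 a (sub_mem_lattice_comm.1 (by simpa using hl))
    · intro hab hl
      exact h1 ⟨a, b, fun h => hab (by rw [h]), by simpa using hl⟩

lemma measurePreserving_ins : MeasurePreserving (ins i : ℂ × ℂ^n → ℂ^(n + 1)) :=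
  (volume_preserving_piFinSuccAbove (fun _ => ℂ) i).symm

attribute [irreducible] ins

end Insertion

/-! ### Functions with poles along the diagonals and compact support -/

/-- The monoid of products of equations `z_i - z_j - λ` of diagonals. -/
def Denom (n : ℕ) (τ : ℂ) : Submonoid (ℂ^n → ℂ) :=
  Submonoid.closure {f | ∃ i j, i ≠ j ∧ ∃ l ∈ lattice τ, f = fun z => z i - z j - l}

lemma sub_mem_Denom {τ : ℂ} {i j : Fin n} (hij : i ≠ j) {l : ℂ} (hl : l ∈ lattice τ) :
    (fun z : ℂ^n => z i - z j - l) ∈ Denom n τ := Submonoid.subset_closure ⟨i, j, hij, l, hl, rfl⟩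

lemma contDiff_of_mem_Denom {τ : ℂ} (hD : D ∈ Denom n τ) : ContDiff ℂ ∞ D := by
  induction hD using Submonoid.closure_induction with
  | mem f hf => obtain ⟨i, j, _, l, _, rfl⟩ := hf; fun_prop
  | one => exact contDiff_const
  | mul f g _ _ hf hg => exact hf.mul hg

lemma ne_zero_of_mem_Denom {τ : ℂ} (hD : D ∈ Denom n τ) (hz : z ∉ bigDiagonal n τ) : D z ≠ 0 := by
  induction hD using Submonoid.closure_induction with
  | mem f hf =>
    obtain ⟨i, j, hij, l, hl, rfl⟩ := hf
    intro h
    exact hz ⟨i, j, hij, by rwa [sub_eq_zero.1 h]⟩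
  | one => simp
  | mul f g _ _ hf hg => exact mul_ne_zero hf hg

lemma comp_add_mem_Denom {τ : ℂ} (hD : D ∈ Denom n τ)
    {l : ℂ^n} (hl : ∀ i, l i ∈ lattice τ) : (fun z => D (z + l)) ∈ Denom n τ := by
  induction hD using Submonoid.closure_induction with
  | mem f hf =>
    obtain ⟨i, j, hij, m, hm, rfl⟩ := hf
    have : (fun z : ℂ^n => (z + l) i - (z + l) j - m) = fun z => z i - z j - (m - (l i - l j)) := by
      funext z; simp only [Pi.add_apply]; ring
    rw [this]
    exact sub_mem_Denom hij (sub_mem_lattice hm (sub_mem_lattice (hl i) (hl j)))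
  | one => exact one_mem _
  | mul f g _ _ hf hg => exact mul_mem hf hg

lemma contDiff_real_of_mem_Denom {τ : ℂ} (hD : D ∈ Denom n τ) :
    Smooth D := (contDiff_of_mem_Denom hD).restrict_scalars ℝ

/-- Off the diagonals, `F` is a smooth function of compact support divided by a product of
equations of diagonals. -/
def IsK (τ : ℂ) (F : ℂ^n → ℂ) : Prop := ∃ h D, IsTest h ∧ D ∈ Denom n τ ∧ ∀ z ∉ bigDiagonal n τ, F z = h z / D z

section IsK

variable {G : ℂ^n → ℂ}

lemma IsK.congr (hF : IsK τ F) (h : ∀ z ∉ bigDiagonal n τ, F z = G z) : IsK τ G := by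
  obtain ⟨k, D, hk, hD, e⟩ := hF
  exact ⟨k, D, hk, hD, fun z hz => by rw [← h z hz, e z hz]⟩

lemma IsTest.isK (hF : IsTest F) : IsK τ F := ⟨F, 1, hF, one_mem _, fun z _ => by simp⟩

lemma IsK.add (hF : IsK τ F) (hG : IsK τ G) : IsK τ fun z => F z + G z := by
  obtain ⟨k, D, hk, hD, e⟩ := hF
  obtain ⟨k', D', hk', hD', e'⟩ := hG
  refine ⟨fun z => k z * D' z + k' z * D z, D * D', (hk.mul_smooth (contDiff_real_of_mem_Denom hD')).add
      (hk'.mul_smooth (contDiff_real_of_mem_Denom hD)), mul_mem hD hD', fun z hz => ?_⟩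
  have h1 := ne_zero_of_mem_Denom hD hz
  have h2 := ne_zero_of_mem_Denom hD' hz
  simp only [e z hz, e' z hz, Pi.mul_apply]
  field_simp

lemma IsK.smooth_mul {k : ℂ^n → ℂ} (hk : Smooth k) (hF : IsK τ F) : IsK τ fun z => k z * F z := by
  obtain ⟨h, D, hh, hD, e⟩ := hF
  exact ⟨fun z => k z * h z, D, IsTest.smooth_mul hk hh, hD, fun z hz => by simp only [e z hz, mul_div_assoc]⟩

lemma IsK.const_mul (a : ℂ) (hF : IsK τ F) : IsK τ fun z => a * F z := hF.smooth_mul contDiff_const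

lemma IsK.sum (s : Finset ι) {F : ι → ℂ^n → ℂ} (hF : ∀ i ∈ s, IsK τ (F i)) : IsK τ fun z => ∑ i ∈ s, F i z :=
  sum_prop (IsTest.isK IsTest.zero) IsK.add s hF

lemma IsK.comp_add (hF : IsK τ F) {l : ℂ^n} (hl : ∀ i, l i ∈ lattice τ) : IsK τ fun z => F (z + l) := by
  obtain ⟨h, D, hh, hD, e⟩ := hF
  exact ⟨fun z => h (z + l), fun z => D (z + l), hh.comp_add l, comp_add_mem_Denom hD hl,
    fun z hz => e _ (by rwa [add_mem_bigDiagonal_iff hl])⟩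

lemma compl_bigDiagonal_mem_nhds (hz : z ∉ bigDiagonal n τ) : ∀ᶠ y in 𝓝 z, y ∉ bigDiagonal n τ :=
  (isClosed_bigDiagonal n τ).isOpen_compl.mem_nhds hz

lemma IsK.contDiffAt (hF : IsK τ F) (hz : z ∉ bigDiagonal n τ) : SmoothAt F z := by
  obtain ⟨h, D, hh, hD, e⟩ := hF
  refine (contDiffAt_div hh.1.contDiffAt (contDiff_real_of_mem_Denom hD).contDiffAt
    (ne_zero_of_mem_Denom hD hz)).congr_of_eventuallyEq ((compl_bigDiagonal_mem_nhds hz).mono e)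

lemma dz_div {h D : E → ℂ} {x : E} (v : E)
    (hh : DifferentiableAt ℝ h x) (hD : DifferentiableAt ℝ D x) (h0 : D x ≠ 0) :
    dz v (fun y => h y / D y) x = dz v h x / D x - h x * dz v D x / D x ^ 2 := by
  have h1 : HasFDerivAt (fun y => (D y)⁻¹) (-(D x ^ 2)⁻¹ • fderiv ℝ D x) x := by
    have h2 := (hasDerivAt_inv h0).complexToReal_fderiv.comp x hD.hasFDerivAt
    have h4 : (-(D x ^ 2)⁻¹ • (1 : ℂ →L[ℝ] ℂ)).comp (fderiv ℝ D x) = -(D x ^ 2)⁻¹ • fderiv ℝ D x := by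
      ext v; simp
    rw [h4] at h2
    exact h2
  have h3 : dz v (fun y => (D y)⁻¹) x = -(dz v D x) / D x ^ 2 := by
    simp only [dz, h1.fderiv, smul_apply, smul_eq_mul]
    ring
  simp only [div_eq_mul_inv]
  rw [dz_mul v hh h1.differentiableAt, h3]
  ring

lemma dzbar_div {h D : E → ℂ} {x : E} (v : E)
    (hh : DifferentiableAt ℝ h x) (hD : DifferentiableAt ℂ D x) (h0 : D x ≠ 0) :
    dzbar v (fun y => h y / D y) x = dzbar v h x / D x := by
  simp only [div_eq_mul_inv]
  have h1 := hD.fun_inv h0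
  rw [dzbar_mul v hh (h1.restrictScalars ℝ), dzbar_of_holomorphic v h1]
  ring

lemma IsK.dz (v : ℂ^n) (hF : IsK τ F) : IsK τ (dz v F) := by
  obtain ⟨h, D, hh, hD, e⟩ := hF
  have hDr := contDiff_real_of_mem_Denom hD
  refine ⟨fun z => EllipticConfig.dz v h z * D z + (-1) * (h z * EllipticConfig.dz v D z), D * D,
    ((hh.dz v).mul_smooth hDr).add ((hh.mul_smooth (contDiff_dz v hDr)).const_mul _),
    mul_mem hD hD, fun z hz => ?_⟩
  have h0 := ne_zero_of_mem_Denom hD hz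
  have : F =ᶠ[𝓝 z] fun z => h z / D z := (compl_bigDiagonal_mem_nhds hz).mono e
  rw [dz_congr v this, dz_div v (hh.1.diffAt z) (hDr.diffAt z) h0, Pi.mul_apply]
  field_simp
  ring

lemma IsK.dzbar (v : ℂ^n) (hF : IsK τ F) : IsK τ (dzbar v F) := by
  obtain ⟨h, D, hh, hD, e⟩ := hF
  refine ⟨EllipticConfig.dzbar v h, D, hh.dzbar v, hD, fun z hz => ?_⟩
  have : F =ᶠ[𝓝 z] fun z => h z / D z := (compl_bigDiagonal_mem_nhds hz).mono e
  rw [dzbar_congr v this, dzbar_div v (hh.1.diffAt z)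
    ((contDiff_of_mem_Denom hD).contDiffAt.differentiableAt (by simp)) (ne_zero_of_mem_Denom hD hz)]

end IsK

/-! ### Partial fractions in one variable -/

section PartialFractions

/-- The conditions on the pole `w = L z + b` of order `N`. -/
def IsPole (τ : ℂ) (π : E →L[ℂ] ℂ^n) (L : E →L[ℂ] ℂ) (b : ℂ) (N : ℕ) : Prop :=
  N = 0 ∨ ∃ j, L = (proj j : ℂ^n →L[ℂ] ℂ).comp π ∧ b ∈ lattice τ

/-- Functions `H / (D(z) (w - c(z)) ^ N)` of `w` and further variables, where `c = z_j + λ`. -/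
def partialFraction (τ : ℂ) (π : E →L[ℂ] ℂ^n) : Set (ℂ × E → ℂ) :=
  {T | ∃ (H : ℂ × E → ℂ) (D : ℂ^n → ℂ) (L : E →L[ℂ] ℂ) (b : ℂ) (N : ℕ), IsTest H ∧
    D ∈ Denom n τ ∧ IsPole τ π L b N ∧ T = fun p => H p / (D (π p.2) * (p.1 - (L p.2 + b)) ^ N)}

/-- Sums of partial fractions. -/
def PF (τ : ℂ) (π : E →L[ℂ] ℂ^n) : AddSubmonoid (ℂ × E → ℂ) := AddSubmonoid.closure (partialFraction τ π)

variable {π : E →L[ℂ] ℂ^n}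

lemma PF.const_mul {T : ℂ × E → ℂ} (hT : T ∈ PF τ π) (a : ℂ) : (fun p => a * T p) ∈ PF τ π := by
  induction hT using AddSubmonoid.closure_induction with
  | mem T hT =>
    obtain ⟨H, D, L, b, N, hH, hD, hc, rfl⟩ := hT
    exact AddSubmonoid.subset_closure ⟨fun p => a * H p, D, L, b, N, hH.const_mul a, hD, hc, by
      funext p; rw [mul_div_assoc]⟩
  | zero =>
    convert (PF τ π).zero_mem using 1
    funext p; simp
  | add S T _ _ hS hT =>
    convert add_mem hS hT using 1
    funext p; simp [mul_add]

lemma PF.div_Denom {T : ℂ × E → ℂ} (hT : T ∈ PF τ π) {D' : ℂ^n → ℂ}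
    (hD' : D' ∈ Denom n τ) : (fun p => T p / D' (π p.2)) ∈ PF τ π := by
  induction hT using AddSubmonoid.closure_induction with
  | mem T hT =>
    obtain ⟨H, D, L, b, N, hH, hD, hc, rfl⟩ := hT
    exact AddSubmonoid.subset_closure ⟨H, D * D', L, b, N, hH, mul_mem hD hD', hc, by
      funext p; simp only [Pi.mul_apply, div_div]; congr 1; ring⟩
  | zero =>
    convert (PF τ π).zero_mem using 1
    funext p; simp
  | add S T _ _ hS hT =>
    convert add_mem hS hT using 1
    funext p; simp [add_div]

/-- The points `(w, z)` that do not lie on a diagonal. -/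
def IsOff (τ : ℂ) (π : E →L[ℂ] ℂ^n) (p : ℂ × E) : Prop :=
  π p.2 ∉ bigDiagonal n τ ∧ ∀ j, p.1 - π p.2 j ∉ lattice τ

lemma IsOff.ne {p : ℂ × E} (hp : IsOff τ π p) (j : Fin n) {l : ℂ} (hl : l ∈ lattice τ) :
    p.1 - (π p.2 j + l) ≠ 0 := by
  intro h
  refine hp.2 j ?_
  rwa [show p.1 - π p.2 j = l by linear_combination h]

lemma IsOff.pow_ne {p : ℂ × E} (hp : IsOff τ π p) {L : E →L[ℂ] ℂ} {b : ℂ}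
    (hc : IsPole τ π L b N) : (p.1 - (L p.2 + b)) ^ N ≠ 0 := by
  rcases hc with rfl | ⟨j, rfl, hb⟩
  · simp
  · exact pow_ne_zero _ (hp.ne j hb)

/-- The identity `1 / ((w - c)(w - c')) = (1 / (w - c) - 1 / (w - c')) / (c - c')`. If both poles
come from the same `z_j`, then `c - c'` is a nonzero constant; otherwise it is the equation of a
diagonal in the remaining variables and goes into `D`. In the second term the order of the old pole
has dropped by one, which drives the induction. -/
lemma PF.div_sub {T : ℂ × E → ℂ} (hT : T ∈ PF τ π) (j : Fin n) {l : ℂ} (hl : l ∈ lattice τ) :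
    ∃ T' ∈ PF τ π, ∀ p, IsOff τ π p → T p / (p.1 - (π p.2 j + l)) = T' p := by
  classical
  induction hT using AddSubmonoid.closure_induction with
  | mem T hT =>
    obtain ⟨H, D, L, b, N, hH, hD, hc, rfl⟩ := hT
    induction N with
    | zero =>
      refine ⟨_, AddSubmonoid.subset_closure ⟨H, D, (proj j : ℂ^n →L[ℂ] ℂ).comp π, l, 1, hH, hD,
        Or.inr ⟨j, rfl, hl⟩, rfl⟩, fun p _ => ?_⟩
      simp [div_div]
    | succ N ih =>
      obtain ⟨j', hL, hb⟩ := Or.resolve_left hc (Nat.succ_ne_zero N)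
      by_cases hjl : j' = j ∧ b = l
      · obtain ⟨rfl, rfl⟩ := hjl
        refine ⟨_, AddSubmonoid.subset_closure ⟨H, D, L, b, N + 2, hH, hD,
          Or.inr ⟨j', hL, hb⟩, rfl⟩, fun p _ => ?_⟩
        rw [div_div, pow_succ _ (N + 1), hL]
        simp [mul_assoc]
      · obtain ⟨T', hT', e⟩ := ih (Or.inr ⟨j', hL, hb⟩)
        have hmem : (fun p => H p / (D (π p.2) * (p.1 - (L p.2 + b)) ^ (N + 1)) - T' p) ∈ PF τ π := by
          have h1 : (fun p => H p / (D (π p.2) * (p.1 - (L p.2 + b)) ^ (N + 1))) ∈ PF τ π :=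
            AddSubmonoid.subset_closure ⟨H, D, L, b, N + 1, hH, hD, Or.inr ⟨j', hL, hb⟩, rfl⟩
          convert add_mem h1 (PF.const_mul hT' (-1)) using 1
          funext p; simp [sub_eq_add_neg]
        have key : ∀ p, IsOff τ π p → (π p.2 j' + b - (π p.2 j + l)) ≠ 0 →
            H p / (D (π p.2) * (p.1 - (L p.2 + b)) ^ (N + 1)) / (p.1 - (π p.2 j + l)) =
            (H p / (D (π p.2) * (p.1 - (L p.2 + b)) ^ (N + 1)) - T' p) / (π p.2 j' + b - (π p.2 j + l)) := by
          intro p hp hd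
          rw [← e p hp]
          have h1 : p.1 - (L p.2 + b) ≠ 0 := by rw [hL]; exact hp.ne j' hb
          have h2 := hp.ne j hl
          have h3 := ne_zero_of_mem_Denom hD hp.1
          have hLp : L p.2 = π p.2 j' := by rw [hL]; rfl
          simp only [hLp] at h1 ⊢
          field_simp
          ring
        by_cases hj : j' = j
        · subst hj
          have hbl : b - l ≠ 0 := sub_ne_zero.2 fun h => hjl ⟨rfl, h⟩
          refine ⟨_, PF.const_mul hmem (b - l)⁻¹, fun p hp => ?_⟩
          have hd : π p.2 j' + b - (π p.2 j' + l) = b - l := by ring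
          rw [key p hp (by rwa [hd]), hd, div_eq_inv_mul]
        · refine ⟨_, PF.div_Denom hmem (sub_mem_Denom hj (sub_mem_lattice hl hb)), fun p hp => ?_⟩
          have hd : π p.2 j' + b - (π p.2 j + l) = π p.2 j' - π p.2 j - (l - b) := by ring
          have h0 := ne_zero_of_mem_Denom (sub_mem_Denom hj (sub_mem_lattice hl hb)) hp.1
          rw [key p hp (by rw [hd]; exact h0), hd]
  | zero => exact ⟨0, zero_mem _, fun p _ => by simp⟩
  | add S T _ _ hS hT =>
    obtain ⟨S', hS', eS⟩ := hS
    obtain ⟨T', hT', eT⟩ := hT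
    exact ⟨S' + T', add_mem hS' hT', fun p hp => by rw [Pi.add_apply, Pi.add_apply, add_div, eS p hp, eT p hp]⟩

lemma PF.div_Denom_ins (i : Fin (n + 1)) {D : ℂ^(n + 1) → ℂ} (hD : D ∈ Denom (n + 1) τ)
    {T : ℂ × E → ℂ} (hT : T ∈ PF τ π) :
    ∃ T' ∈ PF τ π, ∀ p, IsOff τ π p → T p / D (ins i (p.1, π p.2)) = T' p := by
  induction hD using Submonoid.closure_induction generalizing T with
  | mem f hf =>
    obtain ⟨a, b, hab, l, hl, rfl⟩ := hf
    revert hab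
    refine Fin.succAboveCases i ?_ (fun a => ?_) a <;> refine Fin.succAboveCases i ?_ (fun b => ?_) b
    · intro h; exact absurd rfl h
    · intro _
      obtain ⟨T', hT', e⟩ := PF.div_sub hT b hl
      refine ⟨T', hT', fun p hp => ?_⟩
      rw [← e p hp]; simp [sub_sub]
    · intro _
      obtain ⟨T', hT', e⟩ := PF.div_sub hT a (neg_mem_lattice hl)
      refine ⟨_, PF.const_mul hT' (-1), fun p hp => ?_⟩
      rw [← e p hp]
      simp only [ins_succAbove, ins_same]
      rw [show π p.2 a - p.1 - l = -(p.1 - (π p.2 a + -l)) by ring, div_neg]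
      ring
    · intro hab
      refine ⟨_, PF.div_Denom hT (sub_mem_Denom (i := a) (j := b) (fun h => hab (by rw [h])) hl), fun p _ => ?_⟩
      simp
  | one => exact ⟨T, hT, fun p _ => by simp⟩
  | mul f g _ _ hf hg =>
    obtain ⟨T', hT', e⟩ := hf hT
    obtain ⟨T'', hT'', e'⟩ := hg hT'
    exact ⟨T'', hT'', fun p hp => by rw [← e' p hp, ← e p hp, Pi.mul_apply, div_div]⟩

/-- Partial fraction decomposition with respect to the variable at position `i`. -/
lemma exists_PF (i : Fin (n + 1)) {D : ℂ^(n + 1) → ℂ} (hD : D ∈ Denom (n + 1) τ)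
    {H : ℂ × E → ℂ} (hH : IsTest H) : ∃ T ∈ PF τ π, ∀ p, IsOff τ π p → H p / D (ins i (p.1, π p.2)) = T p := by
  refine PF.div_Denom_ins i hD (AddSubmonoid.subset_closure ⟨H, 1, 0, 0, 0, hH, one_mem _, Or.inl rfl, ?_⟩)
  funext p; simp

end PartialFractions

/-! ### Regularized integration of one variable -/

section OneVariable

/-- Regularized integration over the first variable of `H / (D(z) (w - L z - b) ^ (N + 1))`. -/
lemma hasPV_partialFraction {H : ℂ × ℂ^n → ℂ} (hH : IsTest H)
    (hD : D ∈ Denom n τ) (L : ℂ^n →L[ℂ] ℂ) (b : ℂ) (N : ℕ) {T : ℂ × ℂ^n → ℂ}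
    (hT : ∀ p : ℂ × ℂ^n, p.1 - (L p.2 + b) ≠ 0 → T p = H p / (D p.2 * (p.1 - (L p.2 + b)) ^ (N + 1))) :
    ∃ K, IsK τ K ∧ (∀ z ∉ bigDiagonal n τ, HasPV (fun w => T (w, z)) (K z)) ∧
      ∀ v, ∀ z ∉ bigDiagonal n τ, HasPV (fun w => dz (0, v) T (w, z)) (dz v K z) := by
  set H' : ℂ × ℂ^n → ℂ := fun p => H (shear L b p) with hH'
  have hH't : IsTest H' := hH.comp_homeomorph (shear L b) (contDiff_shear L b)
  have hDr := contDiff_real_of_mem_Denom hD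
  have hslice : ∀ {G : ℂ × ℂ^n → ℂ} (_ : IsTest G) (M : ℕ) (z : ℂ^n),
      HasPV (fun w => G (w, z) / (w - (L z + b)) ^ (M + 1)) (Lf M fun w => G (shear L b (w, z))) :=
    fun hG M z => HasPV.single (hG.slice z) (L z + b) M
  refine ⟨fun z => (Lf N fun w => H' (w, z)) / D z, ⟨_, D, isTest_Lf hH't N, hD, fun z _ => rfl⟩,
    fun z hz => ?_, fun v z hz => ?_⟩
  · have h0 := ne_zero_of_mem_Denom hD hz
    have := (hslice hH N z).const_mul (D z)⁻¹
    rw [← div_eq_inv_mul] at this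
    refine this.congr ?_
    filter_upwards [ae_ne (L z + b)] with w hw
    have hw' : w - (L z + b) ≠ 0 := sub_ne_zero.2 hw
    rw [hT (w, z) hw']
    field_simp
  · have h0 := ne_zero_of_mem_Denom hD hz
    have e1 : dz v (fun z => (Lf N fun w => H' (w, z)) / D z) z =
        (D z)⁻¹ * (Lf N fun w => dz (0, v) H (shear L b (w, z))) +
          (D z)⁻¹ * L v * (N + 1) * (Lf (N + 1) fun w => H (shear L b (w, z))) +
          -(dz v D z) / D z ^ 2 * (Lf N fun w => H (shear L b (w, z))) := by
      rw [dz_div v ((isTest_Lf hH't N).1.diffAt z) (hDr.diffAt z) h0, dz_Lf hH't]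
      have e2 : (fun w => dz (0, v) H' (w, z)) = fun w =>
          L v * dz 1 (fun w => H' (w, z)) w + dz (0, v) H (shear L b (w, z)) := by
        funext w
        rw [hH', dz_shear hH.1]
        congr 2
        rw [← dz_slice hH.1 z (w + (L z + b))]
        have hsh : (fun w => H (shear L b (w, z))) = fun w => (fun w => H (w, z)) (w + (L z + b)) := rfl
        simp only [hsh, dz, fderiv_comp_add_right (f := fun w => H (w, z))]
      rw [e2, Lf_add ((((hH't.slice z).dz 1)).const_mul _)
        ((((hH.dz (0, v)).comp_homeomorph (shear L b) (contDiff_shear L b))).slice z),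
        Lf_const_mul _ ((hH't.slice z).dz 1), Lf_dz]
      simp only [hH']
      field_simp
      ring
    rw [e1]
    have p1 := (hslice (hH.dz (0, v)) N z).const_mul (D z)⁻¹
    have p2 := (hslice hH (N + 1) z).const_mul ((D z)⁻¹ * L v * (N + 1))
    have p3 := (hslice hH N z).const_mul (-(dz v D z) / D z ^ 2)
    refine ((p1.add p2).add p3).congr ?_
    filter_upwards [ae_ne (L z + b)] with w hw
    have hw' : w - (L z + b) ≠ 0 := sub_ne_zero.2 hw
    have hev : T =ᶠ[𝓝 (w, z)] fun p => H p / (D p.2 * (p.1 - (L p.2 + b)) ^ (N + 1)) :=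
      ((hasFDerivAt_sub_add L b (w, z)).continuousAt.eventually_ne hw').mono hT
    have hd2 : DifferentiableAt ℂ (fun p : ℂ × ℂ^n => (p.1 - (L p.2 + b)) ^ (N + 1)) (w, z) := by fun_prop
    have hdD : dz (0, v) (fun p : ℂ × ℂ^n => D p.2) (w, z) = dz v D z := by
      have := dz_comp (g := D) (φ := fun p : ℂ × ℂ^n => p.2) (A := snd ℂ ℂ ℂ^n) (y := (w, z)) (0, v)
        (hDr.diffAt _) hasFDerivAt_snd
      simpa using this
    have hD2 : DifferentiableAt ℝ (fun p : ℂ × ℂ^n => D p.2) (w, z) :=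
      (hDr.diffAt z).comp (w, z) differentiableAt_snd
    rw [dz_congr _ hev, dz_div _ (hH.1.diffAt _) (hD2.fun_mul (hd2.restrictScalars ℝ))
      (mul_ne_zero h0 (pow_ne_zero _ hw')), dz_mul _ hD2 (hd2.restrictScalars ℝ), dz_sub_add_pow, hdD]
    push_cast [Nat.add_sub_cancel]
    field_simp
    ring

/-- A sum of partial fractions and its regularized integral over the distinguished variable. -/
lemma PF.spec {T : ℂ × ℂ^n → ℂ} (hT : T ∈ PF τ (ContinuousLinearMap.id ℂ ℂ^n)) :
    (∀ p, IsOff τ (ContinuousLinearMap.id ℂ ℂ^n) p → SmoothAt T p) ∧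
    (∀ z ∉ bigDiagonal n τ, ∃ (s : Finset ℂ) (N : ℕ) (h : ℂ → ℂ → ℂ), (∀ c, IsTest (h c)) ∧
      ∀ w ∉ s, T (w, z) = ∑ c ∈ s, h c w / (w - c) ^ (N + 1)) ∧
    ∃ K, IsK τ K ∧ (∀ z ∉ bigDiagonal n τ, HasPV (fun w => T (w, z)) (K z)) ∧
      ∀ v, ∀ z ∉ bigDiagonal n τ, HasPV (fun w => dz (0, v) T (w, z)) (dz v K z) := by
  classical
  induction hT using AddSubmonoid.closure_induction with
  | mem T hT =>
    obtain ⟨H, D, L, b, N, hH, hD, hc, rfl⟩ := hT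
    -- Expanding by `w - c` raises the order from `N` to `N + 1`, so the case without pole is
    -- covered by the same formula.
    set H1 : ℂ × ℂ^n → ℂ := fun p => (p.1 - (L p.2 + b)) * H p with hH1
    have hH1t : IsTest H1 := by
      refine IsTest.smooth_mul ?_ hH
      have hL : Smooth L := (L.restrictScalars ℝ).contDiff
      fun_prop
    have hT1 : ∀ p : ℂ × ℂ^n, p.1 - (L p.2 + b) ≠ 0 →
        H p / (D p.2 * (p.1 - (L p.2 + b)) ^ N) = H1 p / (D p.2 * (p.1 - (L p.2 + b)) ^ (N + 1)) := by
      intro p hp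
      rw [hH1, pow_succ]
      by_cases h0 : D p.2 = 0
      · simp [h0]
      · field_simp
    refine ⟨fun p hp => ?_, fun z hz => ?_, hasPV_partialFraction hH1t hD L b N hT1⟩
    · have hDr := contDiff_real_of_mem_Denom hD
      have hL : Smooth L := (L.restrictScalars ℝ).contDiff
      refine contDiffAt_div hH.1.contDiffAt (ContDiff.contDiffAt ?_)
        (mul_ne_zero (ne_zero_of_mem_Denom hD hp.1) (hp.pow_ne hc))
      exact (hDr.comp contDiff_snd).mul (by fun_prop)
    · refine ⟨{L z + b}, N, fun _ w => (D z)⁻¹ * H1 (w, z), fun _ => (hH1t.slice z).const_mul _, fun w hw => ?_⟩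
      have hw' : w - (L z + b) ≠ 0 := sub_ne_zero.2 (by simpa using hw)
      have := hT1 (w, z) hw'
      simp only [id_apply, sum_singleton]
      rw [this, ← div_div, div_eq_inv_mul (H1 (w, z))]
  | zero =>
    refine ⟨fun p _ => contDiffAt_const, fun z _ => ⟨∅, 0, fun _ _ => 0, fun _ => IsTest.zero,
      fun w _ => by simp⟩, fun _ => 0, IsTest.isK IsTest.zero, fun z _ => HasPV.zero, fun v z _ => ?_⟩
    have : (fun w : ℂ => dz (0, v) (0 : ℂ × ℂ^n → ℂ) (w, z)) = fun _ => 0 := by funext w; exact dz_const _ 0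
    rw [this, dz_const]; exact HasPV.zero
  | add S T _ _ hS hT =>
    obtain ⟨s1, s2, K, hK, s3, s4⟩ := hS
    obtain ⟨t1, t2, K', hK', t3, t4⟩ := hT
    refine ⟨fun p hp => (s1 p hp).add (t1 p hp), fun z hz => ?_, fun z => K z + K' z, hK.add hK',
      fun z hz => (s3 z hz).add (t3 z hz), fun v z hz => ?_⟩
    · obtain ⟨s, N, h, hh, e⟩ := s2 z hz
      obtain ⟨s', N', h', hh', e'⟩ := t2 z hz
      obtain ⟨k, hk, ek, -⟩ := exists_raise hh (subset_union_left (s₂ := s')) (le_max_left N N')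
      obtain ⟨k', hk', ek', -⟩ := exists_raise hh' (subset_union_right (s₁ := s)) (le_max_right N N')
      refine ⟨s ∪ s', max N N', fun c w => k c w + k' c w, fun c => (hk c).add (hk' c), fun w hw => ?_⟩
      simp only [Finset.mem_union, not_or] at hw
      rw [Pi.add_apply, e w hw.1, e' w hw.2, ek w hw.1, ek' w hw.2, ← sum_add_distrib]
      exact sum_congr rfl fun c _ => by ring
    · rw [dz_add v ((hK.contDiffAt hz).diffAt) ((hK'.contDiffAt hz).diffAt)]
      refine ((s4 v z hz).add (t4 v z hz)).congr ?_
      have hae : ∀ᵐ w : ℂ, ∀ j, w - z j ∉ lattice τ := by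
        rw [ae_all_iff]
        intro j
        have h1 : ((fun w : ℂ => w - z j) ⁻¹' lattice τ).Countable :=
          (countable_lattice τ).preimage fun a b h => by simpa using h
        exact h1.ae_notMem volume
      filter_upwards [hae] with w hw
      have hoff : IsOff τ (ContinuousLinearMap.id ℂ ℂ^n) (w, z) := ⟨hz, hw⟩
      exact (dz_add _ ((s1 _ hoff).diffAt) ((t1 _ hoff).diffAt)).symm

end OneVariable

/-- The regularized integral of `∂f` vanishes. -/
lemma HasPV.dz {s : Finset ℂ} {h : ℂ → ℂ → ℂ} (hh : ∀ c, IsTest (h c))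
    {T : Set ℂ} (hT : T.Countable) (hTd : ∀ p, ∀ᶠ w in 𝓝[≠] p, w ∉ T)
    (hf : ∀ w, w ∉ T → f w = ∑ c ∈ s, h c w / (w - c) ^ (N + 1)) : HasPV (EllipticConfig.dz 1 f) 0 := by
  have hterm : ∀ c ∈ s, HasPV (fun w => EllipticConfig.dz 1 (h c) w / (w - c) ^ (N + 1) +
      -(N + 1) * (h c w / (w - c) ^ (N + 1 + 1))) 0 := by
    intro c _
    have h1 := (HasPV.single ((hh c).dz 1) c N).add ((HasPV.single (hh c) c (N + 1)).const_mul (-(N + 1)))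
    have e : (fun w => EllipticConfig.dz 1 (h c) (w + c)) = EllipticConfig.dz 1 fun w => h c (w + c) := by
      funext w
      simp only [EllipticConfig.dz, fderiv_comp_add_right]
    rw [e, Lf_dz] at h1
    convert h1 using 1
    ring
  have := HasPV.sum s hterm
  simp only [Finset.sum_const_zero] at this
  refine this.congr ?_
  filter_upwards [hT.ae_notMem volume, ae_notMem_finset s] with w hw hws
  have hloc : f =ᶠ[𝓝 w] fun w => ∑ c ∈ s, h c w / (w - c) ^ (N + 1) :=
    eventually_nhds_of_ne ((hTd w).mono hf) (hf w hw)
  have hne : ∀ c ∈ s, w - c ≠ 0 := fun c hc => sub_ne_zero.2 fun h => hws (by rwa [h])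
  rw [dz_congr 1 hloc, dz_sum]
  · refine sum_congr rfl fun c hc => ?_
    have h0 := hne c hc
    have e1 := congrFun (dz_iterate_sub_pow c (N + 1) 1) w
    simp only [iterate_one, Nat.descFactorial_one, Nat.add_sub_cancel] at e1
    rw [dz_div 1 ((hh c).1.diffAt w) ((contDiff_sub_pow c (N + 1)).diffAt w) (pow_ne_zero _ h0), e1]
    push_cast
    field_simp
    ring
  · intro c hc
    exact (contDiffAt_div (hh c).1.contDiffAt
      (contDiff_sub_pow c (N + 1)).contDiffAt (pow_ne_zero _ (hne c hc))).diffAt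

/-! ### Integration along coordinate lines of functions with poles along the diagonals -/

section Fibre

/-- The poles of the restriction to a line parallel to a coordinate axis. -/
def poleSet (τ : ℂ) (z : ℂ^n) : Set ℂ := {w | ∃ j, w - z j ∈ lattice τ}

lemma notMem_poleSet : w ∉ poleSet τ z ↔ ∀ j, w - z j ∉ lattice τ := by simp [poleSet]

lemma poleSet_eq (z : ℂ^n) : poleSet τ z = ⋃ j, (fun w : ℂ => w - z j) ⁻¹' lattice τ := by ext w; simp [poleSet]

lemma countable_poleSet (z : ℂ^n) : (poleSet τ z).Countable := by
  rw [poleSet_eq]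
  exact Set.countable_iUnion fun j => (countable_lattice τ).preimage fun a b h => by simpa using h

lemma eventually_notMem_poleSet (z : ℂ^n) (p : ℂ) : ∀ᶠ w in 𝓝[≠] p, w ∉ poleSet τ z := by
  simp only [notMem_poleSet]
  rw [eventually_all]
  intro j
  simpa only [sub_eq_add_neg] using (tendsto_add_nhdsNE p (-z j)).eventually (eventually_notMem_lattice τ _)

/-- Regularized integration over the variable at position `i`. -/
def pvAt (i : Fin (n + 1)) (F : ℂ^(n + 1) → ℂ) (z : ℂ^n) : ℂ := pvInt fun w => F (ins i (w, z))

variable {F G : ℂ^(n + 1) → ℂ} (i : Fin (n + 1))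

lemma isOff_id_iff {p : ℂ × ℂ^n} : IsOff τ (ContinuousLinearMap.id ℂ ℂ^n) p ↔ ins i p ∉ bigDiagonal (n + 1) τ :=
  (ins_notMem_bigDiagonal i).symm

lemma IsK.exists_PF (hF : IsK τ F) : ∃ T ∈ PF τ (ContinuousLinearMap.id ℂ ℂ^n),
    ∀ p : ℂ × ℂ^n, ins i p ∉ bigDiagonal (n + 1) τ → F (ins i p) = T p := by
  obtain ⟨h, D, hh, hD, e⟩ := hF
  have hH : IsTest fun p => h (ins i p) :=
    hh.comp_homeomorph (ins i).toHomeomorph ((ins i).contDiff.restrict_scalars ℝ)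
  obtain ⟨T, hT, eT⟩ := EllipticConfig.exists_PF (π := ContinuousLinearMap.id ℂ ℂ^n) i hD hH
  refine ⟨T, hT, fun p hp => ?_⟩
  rw [e _ hp, ← eT p ((isOff_id_iff i).2 hp)]
  rfl

/-- Presentation of the restriction to a line as a sum of simple fractions. -/
lemma IsK.exists_rep (hF : IsK τ F) (hz : z ∉ bigDiagonal n τ) :
    ∃ (s : Finset ℂ) (N : ℕ) (h : ℂ → ℂ → ℂ), (∀ c, IsTest (h c)) ∧
      ∀ w, w ∉ poleSet τ z ∪ s → F (ins i (w, z)) = ∑ c ∈ s, h c w / (w - c) ^ (N + 1) := by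
  obtain ⟨T, hT, e⟩ := hF.exists_PF i
  obtain ⟨s, N, h, hh, e'⟩ := (PF.spec hT).2.1 z hz
  refine ⟨s, N, h, hh, fun w hw => ?_⟩
  simp only [Set.mem_union, not_or] at hw
  rw [e (w, z) ((ins_notMem_bigDiagonal i).2 ⟨hz, notMem_poleSet.1 hw.1⟩), e' w hw.2]

lemma countable_poleSet_union (z : ℂ^n) (s : Finset ℂ) : (poleSet τ z ∪ (s : Set ℂ)).Countable :=
  (countable_poleSet z).union s.countable_toSet

lemma eventually_notMem_poleSet_union (z : ℂ^n) (s : Finset ℂ) (p : ℂ) :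
    ∀ᶠ w in 𝓝[≠] p, w ∉ poleSet τ z ∪ (s : Set ℂ) := by
  have h2 : ∀ᶠ w in 𝓝[≠] p, w ∉ (s : Set ℂ) := by
    have hfin : ((s : Set ℂ) \ {p}).Finite := s.finite_toSet.subset Set.sdiff_subset
    have hmem : ((s : Set ℂ) \ {p})ᶜ ∈ 𝓝 p := hfin.isClosed.isOpen_compl.mem_nhds (by simp)
    filter_upwards [nhdsWithin_le_nhds hmem, self_mem_nhdsWithin] with w hw hne hws
    exact hw ⟨hws, hne⟩
  filter_upwards [eventually_notMem_poleSet (τ := τ) z p, h2] with w h1 h2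
  simp only [Set.mem_union, not_or]
  exact ⟨h1, h2⟩

lemma ae_ins_notMem (hz : z ∉ bigDiagonal n τ) : ∀ᵐ w : ℂ, ins i (w, z) ∉ bigDiagonal (n + 1) τ := by
  filter_upwards [(countable_poleSet (τ := τ) z).ae_notMem volume] with w hw
  exact (ins_notMem_bigDiagonal i).2 ⟨hz, notMem_poleSet.1 hw⟩

/-- Once `F` is decomposed into partial fractions in the distinguished variable, the other
denominators do not involve that variable. Hence integrating it out stays inside the class, and
derivatives in the remaining directions can be taken under the regularized integral. -/
lemma IsK.pvAt_spec (hF : IsK τ F) : IsK τ (pvAt i F) ∧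
    (∀ z ∉ bigDiagonal n τ, HasPV (fun w => F (ins i (w, z))) (pvAt i F z)) ∧ ∀ v, ∀ z ∉ bigDiagonal n τ,
      HasPV (fun w => EllipticConfig.dz (ins i (0, v)) F (ins i (w, z)))
        (EllipticConfig.dz v (pvAt i F) z) := by
  obtain ⟨T, hT, e⟩ := hF.exists_PF i
  obtain ⟨t1, -, K, hK, t2, t3⟩ := PF.spec hT
  have hpv : ∀ z ∉ bigDiagonal n τ, HasPV (fun w => F (ins i (w, z))) (K z) := by
    intro z hz
    refine (t2 z hz).congr ?_
    filter_upwards [ae_ins_notMem (τ := τ) i hz] with w hw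
    exact (e (w, z) hw).symm
  have heq : ∀ z ∉ bigDiagonal n τ, pvAt i F z = K z := fun z hz => (hpv z hz).pvInt_eq
  refine ⟨hK.congr fun z hz => (heq z hz).symm, fun z hz => by rw [heq z hz]; exact hpv z hz, fun v z hz => ?_⟩
  rw [dz_congr v ((compl_bigDiagonal_mem_nhds hz).mono heq)]
  refine (t3 v z hz).congr ?_
  filter_upwards [ae_ins_notMem (τ := τ) i hz] with w hw
  have hTF : T =ᶠ[𝓝 (w, z)] fun p => F (ins i p) := by
    filter_upwards [(ins i).continuous.continuousAt.eventually (compl_bigDiagonal_mem_nhds hw)]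
      with p hp using (e p hp).symm
  rw [dz_congr _ hTF]
  have hA : HasFDerivAt (fun p => ins i p) (ins i : ℂ × ℂ^n →L[ℂ] ℂ^(n + 1)) (w, z) := (ins i).hasFDerivAt
  exact dz_comp (φ := fun p => ins i p) _ ((hF.contDiffAt hw).diffAt) hA

lemma IsK.pvAt (hF : IsK τ F) : IsK τ (pvAt i F) := (hF.pvAt_spec i).1

lemma IsK.hasPV (hF : IsK τ F) (hz : z ∉ bigDiagonal n τ) :
    HasPV (fun w => F (ins i (w, z))) (EllipticConfig.pvAt i F z) := (hF.pvAt_spec i).2.1 z hz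

lemma hasFDerivAt_ins_left (w : ℂ) (z : ℂ^n) : HasFDerivAt (fun w : ℂ => ins i (w, z))
    ((ins i : ℂ × ℂ^n →L[ℂ] ℂ^(n + 1)).comp (inl ℂ ℂ ℂ^n)) w :=
  (ins i).hasFDerivAt.comp w (hasFDerivAt_prodMk_left w z)

/-- The component of `v` along the line contributes an exact term, which has regularized integral
zero; only the component in the remaining variables survives. -/
lemma pvAt_dz (hF : IsK τ F) (v : ℂ^(n + 1)) (hz : z ∉ bigDiagonal n τ) :
    pvAt i (dz v F) z = dz ((ins i).symm v).2 (pvAt i F) z := by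
  set v' := ((ins i).symm v).2
  set a := ((ins i).symm v).1
  have hv : v = a • (Pi.single i 1 : ℂ^(n + 1)) + ins i ((0 : ℂ), v') := by
    rw [← ins_single_same, ← map_smul, ← map_add]
    simp [a, v']
  have h1 := (hF.pvAt_spec i).2.2 v' z hz
  obtain ⟨s, N, h, hh, e⟩ := hF.exists_rep i hz
  have h2 := HasPV.dz hh (countable_poleSet_union z s) (eventually_notMem_poleSet_union z s) e
  have h3 := (h2.const_mul a).add h1
  rw [mul_zero, zero_add] at h3
  refine HasPV.pvInt_eq (h3.congr ?_)
  filter_upwards [ae_ins_notMem (τ := τ) i hz] with w hw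
  rw [hv, dz_add_dir, dz_smul_dir]
  congr 2
  rw [dz_comp (φ := fun w : ℂ => ins i (w, z)) 1 (hF.contDiffAt hw).diffAt (hasFDerivAt_ins_left i w z)]
  simp [← ins_single_same]

lemma pvAt_congr (h : ∀ z ∉ bigDiagonal (n + 1) τ, F z = G z)
    (hF : IsK τ F) (hz : z ∉ bigDiagonal n τ) : pvAt i F z = pvAt i G z := by
  refine (HasPV.pvInt_eq ((hF.hasPV i hz).congr ?_)).symm
  filter_upwards [ae_ins_notMem (τ := τ) i hz] with w hw
  exact h _ hw

end Fibre

/-! ### Functionals that regularize the integral over `ℂⁿ` -/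

/-- A linear functional on functions with poles along the diagonals that regularizes the
integral. -/
structure IsReg {n : ℕ} (τ : ℍ) (ℓ : (ℂ^n → ℂ) → ℂ) : Prop where
  congr : ∀ {F G}, IsK τ F → (∀ z ∉ bigDiagonal n τ, F z = G z) → ℓ F = ℓ G
  add : ∀ {F G}, IsK τ F → IsK τ G → ℓ (fun z => F z + G z) = ℓ F + ℓ G
  const_mul : ∀ (a : ℂ) {F}, IsK τ F → ℓ (fun z => a * F z) = a * ℓ F
  dz : ∀ (v : ℂ^n) {F}, IsK τ F → ℓ (dz v F) = 0
  comp_add : ∀ {l : ℂ^n} {F}, IsK τ F → (∀ i, l i ∈ lattice τ) → ℓ (fun z => F (z + l)) = ℓ F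
  integral : ∀ {F}, IsK τ F → Integrable F → ℓ F = ∫ z, F z

section IsReg

variable {ℓ : (ℂ^n → ℂ) → ℂ}

lemma IsReg.zero (hℓ : IsReg τ ℓ) : ℓ (fun _ => 0) = 0 := by
  have := hℓ.integral (F := fun _ => 0) (IsTest.isK IsTest.zero) (integrable_zero _ _ _)
  simpa using this

lemma IsReg.sum (hℓ : IsReg τ ℓ) (s : Finset ι) {F : ι → ℂ^n → ℂ}
    (hF : ∀ i ∈ s, IsK τ (F i)) : ℓ (fun z => ∑ i ∈ s, F i z) = ∑ i ∈ s, ℓ (F i) :=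
  (sum_rel (R := fun F v => IsK τ F ∧ ℓ F = v) ⟨IsTest.isK IsTest.zero, hℓ.zero⟩
    (fun hf hg => ⟨hf.1.add hg.1, by rw [hℓ.add hf.1 hg.1, hf.2, hg.2]⟩) s fun i hi => ⟨hF i hi, rfl⟩).2

/-- Any variable may be integrated out first. This freedom is used in the residue formula, where the
variable to begin with is the one that is differentiated. -/
lemma IsReg.pvAt (hℓ : IsReg τ ℓ) (i : Fin (n + 1)) :
    IsReg τ fun F : ℂ^(n + 1) → ℂ => ℓ (EllipticConfig.pvAt i F) where
  congr hF h := hℓ.congr (hF.pvAt i) fun _ hz => pvAt_congr i h hF hz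
  add hF hG := by
    rw [← hℓ.add (hF.pvAt i) (hG.pvAt i)]
    exact hℓ.congr ((hF.add hG).pvAt i) fun z hz => ((hF.hasPV i hz).add (hG.hasPV i hz)).pvInt_eq
  const_mul a _ hF := by
    rw [← hℓ.const_mul a (hF.pvAt i)]
    exact hℓ.congr ((hF.const_mul a).pvAt i) fun z hz => ((hF.hasPV i hz).const_mul a).pvInt_eq
  dz v _ hF := by
    rw [hℓ.congr ((hF.dz v).pvAt i) fun z hz => pvAt_dz i hF v hz]
    exact hℓ.dz _ (hF.pvAt i)
  comp_add {l F} hF hl := by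
    have hl' : ∀ k, ((ins i).symm l).2 k ∈ lattice τ := by
      intro k
      have := hl (i.succAbove k)
      rwa [← (ins i).apply_symm_apply l, ins_succAbove] at this
    rw [← hℓ.comp_add (hF.pvAt i) hl']
    refine hℓ.congr ((hF.comp_add hl).pvAt i) fun z hz => ?_
    have hz' : z + ((ins i).symm l).2 ∉ bigDiagonal n τ := by rwa [add_mem_bigDiagonal_iff hl']
    have := (hF.hasPV i hz').comp_add ((ins i).symm l).1
    refine HasPV.pvInt_eq (this.congr (.of_forall fun w => ?_))
    show F (ins i (w + ((ins i).symm l).1, z + ((ins i).symm l).2)) = F (ins i (w, z) + l)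
    congr 1
    conv_rhs => rw [← (ins i).apply_symm_apply l, ← map_add]
    rfl
  -- Fubini: almost every slice is integrable, and on such a slice the regularized integral is the
  -- ordinary one.
  integral {F} hF hi := by
    have hmp := measurePreserving_ins (n := n) i
    have hme : MeasurableEmbedding (ins i : ℂ × ℂ^n → ℂ^(n + 1)) := (ins i).toHomeomorph.measurableEmbedding
    have h1 : Integrable (fun p => F (ins i p)) := (hmp.integrable_comp_emb hme).2 hi
    have h2 : ∫ z, F z = ∫ p, F (ins i p) := (hmp.integral_comp hme F).symm
    have h3 := h1.swap
    rw [Measure.volume_eq_prod, ← integral_prod_swap] at h2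
    have h4 : Integrable (fun p : ℂ^n × ℂ => F (ins i (p.2, p.1))) ((volume : Measure ℂ^n).prod volume) := h3
    have h6 : EllipticConfig.pvAt i F =ᵐ[volume] fun z => ∫ w, F (ins i (w, z)) := by
      filter_upwards [h4.prod_right_ae, ae_notMem_bigDiagonal n τ] with z hz hzd
      exact (hF.hasPV i hzd).eq_integral hz
    rw [hℓ.integral (hF.pvAt i) (h4.integral_prod_left.congr h6.symm), integral_congr_ae h6, h2]
    exact (integral_prod _ h4).symm

end IsReg

/-- The regularized integral over `ℂⁿ`, one variable at a time. -/
def regC : (n : ℕ) → (ℂ^n → ℂ) → ℂ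
  | 0, F => F 0
  | n + 1, F => regC n (pvAt 0 F)

lemma isReg_regC (τ : ℍ) (n : ℕ) : IsReg τ (regC n) := by
  induction n with
  | zero =>
    have hd : ∀ z : ℂ^0, z ∉ bigDiagonal 0 τ := fun z ⟨i, _⟩ => i.elim0
    refine ⟨fun _ h => h 0 (hd 0), fun _ _ => rfl, fun _ _ _ => rfl, fun v F _ => ?_,
      fun {l F} _ _ => ?_, fun {F} _ _ => ?_⟩
    · show dz v F 0 = 0
      rw [Subsingleton.elim v 0, dz_zero_dir]
    · show F (0 + l) = F 0
      rw [Subsingleton.elim (0 + l) 0]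
    · show F 0 = _
      rw [volume_pi, Measure.pi_of_empty (x := 0)]
      simp
  | succ n ih => exact ih.pvAt 0

/-! ### Real coordinates and a cutoff function -/

/-- The coordinate `y` in `w = x + y τ`. -/
def yc (τ : ℍ) : ℂ →L[ℝ] ℝ := (τ.im)⁻¹ • imCLM

/-- The coordinate `x` in `w = x + y τ`. -/
def xc (τ : ℍ) : ℂ →L[ℝ] ℝ := Complex.reCLM - τ.re • yc τ

section Coordinates

variable (τ : ℍ)

lemma yc_apply (w : ℂ) : yc τ w = w.im / τ.im := by simp [yc, div_eq_inv_mul]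

lemma xc_apply (w : ℂ) : xc τ w = w.re - τ.re * (w.im / τ.im) := by simp [xc, yc_apply]

lemma xc_add_yc (w : ℂ) : (xc τ w : ℂ) + yc τ w * τ = w := by
  have h : τ.im ≠ 0 := τ.im_ne_zero
  apply Complex.ext
  · simp [xc_apply, yc_apply]; ring
  · simp [yc_apply]; field_simp

lemma yc_coord (x y : ℝ) : yc τ (x + y * τ) = y := by
  have h : τ.im ≠ 0 := τ.im_ne_zero
  simp [yc_apply, h]

lemma xc_coord (x y : ℝ) : xc τ (x + y * τ) = x := by
  have h : τ.im ≠ 0 := τ.im_ne_zero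
  simp [xc_apply, h]; field_simp; ring

lemma yc_one : yc τ 1 = 0 := by simp [yc_apply]

/-- The real coordinates as a homeomorphism. -/
def coordHomeo : ℂ ≃ₜ ℝ × ℝ where
  toFun w := (xc τ w, yc τ w)
  invFun p := (p.1 : ℂ) + p.2 * τ
  left_inv w := xc_add_yc τ w
  right_inv p := by
    ext
    · exact xc_coord τ p.1 p.2
    · exact yc_coord τ p.1 p.2
  continuous_toFun := by fun_prop
  continuous_invFun := by fun_prop

end Coordinates

/-- The translates of this function by integers add up to `1`. -/
def unitBump (t : ℝ) : ℝ := smoothTransition (t + 1) - smoothTransition t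

lemma contDiff_smoothTransition : Smooth smoothTransition := smoothTransition.contDiff

lemma contDiff_unitBump : Smooth unitBump := by
  have := contDiff_smoothTransition
  unfold unitBump
  exact (this.comp (by fun_prop)).sub this

lemma unitBump_eq_zero {t : ℝ} (h : 1 ≤ |t|) : unitBump t = 0 := by
  rcases le_abs'.1 h with h | h
  · rw [unitBump, smoothTransition.zero_of_nonpos (by linarith),
      smoothTransition.zero_of_nonpos (by linarith), sub_zero]
  · rw [unitBump, smoothTransition.one_of_one_le (by linarith), smoothTransition.one_of_one_le h, sub_self]

/-- The sum telescopes to `smoothTransition (t + M) - smoothTransition (t - M)`. -/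
lemma sum_unitBump {t : ℝ} {M : ℕ} (ht : |t| ≤ M - 1) :
    ∑ k ∈ Finset.range (2 * M), unitBump (t + (k - M)) = 1 := by
  have h := Finset.sum_range_sub (fun k : ℕ => smoothTransition (t + (k - M))) (2 * M)
  rw [abs_le] at ht
  rw [smoothTransition.one_of_one_le (by push_cast; linarith), smoothTransition.zero_of_nonpos
    (by push_cast; linarith), sub_zero] at h
  rw [← h]
  refine sum_congr rfl fun k _ => ?_
  rw [unitBump]; push_cast; ring_nf

section Product

variable (τ : ℍ)

/-- Functions of compact support in the real coordinates. -/
lemma isTest_coord {f g : ℝ → ℝ} (hf : Smooth f) (hg : Smooth g) {R : ℝ}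
    (hf0 : ∀ t, R < |t| → f t = 0) (hg0 : ∀ t, R < |t| → g t = 0) :
    IsTest fun w : ℂ => ((f (xc τ w) * g (yc τ w) : ℝ) : ℂ) := by
  refine ⟨ofRealCLM.contDiff.comp ((hf.comp (xc τ).contDiff).mul (hg.comp (yc τ).contDiff)), ?_⟩
  have hc : IsCompact ((coordHomeo τ) ⁻¹' (Icc (-R) R ×ˢ Icc (-R) R)) :=
    (coordHomeo τ).isCompact_preimage.2 (isCompact_Icc.prod isCompact_Icc)
  refine HasCompactSupport.intro hc fun w hw => ?_
  have hw' : ¬ (xc τ w ∈ Icc (-R) R ∧ yc τ w ∈ Icc (-R) R) := hw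
  rw [not_and_or] at hw'
  rcases hw' with h | h
  · rw [hf0 _ (by by_contra hn; exact h (abs_le.1 (not_lt.1 hn)))]; simp
  · rw [hg0 _ (by by_contra hn; exact h (abs_le.1 (not_lt.1 hn)))]; simp

/-- The cutoff function on `ℂ` whose translates under the lattice add up to `1`. -/
def chi₁ (w : ℂ) : ℂ := ((unitBump (xc τ w) * unitBump (yc τ w) : ℝ) : ℂ)

lemma isTest_chi₁ : IsTest (chi₁ τ) := isTest_coord τ contDiff_unitBump contDiff_unitBump (R := 1)
    (fun _ h => unitBump_eq_zero h.le) (fun _ h => unitBump_eq_zero h.le)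

lemma IsTest.prod {f : Fin n → ℂ → ℂ} (hf : ∀ i, IsTest (f i)) : IsTest fun z : ℂ^n => ∏ i, f i (z i) := by
  refine ⟨contDiff_prod fun i _ => (hf i).1.comp (contDiff_apply ℝ ℂ i), ?_⟩
  refine HasCompactSupport.intro (isCompact_univ_pi fun i => (hf i).2.isCompact) fun z hz => ?_
  simp only [Set.mem_pi, Set.mem_univ, forall_const, not_forall] at hz
  obtain ⟨i, hi⟩ := hz
  exact prod_eq_zero (mem_univ i) (image_eq_zero_of_notMem_tsupport hi)

/-- The cutoff function on `ℂⁿ` whose translates under the lattice add up to `1`. -/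
def chi (n : ℕ) (z : ℂ^n) : ℂ := ∏ i, chi₁ τ (z i)

lemma isTest_chi (n : ℕ) : IsTest (chi τ n) := IsTest.prod fun _ => isTest_chi₁ τ

end Product

/-! ### Localization -/

/-- A property of products `φ G`, additive in `φ`, holds for all test functions `φ` if it holds for
those with support in suitable neighbourhoods of the points. -/
lemma of_local {G : ℂ^n → ℂ} (P : (ℂ^n → ℂ) → Prop)
    (hzero : P fun _ => 0) (hadd : ∀ f g, P f → P g → P fun z => f z + g z)
    (hloc : ∀ p, ∃ U ∈ 𝓝 p, ∀ φ, IsTest φ → tsupport φ ⊆ U → P fun z => φ z * G z)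
    {φ : ℂ^n → ℂ} (hφ : IsTest φ) : P fun z => φ z * G z := by
  classical
  choose U hU hP using hloc
  have hb := fun p => exists_bump (hU p)
  choose b hbt hbs hb1 using hb
  -- The factor `1 - ∏ (1 - b p)` is `1` wherever one of the bump functions is `1`. Splitting off
  -- one bump at a time shows that the property holds for each such product, which takes the place
  -- of a partition of unity.
  have hind : ∀ (t : Finset ℂ^n) (φ : ℂ^n → ℂ), IsTest φ →
      P fun z => φ z * (1 - ∏ p ∈ t, (1 - b p z)) * G z := by
    intro t
    induction t using Finset.induction_on with
    | empty => intro φ _; simpa using hzero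
    | insert p t hp ih =>
      intro φ hφ
      have h1 := hP p (fun z => φ z * b p z) (hφ.mul_smooth (hbt p).1)
        ((tsupport_mul_subset_right (f := φ) (g := b p)).trans (hbs p))
      have h2 := ih (fun z => φ z * (1 - b p z)) (hφ.mul_smooth (contDiff_const.sub (hbt p).1))
      have h3 := hadd _ _ h1 h2
      convert h3 using 1
      funext z
      rw [Finset.prod_insert hp]
      ring
  obtain ⟨t, ht⟩ := hφ.2.isCompact.elim_nhds_subcover (fun p => {z | b p z = 1}) (fun p _ => hb1 p)
  convert hind t φ hφ using 1
  funext z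
  by_cases hz : z ∈ tsupport φ
  · obtain ⟨p, hp, hpz⟩ := Set.mem_iUnion₂.1 (ht.2 hz)
    have hpz' : b p z = 1 := hpz
    rw [prod_eq_zero hp (by rw [hpz', sub_self]), sub_zero, mul_one]
  · rw [image_eq_zero_of_notMem_tsupport hz]; ring

section Poles

variable {G : ℂ^n → ℂ}

lemma localEquation_mem_Denom {p : ℂ^n} {e : Fin n × Fin n} (he : diagonalThrough τ p e) :
    localEquation p e ∈ Denom n τ := sub_mem_Denom he.1 he.2

lemma HasHolomorphicPoles.isK (hG : HasHolomorphicPoles τ G) {φ : ℂ^n → ℂ}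
    (hφ : IsTest φ) : IsK τ fun z => φ z * G z := by
  classical
  refine of_local (IsK τ) (IsTest.isK IsTest.zero) (fun f g hf hg => hf.add hg) (fun p => ?_) hφ
  obtain ⟨U, N, h, hU, hp, hh, e⟩ := hG.2 p
  refine ⟨U, hU.mem_nhds hp, fun φ hφ hs => ⟨fun z => φ z * h z,
    (∏ e : Fin n × Fin n with diagonalThrough τ p e, localEquation p e) ^ N,
    hφ.mul_of_tsupport_subset hU hh hs, pow_mem (prod_mem fun e he =>
      localEquation_mem_Denom (mem_filter.1 he).2) N, fun z hz => ?_⟩⟩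
  by_cases hzU : z ∈ tsupport φ
  · have := e z (hs hzU) hz
    simp only [this, Pi.pow_apply, Finset.prod_apply]
    rw [mul_div_assoc]
  · simp [image_eq_zero_of_notMem_tsupport hzU]

end Poles

/-! ### Integration over the fundamental domain -/

section FundamentalDomain

/-- The lattice `Λⁿ`. -/
def latticeGroup (n : ℕ) (τ : ℂ) : AddSubgroup ℂ^n where
  carrier := {l | ∀ i, l i ∈ lattice τ}
  zero_mem' _ := zero_mem_lattice τ
  add_mem' ha hb i := add_mem_lattice (ha i) (hb i)
  neg_mem' ha i := neg_mem_lattice (ha i)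

lemma countable_latticeGroup (n : ℕ) (τ : ℂ) : Countable (latticeGroup n τ) := by
  have : ({l : ℂ^n | ∀ i, l i ∈ lattice τ}).Countable := by
    have h := Set.countable_univ_pi fun _ : Fin n => countable_lattice τ
    convert h using 1
    ext l; simp
  exact this.to_subtype

lemma mem_fundamentalDomain : z ∈ fundamentalDomain n τ ↔
    ∀ i, xc τ (z i) ∈ Ico (0 : ℝ) 1 ∧ yc τ (z i) ∈ Ico (0 : ℝ) 1 := by
  refine forall_congr' fun i => ⟨?_, fun h => ⟨_, h.1, _, h.2, (xc_add_yc τ (z i)).symm⟩⟩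
  rintro ⟨s, hs, t, ht, h⟩
  rw [h, xc_coord, yc_coord]
  exact ⟨hs, ht⟩

lemma measurableSet_fundamentalDomain : MeasurableSet (fundamentalDomain n τ) := by
  have : fundamentalDomain n τ = ⋂ i, ((fun z : ℂ^n => xc τ (z i)) ⁻¹' Ico 0 1 ∩
      (fun z : ℂ^n => yc τ (z i)) ⁻¹' Ico 0 1) := by
    ext z
    simp only [mem_fundamentalDomain, Set.mem_iInter, Set.mem_inter_iff, mem_preimage]
  rw [this]
  refine MeasurableSet.iInter fun i => MeasurableSet.inter ?_ ?_
  · exact measurableSet_Ico.preimage (by fun_prop : Continuous fun z : ℂ^n => xc τ (z i)).measurable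
  · exact measurableSet_Ico.preimage (by fun_prop : Continuous fun z : ℂ^n => yc τ (z i)).measurable

lemma isAddFundamentalDomain : IsAddFundamentalDomain (latticeGroup n τ)
    (fundamentalDomain n τ) (volume : Measure ℂ^n) := by
  refine IsAddFundamentalDomain.mk' measurableSet_fundamentalDomain.nullMeasurableSet fun z => ?_
  refine ⟨⟨fun i => ((-⌊xc τ (z i)⌋ : ℤ) : ℂ) + ((-⌊yc τ (z i)⌋ : ℤ) : ℂ) * τ, fun i => ⟨_, _, rfl⟩⟩, ?_, ?_⟩
  · simp only [AddSubgroup.vadd_def, mem_fundamentalDomain, vadd_eq_add, Pi.add_apply, map_add]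
    intro i
    have h1 := xc_coord τ (-⌊xc τ (z i)⌋ : ℤ) (-⌊yc τ (z i)⌋ : ℤ)
    have h2 := yc_coord τ (-⌊xc τ (z i)⌋ : ℤ) (-⌊yc τ (z i)⌋ : ℤ)
    simp only [ofReal_intCast, map_add] at h1 h2
    rw [h1, h2]
    push_cast
    constructor
    · exact ⟨by linarith [Int.floor_le (xc τ (z i))], by linarith [Int.lt_floor_add_one (xc τ (z i))]⟩
    · exact ⟨by linarith [Int.floor_le (yc τ (z i))], by linarith [Int.lt_floor_add_one (yc τ (z i))]⟩
  · rintro ⟨l, hl⟩ h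
    ext i
    simp only [AddSubgroup.vadd_def, mem_fundamentalDomain, vadd_eq_add, Pi.add_apply, map_add] at h
    obtain ⟨k, m, hkm⟩ := hl i
    have hi := h i
    have h1 := xc_coord τ k m
    have h2 := yc_coord τ k m
    simp only [ofReal_intCast] at h1 h2
    rw [hkm, h1, h2] at hi
    have e1 : ⌊xc τ (z i)⌋ = -k := by
      rw [Int.floor_eq_iff]; push_cast
      exact ⟨by linarith [hi.1.1], by linarith [hi.1.2]⟩
    have e2 : ⌊yc τ (z i)⌋ = -m := by
      rw [Int.floor_eq_iff]; push_cast
      exact ⟨by linarith [hi.2.1], by linarith [hi.2.2]⟩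
    simp [hkm, e1, e2]

lemma finite_lattice_inter {K : Set ℂ} (hK : Bornology.IsBounded K) : (lattice τ ∩ K).Finite := by
  obtain ⟨R, hR⟩ := hK.subset_closedBall 0
  refine Set.Finite.subset ?_ (Set.inter_subset_inter_right _ hR)
  have hc : IsCompact (lattice τ ∩ closedBall 0 R) := (isCompact_closedBall 0 R).inter_left (isClosed_lattice τ)
  by_contra hinf
  obtain ⟨p, _, hp⟩ := Set.Infinite.exists_accPt_of_subset_isCompact hinf hc subset_rfl
  rw [accPt_iff_frequently_nhdsNE] at hp
  exact hp (((eventually_notMem_lattice τ p)).mono fun w hw h => hw h.1)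

lemma norm_le_of_mem_fundamentalDomain (hz : z ∈ fundamentalDomain n τ) : ‖z‖ ≤ 1 + ‖(τ : ℂ)‖ := by
  rw [pi_norm_le_iff_of_nonneg (by positivity)]
  intro i
  have h := mem_fundamentalDomain.1 hz i
  rw [← xc_add_yc τ (z i)]
  refine (norm_add_le _ _).trans (add_le_add ?_ ?_)
  · rw [norm_real, norm_eq_abs, abs_of_nonneg h.1.1]; exact h.1.2.le
  · rw [norm_mul, norm_real, norm_eq_abs, abs_of_nonneg h.2.1]
    exact mul_le_of_le_one_left (norm_nonneg _) h.2.2.le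

/-- Finitely many translates of `chi₁` matter on a bounded set, and they add up to `1`. -/
lemma exists_sum_chi₁ (τ : ℍ) (R : ℝ) : ∃ s : Finset ℂ, (∀ l ∈ s, l ∈ lattice τ) ∧
    ∀ w, ‖w‖ ≤ R → ∑ l ∈ s, chi₁ τ (l + w) = 1 ∧ ∀ l ∈ lattice τ, l ∉ s → chi₁ τ (l + w) = 0 := by
  classical
  obtain ⟨M, hM⟩ := exists_nat_ge (max ‖xc τ‖ ‖yc τ‖ * R + 1)
  let e : ℕ × ℕ → ℂ := fun p => ((p.1 - M : ℝ) : ℂ) + ((p.2 - M : ℝ) : ℂ) * τ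
  have hx : ∀ p, xc τ (e p) = p.1 - M := fun p => xc_coord τ _ _
  have hy : ∀ p, yc τ (e p) = p.2 - M := fun p => yc_coord τ _ _
  have he : Injective e := fun p q h => by
    have h1 := congrArg (xc τ) h
    have h2 := congrArg (yc τ) h
    rw [hx, hx, sub_left_inj, Nat.cast_inj] at h1
    rw [hy, hy, sub_left_inj, Nat.cast_inj] at h2
    exact Prod.ext h1 h2
  refine ⟨(Finset.range (2 * M) ×ˢ Finset.range (2 * M)).image e, fun l hl => ?_, fun w hw => ?_⟩
  · obtain ⟨p, -, rfl⟩ := Finset.mem_image.1 hl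
    exact ⟨p.1 - M, p.2 - M, by simp [e]⟩
  have bx : |xc τ w| ≤ M - 1 := ((xc τ).le_of_opNorm_le_of_le (le_max_left _ _) hw).trans (by linarith)
  have bY : |yc τ w| ≤ M - 1 := ((yc τ).le_of_opNorm_le_of_le (le_max_right _ _) hw).trans (by linarith)
  refine ⟨?_, fun l hl hn => ?_⟩
  · rw [sum_image he.injOn, Finset.sum_product]
    simp only [chi₁, map_add, hx, hy, add_comm _ (xc τ w), add_comm _ (yc τ w)]
    simp only [← Complex.ofReal_sum]
    rw [← Finset.sum_mul_sum, sum_unitBump bx, sum_unitBump bY, mul_one, Complex.ofReal_one]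
  · obtain ⟨k, m, rfl⟩ := hl
    by_contra hne
    have h1 := xc_coord τ k m
    have h2 := yc_coord τ k m
    simp only [ofReal_intCast] at h1 h2
    simp only [chi₁, map_add, h1, h2, Complex.ofReal_eq_zero, mul_eq_zero, not_or] at hne
    have a1 := abs_lt.1 (not_le.1 (mt unitBump_eq_zero hne.1))
    have a2 := abs_lt.1 (not_le.1 (mt unitBump_eq_zero hne.2))
    rw [abs_le] at bx bY
    have : ∀ {k : ℤ} {x : ℝ}, -1 < k + x ∧ k + x < 1 → -(M - 1) ≤ x ∧ x ≤ M - 1 → 0 ≤ k + M ∧ k < M :=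
      fun {k x} h h' => by
        have h1 : (-M : ℝ) < k := by linarith [h.1, h'.2]
        have h2 : (k : ℝ) < M := by linarith [h.2, h'.1]
        have h1 : (-M : ℤ) < k := by exact_mod_cast h1
        have h2 : k < M := by exact_mod_cast h2
        omega
    have c1 := this a1 bx
    have c2 := this a2 bY
    refine hn (Finset.mem_image.2 ⟨((k + M).toNat, (m + M).toNat), by simp; omega, ?_⟩)
    have e1 : (((k + M).toNat : ℤ) : ℂ) = k + M := by rw [Int.toNat_of_nonneg c1.1]; push_cast; rfl
    have e2 : (((m + M).toNat : ℤ) : ℂ) = m + M := by rw [Int.toNat_of_nonneg c2.1]; push_cast; rfl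
    simp only [Int.cast_natCast] at e1 e2
    simp [e, e1, e2]

/-- The sum of all lattice translates. -/
def periodize (n : ℕ) (τ : ℂ) (f : ℂ^n → ℂ) (z : ℂ^n) : ℂ := ∑ᶠ l : latticeGroup n τ, f (l + z)

lemma add_notMem_iff (l : latticeGroup n τ) : (l : ℂ^n) + z ∉ bigDiagonal n τ ↔ z ∉ bigDiagonal n τ := by
  rw [add_comm, add_mem_bigDiagonal_iff l.2]

lemma exists_finset_translates {f : ℂ^n → ℂ} (hf : HasCompactSupport f) {K : Set ℂ^n}
    (hK : Bornology.IsBounded K) : ∃ s : Finset (latticeGroup n τ), ∀ z ∈ K, ∀ l ∉ s, f (l + z) = 0 := by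
  obtain ⟨R, hR⟩ := hf.isBounded.subset_closedBall 0
  obtain ⟨R', hR'⟩ := hK.subset_closedBall 0
  have hS : {l : latticeGroup n τ | ∀ i, (l : ℂ^n) i ∈ lattice τ ∩ closedBall 0 (R + R')}.Finite :=
    Set.Finite.preimage (f := fun l : latticeGroup n τ => (l : ℂ^n)) Subtype.val_injective.injOn
      (Set.Finite.pi' fun _ => finite_lattice_inter Metric.isBounded_closedBall)
  refine ⟨hS.toFinset, fun z hz l hl => ?_⟩
  by_contra hne
  refine hl (hS.mem_toFinset.2 fun i => ⟨l.2 i, ?_⟩)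
  have h1 : ‖(l : ℂ^n) + z‖ ≤ R := by simpa using hR (subset_tsupport _ hne)
  have h2 : ‖z‖ ≤ R' := by simpa using hR' hz
  have h3 := norm_sub_le ((l : ℂ^n) + z) z
  rw [add_sub_cancel_right] at h3
  rw [mem_closedBall_zero_iff]
  linarith [norm_le_pi_norm (l : ℂ^n) i]

lemma periodize_eq_sum {f : ℂ^n → ℂ} {s : Finset (latticeGroup n τ)}
    (hs : ∀ l ∉ s, f (l + z) = 0) : periodize n τ f z = ∑ l ∈ s, f (l + z) :=
  finsum_eq_sum_of_support_subset _ fun l hl => by_contra fun h => hl (hs l h)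

lemma periodize_chi (z : ℂ^n) : periodize n τ (chi τ n) z = 1 := by
  classical
  choose s hs h using fun i => exists_sum_chi₁ τ ‖z i‖
  have hz := fun i => h i (z i) le_rfl
  have hSl : ∀ l ∈ Fintype.piFinset s, l ∈ latticeGroup n τ := fun l hl i =>
    hs i _ (Fintype.mem_piFinset.1 hl i)
  rw [periodize_eq_sum (s := (Fintype.piFinset s).subtype (· ∈ latticeGroup n τ)),
    Finset.sum_subtype_of_mem (fun l => chi τ n (l + z)) hSl]
  · have := Finset.prod_univ_sum s fun i l => chi₁ τ (l + z i)
    simp only [chi, Pi.add_apply]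
    rw [← this]
    exact Finset.prod_eq_one fun i _ => (hz i).1
  · intro l hl
    have hl' : (l : ℂ^n) ∉ Fintype.piFinset s := by simpa using hl
    simp only [Fintype.mem_piFinset, not_forall] at hl'
    obtain ⟨i, hli⟩ := hl'
    exact prod_eq_zero (mem_univ i) ((hz i).2 _ (l.2 i) hli)

/-- Locally the sum over the lattice is finite. An arbitrary additive functional of the differential
is admitted in order to treat `∂` and `∂̄` at once. -/
lemma fderiv_periodize {f : ℂ^n → ℂ} (hf : HasCompactSupport f)
    (hd : ∀ l : latticeGroup n τ, DifferentiableAt ℝ f (l + z)) :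
    DifferentiableAt ℝ (periodize n τ f) z ∧ ∀ A : (ℂ^n →L[ℝ] ℂ) →+ ℂ,
      A (fderiv ℝ (periodize n τ f) z) = periodize n τ (fun y => A (fderiv ℝ f y)) z := by
  obtain ⟨s, hs⟩ := exists_finset_translates (τ := τ) hf (Metric.isBounded_ball (x := z) (r := 1))
  have hb := ball_mem_nhds z one_pos
  have hA : ∀ l : latticeGroup n τ, HasFDerivAt (fun y => f (l + y)) (fderiv ℝ f (l + z)) z := fun l =>
    (hasFDerivAt_comp_add_left _).2 (hd l).hasFDerivAt
  have h := (HasFDerivAt.fun_sum fun l (_ : l ∈ s) => hA l).congr_of_eventuallyEq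
    (f₁ := periodize n τ f) (by filter_upwards [hb] with y hy using periodize_eq_sum (hs y hy))
  refine ⟨h.differentiableAt, fun A => ?_⟩
  rw [h.fderiv, map_sum, periodize_eq_sum fun l hl => ?_]
  have : (fun y => f (l + y)) =ᶠ[𝓝 z] fun _ => 0 := by filter_upwards [hb] with y hy using hs y hy l hl
  rw [← (hA l).fderiv, this.fderiv_eq]
  simp

/-- `∂_v` as a functional of the differential. -/
def dzHom (v : ℂ^n) : (ℂ^n →L[ℝ] ℂ) →+ ℂ :=
  AddMonoidHom.mk' (fun L => (1 / 2) * (L v - I * L (I • v))) fun L L' => by simp; ring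

/-- `∂̄_v` as a functional of the differential. -/
def dzbarHom (v : ℂ^n) : (ℂ^n →L[ℝ] ℂ) →+ ℂ :=
  AddMonoidHom.mk' (fun L => (1 / 2) * (L v + I * L (I • v))) fun L L' => by simp; ring

/-- The translates of `χ` add up to the constant `1`, so those of its derivatives add up to zero. -/
lemma periodize_fderiv_chi (A : (ℂ^n →L[ℝ] ℂ) →+ ℂ) (z : ℂ^n) :
    periodize n τ (fun y => A (fderiv ℝ (chi τ n) y)) z = 0 := by
  rw [← (fderiv_periodize (isTest_chi τ n).2 fun l => (isTest_chi τ n).1.diffAt _).2 A, funext periodize_chi]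
  simp

/-- Insert the factor `∑ χ(l + z) = 1`, translate the term of index `l` by `-l`, and use that `G` is
periodic and `ℓ` invariant: the sum becomes `ℓ` of `χ G` times the sum of the translates of `T`,
which is zero. This is how the cutoff function disappears from the final formulas. -/
lemma IsReg.mul_eq_zero {ℓ : (ℂ^n → ℂ) → ℂ} (hℓ : IsReg τ ℓ) {G T : ℂ^n → ℂ} (hT : IsTest T)
    (h0 : ∀ z, periodize n τ T z = 0) (hG : HasHolomorphicPoles τ G) : ℓ (fun z => T z * G z) = 0 := by
  classical
  have hχ := isTest_chi τ n
  obtain ⟨s, hs⟩ := exists_finset_translates (τ := τ) hχ.2 hT.2.isBounded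
  obtain ⟨s', hs'⟩ := exists_finset_translates (τ := τ) hT.2 hχ.2.isBounded
  -- Large enough for both summations: the translates of `χ` that meet the support of `T`, and the
  -- negatives of the translates of `T` that meet the support of `χ`.
  let t : Finset (latticeGroup n τ) := s ∪ s'.image fun l => -l
  have k1 : ∀ l : latticeGroup n τ, IsK τ fun z : ℂ^n => T (-l + z) * chi τ n z * G z := fun l =>
    hG.isK (IsTest.smooth_mul (hT.1.comp (by fun_prop)) hχ)
  have k2 : ∀ l : latticeGroup n τ, IsK τ fun z : ℂ^n => chi τ n (l + z) * T z * G z := fun l =>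
    hG.isK (IsTest.smooth_mul (hχ.1.comp (by fun_prop)) hT)
  have e1 : (fun z => T z * G z) = fun z => ∑ l ∈ t, chi τ n (l + z) * T z * G z := by
    funext z
    by_cases hz : z ∈ tsupport T
    · rw [← sum_mul, ← sum_mul, ← periodize_eq_sum fun l hl => hs z hz l fun h => hl (by simp [t, h]),
        periodize_chi, one_mul]
    · simp [image_eq_zero_of_notMem_tsupport hz]
  have e2 : (fun z => ∑ l ∈ t, T (-l + z) * chi τ n z * G z) = fun _ => 0 := by
    funext z
    by_cases hz : z ∈ tsupport (chi τ n)
    · have := periodize_eq_sum (s := t.image fun l => -l) fun l hl => hs' z hz l fun h => hl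
        (Finset.mem_image.2 ⟨-l, Finset.mem_union_right _ (Finset.mem_image_of_mem _ h), neg_neg l⟩)
      rw [h0, sum_image neg_injective.injOn] at this
      rw [← sum_mul, ← sum_mul]
      simp only [AddSubgroup.coe_neg] at this
      rw [← this, zero_mul, zero_mul]
    · simp [image_eq_zero_of_notMem_tsupport hz]
  rw [e1, hℓ.sum t fun l _ => k2 l, ← hℓ.zero, ← e2, hℓ.sum t fun l _ => k1 l]
  refine sum_congr rfl fun l _ => ?_
  rw [← hℓ.comp_add (k1 l) l.2]
  refine (hℓ.congr ((k1 l).comp_add l.2) fun z hz => ?_).symm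
  rw [hG.1 z hz l l.2, neg_add_cancel_comm_assoc, add_comm z, mul_comm (T z)]

/-- Unfolding: integration of a periodic function over the fundamental domain. -/
lemma integral_fundamentalDomain {a : ℂ^n → ℂ} (ha : IsPeriodic τ a)
    (hi : Integrable fun z => chi τ n z * a z) (hi' : IntegrableOn a (fundamentalDomain n τ)) :
    ∫ z in fundamentalDomain n τ, a z = ∫ z, chi τ n z * a z := by
  have := countable_latticeGroup n τ
  have hχ := isTest_chi τ n
  rw [isAddFundamentalDomain.integral_eq_tsum'' (G := latticeGroup n τ) (s := fundamentalDomain n τ) _ hi]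
  obtain ⟨s, hs⟩ := exists_finset_translates (τ := τ) hχ.2 (isBounded_iff_forall_norm_le.2
    ⟨_, fun z hz => norm_le_of_mem_fundamentalDomain (n := n) (τ := τ) hz⟩)
  have hper : ∀ l : latticeGroup n τ, ∫ z in fundamentalDomain n τ, chi τ n (l +ᵥ z) * a (l +ᵥ z) =
      ∫ z in fundamentalDomain n τ, chi τ n (l + z) * a z := fun l => by
    refine integral_congr_ae ?_
    filter_upwards [ae_restrict_of_ae (ae_notMem_bigDiagonal n τ)] with z hz
    rw [AddSubgroup.vadd_def, vadd_eq_add, add_comm (l : ℂ^n) z, ha z hz l l.2]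
  rw [tsum_congr hper, tsum_eq_sum (s := s) fun l hl => ?_, ← integral_finsetSum _ fun l _ => ?_]
  · refine setIntegral_congr_fun measurableSet_fundamentalDomain fun z hz => ?_
    rw [← sum_mul, ← periodize_eq_sum (hs z hz), periodize_chi, one_mul]
  · obtain ⟨C, hC⟩ := hχ.continuous.bounded_above_of_compact_support hχ.2
    exact Integrable.bdd_mul hi' (hχ.continuous.comp (by fun_prop)).aestronglyMeasurable
      (.of_forall fun z => hC _)
  · rw [setIntegral_congr_fun (g := fun _ => 0) measurableSet_fundamentalDomain fun z hz => ?_]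
    · simp
    · simp [hs z hz l hl]

lemma exists_isTest_eq_one_on_fundamentalDomain :
    ∃ φ : ℂ^n → ℂ, IsTest φ ∧ ∀ z ∈ fundamentalDomain n τ, φ z = 1 := by
  let R := 1 + ‖(τ : ℂ)‖
  let ψ : ContDiffBump (0 : ℂ^n) := ⟨R, R + 1, by positivity, by linarith⟩
  refine ⟨fun x => (ψ x : ℂ), ⟨ofRealCLM.contDiff.comp ψ.contDiff,
    ψ.hasCompactSupport.comp_left (g := fun r : ℝ => (r : ℂ)) (by simp)⟩, fun z hz => ?_⟩
  have : ψ z = 1 := ψ.one_of_mem_closedBall  (mem_closedBall_zero_iff.2 (norm_le_of_mem_fundamentalDomain hz))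
  simp [this]

end FundamentalDomain

/-! ### Integrability of logarithmic forms -/

section Logarithmic

lemma integrable_comp_linearEquiv (e : ℂ^n ≃L[ℝ] ℂ^n) {f : ℂ^n → ℂ}
    (hf : Integrable f) : Integrable fun z => f (e z) := by
  have hm : Measure.map e volume = ENNReal.ofReal |(LinearMap.det (e : ℂ^n →ₗ[ℝ] ℂ^n))⁻¹| • volume :=
    Measure.map_linearMap_addHaar_eq_smul_addHaar volume (LinearEquiv.isUnit_det' e.toLinearEquiv).ne_zero
  have h : Integrable f (Measure.map e volume) := by rw [hm]; exact hf.smul_measure ENNReal.ofReal_ne_top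
  exact (e.toHomeomorph.measurableEmbedding.integrable_map_iff).1 h

lemma integrable_test_mul_prod {g : Fin n → ℂ → ℂ} (hg : ∀ k, LocallyIntegrable (g k))
    {φ : ℂ^n → ℂ} (hφ : IsTest φ) : Integrable fun u => φ u * ∏ k, g k (u k) := by
  obtain ⟨C, hC⟩ := hφ.continuous.bounded_above_of_compact_support hφ.2
  obtain ⟨R, hR⟩ := hφ.2.isCompact.isBounded.subset_closedBall (0 : ℂ^n)
  have h1 : Integrable fun u : ℂ^n =>
      ∏ k, (closedBall (0 : ℂ) R).indicator (g k) (u k) := by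
    refine Integrable.fintype_prod (f := fun k => (closedBall (0 : ℂ) R).indicator (g k)) fun k => ?_
    rw [integrable_indicator_iff measurableSet_closedBall]
    exact (hg k).integrableOn_isCompact (isCompact_closedBall 0 R)
  have h2 := h1.bdd_mul hφ.continuous.aestronglyMeasurable (.of_forall hC)
  refine h2.congr (.of_forall fun u => ?_)
  by_cases hu : u ∈ tsupport φ
  · have hu' := hR hu
    simp only
    congr 1
    refine prod_congr rfl fun k _ => indicator_of_mem ?_ _
    rw [mem_closedBall_zero_iff] at hu' ⊢
    exact (norm_le_pi_norm u k).trans hu'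
  · simp [image_eq_zero_of_notMem_tsupport hu]

lemma locallyIntegrable_sub_inv (c : ℂ) : LocallyIntegrable fun w : ℂ => (w - c)⁻¹ := by
  rw [MeasureTheory.locallyIntegrable_iff]
  intro k hk
  have h1 := locallyIntegrable_inv.integrableOn_isCompact (hk.image (by fun_prop :
    Continuous fun w : ℂ => w - c))
  have hmp := measurePreserving_sub_right (volume : Measure ℂ) c
  have hme : MeasurableEmbedding fun w : ℂ => w - c := measurableEmbedding_subRight c
  have := (hmp.integrableOn_image hme (f := fun w : ℂ => w⁻¹) (s := k)).1 h1
  exact this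

open scoped Classical in
-- The forms `dz_j` and `d(z_i - z_j)` in the wedge product have a constant coefficient matrix `B`.
-- If `det B = 0`, the product vanishes. Otherwise these linear forms are coordinates, in which the
-- coefficient is a product of functions of one variable each, either constant or of the form `1 /
-- (u - c)`; such a product is locally integrable by Fubini.
lemma logGenerator_wedge (p : ℂ^n) (r : Fin n → Fin n ⊕ (Fin n × Fin n)) {ψ : ℂ^n → ℂ} (hψ : IsTest ψ) :
    IsK τ (fun z => ψ z * Matrix.det (Matrix.of fun k => logGenerator τ p z (r k))) ∧
      Integrable fun z => ψ z * Matrix.det (Matrix.of fun k => logGenerator τ p z (r k)) := by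
  set B : Matrix (Fin n) (Fin n) ℂ := Matrix.of fun k =>
    Sum.elim (fun j => (Pi.single j 1 : ℂ^n))
      (fun e => if diagonalThrough τ p e then Pi.single e.1 1 - Pi.single e.2 1 else 0) (r k) with hB
  set d : Fin n → ℂ^n → ℂ := fun k =>
    Sum.elim (fun _ => 1) (fun e => if diagonalThrough τ p e then localEquation p e else 1) (r k)
    with hd
  have hdm : ∀ k, d k ∈ Denom n τ := by
    intro k
    simp only [hd]
    rcases r k with j | e
    · exact one_mem _
    simp only [Sum.elim_inr]
    split_ifs with h
    exacts [localEquation_mem_Denom h, one_mem _]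
  have hdet : ∀ z, Matrix.det (Matrix.of fun k => logGenerator τ p z (r k)) = (∏ k, (d k z)⁻¹) * B.det := by
    intro z
    rw [← Matrix.det_mul_column]
    congr 1
    ext k m
    simp only [Matrix.of_apply, hB, hd]
    rcases r k with j | e
    · simp [logGenerator]
    · simp only [logGenerator, Sum.elim_inr]
      split_ifs <;> simp
  simp only [hdet]
  constructor
  · refine ⟨fun z => B.det * ψ z, ∏ k, d k, hψ.const_mul _, prod_mem fun k _ => hdm k, fun z _ => ?_⟩
    simp only [Finset.prod_apply, Finset.prod_inv_distrib]
    ring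
  · by_cases hdB : B.det = 0
    · simp [hdB]
    · let e₀ : ℂ^n ≃ₗ[ℂ] ℂ^n := Matrix.toLinearEquiv' B
        (Matrix.invertibleOfIsUnitDet B (isUnit_iff_ne_zero.2 hdB))
      let e : ℂ^n ≃L[ℝ] ℂ^n := e₀.toContinuousLinearEquiv.restrictScalars ℝ
      have he : ∀ z, e z = B.mulVec z := fun z => rfl
      set g : Fin n → ℂ → ℂ := fun k =>
        Sum.elim (fun _ _ => 1) (fun e u => if diagonalThrough τ p e then (u - (p e.1 - p e.2))⁻¹ else 1)
          (r k) with hg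
      have hgl : ∀ k, LocallyIntegrable (g k) := by
        intro k
        simp only [hg]
        rcases r k with j | e
        · exact locallyIntegrable_const _
        simp only [Sum.elim_inr]
        split_ifs
        exacts [locallyIntegrable_sub_inv _, locallyIntegrable_const _]
      have hgd : ∀ k z, (d k z)⁻¹ = g k (e z k) := by
        intro k z
        rw [he]
        simp only [hd, hg, Matrix.mulVec, hB]
        rcases hrk : r k with j | e
        · simp
        · simp only [Sum.elim_inr]
          split_ifs with h
          · simp only [Matrix.of_apply, hrk, Sum.elim_inr, if_pos h]
            rw [sub_dotProduct, single_one_dotProduct, single_one_dotProduct]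
            rfl
          · simp
      have h1 := integrable_test_mul_prod hgl
        ((hψ.const_mul B.det).comp_homeomorph e.symm.toHomeomorph e.symm.contDiff)
      have h2 := integrable_comp_linearEquiv e h1
      refine h2.congr (.of_forall fun z => ?_)
      simp only [hgd, ContinuousLinearEquiv.coe_toHomeomorph, ContinuousLinearEquiv.symm_apply_apply]
      ring

lemma IsLogarithmic.isK_integrable {a : ℂ^n → ℂ} (ha : IsLogarithmic τ a) {φ : ℂ^n → ℂ} (hφ : IsTest φ) :
    IsK τ (fun z => φ z * a z) ∧ Integrable fun z => φ z * a z := by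
  refine of_local (fun F => IsK τ F ∧ Integrable F) ⟨IsTest.isK IsTest.zero, integrable_zero _ _ _⟩
    (fun f g hf hg => ⟨hf.1.add hg.1, hf.2.add hg.2⟩) (fun p => ?_) hφ
  obtain ⟨U, c, hU, hp, hc, e⟩ := ha.2 p
  refine ⟨U, hU.mem_nhds hp, fun φ hφ hs => ?_⟩
  have hterm := fun r => logGenerator_wedge (τ := τ) p r (hφ.mul_of_tsupport_subset hU (hc r) hs)
  have heq : ∀ z ∉ bigDiagonal n τ, ∑ r, φ z * c r z *
      Matrix.det (Matrix.of fun k => logGenerator τ p z (r k)) = φ z * a z := by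
    intro z hz
    by_cases hzs : z ∈ tsupport φ
    · rw [e z (hs hzs) hz, mul_sum]
      exact sum_congr rfl fun r _ => by ring
    · simp [image_eq_zero_of_notMem_tsupport hzs]
  refine ⟨(IsK.sum Finset.univ fun r _ => (hterm r).1).congr heq,
    (integrable_finsetSum Finset.univ fun r _ => (hterm r).2).congr ?_⟩
  filter_upwards [ae_notMem_bigDiagonal n τ] with z hz
  exact heq z hz

end Logarithmic

open scoped Classical in
lemma HasHolomorphicPoles.contDiffAt {g : ℂ^n → ℂ}
    (hg : HasHolomorphicPoles τ g) (hz : z ∉ bigDiagonal n τ) : SmoothAt g z := by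
  obtain ⟨U, N, h, hU, hp, hh, e⟩ := hg.2 z
  have hev : g =ᶠ[𝓝 z] h := by
    filter_upwards [hU.mem_nhds hp, compl_bigDiagonal_mem_nhds hz] with y hy hyd
    rw [e y hy hyd]
    have : (Finset.univ.filter fun e : Fin n × Fin n => diagonalThrough τ z e) = ∅ :=
      Finset.filter_eq_empty_iff.2 fun e _ he => hz ⟨e.1, e.2, he⟩
    simp [this]
  exact (hh.contDiffAt (hU.mem_nhds hp)).congr_of_eventuallyEq hev

/-- The integral of `α` for a decomposition `ω = α + ∂β` is determined by `ω`. -/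
lemma IsDecomposition.integral_eq {a : ℂ^n → ℂ}
    {g : Fin n → ℂ^n → ℂ} (hd : IsDecomposition τ F a g) {ℓ : (ℂ^n → ℂ) → ℂ}
    (hℓ : IsReg τ ℓ) : IntegrableOn a (fundamentalDomain n τ) ∧
      ∫ z in fundamentalDomain n τ, a z = ℓ fun z => chi τ n z * F z := by
  obtain ⟨ha, hg, e⟩ := hd
  have hint : IntegrableOn a (fundamentalDomain n τ) := by
    obtain ⟨φ, hφ, h1⟩ := exists_isTest_eq_one_on_fundamentalDomain (n := n) (τ := τ)
    refine ((ha.isK_integrable hφ).2.integrableOn (s := fundamentalDomain n τ)).congr_fun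
      (fun z hz => ?_) measurableSet_fundamentalDomain
    simp [h1 z hz]
  refine ⟨hint, ?_⟩
  have hχ := isTest_chi τ n
  obtain ⟨hK, hI⟩ := ha.isK_integrable hχ
  rw [integral_fundamentalDomain ha.1 hI hint, ← hℓ.integral hK hI]
  -- Off the diagonals `χ F = χ a + ∑ ∂_i (χ g_i) - ∑ (∂_i χ) g_i`. The first sum is killed because
  -- it is exact, the second because the translates of `∂_i χ` add up to zero.
  have k1 := fun i => ((hg i).isK hχ).dz (Pi.single i 1)
  have k2 := fun i => ((hg i).isK (hχ.dz (Pi.single i 1))).const_mul (-1)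
  have hk := hK.add ((IsK.sum Finset.univ fun i _ => k1 i).add (IsK.sum Finset.univ fun i _ => k2 i))
  rw [← hℓ.congr hk (G := fun z => chi τ n z * F z), hℓ.add hK ((IsK.sum Finset.univ fun i _ => k1 i).add
    (IsK.sum Finset.univ fun i _ => k2 i)), hℓ.add (IsK.sum Finset.univ fun i _ => k1 i)
    (IsK.sum Finset.univ fun i _ => k2 i), hℓ.sum _ fun i _ => k1 i, hℓ.sum _ fun i _ => k2 i]
  · rw [sum_eq_zero fun i _ => hℓ.dz _ ((hg i).isK hχ), sum_eq_zero fun i _ => ?_]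
    · ring
    · rw [hℓ.const_mul _ ((hg i).isK (hχ.dz _)),
        hℓ.mul_eq_zero (hχ.dz _) (periodize_fderiv_chi (dzHom (Pi.single i 1))) (hg i), mul_zero]
  · intro z hz
    rw [e z hz, mul_add, mul_sum]
    congr 1
    rw [← sum_add_distrib]
    refine sum_congr rfl fun i _ => ?_
    rw [dz_mul _ (hχ.1.diffAt z) ((hg i).contDiffAt hz).diffAt, wirtinger_eq_dz]
    ring

/-! ### Reduction of the poles modulo exact forms -/

/-- The denominators of the logarithmic forms that remain after the reduction: products of at most
one equation `z_i - z_j - λ`, `j > i`, for each `i`. -/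
def logFactor (t : Fin n → Option (Fin n × ℂ)) (i : Fin n) (z : ℂ^n) : ℂ :=
  (t i).elim 1 fun p => z i - z p.1 - p.2

/-- The condition `i < j` makes the matrix of the corresponding logarithmic generators triangular,
so that its determinant is the product of the diagonal entries. -/
def LogDenom (n : ℕ) (τ : ℂ) : Set (ℂ^n → ℂ) :=
  {D | ∃ t : Fin n → Option (Fin n × ℂ), (∀ i j l, t i = some (j, l) → i < j ∧ l ∈ lattice τ) ∧
    D = fun z => ∏ i, logFactor t i z}

lemma LogDenom.cons {τ : ℂ} (hD : D ∈ LogDenom n τ)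
    (o : Option (Fin n × ℂ)) (ho : ∀ j l, o = some (j, l) → l ∈ lattice τ) : ∃ D' ∈ LogDenom (n + 1) τ, ∀ w z,
      D' (ins 0 (w, z)) = (o.elim 1 fun p => w - z p.1 - p.2) * D z := by
  obtain ⟨t, ht, rfl⟩ := hD
  let f : Fin n × ℂ → Fin (n + 1) × ℂ := fun p => (p.1.succ, p.2)
  refine ⟨_, ⟨Fin.cons (o.map f) fun i => (t i).map f, ?_, rfl⟩, fun w z => ?_⟩
  · intro i
    refine Fin.cases ?_ (fun i => ?_) i <;> intro j l h <;>
      simp only [Fin.cons_zero, Fin.cons_succ, Option.map_eq_some_iff] at h <;>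
      obtain ⟨⟨j', l'⟩, h1, h2⟩ := h <;> obtain ⟨rfl, rfl⟩ := Prod.mk.inj h2
    · exact ⟨Fin.succ_pos _, ho _ _ h1⟩
    · exact ⟨Fin.succ_lt_succ_iff.2 (ht _ _ _ h1).1, (ht _ _ _ h1).2⟩
  · have h0 : ins 0 (w, z) 0 = w := ins_same 0 (w, z)
    have hs : ∀ k : Fin n, ins 0 (w, z) k.succ = z k := fun k => by
      have := ins_succAbove 0 (w, z) k
      rwa [Fin.succAbove_zero] at this
    rw [Fin.prod_univ_succ]
    congr 1
    · rcases o with _ | p <;> simp [logFactor, f, h0, hs]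
    · refine prod_congr rfl fun i _ => ?_
      rcases hti : t i with _ | p <;> simp [logFactor, hti, f, hs]

section Reduction

variable {X : Type*} [NormedAddCommGroup X] [NormedSpace ℂ X] {m : ℕ}

/-- Sums of test functions divided by denominators of logarithmic forms. -/
def LogSum (τ : ℂ) (P : X →L[ℂ] ℂ^m) : AddSubmonoid (X → ℂ) :=
  AddSubmonoid.closure {S | ∃ h D, IsTest h ∧ D ∈ LogDenom m τ ∧ S = fun x => h x / D (P x)}

/-- The quotient of a test function by a product of equations of diagonals. -/
def IsQuot (τ : ℂ) (P : X →L[ℂ] ℂ^m) (G : X → ℂ) : Prop :=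
  ∃ h D, IsTest h ∧ D ∈ Denom m τ ∧ G = fun x => h x / D (P x)

variable {P : X →L[ℂ] ℂ^m}

lemma IsQuot.differentiableAt {G : X → ℂ} (hG : IsQuot τ P G) {x : X}
    (hx : P x ∉ bigDiagonal m τ) : DifferentiableAt ℝ G x := by
  obtain ⟨h, D, hh, hD, rfl⟩ := hG
  refine (contDiffAt_div hh.1.contDiffAt (ContDiff.contDiffAt ?_) (ne_zero_of_mem_Denom hD hx)).diffAt
  exact (contDiff_real_of_mem_Denom hD).comp (P.restrictScalars ℝ).contDiff

/-- A decomposition of `T` into a sum with logarithmic poles and a sum of derivatives. -/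
def HasReduction (τ : ℂ) (P : X →L[ℂ] ℂ^m) (v : Fin m → X) (T : X → ℂ) : Prop :=
  ∃ S ∈ LogSum τ P, ∃ (ι : Type) (s : Finset ι) (k : ι → Fin m) (G : ι → X → ℂ), (∀ i, IsQuot τ P (G i)) ∧
    ∀ x, P x ∉ bigDiagonal m τ → T x = S x + ∑ i ∈ s, dz (v (k i)) (G i) x

variable {v : Fin m → X} {T T' : X → ℂ}

lemma HasReduction.congr (hT : HasReduction τ P v T)
    (h : ∀ x, P x ∉ bigDiagonal m τ → T x = T' x) : HasReduction τ P v T' := by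
  obtain ⟨S, hS, ι, s, k, G, hG, e⟩ := hT
  exact ⟨S, hS, ι, s, k, G, hG, fun x hx => by rw [← h x hx, e x hx]⟩

lemma HasReduction.zero : HasReduction τ P v fun _ => 0 :=
  ⟨0, zero_mem _, Empty, ∅, fun i => i.elim, fun i => i.elim, fun i => i.elim, fun x _ => by simp⟩

lemma HasReduction.add (hT : HasReduction τ P v T) (hT' : HasReduction τ P v T') :
    HasReduction τ P v fun x => T x + T' x := by
  obtain ⟨S, hS, ι, s, k, G, hG, e⟩ := hT
  obtain ⟨S', hS', ι', s', k', G', hG', e'⟩ := hT'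
  refine ⟨S + S', add_mem hS hS', ι ⊕ ι', s.disjSum s', Sum.elim k k', Sum.elim G G', ?_, ?_⟩
  · rintro (i | i)
    · exact hG i
    · exact hG' i
  · intro x hx
    simp only [e x hx, e' x hx, Finset.sum_disjSum, Pi.add_apply, Sum.elim_inl, Sum.elim_inr]
    ring

lemma HasReduction.sum (s : Finset ι) {T : ι → X → ℂ}
    (hT : ∀ i ∈ s, HasReduction τ P v (T i)) : HasReduction τ P v fun x => ∑ i ∈ s, T i x :=
  sum_prop HasReduction.zero HasReduction.add s hT

lemma HasReduction.of_dz {G : X → ℂ} (hG : IsQuot τ P G) (i : Fin m) : HasReduction τ P v (dz (v i) G) :=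
  ⟨0, zero_mem _, Unit, Finset.univ, fun _ => i, fun _ => G, fun _ => hG, fun x _ => by simp⟩

lemma HasReduction.of_logSum {S : X → ℂ} (hS : S ∈ LogSum τ P) : HasReduction τ P v S :=
  ⟨S, hS, Empty, ∅, fun i => i.elim, fun i => i.elim, fun i => i.elim, fun x _ => by simp⟩

lemma HasReduction.comp_equiv {Y : Type*} [NormedAddCommGroup Y] [NormedSpace ℂ Y]
    (hT : HasReduction τ P v T) (e : Y ≃L[ℂ] X) {P' : Y →L[ℂ] ℂ^m} (hP : ∀ y, P' y = P (e y))
    {v' : Fin m → Y} (hv : ∀ i, e (v' i) = v i) : HasReduction τ P' v' fun y => T (e y) := by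
  have hcomp : ∀ {h : X → ℂ}, IsTest h → IsTest fun y => h (e y) := fun hh =>
    hh.comp_homeomorph e.toHomeomorph (e.contDiff.restrict_scalars ℝ)
  obtain ⟨S, hS, ι, s, k, G, hG, eT⟩ := hT
  refine ⟨fun y => S (e y), ?_, ι, s, k, fun i y => G i (e y), fun i => ?_, fun y hy => ?_⟩
  · clear eT
    induction hS using AddSubmonoid.closure_induction with
    | mem S h =>
      obtain ⟨h, D, hh, hD, rfl⟩ := h
      exact AddSubmonoid.subset_closure ⟨fun y => h (e y), D, hcomp hh, hD, by simp only [hP]⟩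
    | zero => exact zero_mem _
    | add f g _ _ hf hg => exact add_mem hf hg
  · obtain ⟨h, D, hh, hD, e'⟩ := hG i
    exact ⟨fun y => h (e y), D, hcomp hh, hD, by simp only [hP, e']⟩
  · rw [hP] at hy
    simp only [eT _ hy]
    congr 1
    refine sum_congr rfl fun i _ => ?_
    have hA : HasFDerivAt (fun y => e y) (e : Y →L[ℂ] X) y := e.hasFDerivAt
    rw [dz_comp (φ := fun y => e y) _ ((hG i).differentiableAt hy) hA]
    simp [hv]

end Reduction

section Step

variable {Q : Type} [NormedAddCommGroup Q] [NormedSpace ℂ Q]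

/-- `(w, (q, z)) ↦ (w, z) ∈ ℂⁿ⁺¹`. -/
def consProj (Q : Type) [NormedAddCommGroup Q] [NormedSpace ℂ Q] (n : ℕ) : ℂ × (Q × ℂ^n) →L[ℂ] ℂ^(n + 1) :=
  (ins (0 : Fin (n + 1))).toContinuousLinearMap.comp ((fst ℂ ℂ (Q × ℂ^n)).prod ((snd ℂ Q ℂ^n).comp (snd ℂ ℂ _)))

lemma consProj_apply (x : ℂ × (Q × ℂ^n)) : consProj Q n x = ins 0 (x.1, x.2.2) := rfl

/-- The coordinate directions of `ℂⁿ⁺¹`. -/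
def consDir (Q : Type) [NormedAddCommGroup Q] [NormedSpace ℂ Q] (n : ℕ) : Fin (n + 1) → ℂ × (Q × ℂ^n) :=
  Fin.cons ((1 : ℂ), (0, 0)) fun k => ((0 : ℂ), ((0 : Q), (Pi.single k 1 : ℂ^n)))

lemma mem_Denom_snd (hD : D ∈ Denom n τ) : ∃ D' ∈ Denom (n + 1) τ, ∀ w z, D' (ins 0 (w, z)) = D z := by
  induction hD using Submonoid.closure_induction with
  | mem f hf =>
    obtain ⟨i, j, hij, l, hl, rfl⟩ := hf
    refine ⟨_, sub_mem_Denom (i := (0 : Fin (n + 1)).succAbove i) (j := (0 : Fin (n + 1)).succAbove j)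
      (by simpa using hij) hl, fun w z => ?_⟩
    simp only [ins_succAbove]
  | one => exact ⟨1, one_mem _, fun _ _ => rfl⟩
  | mul f g _ _ hf hg =>
    obtain ⟨f', hf', ef⟩ := hf
    obtain ⟨g', hg', eg⟩ := hg
    exact ⟨f' * g', mul_mem hf' hg', fun w z => by simp [ef, eg]⟩

lemma mem_Denom_sub_pow (hD : D ∈ Denom n τ) {L : Q × ℂ^n →L[ℂ] ℂ} {b : ℂ} (hc : IsPole τ (snd ℂ Q ℂ^n) L b N) :
    ∃ D' ∈ Denom (n + 1) τ, ∀ x : ℂ × (Q × ℂ^n), D' (consProj Q n x) = D x.2.2 * (x.1 - (L x.2 + b)) ^ N := by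
  obtain ⟨D', hD', e⟩ := mem_Denom_snd hD
  rcases hc with rfl | ⟨j, rfl, hb⟩
  · exact ⟨D', hD', fun x => by simp [consProj_apply, e]⟩
  · refine ⟨D' * _ ^ N, mul_mem hD' (pow_mem (sub_mem_Denom (i := 0)
      (j := (0 : Fin (n + 1)).succAbove j) (Fin.succAbove_ne 0 j).symm hb) N), fun x => ?_⟩
    simp only [consProj_apply, Pi.mul_apply, Pi.pow_apply, e, ins_same, ins_succAbove]
    simp [sub_sub]

lemma consProj_notMem_iff {x : ℂ × (Q × ℂ^n)} : consProj Q n x ∉ bigDiagonal (n + 1) τ ↔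
      IsOff τ (snd ℂ Q ℂ^n) x := ins_notMem_bigDiagonal 0

/-- Partial fractions with simple poles are reduced by applying the reduction to the remaining
variables after the substitution `u = w - c`. -/
lemma HasReduction.of_partialFraction_simple [FiniteDimensional ℂ Q]
    (ih : ∀ (H : (ℂ × Q) × ℂ^n → ℂ) (D : ℂ^n → ℂ), IsTest H → D ∈ Denom n τ → HasReduction τ (snd ℂ (ℂ × Q) ℂ^n)
        (fun k => (0, (Pi.single k 1 : ℂ^n))) fun x => H x / D x.2)
    {H : ℂ × (Q × ℂ^n) → ℂ} {D : ℂ^n → ℂ} {L : Q × ℂ^n →L[ℂ] ℂ} {b : ℂ}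
    {N : ℕ} (hN : N ≤ 1) (hH : IsTest H) (hD : D ∈ Denom n τ) (hc : IsPole τ (snd ℂ Q ℂ^n) L b N) :
    HasReduction τ (consProj Q n) (consDir Q n) fun x => H x / (D x.2.2 * (x.1 - (L x.2 + b)) ^ N) := by
  let asc : (ℂ × Q) × ℂ^n ≃ₜ ℂ × (Q × ℂ^n) := Homeomorph.prodAssoc ℂ Q ℂ^n
  -- The substitution `u = w - L(q, z) - b`, with `u` regarded as a further parameter next to `q`.
  -- The factor `u ^ (-N)` then does not involve the variables `z` to which the induction hypothesis
  -- applies.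
  let φ : ℂ × (Q × ℂ^n) ≃ₜ (ℂ × Q) × ℂ^n := (shear L b).symm.trans asc.symm
  have hφc : Smooth φ := by
    have hL : Smooth L := (L.restrictScalars ℝ).contDiff
    show Smooth fun x : ℂ × (Q × ℂ^n) => ((x.1 - (L x.2 + b), x.2.1), x.2.2)
    fun_prop
  have hψc : Smooth φ.symm := by
    have hL : Smooth L := (L.restrictScalars ℝ).contDiff
    show Smooth fun x : (ℂ × Q) × ℂ^n => (x.1.1 + (L (x.1.2, x.2) + b), (x.1.2, x.2))
    fun_prop
  obtain ⟨S, hS, ι, s, k, G, hG, e⟩ := ih (fun y => H (φ.symm y)) D (hH.comp_homeomorph φ.symm hψc) hD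
  have hSr : HasReduction τ (consProj Q n) (consDir Q n) fun x => S (φ x) / (x.1 - (L x.2 + b)) ^ N := by
    refine HasReduction.of_logSum ?_
    clear e
    induction hS using AddSubmonoid.closure_induction with
    | mem S h =>
      obtain ⟨h, D₁, hh, hD₁, rfl⟩ := h
      have : ∃ D' ∈ LogDenom (n + 1) τ, ∀ x : ℂ × (Q × ℂ^n),
          D' (consProj Q n x) = (x.1 - (L x.2 + b)) ^ N * D₁ x.2.2 := by
        by_cases hN0 : N = 0
        · obtain ⟨D', hD', e'⟩ := LogDenom.cons hD₁ none (by simp)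
          exact ⟨D', hD', fun x => by simp [consProj_apply, e', hN0]⟩
        · obtain ⟨j, rfl, hb⟩ := Or.resolve_left hc hN0
          obtain ⟨D', hD', e'⟩ := LogDenom.cons hD₁ (some (j, b)) (by rintro _ _ ⟨⟩; exact hb)
          refine ⟨D', hD', fun x => ?_⟩
          rw [consProj_apply, e', show N = 1 by omega]
          simp [sub_sub]
      obtain ⟨D', hD', e'⟩ := this
      refine AddSubmonoid.subset_closure ⟨fun x => h (φ x), D', hh.comp_homeomorph φ hφc, hD', ?_⟩
      funext x
      rw [e', div_div, mul_comm]
      rfl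
    | zero =>
      convert zero_mem (LogSum τ (consProj Q n)) using 1
      funext x; simp
    | add f g _ _ hf hg =>
      convert add_mem hf hg using 1
      funext x; simp [add_div]
  set K : ι → ℂ × (Q × ℂ^n) → ℂ := fun i x => G i (φ x) / (x.1 - (L x.2 + b)) ^ N with hK
  have hKq : ∀ i, IsQuot τ (consProj Q n) (K i) := by
    intro i
    obtain ⟨h, D₁, hh, hD₁, e'⟩ := hG i
    obtain ⟨D', hD', e''⟩ := mem_Denom_sub_pow (Q := Q) hD₁ hc
    refine ⟨fun x => h (φ x), D', hh.comp_homeomorph φ hφc, hD', ?_⟩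
    funext x
    simp only [hK]
    rw [e', e'', div_div]
    rfl
  have hKc : ∀ (a : ℂ) i, IsQuot τ (consProj Q n) fun x => a * K i x := by
    intro a i
    obtain ⟨h, D₁, hh, hD₁, e'⟩ := hKq i
    refine ⟨fun x => a * h x, D₁, hh.const_mul a, hD₁, ?_⟩
    funext x
    rw [e', mul_div_assoc]
  have hred := hSr.add ((HasReduction.sum s fun i _ =>
    HasReduction.of_dz (v := consDir Q n) (hKq i) (k i).succ).add (HasReduction.sum s fun i _ =>
      HasReduction.of_dz (v := consDir Q n) (hKc (L (0, Pi.single (k i) 1)) i) 0))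
  refine hred.congr fun x hx => ?_
  have hoff := consProj_notMem_iff.1 hx
  have hφx : (snd ℂ (ℂ × Q) ℂ^n) (φ x) ∉ bigDiagonal n τ := hoff.1
  have hex := e (φ x) hφx
  have hT : H x / (D x.2.2 * (x.1 - (L x.2 + b)) ^ N) =
      (S (φ x) + ∑ i ∈ s, dz ((0 : ℂ × Q), (Pi.single (k i) 1 : ℂ^n)) (G i) (φ x)) /
        (x.1 - (L x.2 + b)) ^ N := by
    simp only [Homeomorph.symm_apply_apply] at hex
    rw [← hex, ← div_div]
    rfl
  rw [hT, add_div, sum_div, ← sum_add_distrib]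
  congr 1
  refine sum_congr rfl fun i _ => ?_
  rw [dz_const_mul _ _ ((hKq i).differentiableAt hx), ← dz_smul_dir, ← dz_add_dir]
  have hφd : HasFDerivAt (fun x => φ x)
      (((fst ℂ ℂ (Q × ℂ^n) - L.comp (snd ℂ ℂ _)).prod ((fst ℂ Q ℂ^n).comp (snd ℂ ℂ _))).prod
        ((snd ℂ Q ℂ^n).comp (snd ℂ ℂ _))) x := by
    exact ((hasFDerivAt_sub_add L b x).prodMk ((fst ℂ Q ℂ^n).comp (snd ℂ ℂ _)).hasFDerivAt).prodMk
      ((snd ℂ Q ℂ^n).comp (snd ℂ ℂ _)).hasFDerivAt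
  -- Differentiating in `z_k` with `u` fixed means differentiating along `e_k + L(e_k) e_w` in the
  -- original coordinates. This direction annihilates `u`, so division by `u ^ N` commutes with the
  -- derivative and exact terms remain exact.
  set V : ℂ × (Q × ℂ^n) := consDir Q n (k i).succ + L (0, Pi.single (k i) 1) • consDir Q n 0 with hV
  have hVe : V = (L (0, Pi.single (k i) 1), (0, Pi.single (k i) 1)) := by simp [hV, consDir]
  have d1 : dz V (fun x => G i (φ x)) x = dz ((0 : ℂ × Q), (Pi.single (k i) 1 : ℂ^n)) (G i) (φ x) := by
    rw [dz_comp (φ := fun x => φ x) _ ((hG i).differentiableAt hφx) hφd]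
    congr 1
    simp [hVe]
  have hd2 : DifferentiableAt ℂ (fun x : ℂ × (Q × ℂ^n) => (x.1 - (L x.2 + b)) ^ N) x := by fun_prop
  have d2 : dz V (fun x : ℂ × (Q × ℂ^n) => (x.1 - (L x.2 + b)) ^ N) x = 0 := by
    rw [dz_sub_add_pow]
    simp [hVe]
  have hd1 : DifferentiableAt ℝ (fun x => G i (φ x)) x :=
    ((hG i).differentiableAt hφx).comp x (hφd.differentiableAt.restrictScalars ℝ)
  rw [hK, dz_div V hd1 (hd2.restrictScalars ℝ) (hoff.pow_ne hc), d1, d2]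
  simp

/-- A pole of order `M + 2` in `u = w - c` is lowered by integration by parts in `w`: `H / u^(M+2) =
∂_w H / ((M+1) u^(M+1)) - ∂_w (H / ((M+1) u^(M+1)))`. This ends at order at most one, where the
substitution of the preceding lemma applies. -/
lemma HasReduction.of_partialFraction [FiniteDimensional ℂ Q]
    (ih : ∀ (H : (ℂ × Q) × ℂ^n → ℂ) (D : ℂ^n → ℂ), IsTest H → D ∈ Denom n τ → HasReduction τ (snd ℂ (ℂ × Q) ℂ^n)
        (fun k => (0, (Pi.single k 1 : ℂ^n))) fun x => H x / D x.2)
    {T : ℂ × (Q × ℂ^n) → ℂ} (hT : T ∈ PF τ (snd ℂ Q ℂ^n)) : HasReduction τ (consProj Q n) (consDir Q n) T := by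
  induction hT using AddSubmonoid.closure_induction with
  | mem T hT =>
    obtain ⟨H, D, L, b, N, hH, hD, hc, rfl⟩ := hT
    simp only [ContinuousLinearMap.coe_snd']
    induction N using Nat.strong_induction_on generalizing H with
    | _ N ihN =>
      by_cases hN : N ≤ 1
      · exact HasReduction.of_partialFraction_simple ih hN hH hD hc
      · obtain ⟨M, rfl⟩ : ∃ M, N = M + 2 := ⟨N - 2, by omega⟩
        have hc' : IsPole τ (snd ℂ Q ℂ^n) L b (M + 1) := Or.inr (Or.resolve_left hc (by omega))
        have hM : (M : ℂ) + 1 ≠ 0 := by exact_mod_cast Nat.succ_ne_zero M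
        have h1 := ihN (M + 1) (by omega) (fun x => ((M : ℂ) + 1)⁻¹ * dz (1, 0) H x) ((hH.dz _).const_mul _) hc'
        obtain ⟨D', hD', e'⟩ := mem_Denom_sub_pow (Q := Q) hD hc'
        have hq : IsQuot τ (consProj Q n) fun x =>
            (-((M : ℂ) + 1)⁻¹ * H x) / (D x.2.2 * (x.1 - (L x.2 + b)) ^ (M + 1)) :=
          ⟨fun x => -((M : ℂ) + 1)⁻¹ * H x, D', hH.const_mul _, hD', by funext x; rw [e']⟩
        refine (h1.add (HasReduction.of_dz hq 0)).congr fun x hx => ?_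
        have hoff := consProj_notMem_iff.1 hx
        have hu := hoff.pow_ne hc'
        have hD0 : D x.2.2 ≠ 0 := ne_zero_of_mem_Denom hD hoff.1
        have hh2 : DifferentiableAt ℂ (fun p : ℂ × (Q × ℂ^n) => (p.1 - (L p.2 + b)) ^ (M + 1)) x := by fun_prop
        have hDd : DifferentiableAt ℂ (fun p : ℂ × (Q × ℂ^n) => D p.2.2) x := by
          have := ((contDiff_of_mem_Denom hD).differentiable (by simp)) x.2.2
          exact this.comp x (differentiableAt_snd.snd)
        have d3 : dz (1, 0) (fun p : ℂ × (Q × ℂ^n) => D p.2.2) x = 0 := by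
          have := dz_comp (g := D) (φ := fun p : ℂ × (Q × ℂ^n) => p.2.2)
            (A := (snd ℂ Q ℂ^n).comp (snd ℂ ℂ _)) (y := x) (1, 0)
            ((contDiff_real_of_mem_Denom hD).diffAt _) (hasFDerivAt_snd.comp x hasFDerivAt_snd)
          exact this.trans (dz_zero_dir _ _)
        have hv0 : consDir Q n 0 = (1, 0) := rfl
        rw [hv0, dz_div _ ((hH.1.diffAt x).const_mul _) ((hDd.restrictScalars ℝ).fun_mul
          (hh2.restrictScalars ℝ)) (mul_ne_zero hD0 hu),
          dz_mul _ (hDd.restrictScalars ℝ) (hh2.restrictScalars ℝ), dz_sub_add_pow, d3,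
          dz_const_mul _ _ (hH.1.diffAt x)]
        have hu : x.1 - (L x.2 + b) ≠ 0 := (pow_ne_zero_iff (by omega)).1 hu
        push_cast [Nat.add_sub_cancel]
        simp only [map_zero, sub_zero, mul_one, zero_mul, zero_add]
        field_simp
        ring
  | zero => exact HasReduction.zero
  | add S T _ _ hS hT => exact hS.add hT

end Step

/-- Induction on `n` with the parameter space `Q` free: it takes up the differences `u` from earlier
steps, on which the numerators depend but the remaining diagonals do not. Each step fixes at most
one simple pole per variable, which leads to the denominators in `LogDenom`. -/
lemma hasReduction (Q : Type) [NormedAddCommGroup Q] [NormedSpace ℂ Q]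
    [FiniteDimensional ℂ Q] {H : Q × ℂ^n → ℂ} (hH : IsTest H)
    (hD : D ∈ Denom n τ) : HasReduction τ (snd ℂ Q ℂ^n)
      (fun k => (0, (Pi.single k 1 : ℂ^n))) fun x => H x / D x.2 := by
  induction n generalizing Q with
  | zero =>
    have hD1 : D = 1 := by
      induction hD using Submonoid.closure_induction with
      | mem f hf => obtain ⟨i, _⟩ := hf; exact i.elim0
      | one => rfl
      | mul f g _ _ hf hg => rw [hf, hg, one_mul]
    refine HasReduction.of_logSum (AddSubmonoid.subset_closure ⟨H, 1, hH,
      ⟨fun i => i.elim0, fun i => i.elim0, ?_⟩, ?_⟩)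
    · funext z; simp
    · funext x; simp [hD1]
  | succ n ih =>
    let e : (Q × ℂ^(n + 1)) ≃L[ℂ] ℂ × (Q × ℂ^n) :=
      ((ContinuousLinearEquiv.refl ℂ Q).prodCongr (ins 0).symm).trans
        (((ContinuousLinearEquiv.prodAssoc ℂ Q ℂ ℂ^n).symm.trans
          ((ContinuousLinearEquiv.prodComm ℂ Q ℂ).prodCongr (ContinuousLinearEquiv.refl ℂ _))).trans
            (ContinuousLinearEquiv.prodAssoc ℂ ℂ Q ℂ^n))
    have he : ∀ x, e x = (((ins 0).symm x.2).1, (x.1, ((ins 0).symm x.2).2)) := fun x => rfl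
    have hes : ∀ y, e.symm y = (y.2.1, ins 0 (y.1, y.2.2)) := fun y => rfl
    have hHt : IsTest fun y => H (e.symm y) :=
      hH.comp_homeomorph e.symm.toHomeomorph (e.symm.contDiff.restrict_scalars ℝ)
    obtain ⟨T, hT, eT⟩ := exists_PF (π := snd ℂ Q ℂ^n) 0 hD hHt
    have h1 := HasReduction.of_partialFraction (fun H D hH hD => ih (ℂ × Q) hH hD) hT
    have h2 := h1.congr fun x hx => (eT x (consProj_notMem_iff.1 hx)).symm
    have h3 := h2.comp_equiv e (P' := snd ℂ Q ℂ^(n + 1)) (v' := fun k => (0, (Pi.single k 1 : ℂ^(n + 1))))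
      (fun y => by simp [consProj_apply, he]) (fun i => by
        refine Fin.cases ?_ (fun i => ?_) i
        · simp only [he, ← ins_single_same, ContinuousLinearEquiv.symm_apply_apply]
          rfl
        · have := ins_single_succAbove 0 i
          rw [Fin.succAbove_zero] at this
          simp only [he, ← this, ContinuousLinearEquiv.symm_apply_apply]
          rfl)
    refine h3.congr fun x _ => ?_
    rw [e.symm_apply_apply]
    simp [he]

/-! ### Periodization and the existence of decompositions -/

lemma isPeriodic_periodize (f : ℂ^n → ℂ) : IsPeriodic τ (periodize n τ f) := by
  intro z _ l hl
  have := finsum_comp_equiv (Equiv.addRight (⟨l, hl⟩ : latticeGroup n τ))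
    (f := fun m : latticeGroup n τ => f (m + z))
  simp only [periodize]
  rw [← this]
  congr 1
  funext m
  simp only [Equiv.coe_addRight, AddSubgroup.coe_add]
  congr 1
  abel

lemma periodize_chi_mul (hF : IsPeriodic τ F)
    (hz : z ∉ bigDiagonal n τ) : periodize n τ (fun z => chi τ n z * F z) z = F z := by
  have h := periodize_chi (τ := τ) z
  obtain ⟨s, hs⟩ := exists_finset_translates (τ := τ) (isTest_chi τ n).2 (Bornology.isBounded_singleton (x := z))
  have hs' := hs z rfl
  rw [periodize_eq_sum hs'] at h
  rw [periodize_eq_sum (s := s) fun l hl => by simp [hs' l hl]]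
  have : ∀ l : latticeGroup n τ, F (l + z) = F z := fun l => by rw [add_comm, hF z hz l l.2]
  simp only [this, ← sum_mul, h, one_mul]

lemma periodize_add {f g : ℂ^n → ℂ} (hf : HasCompactSupport f) (hg : HasCompactSupport g) (z : ℂ^n) :
    periodize n τ (fun z => f z + g z) z = periodize n τ f z + periodize n τ g z := by
  classical
  obtain ⟨s, hs⟩ := exists_finset_translates (τ := τ) hf (Bornology.isBounded_singleton (x := z))
  obtain ⟨t, ht⟩ := exists_finset_translates (τ := τ) hg (Bornology.isBounded_singleton (x := z))
  have hs' := hs z rfl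
  have ht' := ht z rfl
  rw [periodize_eq_sum (s := s ∪ t) (f := f), periodize_eq_sum (s := s ∪ t) (f := g),
    periodize_eq_sum (s := s ∪ t), sum_add_distrib]
  all_goals
    intro l hl
    simp only [Finset.mem_union, not_or] at hl
    simp [hs' l, ht' l, hl]

lemma periodize_sum (t : Finset ι) {f : ι → ℂ^n → ℂ} (hf : ∀ i, HasCompactSupport (f i)) (z : ℂ^n) :
    periodize n τ (fun z => ∑ i ∈ t, f i z) z = ∑ i ∈ t, periodize n τ (f i) z :=
  (sum_rel (R := fun f v => HasCompactSupport f ∧ periodize n τ f z = v)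
    ⟨HasCompactSupport.zero, by simp [periodize]⟩
    (fun hf hg => ⟨hf.1.add hg.1, by rw [periodize_add hf.1 hg.1, hf.2, hg.2]⟩) t fun i _ => ⟨hf i, rfl⟩).2

/-- A local property of functions off the diagonals that is stable under sums and translations
passes to periodizations. -/
lemma periodize_local {P : ℂ^n → (ℂ^n → ℂ) → Prop}
    (hzero : ∀ p, P p fun _ => 0) (hadd : ∀ p f g, P p f → P p g → P p fun z => f z + g z)
    (htrans : ∀ p f, ∀ l : latticeGroup n τ, P (l + p) f → P p fun z => f (l + z))
    (hcongr : ∀ p f g, f =ᶠ[𝓝 p] g → P p f → P p g) {f : ℂ^n → ℂ}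
    (hf : HasCompactSupport f) (hP : ∀ p, P p f) (p : ℂ^n) : P p (periodize n τ f) := by
  classical
  obtain ⟨s, hs⟩ := exists_finset_translates (τ := τ) hf (Metric.isBounded_ball (x := p) (r := 1))
  have hsum : P p fun z => ∑ l ∈ s, f (l + z) :=
    sum_prop (hzero p) (hadd p _ _) s fun a _ => htrans p f a (hP _)
  refine hcongr p _ _ ?_ hsum
  filter_upwards [ball_mem_nhds p one_pos] with y hy using (periodize_eq_sum (hs y hy)).symm

/-! ### Local conditions on poles and on logarithmic forms -/

open scoped Classical in
/-- The condition on poles in `HasHolomorphicPoles` near `p`. -/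
def PoleAt (τ : ℍ) (p : ℂ^n) (G : ℂ^n → ℂ) : Prop := ∃ (U : Set ℂ^n) (N : ℕ) (h : ℂ^n → ℂ),
    IsOpen U ∧ p ∈ U ∧ SmoothOn h U ∧ ∀ z ∈ U, z ∉ bigDiagonal n τ →
      G z = h z / (∏ e : Fin n × Fin n with diagonalThrough τ p e, localEquation p e z) ^ N

/-- The condition in `IsLogarithmic` near `p`. -/
def LogAt (τ : ℍ) (p : ℂ^n) (a : ℂ^n → ℂ) : Prop :=
  ∃ (U : Set ℂ^n) (c : (Fin n → Fin n ⊕ (Fin n × Fin n)) → ℂ^n → ℂ),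
    IsOpen U ∧ p ∈ U ∧ (∀ r, SmoothOn (c r) U) ∧ ∀ z ∈ U, z ∉ bigDiagonal n τ →
      a z = ∑ r, c r z * Matrix.det (Matrix.of fun k => logGenerator τ p z (r k))

section Local

variable {p : ℂ^n} {f g : ℂ^n → ℂ}

lemma contDiff_localEquation (p : ℂ^n) (e : Fin n × Fin n) : Smooth (localEquation p e) := by
  unfold localEquation
  fun_prop

lemma localEquation_ne_zero {e : Fin n × Fin n} (he : diagonalThrough τ p e)
    (hz : z ∉ bigDiagonal n τ) : localEquation p e z ≠ 0 := ne_zero_of_mem_Denom (localEquation_mem_Denom he) hz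

lemma diagonalThrough_add (l : latticeGroup n τ) : diagonalThrough τ ((l : ℂ^n) + p) = diagonalThrough τ p := by
  funext e
  have : ((l : ℂ^n) + p) e.1 - ((l : ℂ^n) + p) e.2 = p e.1 - p e.2 + (l.1 e.1 - l.1 e.2) := by
    simp only [Pi.add_apply]; ring
  simp only [diagonalThrough, this, add_mem_lattice_iff (sub_mem_lattice (l.2 e.1) (l.2 e.2))]

lemma localEquation_add (l z : ℂ^n) (e : Fin n × Fin n) :
    localEquation (l + p) e (l + z) = localEquation p e z := by
  simp only [localEquation, Pi.add_apply]; ring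

lemma exists_nhds_of_eventuallyEq {U : Set ℂ^n} (hU : IsOpen U) (hp : p ∈ U)
    (h : f =ᶠ[𝓝 p] g) : ∃ V, IsOpen V ∧ p ∈ V ∧ V ⊆ U ∧ ∀ z ∈ V, f z = g z := by
  obtain ⟨V, hV, hVo, hpV⟩ := mem_nhds_iff.1 (inter_mem h (hU.mem_nhds hp))
  exact ⟨V, hVo, hpV, fun z hz => (hV hz).2, fun z hz => (hV hz).1⟩

lemma PoleAt.congr (hf : PoleAt τ p f) (h : f =ᶠ[𝓝 p] g) : PoleAt τ p g := by
  obtain ⟨U, N, k, hU, hp, hk, e⟩ := hf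
  obtain ⟨V, hV, hpV, hVU, hVe⟩ := exists_nhds_of_eventuallyEq hU hp h
  exact ⟨V, N, k, hV, hpV, hk.mono hVU, fun z hz hd => by rw [← hVe z hz, e z (hVU hz) hd]⟩

open scoped Classical in
lemma PoleAt.add (hf : PoleAt τ p f) (hg : PoleAt τ p g) : PoleAt τ p fun z => f z + g z := by
  obtain ⟨U, N, k, hU, hp, hk, e⟩ := hf
  obtain ⟨U', N', k', hU', hp', hk', e'⟩ := hg
  have hP : Smooth fun z => ∏ e : Fin n × Fin n with diagonalThrough τ p e, localEquation p e z :=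
    contDiff_prod fun e _ => contDiff_localEquation p e
  refine ⟨U ∩ U', N + N', _, hU.inter hU', ⟨hp, hp'⟩, ((hk.mono inter_subset_left).mul
    (hP.pow N').contDiffOn).add ((hk'.mono Set.inter_subset_right).mul (hP.pow N).contDiffOn),
    fun z hz hd => ?_⟩
  have h0 : ∏ e : Fin n × Fin n with diagonalThrough τ p e, localEquation p e z ≠ 0 :=
    Finset.prod_ne_zero_iff.2 fun e he => localEquation_ne_zero (mem_filter.1 he).2 hd
  simp only [e z hz.1 hd, e' z hz.2 hd, pow_add]
  field_simp

lemma PoleAt.translate (l : latticeGroup n τ) (hf : PoleAt τ ((l : ℂ^n) + p) f) :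
    PoleAt τ p fun z => f (l + z) := by
  obtain ⟨U, N, k, hU, hp, hk, e⟩ := hf
  have hc : Smooth fun z : ℂ^n => (l : ℂ^n) + z := contDiff_const.add contDiff_id
  refine ⟨_, N, fun z => k (l + z), hU.preimage hc.continuous, hp, hk.comp hc.contDiffOn
    (Set.mapsTo_preimage _ U), fun z hz hd => ?_⟩
  simp only [e _ hz ((add_notMem_iff l).2 hd)]
  rw [diagonalThrough_add]
  simp only [localEquation_add]

lemma LogAt.congr (hf : LogAt τ p f) (h : f =ᶠ[𝓝 p] g) : LogAt τ p g := by
  obtain ⟨U, c, hU, hp, hc, e⟩ := hf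
  obtain ⟨V, hV, hpV, hVU, hVe⟩ := exists_nhds_of_eventuallyEq hU hp h
  exact ⟨V, c, hV, hpV, fun r => (hc r).mono hVU, fun z hz hd => by rw [← hVe z hz, e z (hVU hz) hd]⟩

lemma LogAt.add (hf : LogAt τ p f) (hg : LogAt τ p g) : LogAt τ p fun z => f z + g z := by
  obtain ⟨U, c, hU, hp, hc, e⟩ := hf
  obtain ⟨U', c', hU', hp', hc', e'⟩ := hg
  refine ⟨U ∩ U', fun r z => c r z + c' r z, hU.inter hU', ⟨hp, hp'⟩, fun r =>
    ((hc r).mono inter_subset_left).add ((hc' r).mono Set.inter_subset_right), fun z hz hd => ?_⟩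
  simp only [e z hz.1 hd, e' z hz.2 hd, add_mul, sum_add_distrib]

lemma LogAt.translate (l : latticeGroup n τ) (hf : LogAt τ ((l : ℂ^n) + p) f) :
    LogAt τ p fun z => f (l + z) := by
  obtain ⟨U, c, hU, hp, hk, e⟩ := hf
  have hc : Smooth fun z : ℂ^n => (l : ℂ^n) + z := contDiff_const.add contDiff_id
  refine ⟨_, fun r z => c r (l + z), hU.preimage hc.continuous, hp, fun r => (hk r).comp hc.contDiffOn
    (Set.mapsTo_preimage _ U), fun z hz hd => ?_⟩
  simp only [e _ hz ((add_notMem_iff l).2 hd)]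
  have : ∀ s, logGenerator τ ((l : ℂ^n) + p) (l + z) s = logGenerator τ p z s := by
    rintro (j | s)
    · rfl
    · rw [logGenerator, logGenerator, diagonalThrough_add, localEquation_add]
  simp only [this]

lemma contDiffOn_sub_inv {i j : Fin n} {l : ℂ} (hp : p i - p j ≠ l) :
    IsOpen {z : ℂ^n | z i - z j - l ≠ 0} ∧ p ∈ {z : ℂ^n | z i - z j - l ≠ 0} ∧
      SmoothOn (fun z : ℂ^n => (z i - z j - l)⁻¹) {z | z i - z j - l ≠ 0} :=
  ⟨isOpen_ne_fun (by fun_prop) (by fun_prop), sub_ne_zero.2 hp,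
    ContDiffOn.inv (ContDiff.contDiffOn (by fun_prop)) fun _ hz => hz⟩

/-- A factor of `D` that does not vanish at `p` has a smooth inverse nearby. A factor vanishing at
`p` is one of the local equations; multiplying numerator and denominator by the other local
equations gives the product of all of them. -/
lemma poleAt_div {h : ℂ^n → ℂ} {V : Set ℂ^n} (hV : IsOpen V) (hpV : p ∈ V)
    (hh : SmoothOn h V) (hD : D ∈ Denom n τ) : PoleAt τ p fun z => h z / D z := by
  classical
  have key : ∃ (U : Set ℂ^n) (N : ℕ) (k : ℂ^n → ℂ), IsOpen U ∧ p ∈ U ∧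
      SmoothOn k U ∧ ∀ z ∈ U, z ∉ bigDiagonal n τ →
      (D z)⁻¹ = k z / (∏ e : Fin n × Fin n with diagonalThrough τ p e, localEquation p e z) ^ N := by
    clear hh
    induction hD using Submonoid.closure_induction with
    | mem D hD =>
      obtain ⟨i, j, hij, l, hl, rfl⟩ := hD
      by_cases hp : p i - p j = l
      · have he : diagonalThrough τ p (i, j) := ⟨hij, hp ▸ hl⟩
        refine ⟨Set.univ, 1, fun z => ∏ e ∈ ({e : Fin n × Fin n | diagonalThrough τ p e} : Finset _).erase (i, j),
          localEquation p e z, isOpen_univ, trivial,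
          (contDiff_prod fun e _ => contDiff_localEquation p e).contDiffOn, fun z _ hd => ?_⟩
        rw [← Finset.prod_erase_mul _ _ (show (i, j) ∈ ({e : Fin n × Fin n | diagonalThrough τ p e} :
          Finset _) by simpa using he), pow_one]
        have h1 : localEquation p (i, j) z ≠ 0 := localEquation_ne_zero he hd
        have h2 : ∏ e ∈ ({e : Fin n × Fin n | diagonalThrough τ p e} : Finset _).erase (i, j),
            localEquation p e z ≠ 0 := Finset.prod_ne_zero_iff.2 fun e he =>
              localEquation_ne_zero (by simpa using Finset.mem_of_mem_erase he) hd
        have h3 : z i - z j - l = localEquation p (i, j) z := by simp [localEquation, hp]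
        simp only [h3]
        field_simp
      · obtain ⟨hU, hpU, hk⟩ := contDiffOn_sub_inv hp
        exact ⟨_, 0, _, hU, hpU, hk, fun z _ _ => by simp⟩
    | one => exact ⟨Set.univ, 0, fun _ => 1, isOpen_univ, trivial, contDiffOn_const, by simp⟩
    | mul f g _ _ hf hg =>
      obtain ⟨U, N, k, hU, hp, hk, e⟩ := hf
      obtain ⟨U', N', k', hU', hp', hk', e'⟩ := hg
      refine ⟨U ∩ U', N + N', _, hU.inter hU', ⟨hp, hp'⟩, (hk.mono inter_subset_left).mul
        (hk'.mono Set.inter_subset_right), fun z hz hd => ?_⟩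
      rw [Pi.mul_apply, mul_inv, e z hz.1 hd, e' z hz.2 hd, pow_add, div_mul_div_comm]
  obtain ⟨U, N, k, hU, hp, hk, e⟩ := key
  refine ⟨V ∩ U, N, fun z => h z * k z, hV.inter hU, ⟨hpV, hp⟩, (hh.mono inter_subset_left).mul
    (hk.mono Set.inter_subset_right), fun z hz hd => ?_⟩
  simp only [div_eq_mul_inv, e z hz.2 hd, mul_assoc]

/-- If the factor of index `i` vanishes at `p`, the `i`-th row is the generator `d(z_i - z_j) / (z_i
- z_j - λ)`; otherwise it is `dz_i`, and the inverse of the factor goes into the smooth coefficient.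
As `i < j`, the matrix is upper triangular with exactly the inverse factors left on its diagonal. -/
lemma logAt_div {h : ℂ^n → ℂ} (hh : Smooth h) (hD : D ∈ LogDenom n τ) : LogAt τ p fun z => h z / D z := by
  classical
  obtain ⟨t, ht, rfl⟩ := hD
  let r : Fin n → Fin n ⊕ (Fin n × Fin n) := fun i => (t i).elim (Sum.inl i) fun q =>
    if p i - p q.1 = q.2 then Sum.inr (i, q.1) else Sum.inl i
  let k : Fin n → ℂ^n → ℂ := fun i z => (t i).elim 1 fun q =>
    if p i - p q.1 = q.2 then 1 else (z i - z q.1 - q.2)⁻¹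
  have hk : ∀ i, ∃ U, IsOpen U ∧ p ∈ U ∧ SmoothOn (k i) U := by
    intro i
    rcases hti : t i with _ | q
    · refine ⟨Set.univ, isOpen_univ, trivial, ?_⟩
      simp only [k, hti, Option.elim_none]
      exact contDiffOn_const
    · simp only [k, hti, Option.elim_some]
      split_ifs with hq
      · exact ⟨Set.univ, isOpen_univ, trivial, contDiffOn_const⟩
      · exact ⟨_, contDiffOn_sub_inv hq⟩
  choose U hUo hpU hU using hk
  refine ⟨⋂ i, U i, fun r' z => if r' = r then h z * ∏ i, k i z else 0, isOpen_iInter_of_finite hUo,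
    Set.mem_iInter.2 hpU, fun r' => ?_, fun z hz hd => ?_⟩
  · by_cases hr : r' = r
    · simp only [hr, if_true]
      exact hh.contDiffOn.mul (contDiffOn_prod fun i _ => (hU i).mono (Set.iInter_subset U i))
    · simp only [hr, if_false]
      exact contDiffOn_const
  simp only
  rw [Finset.sum_eq_single r (fun r' _ hr' => by simp [hr']) (by simp), if_pos rfl]
  have hdet : Matrix.det (Matrix.of fun i => logGenerator τ p z (r i)) = ∏ i, logGenerator τ p z (r i) i := by
    refine Matrix.det_of_isUpperTriangular fun i j hij => ?_
    have hij : j < i := hij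
    rcases hti : t i with _ | q
    · simp [r, hti, logGenerator, hij.ne]
    · have := (ht i q.1 q.2 hti).1
      by_cases hq : p i - p q.1 = q.2
      · have hjq : j ≠ q.1 := (hij.trans this).ne
        simp only [Matrix.of_apply, r, hti, Option.elim_some, hq, if_true, logGenerator]
        split_ifs
        · simp [hij.ne, hjq]
        · rfl
      · simp [r, hti, hq, logGenerator, hij.ne]
  rw [hdet, mul_assoc, ← Finset.prod_mul_distrib, div_eq_mul_inv, ← Finset.prod_inv_distrib]
  congr 1
  refine prod_congr rfl fun i _ => ?_
  rcases hti : t i with _ | q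
  · simp [r, k, logFactor, hti, logGenerator]
  · obtain ⟨hiq, hl⟩ := ht i q.1 q.2 hti
    by_cases hq : p i - p q.1 = q.2
    · have : diagonalThrough τ p (i, q.1) := ⟨hiq.ne, hq ▸ hl⟩
      simp [r, k, logFactor, hti, hq, logGenerator, this, hiq.ne, localEquation]
    · simp [r, k, logFactor, hti, hq, logGenerator]

lemma HasHolomorphicPoles.sum (s : Finset ι) {G : ι → ℂ^n → ℂ}
    (hG : ∀ i ∈ s, HasHolomorphicPoles τ (G i)) : HasHolomorphicPoles τ fun z => ∑ i ∈ s, G i z :=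
  ⟨fun z hz l hl => sum_congr rfl fun i hi => (hG i hi).1 z hz l hl, fun p =>
    sum_prop (P := PoleAt τ p)
      ⟨Set.univ, 0, fun _ => 0, isOpen_univ, trivial, contDiffOn_const, by simp⟩ PoleAt.add s
      fun i hi => (hG i hi).2 p⟩

end Local

lemma HasCompactSupport.div_right {h : ℂ^n → ℂ} (hh : HasCompactSupport h)
    (D : ℂ^n → ℂ) : HasCompactSupport fun z => h z / D z := by
  simp only [div_eq_mul_inv]
  exact hh.mul_right

/-- Reduce the poles of `χ F` on `ℂⁿ` modulo exact terms and sum over all lattice translates. The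
left-hand side becomes `F`, and the local conditions on the two parts survive because the sums are
locally finite. -/
lemma exists_isDecomposition (hF : HasHolomorphicPoles τ F) : ∃ a g, IsDecomposition τ F a g := by
  classical
  obtain ⟨h, D, hh, hD, e⟩ := hF.isK (isTest_chi τ n)
  -- The reduction starts without parameters.
  let Q := ℂ^0
  let eqv : ℂ^n ≃L[ℂ] Q × ℂ^n := (ContinuousLinearEquiv.uniqueProd ℂ ℂ^n Q).symm
  have heqv : ∀ z, eqv z = (0, z) := fun z => by refine Prod.ext (Subsingleton.elim _ _) rfl
  have h0 := hasReduction (τ := τ) Q (H := fun x => h x.2)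
    (hh.comp_homeomorph eqv.symm.toHomeomorph (eqv.symm.contDiff.restrict_scalars ℝ)) hD
  obtain ⟨S, hS, ι, s, k, G, hG, eT⟩ := h0.comp_equiv eqv (P' := ContinuousLinearMap.id ℂ _)
    (v' := fun k => Pi.single k 1) (fun y => by simp [heqv]) (fun i => by simp [heqv])
  have hGc : ∀ i, HasCompactSupport (G i) := fun i => by
    obtain ⟨h, D, hh, hD, e⟩ := hG i
    rw [e]
    exact HasCompactSupport.div_right hh.2 _
  have hGd : ∀ i, ∀ z ∉ bigDiagonal n τ, DifferentiableAt ℝ (G i) z := fun i z hz => (hG i).differentiableAt hz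
  have hSl : HasCompactSupport S ∧ ∀ p, LogAt τ p S := by
    clear eT
    induction hS using AddSubmonoid.closure_induction with
    | mem S h =>
      obtain ⟨h, D, hh, hD, rfl⟩ := h
      exact ⟨HasCompactSupport.div_right hh.2 _, fun p => logAt_div hh.1 hD⟩
    | zero => exact ⟨HasCompactSupport.zero, fun p => ⟨Set.univ, fun _ _ => 0, isOpen_univ, trivial,
        fun _ => contDiffOn_const, by simp⟩⟩
    | add f g _ _ hf hg => exact ⟨hf.1.add hg.1, fun p => (hf.2 p).add (hg.2 p)⟩
  have hGp : ∀ i, HasHolomorphicPoles τ (periodize n τ (G i)) := fun i =>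
    ⟨isPeriodic_periodize _, periodize_local (P := PoleAt τ)
      (fun p => ⟨Set.univ, 0, fun _ => 0, isOpen_univ, trivial, contDiffOn_const, by simp⟩)
      (fun p f g => PoleAt.add) (fun p f l => PoleAt.translate l) (fun p f g h hf => hf.congr h) (hGc i)
      (fun p => by
        obtain ⟨h, D, hh, hD, e⟩ := hG i
        rw [e]
        exact poleAt_div isOpen_univ trivial hh.1.contDiffOn hD)⟩
  refine ⟨periodize n τ S, fun j z => ∑ i ∈ s with k i = j, periodize n τ (G i) z,
    ⟨isPeriodic_periodize _, ?_⟩, fun j => HasHolomorphicPoles.sum _ fun i _ => hGp i, fun z hz => ?_⟩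
  · exact periodize_local (P := LogAt τ) (fun p => ⟨Set.univ, fun _ _ => 0, isOpen_univ, trivial,
        fun _ => contDiffOn_const, by simp⟩) (fun p f g => LogAt.add) (fun p f l => LogAt.translate l)
      (fun p f g h hf => hf.congr h) hSl.1 hSl.2
  have hper := fun i => fderiv_periodize (hGc i) fun l => hGd i _ ((add_notMem_iff l).2 hz)
  have hdzc := fun i => hasCompactSupport_dz (Pi.single (k i) 1) (hGc i)
  have hsum : ∑ j, wirtinger j (fun z => ∑ i ∈ s with k i = j, periodize n τ (G i) z) z =
      ∑ i ∈ s, periodize n τ (dz (Pi.single (k i) 1) (G i)) z := by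
    rw [← Finset.sum_fiberwise s k]
    refine sum_congr rfl fun j _ => ?_
    rw [wirtinger_eq_dz, dz_sum _ _ fun i _ => (hper i).1]
    refine sum_congr rfl fun i hi => ?_
    rw [← (mem_filter.1 hi).2]
    exact (hper i).2 (dzHom _)
  rw [hsum, ← periodize_sum s hdzc, ← periodize_chi_mul hF.1 hz]
  rw [← periodize_add hSl.1 (sum_prop .zero .add s fun i _ => hdzc i)]
  refine finsum_congr fun l => ?_
  have hoff := (add_notMem_iff l).2 hz
  have := eT ((l : ℂ^n) + z) hoff
  simp only [heqv] at this
  rw [e _ hoff, this]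

/-- The second assertion is the working form of the definition: every regularizing functional
computes the same number, so it can be chosen to suit the situation. -/
lemma regularizedIntegral_wellDefined (hF : HasHolomorphicPoles τ F) :
    RegularizedIntegralWellDefined τ F ∧ ∀ ℓ, IsReg τ ℓ →
      regularizedIntegral τ F = ℓ fun z => chi τ n z * F z := by
  have hex := exists_isDecomposition hF
  have key : ∀ ℓ, IsReg τ ℓ → regularizedIntegral τ F = ℓ fun z => chi τ n z * F z := by
    intro ℓ hℓ
    obtain ⟨g, hg⟩ := hex.choose_spec
    rw [regularizedIntegral, dif_pos hex]
    exact (hg.integral_eq hℓ).2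
  refine ⟨⟨hex, fun a g hd => ?_⟩, key⟩
  have := hd.integral_eq (isReg_regC τ n)
  exact ⟨this.1, by rw [this.2, key _ (isReg_regC τ n)]⟩

/-! ### The residue formula for regularized integrals -/

lemma chi_ins (i : Fin (n + 1)) (w : ℂ) (z : ℂ^n) : chi τ (n + 1) (ins i (w, z)) = chi₁ τ w * chi τ n z := by
  simp [chi, Fin.prod_univ_succAbove _ i]

lemma ins_add_left (i : Fin (n + 1)) (w l : ℂ) (z : ℂ^n) : ins i (w + l, z) = ins i (w, z) + Pi.single i l := by
  have : ins i (l, (0 : ℂ^n)) = Pi.single i l := by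
    have := congrArg (l • ·) (ins_single_same (n := n) i)
    simpa [← map_smul, ← Pi.single_smul] using this
  rw [← this, ← map_add]
  simp

lemma single_mem_latticeGroup (i : Fin n) {l : ℂ} (hl : l ∈ lattice τ) (k : Fin n) :
    (Pi.single i l : ℂ^n) k ∈ lattice τ := by
  rcases eq_or_ne k i with rfl | hk
  · simpa using hl
  · simpa [hk] using zero_mem_lattice _

/-- The regularized integral over one variable of `∂̄(χ₁ F)`, for `F` elliptic, is given by the
residues at one pole from each orbit of the lattice. -/
lemma pvAt_dzbar_chi_mul (i : Fin (n + 1)) {F : ℂ^(n + 1) → ℂ}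
    (hF : HasHolomorphicPoles τ F) (hz : z ∉ bigDiagonal n τ) {R : ℂ^n}
    (hR : ∀ j, HasRes (fun w => F (ins i (w, z))) (z j) (R j)) :
    pvAt i (dzbar (Pi.single i 1) fun z => chi τ (n + 1) z * F z) z = -(pi : ℂ) * ∑ j, chi τ n z * R j := by
  classical
  have hK := hF.isK (isTest_chi τ (n + 1))
  have hper : ∀ {w l : ℂ}, w ∉ poleSet τ z → l ∈ lattice τ →
      F (ins i (w + l, z)) = F (ins i (w, z)) := fun hw hl => by
    rw [ins_add_left]
    exact hF.1 _ ((ins_notMem_bigDiagonal i).2 ⟨hz, notMem_poleSet.1 hw⟩) _ (single_mem_latticeGroup i hl)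
  set g : ℂ → ℂ := fun w => chi₁ τ w * F (ins i (w, z)) with hg
  set f : ℂ → ℂ := fun w => chi τ (n + 1) (ins i (w, z)) * F (ins i (w, z)) with hf
  have hfg : f = fun w => chi τ n z * g w := by funext w; simp only [hf, hg, chi_ins]; ring
  -- By periodicity the germ of `F` at `z_j + l` is the translate of its germ at `z_j`, so residues
  -- of `χ₁ F` exist along the whole orbit.
  have hresF : ∀ j, ∀ l ∈ lattice τ, ∃ r, HasRes g (z j + l) r := by
    intro j l hl
    obtain ⟨N, h, hh, e, _⟩ := hR j
    refine ⟨_, N, fun w => chi₁ τ w * h (w - l), (isTest_chi₁ τ).1.mul (hh.comp (by fun_prop)), ?_, rfl⟩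
    have ht : Tendsto (fun w : ℂ => w - l) (𝓝[≠] (z j + l)) (𝓝[≠] (z j)) := by
      simpa [sub_eq_add_neg] using tendsto_add_nhdsNE (z j + l) (-l)
    filter_upwards [ht.eventually e, ht.eventually (eventually_notMem_poleSet (τ := τ) z (z j))] with w hw hw'
    have := hper hw' hl
    rw [sub_add_cancel] at this
    rw [hg]
    simp only
    rw [this, hw, mul_div_assoc]
    congr 3
    ring
  have hex : ∀ c, ∃ r, HasRes g c r ∧ (c ∉ poleSet τ z → r = 0) := by
    intro c
    by_cases hc : c ∈ poleSet τ z
    · obtain ⟨j, hj⟩ := hc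
      obtain ⟨r, hr⟩ := hresF j _ hj
      exact ⟨r, by simpa using hr, fun h => absurd ⟨j, hj⟩ h⟩
    · refine ⟨0, ?_, fun _ => rfl⟩
      have hoff := (ins_notMem_bigDiagonal i).2 ⟨hz, notMem_poleSet.1 hc⟩
      obtain ⟨h', hh', e'⟩ := exists_isTest_eventuallyEq (h := fun w => F (ins i (w, z)))
        ((hasFDerivAt_ins_left i c z).continuousAt.eventually (compl_bigDiagonal_mem_nhds hoff))
        fun w hw => ((hF.contDiffAt hw).comp w (((ins i).contDiff.restrict_scalars ℝ).comp
          (contDiff_id.prodMk contDiff_const)).contDiffAt).contDiffWithinAt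
      exact HasRes.of_contDiff ((isTest_chi₁ τ).1.mul hh'.1)
        (nhdsWithin_le_nhds (e'.mono fun w hw => by simp only [hg, hw]))
  choose r hr hr0 using hex
  choose s hs hsum using fun j => exists_sum_chi₁ τ (‖z j‖ + 1)
  have hshift : ∀ j, ∀ l ∈ lattice τ, HasRes (fun w => chi₁ τ (l + w) * F (ins i (w, z))) (z j) (r (z j + l)) := by
    intro j l hl
    refine (HasRes.comp_add l (hr (z j + l))).congr ?_
    filter_upwards [eventually_notMem_poleSet (τ := τ) z (z j)] with w hw
    simp only [hg]
    rw [hper hw hl, add_comm]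
  have hball : ∀ j, ∀ᶠ w in 𝓝[≠] (z j), ‖w‖ ≤ ‖z j‖ + 1 := fun j =>
    nhdsWithin_le_nhds ((continuous_norm.tendsto (z j)).eventually_le_const (lt_add_one _))
  -- The translates of `χ₁` add up to `1` near `z_j`, so the residues of `χ₁ F` along the orbit of
  -- `z_j` add up to the residue of `F` itself.
  have hRsum : ∀ j, ∑ l ∈ s j, r (z j + l) = R j := by
    intro j
    refine HasRes.unique ((HasRes.sum (s j) fun l hl => hshift j l (hs j l hl)).congr ?_) (hR j)
    filter_upwards [hball j] with w hw
    rw [← sum_mul, (hsum j w hw).1, one_mul]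
  have hrz : ∀ j, ∀ l ∈ lattice τ, l ∉ s j → r (z j + l) = 0 := by
    intro j l hl hls
    refine (hshift j l hl).unique (HasRes.of_contDiff (contDiff_const (c := 0)) ?_)
    filter_upwards [hball j] with w hw
    rw [(hsum j w hw).2 l hl hls, zero_mul]
  obtain ⟨t, N, h, hh, e⟩ := hK.exists_rep i hz
  set S : Finset ℂ := (Finset.univ.sigma s).image fun p => z p.1 + p.2 with hS
  have hpv := HasPV.dzbar (f := f) hh (countable_poleSet_union z t) (eventually_notMem_poleSet_union z t) e
    (r := fun c => chi τ n z * r c) (fun c => by rw [hfg]; exact (hr c).const_mul _) (S := S) (by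
      intro c hc
      suffices r c = 0 by simp [this]
      by_cases hcp : c ∈ poleSet τ z
      · obtain ⟨j, hj⟩ := hcp
        have := hrz j _ hj fun hjs => hc (Finset.mem_image.2 ⟨⟨j, c - z j⟩, by simpa using hjs, by simp⟩)
        simpa using this
      · exact hr0 c hcp)
  -- No pole is counted twice: the orbits of the `z_j` are disjoint because `z` lies off the
  -- diagonals.
  have hinj : Set.InjOn (fun p : (_ : Fin n) × ℂ => z p.1 + p.2) (Finset.univ.sigma s) := by
    rintro ⟨j, l⟩ hp ⟨j', l'⟩ hp' heq
    simp only [Finset.coe_sigma, Set.mem_sigma_iff, Finset.mem_coe] at hp hp' heq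
    by_cases hjj : j = j'
    · subst hjj
      simpa using heq
    · exact absurd ⟨j, j', hjj, by
        rw [show z j - z j' = l' - l by linear_combination heq]
        exact sub_mem_lattice (hs _ _ hp'.2) (hs _ _ hp.2)⟩ hz
  rw [hS, sum_image hinj, Finset.sum_sigma] at hpv
  simp only [← mul_sum, hRsum] at hpv ⊢
  refine HasPV.pvInt_eq (hpv.congr ?_)
  filter_upwards [ae_ins_notMem (τ := τ) i hz] with w hw
  rw [hf, dzbar_comp (g := fun z => chi τ (n + 1) z * F z) (φ := fun w : ℂ => ins i (w, z)) 1
    ((hK.contDiffAt hw).diffAt) (hasFDerivAt_ins_left i w z)]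
  simp [← ins_single_same]

/-- Write `χ ∂̄F = ∂̄(χF) - (∂̄χ) F`. The second term contributes nothing since the translates of
`∂̄χ` add up to zero. In the first one, the variable `z_i` is integrated out first, which leaves
residues times the cutoff function in the remaining variables. -/
lemma regularizedIntegral_dzbar (i : Fin (n + 1)) {F G : ℂ^(n + 1) → ℂ}
    (hF : HasHolomorphicPoles τ F) (hG : HasHolomorphicPoles τ G)
    (hFG : ∀ z ∉ bigDiagonal (n + 1) τ, G z = dzbar (Pi.single i 1) F z)
    {R : Fin n → ℂ^n → ℂ} (hR : ∀ j, HasHolomorphicPoles τ (R j))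
    (hres : ∀ z ∉ bigDiagonal n τ, ∀ j, HasRes (fun w => F (ins i (w, z))) (z j) (R j z)) :
    regularizedIntegral τ G = -(pi : ℂ) * ∑ j, regularizedIntegral τ (R j) := by
  have hℓ := (isReg_regC τ n).pvAt i
  have hχ := isTest_chi τ (n + 1)
  have hK := hF.isK hχ
  have hKd := hK.dzbar (Pi.single i 1)
  have hBF := hF.isK (hχ.dzbar (Pi.single i 1))
  have hRK := fun j => (hR j).isK (isTest_chi τ n)
  rw [(regularizedIntegral_wellDefined hG).2 _ hℓ, hℓ.congr (hG.isK hχ)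
    (G := fun z => dzbar (Pi.single i 1) (fun z => chi τ (n + 1) z * F z) z +
      (-1) * (dzbar (Pi.single i 1) (chi τ (n + 1)) z * F z)) ?_, hℓ.add hKd (hBF.const_mul _),
    hℓ.const_mul _ hBF, hℓ.mul_eq_zero (hχ.dzbar _) (periodize_fderiv_chi (dzbarHom (Pi.single i 1))) hF,
    mul_zero, add_zero, (isReg_regC τ n).congr (hKd.pvAt i) fun z hz =>
      pvAt_dzbar_chi_mul i hF hz (hres z hz), (isReg_regC τ n).const_mul _
        (IsK.sum _ fun j _ => hRK j), (isReg_regC τ n).sum _ fun j _ => hRK j]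
  · simp only [(regularizedIntegral_wellDefined (hR _)).2 _ (isReg_regC τ n)]
  · intro z hz
    rw [dzbar_mul _ (hχ.1.diffAt z) (hF.contDiffAt hz).diffAt, hFG z hz]
    ring

/-! ### Holomorphic dependence of integrals on parameters -/

section Parametric

variable {𝕜 T Z E : Type} [RCLike 𝕜] [TopologicalSpace T] [T2Space T] [MeasurableSpace T] [OpensMeasurableSpace T]
  {μ : Measure T} [IsFiniteMeasureOnCompacts μ] [NormedAddCommGroup Z] [NormedSpace 𝕜 Z]
  [NormedAddCommGroup E] [NormedSpace 𝕜 E] [ProperSpace E]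

/-- Over `𝕜 = ℂ` this is holomorphic dependence, over `ℝ` smooth dependence on the parameter. The
target space is arbitrary because the induction passes from `g` to its partial derivative, which has
values in linear maps. -/
lemma contDiffOn_integral_param {K : Set T} (hK : IsCompact K) {c : T → Z} (hc : ContinuousOn c K)
    {W : Set (E × Z)} (hW : IsOpen W) {U : Set E} (hU : IsOpen U)
    (hUW : ∀ x ∈ U, ∀ t ∈ K, (x, c t) ∈ W) {G : Type} [NormedAddCommGroup G] [NormedSpace ℝ G] [NormedSpace 𝕜 G]
    [SMulCommClass 𝕜 ℝ G] {g : E × Z → G} (hg : ContDiffOn 𝕜 ∞ g W) :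
    ContDiffOn 𝕜 ∞ (fun x => ∫ t in K, g (x, c t) ∂μ) U := by
  rw [contDiffOn_infty]
  intro n
  have key : ∀ {G : Type} [NormedAddCommGroup G] [NormedSpace ℝ G] [NormedSpace 𝕜 G]
    [SMulCommClass 𝕜 ℝ G] {g : E × Z → G},
      ContDiffOn 𝕜 ∞ g W → ∀ x ∈ U, HasFDerivAt (fun x => ∫ t in K, g (x, c t) ∂μ)
        (∫ t in K, (fderiv 𝕜 g (x, c t)).comp (inl 𝕜 E Z) ∂μ) x := by
    intro G _ _ _ _ g hg x hx
    have hg' : ContinuousOn (fun p => (fderiv 𝕜 g p).comp (inl 𝕜 E Z)) W :=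
      ContinuousOn.clm_comp ((contDiffOn_infty_iff_fderiv_of_isOpen hW).1 hg).2.continuousOn continuousOn_const
    have hm : ∀ x ∈ U, Set.MapsTo (fun t => (x, c t)) K W := fun x hx t ht => hUW x hx t ht
    have hcx : ∀ x : E, ContinuousOn (fun t => (x, c t)) K := fun x => continuousOn_const.prodMk hc
    obtain ⟨ε, hε, hεU⟩ := Metric.nhds_basis_closedBall.mem_iff.1 (hU.mem_nhds hx)
    have hb : ContinuousOn (fun p : E × T =>
        (fderiv 𝕜 g (p.1, c p.2)).comp (inl 𝕜 E Z)) (closedBall x ε ×ˢ K) :=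
      hg'.comp (continuousOn_fst.prodMk (hc.comp continuousOn_snd fun p hp => hp.2))
        fun p hp => hUW _ (hεU hp.1) _ hp.2
    obtain ⟨C, hC⟩ := ((isCompact_closedBall x ε).prod hK).exists_bound_of_continuousOn hb
    refine hasFDerivAt_integral_of_dominated_of_fderiv_le (𝕜 := 𝕜) (bound := fun _ => C)
      (F := fun x t => g (x, c t)) (F' := fun x t => (fderiv 𝕜 g (x, c t)).comp (inl 𝕜 E Z))
      (Metric.closedBall_mem_nhds x hε) ?_ ?_ ?_ ?_ ?_ ?_
    · filter_upwards [hU.mem_nhds hx] with y hy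
      exact ((hg.continuousOn.comp (hcx y) (hm y hy)).integrableOn_compact hK).aestronglyMeasurable
    · exact (hg.continuousOn.comp (hcx x) (hm x hx)).integrableOn_compact hK
    · exact ((hg'.comp (hcx x) (hm x hx)).integrableOn_compact hK).aestronglyMeasurable
    · filter_upwards [ae_restrict_mem hK.measurableSet] with t ht y hy using hC (y, t) ⟨hy, ht⟩
    · exact continuousOn_const.integrableOn_compact hK
    · filter_upwards [ae_restrict_mem hK.measurableSet] with t ht y hy
      have : HasFDerivAt g (fderiv 𝕜 g (y, c t)) (y, c t) := ((hg.differentiableOn (by simp)).differentiableAt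
          (hW.mem_nhds (hUW y (hεU hy) t ht))).hasFDerivAt
      exact this.comp y (hasFDerivAt_prodMk_left y (c t))
  induction n generalizing G with
  | zero =>
    exact contDiffOn_zero.2 fun x hx => (key hg x hx).continuousAt.continuousWithinAt
  | succ n ih =>
    refine (contDiffOn_succ_iff_fderiv_of_isOpen hU).2
      ⟨fun x hx => (key hg x hx).differentiableAt.differentiableWithinAt,
        fun h => absurd h (WithTop.natCast_ne_top n), ?_⟩
    refine ContDiffOn.congr (ih (g := fun p => (fderiv 𝕜 g p).comp (inl 𝕜 E Z))
      (((contDiffOn_infty_iff_fderiv_of_isOpen hW).1 hg).2.clm_comp contDiffOn_const))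
      fun x hx => (key hg x hx).fderiv

end Parametric

/-! ### Families of functions with poles along the diagonals -/

/-- The equation `z_i - z_j - (k + l τ) = 0` of a diagonal, as a function of `z` and `τ`. -/
def famEq (i j : Fin n) (k l : ℤ) (x : ℂ^n × ℂ) : ℂ := x.1 i - x.1 j - (k + l * x.2)

/-- Products of equations of diagonals. -/
def FamDenom (n : ℕ) : Submonoid (ℂ^n × ℂ → ℂ) :=
  Submonoid.closure {f | ∃ i j, i ≠ j ∧ ∃ k l, f = famEq i j k l}

lemma contDiff_famEq (i j : Fin n) (k l : ℤ) : ContDiff ℂ ∞ (famEq i j k l) := by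
  unfold famEq
  have h : ∀ m : Fin n, ContDiff ℂ ∞ fun x : ℂ^n × ℂ => x.1 m := fun m =>
    (contDiff_apply ℂ ℂ m).comp contDiff_fst
  exact ((h i).sub (h j)).sub (contDiff_const.add (contDiff_const.mul contDiff_snd))

lemma contDiff_of_mem_FamDenom {D : ℂ^n × ℂ → ℂ} (hD : D ∈ FamDenom n) : ContDiff ℂ ∞ D := by
  induction hD using Submonoid.closure_induction with
  | mem f hf => obtain ⟨i, j, _, k, l, rfl⟩ := hf; exact contDiff_famEq i j k l
  | one => exact contDiff_const
  | mul f g _ _ hf hg => exact hf.mul hg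

lemma mem_Denom_of_mem_FamDenom {D : ℂ^n × ℂ → ℂ} (hD : D ∈ FamDenom n) (τ : ℂ) :
    (fun z => D (z, τ)) ∈ Denom n τ := by
  induction hD using Submonoid.closure_induction with
  | mem f hf =>
    obtain ⟨i, j, hij, k, l, rfl⟩ := hf
    exact sub_mem_Denom hij ⟨k, l, rfl⟩
  | one => exact one_mem _
  | mul f g _ _ hf hg => exact mul_mem hf hg

/-- The points of `ℂⁿ × ℍ` off the diagonals. -/
def offDiag (n : ℕ) : Set (ℂ^n × ℂ) := {x | 0 < x.2.im ∧ x.1 ∉ bigDiagonal n x.2}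

lemma ne_zero_of_mem_FamDenom {D : ℂ^n × ℂ → ℂ} (hD : D ∈ FamDenom n)
    {x : ℂ^n × ℂ} (hx : x ∈ offDiag n) : D x ≠ 0 := ne_zero_of_mem_Denom (mem_Denom_of_mem_FamDenom hD x.2) hx.2

/-- `Φ` is locally a holomorphic function divided by a product of equations of diagonals. -/
def IsFam (Φ : ℂ^n × ℂ → ℂ) : Prop := ∀ p : ℂ^n × ℂ, 0 < p.2.im → ∃ (U : Set (ℂ^n × ℂ)) (h D : ℂ^n × ℂ → ℂ),
    IsOpen U ∧ p ∈ U ∧ ContDiffOn ℂ ∞ h U ∧ D ∈ FamDenom n ∧ ∀ x ∈ U, x ∈ offDiag n → Φ x = h x / D x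

lemma dense_compl_bigDiagonal (n : ℕ) (τ : ℂ) : Dense (bigDiagonal n τ)ᶜ :=
  Measure.dense_of_ae (ae_notMem_bigDiagonal n τ)

/-- Near a point, the diagonals are those through the point. -/
lemma eventually_famEq_eq_zero {p : ℂ^n × ℂ} (hp : 0 < p.2.im) (i j : Fin n) :
    ∀ᶠ x in 𝓝 p, ∀ k l : ℤ, famEq i j k l x = 0 → famEq i j k l p = 0 := by
  -- The coordinates of `x_i - x_j` in the real basis `τ, 1`. The equation with integers `k, l`
  -- vanishes exactly where `q` takes the value `(l, k)`, and the integral points form a closed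
  -- discrete set.
  let q : ℂ^n × ℂ → ℝ × ℝ := fun x =>
    ((x.1 i - x.1 j).im / x.2.im, (x.1 i - x.1 j).re - x.2.re * ((x.1 i - x.1 j).im / x.2.im))
  have hq : ContinuousAt q p := by
    have h1 : ∀ m : Fin n, ContinuousAt (fun x : ℂ^n × ℂ => x.1 m) p := fun m => by fun_prop
    have h2 : ContinuousAt (fun x : ℂ^n × ℂ => (x.1 i - x.1 j).im / x.2.im) p :=
      ContinuousAt.div (by fun_prop) (by fun_prop) hp.ne'
    exact h2.prodMk (ContinuousAt.sub (by fun_prop) (ContinuousAt.mul (by fun_prop) h2))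
  have hiff : ∀ x : ℂ^n × ℂ, 0 < x.2.im → ∀ k l : ℤ, famEq i j k l x = 0 ↔ q x = ((l : ℝ), (k : ℝ)) := by
    intro x hx k l
    simp only [famEq, sub_eq_zero, q, Prod.mk.injEq]
    constructor
    · intro h
      have h1 : (x.1 i - x.1 j).im = l * x.2.im := by rw [h]; simp
      have h2 : (x.1 i - x.1 j).re = k + l * x.2.re := by rw [h]; simp
      rw [h1, h2, mul_div_cancel_right₀ _ hx.ne']
      exact ⟨rfl, by ring⟩
    · rintro ⟨h1, h2⟩
      rw [h1] at h2
      rw [div_eq_iff hx.ne'] at h1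
      apply Complex.ext
      · simp only [Complex.add_re, Complex.mul_re, Complex.intCast_re, intCast_im]
        linarith
      · simpa using h1
  have hclosed : IsClosed (range (Prod.map (Int.cast : ℤ → ℝ) (Int.cast : ℤ → ℝ)) \ {q p}) := by
    have : Topology.IsClosedEmbedding (Prod.map (Int.cast : ℤ → ℝ) (Int.cast : ℤ → ℝ)) :=
      Int.isClosedEmbedding_coe_real.prodMap Int.isClosedEmbedding_coe_real
    have h2 := this.isClosedMap ((Prod.map (Int.cast : ℤ → ℝ) (Int.cast : ℤ → ℝ)) ⁻¹' {q p}ᶜ)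
      (isClosed_discrete _)
    rwa [Set.image_preimage_eq_range_inter, ← Set.sdiff_eq] at h2
  filter_upwards [hq.eventually (hclosed.isOpen_compl.mem_nhds (by simp)),
    (continuous_im.comp continuous_snd).continuousAt.eventually (lt_mem_nhds hp)] with x hx hx' k l h
  rw [hiff x hx'] at h
  rw [hiff p hp]
  by_contra hne
  exact hx ⟨⟨(l, k), by simp [h]⟩, by rw [h]; exact fun h' => hne h'.symm⟩

lemma isOpen_offDiag (n : ℕ) : IsOpen (offDiag n) := by
  rw [isOpen_iff_eventually]
  intro p hp
  have h := eventually_all.2 fun i : Fin n => eventually_all.2 fun j => eventually_famEq_eq_zero hp.1 i j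
  filter_upwards [h, (continuous_im.comp continuous_snd).continuousAt.eventually
    (lt_mem_nhds hp.1)] with x hx hx'
  refine ⟨hx', fun ⟨i, j, hij, k, l, e⟩ => hp.2 ⟨i, j, hij, k, l, ?_⟩⟩
  have := hx i j k l (by simp [famEq, e])
  simpa [famEq, sub_eq_zero] using this

lemma IsFam.contDiffOn (hΦ : IsFam Φ) : ContDiffOn ℂ ∞ Φ (offDiag n) := by
  intro p hp
  obtain ⟨U, h, D, hU, hpU, hh, hD, e⟩ := hΦ p hp.1
  refine ContDiffAt.contDiffWithinAt ?_
  have h1 : ContDiffAt ℂ ∞ (fun x => h x / D x) p := by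
    simp only [div_eq_mul_inv]
    exact (hh.contDiffAt (hU.mem_nhds hpU)).mul
      ((contDiff_of_mem_FamDenom hD).contDiffAt.inv (ne_zero_of_mem_FamDenom hD hp))
  refine h1.congr_of_eventuallyEq ?_
  filter_upwards [hU.mem_nhds hpU, (isOpen_offDiag n).mem_nhds hp] with x hx hx' using e x hx hx'

/-- A family that vanishes near one point vanishes everywhere. -/
lemma IsFam.eq_zero {A : ℂ^n × ℂ → ℂ} (hA : IsFam A) {p : ℂ^n × ℂ}
    (hp : 0 < p.2.im) (h0 : ∀ᶠ x in 𝓝 p, x ∈ offDiag n → A x = 0) : ∀ x ∈ offDiag n, A x = 0 := by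
  let s : Set (ℂ^n × ℂ) := {x | 0 < x.2.im}
  let u : Set (ℂ^n × ℂ) := {q | ∀ᶠ x in 𝓝 q, x ∈ offDiag n → A x = 0}
  -- The propagation runs through all of `ℂⁿ × ℍ`, which is convex, and crosses the diagonals by
  -- means of the local numerators; connectedness of the complement of the diagonals is not needed.
  have hs : IsPreconnected s := by
    refine Convex.isPreconnected ?_
    have : s = (imCLM.toLinearMap ∘ₗ (LinearMap.snd ℝ ℂ^n ℂ)) ⁻¹' Ioi 0 := rfl
    rw [this]
    exact (convex_Ioi 0).linear_preimage _
  have hu : IsOpen u := isOpen_iff_eventually.2 fun q hq => eventually_eventually_nhds.2 hq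
  suffices s ⊆ u from fun x hx => (this hx.1).self_of_nhds hx
  refine hs.subset_of_closure_inter_subset hu ⟨p, hp, h0⟩ ?_
  rintro q ⟨hqc, hq⟩
  obtain ⟨U, h, D, hU, hqU, hh, hD, e⟩ := hA q hq
  have hso : IsOpen s := isOpen_lt continuous_const (continuous_im.comp continuous_snd)
  obtain ⟨ε, hε, hball⟩ := Metric.isOpen_iff.1 (hU.inter hso) q ⟨hqU, hq⟩
  obtain ⟨r, hrb, hru⟩ := mem_closure_iff.1 hqc _ isOpen_ball (mem_ball_self hε)
  have hcont : ContinuousOn h (ball q ε) := hh.continuousOn.mono fun x hx => (hball hx).1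
  have hr0 : ∀ᶠ x in 𝓝 r, h x = 0 := by
    have hr1 : ∀ᶠ x in 𝓝 r, x ∈ ball q ε ∧ (x ∈ offDiag n → A x = 0) :=
      Eventually.and (isOpen_ball.mem_nhds hrb) hru
    filter_upwards [eventually_eventually_nhds.2 hr1] with x hx
    have hxb := hx.self_of_nhds.1
    by_contra hne
    have hev : ∀ᶠ y in 𝓝 x, h y ≠ 0 := ((hcont.continuousAt (isOpen_ball.mem_nhds hxb)).eventually_ne hne)
    have hcz : ContinuousAt (fun z : ℂ^n => (z, x.2)) x.1 := by fun_prop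
    have hev2 := hcz.eventually (hev.and hx)
    obtain ⟨z, hz, hz'⟩ := ((mem_closure_iff_frequently.1 ((dense_compl_bigDiagonal n x.2) x.1)).and_eventually
      hev2).exists
    have hoff : (z, x.2) ∈ offDiag n := ⟨(hball hxb).2, hz⟩
    have := e _ (hball hz'.2.1).1 hoff
    rw [hz'.2.2 hoff] at this
    exact hz'.1 ((div_eq_zero_iff.1 this.symm).resolve_right (ne_zero_of_mem_FamDenom hD hoff))
  have hall : ∀ x ∈ ball q ε, h x = 0 := by
    intro x hx
    -- The identity theorem in one variable on the complex line from `r`, where the numerator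
    -- vanishes locally, to `x`.
    let L : ℂ → ℂ^n × ℂ := fun t => r + t • (x - r)
    have hLc : Differentiable ℂ L := by fun_prop
    let V : Set ℂ := L ⁻¹' ball q ε
    have hVo : IsOpen V := isOpen_ball.preimage hLc.continuous
    have hVc : IsPreconnected V := by
      refine Convex.isPreconnected ?_
      intro a ha b hb c d hc hd hcd
      have : L (c • a + d • b) = c • L a + d • L b := by
        simp only [L]
        have : (c • a + d • b) • (x - r) = c • (a • (x - r)) + d • (b • (x - r)) := by
          rw [add_smul, smul_assoc, smul_assoc]
        rw [this, smul_add, smul_add]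
        nth_rw 1 [← one_smul ℝ r, ← hcd]
        rw [add_smul]
        abel
      show L (c • a + d • b) ∈ ball q ε
      rw [this]
      exact (convex_ball q ε) ha hb hc hd hcd
    have han : AnalyticOnNhd ℂ (fun t => h (L t)) V := by
      refine DifferentiableOn.analyticOnNhd (fun t ht => ?_) hVo
      have := ((hh.contDiffAt (hU.mem_nhds (hball ht).1)).differentiableAt (by simp)).comp t (hLc t)
      exact this.differentiableWithinAt
    have h00 : (0 : ℂ) ∈ V := by simpa [V, L] using hrb
    have hev : (fun t => h (L t)) =ᶠ[𝓝 0] 0 := by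
      have : L 0 = r := by simp [L]
      exact (hLc.continuous.continuousAt (x := 0)).eventually (this ▸ hr0)
    have := han.eqOn_zero_of_preconnected_of_eventuallyEq_zero hVc h00 hev
      (show (1 : ℂ) ∈ V by simpa [V, L] using hx)
    simpa [L] using this
  filter_upwards [ball_mem_nhds q hε] with x hx hoff
  rw [e x (hball hx).1 hoff, hall x hx, zero_div]

lemma IsFam.hasHolomorphicPoles (hΦ : IsFam Φ) (hell : IsElliptic Φ)
    (τ : ℍ) : HasHolomorphicPoles τ fun z => Φ (z, τ) := by
  refine ⟨hell τ, fun p => ?_⟩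
  obtain ⟨U, h, D, hU, hpU, hh, hD, e⟩ := hΦ (p, τ) τ.im_pos
  have hc : ContDiff ℂ ∞ fun z : ℂ^n => (z, (τ : ℂ)) := contDiff_id.prodMk contDiff_const
  have h1 : SmoothOn (fun z : ℂ^n => h (z, τ)) ((fun z => (z, (τ : ℂ))) ⁻¹' U) :=
    (hh.comp hc.contDiffOn (Set.mapsTo_preimage _ U)).restrict_scalars ℝ
  obtain ⟨U', N, k, hU', hp', hk, e'⟩ := poleAt_div (p := p) (hU.preimage hc.continuous) hpU h1
    (mem_Denom_of_mem_FamDenom hD τ)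
  exact ⟨U' ∩ (fun z => (z, (τ : ℂ))) ⁻¹' U, N, k, hU'.inter (hU.preimage hc.continuous), ⟨hp', hpU⟩,
    hk.mono inter_subset_left, fun z hz hd => by
      rw [← e' z hz.1 hd]
      exact e _ hz.2 ⟨τ.im_pos, hd⟩⟩

lemma HasHolomorphicPoles.smooth_mul {G k : ℂ^n → ℂ} (hk : Smooth k)
    (hkp : IsPeriodic τ k) (hG : HasHolomorphicPoles τ G) : HasHolomorphicPoles τ fun z => k z * G z := by
  refine ⟨fun z hz l hl => by simp only [hkp z hz l hl, hG.1 z hz l hl], fun p => ?_⟩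
  obtain ⟨U, N, h, hU, hp, hh, e⟩ := hG.2 p
  exact ⟨U, N, fun z => k z * h z, hU, hp, hk.contDiffOn.mul hh, fun z hz hd => by
    simp only [e z hz hd, mul_div_assoc]⟩

/-! ### Meromorphic functions with poles along the diagonals -/

/-- Removal of removable singularities. -/
lemma exists_analyticAt_extension {k : ℂ → ℂ} {A : Set ℂ}
    (hA : ∀ s ∈ A, ∃ k', AnalyticAt ℂ k' s ∧ ∀ᶠ t in 𝓝[≠] s, k t = k' t) :
    ∃ k', (∀ s ∈ A, AnalyticAt ℂ k' s) ∧ ∀ s, ContinuousAt k s → k' s = k s := by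
  refine ⟨fun s => Filter.limUnder (𝓝[≠] s) k, fun s hs => ?_, fun s hs =>
    (tendsto_nhdsWithin_of_tendsto_nhds hs.tendsto).limUnder_eq⟩
  obtain ⟨k', hk', e⟩ := hA s hs
  refine hk'.congr ?_
  have h1 := hk'.eventually_analyticAt
  have h2 := eventually_nhdsWithin_iff.1 (eventually_eventually_nhdsWithin.2 e)
  filter_upwards [h1, h2] with t ht ht'
  refine (Tendsto.limUnder_eq ?_).symm
  have h3 : ∀ᶠ y in 𝓝[≠] t, k' y = k y := by
    by_cases hts : t = s
    · subst hts
      exact e.mono fun _ h => h.symm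
    · have := ht' hts
      rw [(isOpen_compl_singleton (x := s)).nhdsWithin_eq hts] at this
      exact nhdsWithin_le_nhds (this.mono fun _ h => h.symm)
  exact (tendsto_nhdsWithin_of_tendsto_nhds ht.continuousAt.tendsto).congr' h3

lemma int_lattice_injective {τ : ℂ} (hτ : 0 < τ.im) {k l k' l' : ℤ}
    (h : (k : ℂ) + l * τ = k' + l' * τ) : k = k' ∧ l = l' := by
  have h1 := congrArg Complex.im h
  simp only [add_im, Complex.mul_im, Complex.intCast_re, intCast_im, zero_mul, add_zero, zero_add] at h1
  have hl : l = l' := by exact_mod_cast mul_right_cancel₀ hτ.ne' h1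
  subst hl
  exact ⟨by exact_mod_cast add_right_cancel h, rfl⟩

lemma exists_famEq_ne_zero (s : Finset ι) {i j : ι → Fin n} {k l : ι → ℤ}
    (hij : ∀ e ∈ s, i e ≠ j e) {O : Set (ℂ^n × ℂ)} (hO : IsOpen O) (hne : O.Nonempty) :
    ∃ y ∈ O, ∀ e ∈ s, famEq (i e) (j e) (k e) (l e) y ≠ 0 := by
  classical
  induction s using Finset.induction_on generalizing O with
  | empty => exact hne.imp fun y hy => ⟨hy, by simp⟩
  | insert a s ha ih =>
    have hO' : IsOpen (O ∩ {y | famEq (i a) (j a) (k a) (l a) y ≠ 0}) :=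
      hO.inter (isOpen_ne_fun (contDiff_famEq _ _ _ _).continuous continuous_const)
    have hne' : (O ∩ {y | famEq (i a) (j a) (k a) (l a) y ≠ 0}).Nonempty := by
      obtain ⟨y, hy⟩ := hne
      by_cases h0 : famEq (i a) (j a) (k a) (l a) y = 0
      · let L : ℂ → ℂ^n × ℂ := fun t => (y.1 + t • Pi.single (i a) 1, y.2)
        have hL : Continuous L := by fun_prop
        have h1 : ∀ᶠ t in 𝓝[≠] (0 : ℂ), L t ∈ O := nhdsWithin_le_nhds
          (hL.continuousAt.eventually (hO.mem_nhds (by simpa [L] using hy)))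
        obtain ⟨t, ht, ht0⟩ := (h1.and self_mem_nhdsWithin).exists
        refine ⟨L t, ht, ?_⟩
        have : famEq (i a) (j a) (k a) (l a) (L t) = t := by
          have hji : j a ≠ i a := (hij a (by simp)).symm
          simp only [famEq, L, Pi.add_apply, Pi.smul_apply, Pi.single_eq_same, smul_eq_mul, mul_one,
            Pi.single_eq_of_ne hji, mul_zero, add_zero] at h0 ⊢
          linear_combination h0
        simpa [this] using ht0
      · exact ⟨y, hy, h0⟩
    obtain ⟨y, hy, hs⟩ := ih (fun e he => hij e (by simp [he])) hO' hne'
    refine ⟨y, hy.1, fun e he => ?_⟩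
    rcases mem_insert.1 he with rfl | he
    · exact hy.2
    · exact hs e he

/-! ### Iterated derivatives along complex lines -/

section LineDerivatives

variable {X : Type*} [NormedAddCommGroup X] [NormedSpace ℂ X]

/-- Iterated derivatives of `g` in the direction `v`. -/
def lineIter (v : X) (g : X → ℂ) : ℕ → X → ℂ
  | 0 => g
  | k + 1 => fun x => fderiv ℂ (lineIter v g k) x v

lemma analyticOnNhd_lineIter (v : X) {g : X → ℂ} {B : Set X} (hg : AnalyticOnNhd ℂ g B) (k : ℕ) :
    AnalyticOnNhd ℂ (lineIter v g k) B := by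
  induction k with
  | zero => exact hg
  | succ k ih => exact (ContinuousLinearMap.apply ℂ ℂ v).comp_analyticOnNhd ih.fderiv

lemma hasDerivAt_line (x v : X) (t : ℂ) : HasDerivAt (fun t : ℂ => x + t • v) v t := by
  simpa using ((hasDerivAt_id t).smul_const v).const_add x

lemma analyticAt_line (x v : X) (t : ℂ) : AnalyticAt ℂ (fun t : ℂ => x + t • v) t :=
  analyticAt_const.add (analyticAt_id.smul analyticAt_const)

lemma iteratedDeriv_line (v : X) {g : X → ℂ} {B : Set X} (hB : IsOpen B) (hg : AnalyticOnNhd ℂ g B)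
    (x : X) (k : ℕ) {t : ℂ} (ht : x + t • v ∈ B) :
    iteratedDeriv k (fun t : ℂ => g (x + t • v)) t = lineIter v g k (x + t • v) := by
  induction k generalizing t with
  | zero => rfl
  | succ k ih =>
    rw [iteratedDeriv_succ]
    have hc : ∀ᶠ s in 𝓝 t, x + s • v ∈ B := (hasDerivAt_line x v t).continuousAt.eventually (hB.mem_nhds ht)
    rw [Filter.EventuallyEq.deriv_eq (f := fun s => lineIter v g k (x + s • v)) (hc.mono fun s hs => ih hs)]
    exact ((analyticOnNhd_lineIter v hg k _ ht).differentiableAt.hasFDerivAt.comp_hasDerivAt t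
      (hasDerivAt_line x v t)).deriv

/-- Otherwise `g` vanishes to infinite order at `p` along the line in direction `v`, hence on the
whole part of the line inside the ball, including `p + v`. -/
lemma exists_lineIter_ne_zero {v : X} {g : X → ℂ} {p : X} {ε : ℝ}
    (hg : AnalyticOnNhd ℂ g (ball p ε)) (hv : p + v ∈ ball p ε) (hne : g (p + v) ≠ 0) :
    ∃ m, lineIter v g m p ≠ 0 := by
  by_contra! h
  have hε : 0 < ε := Metric.nonempty_ball.1 ⟨_, hv⟩
  let V : Set ℂ := (fun t : ℂ => p + t • v) ⁻¹' ball p ε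
  have hV : AnalyticOnNhd ℂ (fun t : ℂ => g (p + t • v)) V := fun t ht =>
    AnalyticAt.comp (f := fun t : ℂ => p + t • v) (hg _ ht) (analyticAt_line p v t)
  have h0 : (0 : ℂ) ∈ V := by simpa [V] using hε
  have hVc : IsPreconnected V := by
    have : V = {t : ℂ | ‖t‖ * ‖v‖ < ε} := by ext t; simp [V, dist_eq_norm, norm_smul]
    rw [this]
    refine Convex.isPreconnected ?_
    have hcv : ConvexOn ℝ Set.univ fun t : ℂ => ‖t‖ * ‖v‖ := by
      simpa [mul_comm, smul_eq_mul] using (convexOn_univ_norm (E := ℂ)).smul (norm_nonneg v)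
    simpa using hcv.convex_lt ε
  have htop : analyticOrderAt (fun t : ℂ => g (p + t • v)) 0 = ⊤ := by
    refine ENat.eq_top_iff_forall_ge.2 fun m => ?_
    rw [natCast_le_analyticOrderAt_iff_iteratedDeriv_eq_zero (hV 0 h0)]
    intro i _
    rw [iteratedDeriv_line v isOpen_ball hg p i h0]
    simpa using h i
  have := hV.eqOn_zero_of_preconnected_of_eventuallyEq_zero hVc h0 (analyticOrderAt_eq_top.1 htop)
    (show (1 : ℂ) ∈ V by simpa [V] using hv)
  exact hne (by simpa using this)

end LineDerivatives

/-- Write `Φ = f / g` near `p` and choose a direction `v` transverse to all diagonals through `p`,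
such that `g` is not identically zero on the line through `p`. On neighbouring parallel lines `g`
vanishes to order at most `m`, and `Φ` is singular only on the diagonals, so `∏ ℓ_e ^ m · Φ` has
removable singularities there. Cauchy's formula over a circle that avoids the diagonals then
recovers this product from values of `Φ` at points of holomorphy, and the Cauchy integral is
holomorphic in the base point even across the diagonals. -/
lemma isFam_of_isMeromorphicOn
    (hmer : IsMeromorphicOn Φ {x | 0 < x.2.im}) (hhol : IsHolomorphicAwayFromDiagonals Φ) : IsFam Φ := by
  classical
  intro p hp
  obtain ⟨f, g, hf, hg, hfreq, hΦ⟩ := hmer p hp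
  set E : Finset (Fin n × Fin n) := Finset.univ.filter fun e => e.1 ≠ e.2 ∧
    p.1 e.1 - p.1 e.2 ∈ lattice p.2 with hE
  have hκ : ∀ e : Fin n × Fin n, ∃ q : ℤ × ℤ, e ∈ E → famEq e.1 e.2 q.1 q.2 p = 0 := by
    intro e
    by_cases he : e ∈ E
    · obtain ⟨k, l, h⟩ := (mem_filter.1 he).2.2
      exact ⟨(k, l), fun _ => by simp [famEq, h]⟩
    · exact ⟨0, fun h => absurd h he⟩
  choose κ hκ0 using hκ
  let ℓ : Fin n × Fin n → ℂ^n × ℂ → ℂ := fun e => famEq e.1 e.2 (κ e).1 (κ e).2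
  have hdiag : ∀ᶠ x : ℂ^n × ℂ in 𝓝 p, x ∉ offDiag n → 0 < x.2.im → ∃ e ∈ E, ℓ e x = 0 := by
    filter_upwards [eventually_all.2 fun i : Fin n => eventually_all.2 fun j =>
      eventually_famEq_eq_zero hp i j] with x hx hoff him
    obtain ⟨i, j, hij, k, l, h⟩ : x.1 ∈ bigDiagonal n x.2 := by by_contra h; exact hoff ⟨him, h⟩
    have h0 : famEq i j k l x = 0 := by simp [famEq, h]
    have h1 := hx i j k l h0
    have hmem : (i, j) ∈ E := by
      simp only [hE, mem_filter, mem_univ, true_and]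
      exact ⟨hij, k, l, sub_eq_zero.1 h1⟩
    have h2 := hκ0 (i, j) hmem
    have h3 : ((κ (i, j)).1 : ℂ) + (κ (i, j)).2 * p.2 = k + l * p.2 := by
      rw [← sub_eq_zero.1 h1, ← sub_eq_zero.1 h2]
    obtain ⟨e1, e2⟩ := int_lattice_injective hp h3
    exact ⟨(i, j), hmem, by simpa [ℓ, e1, e2] using h0⟩
  obtain ⟨ε, hε, hball⟩ := Metric.eventually_nhds_iff_ball.1
    ((hf.eventually_analyticAt.and hg.eventually_analyticAt))
  have hgB : AnalyticOnNhd ℂ g (ball p ε) := fun x hx => (hball x hx).2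
  obtain ⟨y, hyB, hyE⟩ := exists_famEq_ne_zero E (k := fun e => (κ e).1) (l := fun e => (κ e).2)
    (fun e he => (mem_filter.1 he).2.1) (O := ball p ε ∩ {x | g x ≠ 0})
    (hgB.continuousOn.isOpen_inter_preimage isOpen_ball isOpen_compl_singleton) (by
      obtain ⟨x, hx, hx'⟩ := (hfreq.and_eventually (ball_mem_nhds p hε)).exists
      exact ⟨x, hx', hx⟩)
  set v : ℂ^n × ℂ := y - p with hv
  have hpv : p + v = y := by simp [hv]
  obtain ⟨m, hm⟩ := exists_lineIter_ne_zero hgB (hpv ▸ hyB.1) (hpv ▸ hyB.2)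
  let lam : Fin n × Fin n → ℂ := fun e => v.1 e.1 - v.1 e.2 - (κ e).2 * v.2
  have hline : ∀ e (x : ℂ^n × ℂ) (t : ℂ), ℓ e (x + t • v) = ℓ e x + t * lam e := by
    intro e x t
    simp only [ℓ, lam, famEq, Prod.fst_add, Prod.snd_add, Prod.smul_fst, Prod.smul_snd, Pi.add_apply,
      Pi.smul_apply, smul_eq_mul]
    ring
  have hlam : ∀ e ∈ E, lam e ≠ 0 := by
    intro e he
    have := hline e p 1
    rw [one_smul, hpv, one_mul, show ℓ e p = 0 from hκ0 e he, zero_add] at this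
    exact this ▸ hyE e he
  obtain ⟨ε', hε', hball'⟩ := Metric.eventually_nhds_iff_ball.1
    ((((analyticOnNhd_lineIter v hgB m p (mem_ball_self hε)).continuousAt.eventually_ne hm).and
      (hdiag.and hΦ)).and (Eventually.and (ball_mem_nhds p hε)
        ((continuous_im.comp continuous_snd).continuousAt.eventually (lt_mem_nhds hp))))
  -- With this radius the discs `x + t v`, `|t| ≤ r`, stay in the ball of radius `ε'`. The
  -- conditions defining `U` say that the zero of `ℓ_e` on each such line lies in `|t| < r`, so the
  -- circle itself avoids the diagonals.
  set r : ℝ := ε' / (2 * (‖v‖ + 1)) with hr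
  have hv1 : 0 < ‖v‖ + 1 := by positivity
  have hr0 : 0 < r := by positivity
  have hrv : r * ‖v‖ < ε' / 2 := by
    rw [hr, div_mul_eq_mul_div, div_lt_div_iff₀ (by positivity) two_pos]
    nlinarith
  set U : Set (ℂ^n × ℂ) := ball p (ε' / 2) ∩ ⋂ e ∈ E, {x | ‖ℓ e x‖ < r * ‖lam e‖} with hU
  have hℓc : ∀ e, Continuous (ℓ e) := fun e => (contDiff_famEq _ _ _ _).continuous
  have hUo : IsOpen U := isOpen_ball.inter
    (E.finite_toSet.isOpen_biInter fun e _ => isOpen_lt (hℓc e).norm continuous_const)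
  have hpU : p ∈ U := ⟨mem_ball_self (by positivity), Set.mem_iInter₂.2 fun e he => by
    have h1 : ℓ e p = 0 := hκ0 e he
    have h2 : 0 < r * ‖lam e‖ := mul_pos hr0 (norm_pos_iff.2 (hlam e he))
    simpa only [mem_ofPred_eq, h1, norm_zero] using h2⟩
  have hin : ∀ x ∈ U, ∀ t : ℂ, ‖t‖ ≤ r → x + t • v ∈ ball p ε' := by
    intro x hx t ht
    have h1 : dist x p < ε' / 2 := hx.1
    have h2 : ‖t • v‖ ≤ r * ‖v‖ := by rw [norm_smul]; gcongr
    rw [Metric.mem_ball, dist_eq_norm, show x + t • v - p = (x - p) + t • v by abel]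
    rw [dist_eq_norm] at h1
    linarith [norm_add_le (x - p) (t • v)]
  have hcirc : ∀ x ∈ U, ∀ t : ℂ, ‖t‖ = r → x + t • v ∈ offDiag n := by
    intro x hx t ht
    obtain ⟨⟨_, hd, _⟩, _, him⟩ := hball' _ (hin x hx t ht.le)
    by_contra hoff
    obtain ⟨e, he, h0⟩ := hd hoff him
    rw [hline] at h0
    have h1 : ‖ℓ e x‖ < r * ‖lam e‖ := Set.mem_iInter₂.1 hx.2 e he
    rw [eq_neg_of_add_eq_zero_left h0, norm_neg, norm_mul, ht] at h1
    exact lt_irrefl _ h1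
  let D : ℂ^n × ℂ → ℂ := ∏ e ∈ E, ℓ e ^ m
  have hD : D ∈ FamDenom n := prod_mem fun e he => pow_mem (show ℓ e ∈ FamDenom n from Submonoid.subset_closure
      ⟨e.1, e.2, (mem_filter.1 he).2.1, _, _, rfl⟩) m
  have hDc := contDiff_of_mem_FamDenom hD
  have hℓan : ∀ e x t, AnalyticAt ℂ (fun t : ℂ => ℓ e (x + t • v)) t := fun e x t => by
    simp only [hline]
    fun_prop
  have hDan : ∀ (s : Finset (Fin n × Fin n)) x t,
      AnalyticAt ℂ (fun t : ℂ => ∏ e ∈ s, ℓ e (x + t • v) ^ m) t := fun s x t =>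
    Finset.analyticAt_fun_prod s fun e _ => (hℓan e x t).pow m
  have hDe : ∀ x, D x = ∏ e ∈ E, ℓ e x ^ m := fun x => by simp [D]
  let H : ℂ^n × ℂ → ℂ := fun x => (2 * pi * I)⁻¹ * ∫ θ in Icc (0 : ℝ) (2 * pi),
    I * (D (x + circleMap 0 r θ • v) * Φ (x + circleMap 0 r θ • v))
  have hHc : ContDiffOn ℂ ∞ H U := by
    refine contDiffOn_const.mul (contDiffOn_integral_param (E := ℂ^n × ℂ) (Z := ℂ) isCompact_Icc
      (continuous_circleMap 0 r).continuousOn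
      (W := {q : (ℂ^n × ℂ) × ℂ | q.1 + q.2 • v ∈ offDiag n}) ((isOpen_offDiag n).preimage (by fun_prop)) hUo
      (fun x hx θ _ => hcirc x hx _ (by simp [abs_of_pos hr0]))
      (g := fun q => I * (D (q.1 + q.2 • v) * Φ (q.1 + q.2 • v))) ?_)
    have hc : ContDiff ℂ ∞ fun q : (ℂ^n × ℂ) × ℂ => q.1 + q.2 • v := by fun_prop
    exact contDiffOn_const.mul ((hDc.comp hc).contDiffOn.mul
      ((AnalyticOnNhd.contDiffOn hhol (isOpen_offDiag n).uniqueDiffOn).comp hc.contDiffOn fun q hq => hq))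
  refine ⟨U, H, D, hUo, hpU, hHc, hD, fun x hxU hx => ?_⟩
  rw [eq_div_iff (ne_zero_of_mem_FamDenom hD hx), mul_comm]
  set k : ℂ → ℂ := fun t => D (x + t • v) * Φ (x + t • v) with hk
  have hkan : ∀ s : ℂ, x + s • v ∈ offDiag n → AnalyticAt ℂ k s := fun s hs => by
    simp only [hk, hDe]
    exact (hDan E x s).mul (AnalyticAt.comp (f := fun t : ℂ => x + t • v) (hhol _ hs) (analyticAt_line x v s))
  obtain ⟨k', hk'an, hk'eq⟩ := exists_analyticAt_extension (k := k) (A := closedBall 0 r) (by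
    intro s hs
    have hsr : ‖s‖ ≤ r := by simpa using hs
    by_cases hoff : x + s • v ∈ offDiag n
    · exact ⟨k, hkan s hoff, .of_forall fun _ => rfl⟩
    obtain ⟨⟨hmne, hd, hq⟩, hB, him⟩ := hball' _ (hin x hxU s hsr)
    obtain ⟨e, he, h0⟩ := hd hoff him
    have hgan : AnalyticAt ℂ (fun t : ℂ => g (x + t • v)) s :=
      AnalyticAt.comp (f := fun t : ℂ => x + t • v) (hgB _ hB) (analyticAt_line x v s)
    -- The `m`-th derivative of `g` along `v` is nonzero on the whole ball, which bounds the order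
    -- of vanishing by `m` at every point.
    have hord : ¬ ((m + 1 : ℕ) : ℕ∞) ≤ analyticOrderAt (fun t : ℂ => g (x + t • v)) s := by
      rw [natCast_le_analyticOrderAt_iff_iteratedDeriv_eq_zero hgan]
      intro h
      have := h m (by omega)
      rw [iteratedDeriv_line v isOpen_ball hgB x m hB] at this
      exact hmne this
    obtain ⟨o, ho⟩ := ENat.ne_top_iff_exists.1 (ne_top_of_lt (not_le.1 hord))
    rw [← ho, Nat.cast_le, not_le, Nat.lt_succ_iff] at hord
    obtain ⟨u, hu, hu0, hgu⟩ := (hgan.analyticOrderAt_eq_natCast).1 ho.symm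
    -- At a point `s` of the diagonal `e` one has `ℓ_e = λ_e (t - s)` along the line, and its `m`-th
    -- power absorbs the zero of `g`, which has order `o ≤ m`.
    refine ⟨fun t => lam e ^ m * (t - s) ^ (m - o) * (∏ e' ∈ E.erase e, ℓ e' (x + t • v) ^ m) *
      f (x + t • v) / u t, ?_, ?_⟩
    · refine AnalyticAt.div (((analyticAt_const.mul ((analyticAt_id.sub analyticAt_const).pow _)).mul
        (hDan _ x s)).mul (AnalyticAt.comp (f := fun t : ℂ => x + t • v) (hball _ hB).1
        (analyticAt_line x v s))) hu hu0
    · have hqc : ∀ᶠ t in 𝓝 s, x + t • v ∈ ball p ε' :=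
        (hasDerivAt_line x v s).continuousAt.eventually (isOpen_ball.mem_nhds (hin x hxU s hsr))
      filter_upwards [nhdsWithin_le_nhds hgu, nhdsWithin_le_nhds (hu.continuousAt.eventually_ne hu0),
        nhdsWithin_le_nhds hqc, self_mem_nhdsWithin] with t h1 h2 h3 h4
      have hts : t - s ≠ 0 := sub_ne_zero.2 h4
      have hgne : g (x + t • v) ≠ 0 := by rw [h1]; exact smul_ne_zero (pow_ne_zero _ hts) h2
      have hℓe : ℓ e (x + t • v) = lam e * (t - s) := by
        rw [hline] at h0 ⊢
        linear_combination h0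
      simp only [hk, hDe, (hball' _ h3).1.2.2 hgne, h1, smul_eq_mul]
      rw [← Finset.mul_prod_erase E _ he, hℓe]
      obtain ⟨d, rfl⟩ := Nat.exists_eq_add_of_le hord
      rw [Nat.add_sub_cancel_left, mul_pow]
      generalize ∏ e' ∈ E.erase e, ℓ e' (x + t • v) ^ (o + d) = P
      field_simp
      ring)
  have hc0 := Complex.circleIntegral_sub_inv_smul_of_differentiable_on_off_countable
    (f := k') Set.countable_empty (mem_ball_self hr0) (fun t ht => (hk'an t ht).continuousAt.continuousWithinAt)
    fun t ht => (hk'an t (Metric.ball_subset_closedBall ht.1)).differentiableAt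
  have h00 : k' 0 = D x * Φ x := by
    have h1 : ContinuousAt k 0 := (hkan 0 (by simpa using hx)).continuousAt
    rw [hk'eq 0 h1]
    simp [hk]
  have hpi : (2 * pi * I : ℂ) ≠ 0 := by simp [Real.pi_ne_zero, I_ne_zero]
  rw [h00, circleIntegral, intervalIntegral.integral_of_le (by positivity),
    ← integral_Icc_eq_integral_Ioc, smul_eq_mul] at hc0
  rw [eq_comm]
  simp only [H]
  rw [inv_mul_eq_iff_eq_mul₀ hpi, ← hc0]
  refine setIntegral_congr_fun measurableSet_Icc fun θ _ => ?_
  have hθ : ‖circleMap 0 r θ‖ = r := by simp [abs_of_pos hr0]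
  have hθ0 : circleMap 0 r θ ≠ 0 := norm_pos_iff.1 (by rw [hθ]; exact hr0)
  simp only [deriv_circleMap, sub_zero, smul_eq_mul, hk'eq _ (hkan _ (hcirc x hxU _ hθ)).continuousAt, hk]
  field_simp

/-! ### Laurent coefficients along a diagonal -/

section Quotients

variable {X : Type*} [NormedAddCommGroup X] [NormedSpace ℂ X]

/-- The numerators of the iterated derivatives of `h / D` in the direction `v`. -/
def quotNum (v : X) (h D : X → ℂ) : ℕ → X → ℂ
  | 0 => h
  | m + 1 => fun x => fderiv ℂ (quotNum v h D m) x v * D x - (m + 1) * quotNum v h D m x * fderiv ℂ D x v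

variable {v : X} {h D : X → ℂ} {U : Set X}

lemma contDiffOn_quotNum (hU : IsOpen U) (hh : ContDiffOn ℂ ∞ h U) (hD : ContDiff ℂ ∞ D) (m : ℕ) :
    ContDiffOn ℂ ∞ (quotNum v h D m) U := by
  induction m with
  | zero => exact hh
  | succ m ih =>
    have h1 := ((contDiffOn_infty_iff_fderiv_of_isOpen hU).1 ih).2
    have h2 : ContDiff ℂ ∞ (fderiv ℂ D) := hD.fderiv_right (by simp)
    exact ((h1.clm_apply contDiffOn_const).mul hD.contDiffOn).sub
      ((contDiffOn_const.mul ih).mul (h2.clm_apply contDiff_const).contDiffOn)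

lemma dz_iterate_quot (hU : IsOpen U) (hh : ContDiffOn ℂ ∞ h U) (hD : ContDiff ℂ ∞ D) (x : X) (m : ℕ) (hw : x + w • v ∈ U) (hw0 : D (x + w • v) ≠ 0) :
    (dz 1)^[m] (fun w : ℂ => h (x + w • v) / D (x + w • v)) w =
      quotNum v h D m (x + w • v) / D (x + w • v) ^ (m + 1) := by
  induction m generalizing w with
  | zero => simp [quotNum]
  | succ m ih =>
    have hL := hasDerivAt_line x v w
    have hev : ∀ᶠ w in 𝓝 w, x + w • v ∈ U ∧ D (x + w • v) ≠ 0 :=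
      (hL.continuousAt.eventually (hU.mem_nhds hw)).and
        ((hD.continuous.continuousAt.comp hL.continuousAt).eventually_ne hw0)
    rw [iterate_succ_apply', dz_congr 1 (hev.mono fun w hw => ih hw.1 hw.2)]
    have h1 := ((((contDiffOn_quotNum (v := v) hU hh hD m).contDiffAt (hU.mem_nhds hw)).differentiableAt
      (by simp)).hasFDerivAt.comp_hasDerivAt w hL)
    have h2 := ((hD.differentiable (by simp) (x + w • v)).hasFDerivAt.comp_hasDerivAt w hL)
    have h3 := h1.div (h2.pow (m + 1)) (pow_ne_zero _ hw0)
    have h4 : HasDerivAt (fun w : ℂ => quotNum v h D m (x + w • v) / D (x + w • v) ^ (m + 1)) _ w := h3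
    rw [dz_of_holomorphic 1 h4.differentiableAt, fderiv_apply_one_eq_deriv, h4.deriv]
    simp only [Function.comp_apply, quotNum, Pi.pow_apply, Nat.add_sub_cancel, Nat.cast_add, Nat.cast_one]
    field_simp
    ring

end Quotients

lemma famEq_mem {i j : Fin n} (hij : i ≠ j) (k l : ℤ) : famEq i j k l ∈ FamDenom n :=
  Submonoid.subset_closure ⟨i, j, hij, k, l, rfl⟩

/-- Needed to see that Laurent coefficients along `z_i = z_j` again have poles only along diagonals:
restricted to `z_i = z_j`, every factor other than `±(z_i - z_j)` becomes, up to sign, either a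
diagonal equation in the remaining variables or `k + l τ` with `(k, l) ≠ 0`, which has no zero in
the upper half-plane. -/
lemma exists_factor_of_mem_FamDenom (i : Fin (n + 1)) (j : Fin n) {D : ℂ^(n + 1) × ℂ → ℂ}
    (hD : D ∈ FamDenom (n + 1)) : ∃ (M : ℕ) (D' : ℂ^(n + 1) × ℂ → ℂ), ContDiff ℂ ∞ D' ∧
      (∀ x, D x = (x.1 i - x.1 (i.succAbove j)) ^ M * D' x) ∧
      ∃ (c : ℂ → ℂ) (D₁ : ℂ^n × ℂ → ℂ), ContDiff ℂ ∞ c ∧ (∀ t, 0 < t.im → c t ≠ 0) ∧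
        D₁ ∈ FamDenom n ∧ ∀ q : ℂ^n × ℂ, D' (ins i (q.1 j, q.1), q.2) = c q.2 * D₁ q := by
  have hne : ∀ k l : ℤ, ¬ (k = 0 ∧ l = 0) → ∀ t : ℂ, 0 < t.im → (-(k + l * t) : ℂ) ≠ 0 := by
    intro k l hkl t ht h0
    exact hkl (int_lattice_injective ht (k' := 0) (l' := 0) (by push_cast; linear_combination -h0))
  have hc : ∀ k l : ℤ, ContDiff ℂ ∞ fun t : ℂ => (-(k + l * t) : ℂ) := fun k l => by fun_prop
  induction hD using Submonoid.closure_induction with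
  | mem f hf =>
    obtain ⟨a, b, hab, k, l, rfl⟩ := hf
    by_cases h0 : (a = i ∧ b = i.succAbove j ∨ a = i.succAbove j ∧ b = i) ∧ k = 0 ∧ l = 0
    · obtain ⟨⟨rfl, rfl⟩ | ⟨rfl, rfl⟩, rfl, rfl⟩ := h0
      · exact ⟨1, fun _ => 1, contDiff_const, fun x => by simp [famEq], fun _ => 1, 1, contDiff_const,
          fun _ _ => one_ne_zero, one_mem _, fun q => by simp⟩
      · exact ⟨1, fun _ => -1, contDiff_const, fun x => by simp [famEq], fun _ => -1, 1, contDiff_const,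
          fun _ _ => by simp, one_mem _, fun q => by simp⟩
    · have key : ∃ (c : ℂ → ℂ) (D₁ : ℂ^n × ℂ → ℂ), ContDiff ℂ ∞ c ∧ (∀ t, 0 < t.im → c t ≠ 0) ∧
          D₁ ∈ FamDenom n ∧ ∀ q : ℂ^n × ℂ, famEq a b k l (ins i (q.1 j, q.1), q.2) = c q.2 * D₁ q := by
        have hone : ContDiff ℂ ∞ fun _ : ℂ => (1 : ℂ) := contDiff_const
        have h1 : ∀ t : ℂ, 0 < t.im → (1 : ℂ) ≠ 0 := fun _ _ => one_ne_zero
        rcases Fin.eq_self_or_eq_succAbove i a with ha | ⟨a', ha⟩ <;>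
          rcases Fin.eq_self_or_eq_succAbove i b with hb | ⟨b', hb⟩ <;> subst ha <;> subst hb
        · exact absurd rfl hab
        · by_cases hj : b' = j
          · subst hj
            exact ⟨_, 1, hc k l, hne k l fun h => h0 ⟨Or.inl ⟨rfl, rfl⟩, h⟩, one_mem _, fun q => by
              simp [famEq]⟩
          · exact ⟨fun _ => 1, famEq j b' k l, hone, h1, famEq_mem (Ne.symm hj) k l, fun q => by simp [famEq]⟩
        · by_cases hj : a' = j
          · subst hj
            exact ⟨_, 1, hc k l, hne k l fun h => h0 ⟨Or.inr ⟨rfl, rfl⟩, h⟩, one_mem _, fun q => by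
              simp [famEq]⟩
          · exact ⟨fun _ => 1, famEq a' j k l, hone, h1, famEq_mem hj k l, fun q => by simp [famEq]⟩
        · exact ⟨fun _ => 1, famEq a' b' k l, hone, h1,
            famEq_mem (fun h => hab (by rw [h])) k l, fun q => by simp [famEq]⟩
      exact ⟨0, _, contDiff_famEq a b k l, fun x => by simp, key⟩
  | one => exact ⟨0, fun _ => 1, contDiff_const, fun x => by simp, fun _ => 1, 1, contDiff_const,
      fun _ _ => one_ne_zero, one_mem _, fun q => by simp⟩
  | mul f g _ _ hf hg =>
    obtain ⟨M, D', h1, h2, c, D₁, h3, h4, h5, h6⟩ := hf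
    obtain ⟨M', E', k1, k2, d, E₁, k3, k4, k5, k6⟩ := hg
    exact ⟨M + M', fun x => D' x * E' x, h1.mul k1, fun x => by rw [Pi.mul_apply, h2, k2]; ring,
      fun t => c t * d t, D₁ * E₁, h3.mul k3, fun t ht => mul_ne_zero (h4 t ht) (k4 t ht),
      mul_mem h5 k5, fun q => by simp only [h6, k6, Pi.mul_apply]; ring⟩

lemma ins_notMem_of_eventually (i : Fin (n + 1)) (τ : ℍ) (hz : z ∉ bigDiagonal n τ)
    (c : ℂ) : ∀ᶠ w in 𝓝[≠] c, ins i (w, z) ∉ bigDiagonal (n + 1) τ :=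
  (eventually_notMem_poleSet z c).mono fun _ hw => (ins_notMem_bigDiagonal i).2 ⟨hz, notMem_poleSet.1 hw⟩

/-- Locally `Φ = (h / D') / (z_i - z_j) ^ M` with `D'` not vanishing on the diagonal `z_i = z_j` off
the others. The Laurent coefficients are normalized `z_i`-derivatives of `h / D'` restricted to that
diagonal; by `dz_iterate_quot` their denominators are powers of `D'`, so they are of the same type
in one variable less. -/
lemma IsFam.exists_laurent_local {Φ : ℂ^(n + 1) × ℂ → ℂ} (hΦ : IsFam Φ) (i : Fin (n + 1))
    (j : Fin n) {p : ℂ^n × ℂ} (hp : 0 < p.2.im) : ∃ (U : Set (ℂ^n × ℂ)) (M : ℕ),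
      IsOpen U ∧ p ∈ U ∧ (∀ x ∈ U, x ∈ offDiag n → ∃ (N : ℕ) (h : ℂ → ℂ), Smooth h ∧
        ∀ᶠ w in 𝓝[≠] (x.1 j), Φ (ins i (w, x.1), x.2) = h w / (w - x.1 j) ^ (N + 1)) ∧
      ∀ k : ℕ, ∃ (h D : ℂ^n × ℂ → ℂ), ContDiffOn ℂ ∞ h U ∧ D ∈ FamDenom n ∧
        (M ≤ k → ∀ x ∈ U, h x = 0) ∧ ∀ x ∈ U, x ∈ offDiag n →
          HasRes (fun w => (w - x.1 j) ^ k * Φ (ins i (w, x.1), x.2)) (x.1 j) (h x / D x) := by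
  obtain ⟨U, h, D, hU, hpU, hh, hD, e⟩ := hΦ (ins i (p.1 j, p.1), p.2) hp
  obtain ⟨M, D', hD', eD, c, D₁, hc, hc0, hD₁, eD'⟩ := exists_factor_of_mem_FamDenom i j hD
  let δ : ℂ^n × ℂ → ℂ^(n + 1) × ℂ := fun x => (ins i (x.1 j, x.1), x.2)
  have hδ : ContDiff ℂ ∞ δ := by
    refine ContDiff.prodMk ((ins i).contDiff.comp (ContDiff.prodMk ?_ contDiff_fst)) contDiff_snd
    exact (contDiff_apply ℂ ℂ j).comp contDiff_fst
  let v : ℂ^(n + 1) × ℂ := (Pi.single i 1, 0)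
  have hline : ∀ (w : ℂ) (x : ℂ^n × ℂ),
      ((ins i (w, x.1), x.2) : ℂ^(n + 1) × ℂ) = (ins i (0, x.1), x.2) + w • v := by
    intro w x
    refine Prod.ext ?_ (by simp [v])
    have := ins_add_left i 0 w x.1
    rw [zero_add] at this
    simp [v, this, ← Pi.single_smul]
  have hVo : IsOpen (δ ⁻¹' U ∩ {x | 0 < x.2.im}) := (hU.preimage hδ.continuous).inter
    (isOpen_lt continuous_const (continuous_im.comp continuous_snd))
  have main : ∀ x ∈ δ ⁻¹' U ∩ {x | 0 < x.2.im}, x ∈ offDiag n → ∃ H : ℂ → ℂ, Smooth H ∧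
      (∀ᶠ w in 𝓝[≠] (x.1 j), Φ (ins i (w, x.1), x.2) = H w / (w - x.1 j) ^ M) ∧
      ∀ m, (dz 1)^[m] H (x.1 j) = quotNum v h D' m (δ x) / D' (δ x) ^ (m + 1) := by
    intro x hx hoff
    have hne : D' (δ x) ≠ 0 := by rw [eD']; exact mul_ne_zero (hc0 _ hx.2) (ne_zero_of_mem_FamDenom hD₁ hoff)
    set y : ℂ^(n + 1) × ℂ := (ins i (0, x.1), x.2) with hy
    have hδx : δ x = y + x.1 j • v := hline _ _
    have hL := hasDerivAt_line y v
    have hV : IsOpen {w : ℂ | y + w • v ∈ U ∧ D' (y + w • v) ≠ 0} := (hU.preimage (by fun_prop)).inter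
        (isOpen_ne_fun (hD'.continuous.comp (by fun_prop)) continuous_const)
    have hxV : x.1 j ∈ {w : ℂ | y + w • v ∈ U ∧ D' (y + w • v) ≠ 0} := by
      rw [mem_ofPred_eq, ← hδx]; exact ⟨hx.1, hne⟩
    have hq : SmoothOn (fun w : ℂ => h (y + w • v) / D' (y + w • v))
        {w : ℂ | y + w • v ∈ U ∧ D' (y + w • v) ≠ 0} := by
      have hl : ContDiff ℂ ∞ fun w : ℂ => y + w • v := by fun_prop
      exact ((hh.comp hl.contDiffOn fun w hw => hw.1).div (hD'.comp hl).contDiffOn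
        fun w hw => hw.2).restrict_scalars ℝ
    obtain ⟨H, hH, eH⟩ := exists_isTest_eventuallyEq (hV.mem_nhds hxV) hq
    refine ⟨H, hH.1, ?_, fun m => ?_⟩
    · have hoff' := ins_notMem_of_eventually i ⟨x.2, hx.2⟩ hoff.2 (x.1 j)
      filter_upwards [hoff', nhdsWithin_le_nhds eH, nhdsWithin_le_nhds (hV.mem_nhds hxV)] with w h1 h2 h3
      rw [hline, e _ h3.1 (by rw [← hline]; exact ⟨hx.2, h1⟩), h2, eD, ← hline]
      simp only [ins_apply, Fin.insertNth_apply_same, Fin.insertNth_apply_succAbove]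
      rw [mul_comm, div_div]
    · rw [(dz_iterate_eventuallyEq 1 m eH).self_of_nhds, hδx]
      exact dz_iterate_quot hU hh hD' y m hxV.1 hxV.2
  refine ⟨δ ⁻¹' U ∩ {x | 0 < x.2.im}, M, hVo, ⟨hpU, hp⟩, fun x hx hoff => ?_, fun k => ?_⟩
  · obtain ⟨H, hH, eH, -⟩ := main x hx hoff
    refine ⟨M, fun w => (w - x.1 j) * H w, (contDiff_id.sub contDiff_const).mul hH, ?_⟩
    filter_upwards [eH, self_mem_nhdsWithin] with w h1 h2
    rw [h1, pow_succ', mul_div_mul_left _ _ (sub_ne_zero.2 h2)]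
  -- The residue of `(z_i - z_j) ^ k Φ` is the Taylor coefficient of order `M - 1 - k`. The
  -- subtraction is truncated, and the case `M ≤ k`, where the coefficient is zero, is separated by
  -- the `if`.
  · set m := M - (k + 1) with hm
    refine ⟨fun x => if k + 1 ≤ M then 1 / (m ! : ℂ) * (quotNum v h D' m (δ x) / c x.2 ^ (m + 1))
      else 0, D₁ ^ (m + 1), ?_, pow_mem hD₁ _, fun hk x _ => if_neg (by omega), fun x hx hoff => ?_⟩
    · split_ifs
      · refine contDiffOn_const.mul (ContDiffOn.div ?_ ((hc.comp contDiff_snd).pow _).contDiffOn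
          fun x hx => pow_ne_zero _ (hc0 _ hx.2))
        exact (contDiffOn_quotNum hU hh hD' m).comp hδ.contDiffOn fun x hx => hx.1
      · exact contDiffOn_const
    · obtain ⟨H, hH, eH, hder⟩ := main x hx hoff
      refine ⟨M, fun w => (w - x.1 j) ^ (k + 1) * H w, ((contDiff_id.sub contDiff_const).pow _).mul hH, ?_, ?_⟩
      · filter_upwards [eH, self_mem_nhdsWithin] with w h1 h2
        have : w - x.1 j ≠ 0 := sub_ne_zero.2 h2
        rw [h1]
        field_simp
        ring
      · rw [dz_iterate_sub_pow_mul hH]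
        split_ifs
        · rw [hder, eD', Pi.pow_apply, mul_pow, mul_div_assoc, div_div]
        · simp

/-- The Laurent coefficients of `Φ` in the variable `z_i` along a diagonal. -/
lemma IsFam.exists_laurent {Φ : ℂ^(n + 1) × ℂ → ℂ} (hΦ : IsFam Φ) (hell : IsElliptic Φ)
    (i : Fin (n + 1)) (j : Fin n) : ∃ (K : ℕ) (a : ℕ → ℂ^n × ℂ → ℂ), (∀ k, IsFam (a k)) ∧
      (∀ k, IsElliptic (a k)) ∧ (∀ k, K ≤ k → ∀ x ∈ offDiag n, a k x = 0) ∧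
      ∀ x ∈ offDiag n, (∃ (N : ℕ) (h : ℂ → ℂ), Smooth h ∧
        ∀ᶠ w in 𝓝[≠] (x.1 j), Φ (ins i (w, x.1), x.2) = h w / (w - x.1 j) ^ (N + 1)) ∧
        ∀ k, HasRes (fun w => (w - x.1 j) ^ k * Φ (ins i (w, x.1), x.2)) (x.1 j) (a k x) := by
  have hex : ∀ (k : ℕ) (x : ℂ^n × ℂ), ∃ r, x ∈ offDiag n →
      HasRes (fun w => (w - x.1 j) ^ k * Φ (ins i (w, x.1), x.2)) (x.1 j) r := by
    intro k x
    by_cases hx : x ∈ offDiag n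
    · obtain ⟨U, M, hU, hxU, -, h⟩ := hΦ.exists_laurent_local i j hx.1
      obtain ⟨h, D, -, -, -, hr⟩ := h k
      exact ⟨_, fun _ => hr x hxU hx⟩
    · exact ⟨0, fun h => absurd h hx⟩
  choose a ha using hex
  have hfam : ∀ k, IsFam (a k) := fun k p hp => by
    obtain ⟨U, M, hU, hpU, -, h⟩ := hΦ.exists_laurent_local i j hp
    obtain ⟨h, D, hh, hD, -, hr⟩ := h k
    exact ⟨U, h, D, hU, hpU, hh, hD, fun x hx hoff => (ha k x hoff).unique (hr x hx hoff)⟩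
  -- The bound on the pole order found near a single point is valid everywhere, because a family
  -- that vanishes near one point vanishes identically.
  obtain ⟨U, M, hU, hpU, -, h⟩ := hΦ.exists_laurent_local i j (p := (0, I)) (by simp)
  refine ⟨M, a, hfam, fun k τ z hz l hl => ?_, fun k hk => ?_, fun x hx => ⟨?_, fun k => ha k x hx⟩⟩
  · have hz' : z + l ∉ bigDiagonal n τ := fun h => hz ((add_mem_bigDiagonal_iff hl).1 h)
    have h1 := (ha k (z + l, τ) ⟨τ.im_pos, hz'⟩).comp_add (c := z j) (l j)
    refine HasRes.unique (h1.congr ?_) (ha k (z, τ) ⟨τ.im_pos, hz⟩)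
    filter_upwards [ins_notMem_of_eventually i τ hz (z j)] with w hw
    have h2 : ins i (w + l j, z + l) = ins i (w, z) + ins i (l j, l) := by rw [← map_add]; rfl
    have h3 : ∀ m, ins i (l j, l) m ∈ lattice τ := fun m => by
      refine Fin.succAboveCases i ?_ (fun m => ?_) m <;> simp [hl]
    have h4 := hell τ _ hw _ h3
    simp only [Pi.add_apply, h2] at h4 ⊢
    rw [h4]
    congr 2
    ring
  · refine (hfam k).eq_zero (p := (0, I)) (by simp) ?_
    filter_upwards [hU.mem_nhds hpU] with x hx hoff
    obtain ⟨h, D, -, -, h0, hr⟩ := h k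
    rw [(ha k x hoff).unique (hr x hx hoff), h0 hk x hx, zero_div]
  · obtain ⟨U, M, hU, hpU, h, -⟩ := hΦ.exists_laurent_local i j hx.1
    exact h x hpU hx

section

/-! ### Expansions in powers of `1 / im τ` -/

section Expansions

variable {f g f₀ g₀ : ℍ → ℂ}

lemma HasHolomorphicLimit.pad (hf : HasHolomorphicLimit f f₀) : ∃ N, ∀ M, N ≤ M → ∃ c,
    IsAlmostHolomorphicExpansion f M c ∧ c 0 = f₀ := by
  obtain ⟨N, c, ⟨hc, e⟩, h0⟩ := hf
  refine ⟨N, fun M hM => ⟨fun i => if i ≤ N then c i else 0, ⟨fun i => ?_, fun τ => ?_⟩, by simp [h0]⟩⟩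
  · by_cases h : i ≤ N
    · simpa [h] using hc i
    · simp only [if_neg h]
      exact mdifferentiable_const
  · rw [e τ]
    refine Finset.sum_congr_of_eq_on_inter (fun i _ h => ?_) (fun i hi h => ?_) fun i hi _ => ?_
    · simp only [mem_range] at *; omega
    · simp only [mem_range] at h; simp [show ¬ i ≤ N by omega]
    · simp only [mem_range] at hi; simp [show i ≤ N by omega]

lemma HasHolomorphicLimit.add (hf : HasHolomorphicLimit f f₀) (hg : HasHolomorphicLimit g g₀) :
    HasHolomorphicLimit (fun τ => f τ + g τ) fun τ => f₀ τ + g₀ τ := by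
  obtain ⟨N, hN⟩ := hf.pad
  obtain ⟨M, hM⟩ := hg.pad
  obtain ⟨c, ⟨hc, ec⟩, rfl⟩ := hN (max N M) (le_max_left _ _)
  obtain ⟨d, ⟨hd, ed⟩, rfl⟩ := hM (max N M) (le_max_right _ _)
  refine ⟨max N M, fun i τ => c i τ + d i τ, ⟨fun i => (hc i).add (hd i), fun τ => ?_⟩, rfl⟩
  simp only [ec, ed, ← sum_add_distrib]
  exact sum_congr rfl fun i _ => (add_div _ _ _).symm

lemma HasHolomorphicLimit.mul_left (hg : MDiff g) (hf : HasHolomorphicLimit f f₀) :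
    HasHolomorphicLimit (fun τ => g τ * f τ) fun τ => g τ * f₀ τ := by
  obtain ⟨N, c, ⟨hc, e⟩, rfl⟩ := hf
  refine ⟨N, fun i τ => g τ * c i τ, ⟨fun i => hg.mul (hc i), fun τ => ?_⟩, rfl⟩
  simp only [e, mul_sum]
  exact sum_congr rfl fun i _ => (mul_div_assoc _ _ _).symm

lemma HasHolomorphicLimit.const_mul (a : ℂ) (hf : HasHolomorphicLimit f f₀) :
    HasHolomorphicLimit (fun τ => a * f τ) fun τ => a * f₀ τ := hf.mul_left mdifferentiable_const

lemma HasHolomorphicLimit.of_holomorphic (hf : MDiff f) : HasHolomorphicLimit f f :=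
  ⟨0, fun _ => f, ⟨fun _ => hf, fun τ => by simp⟩, rfl⟩

lemma HasHolomorphicLimit.sum (s : Finset ι) {f f₀ : ι → ℍ → ℂ}
    (hf : ∀ i ∈ s, HasHolomorphicLimit (f i) (f₀ i)) :
    HasHolomorphicLimit (fun τ => ∑ i ∈ s, f i τ) fun τ => ∑ i ∈ s, f₀ i τ := by
  simpa only [Finset.sum_fn] using sum_rel (R := HasHolomorphicLimit)
    (HasHolomorphicLimit.of_holomorphic mdifferentiable_const) HasHolomorphicLimit.add s hf

/-- Each division by `im τ` shifts the coefficients by one place, so only undivided terms contribute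
to the holomorphic limit. -/
lemma HasHolomorphicLimit.div_im (hf : HasHolomorphicLimit f f₀) (k : ℕ) :
    HasHolomorphicLimit (fun τ => f τ / (τ.im : ℂ) ^ k) fun τ => if k = 0 then f₀ τ else 0 := by
  induction k with
  | zero => simpa using hf
  | succ k ih =>
    obtain ⟨N, c, ⟨hc, ec⟩, -⟩ := ih
    refine ⟨N + 1, fun i => Nat.casesOn i (fun _ => 0) c, ⟨fun i => ?_, fun τ => ?_⟩, ?_⟩
    · cases i with
      | zero => exact mdifferentiable_const
      | succ i => exact hc i
    · have h := ec τ
      simp only at h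
      simp only [pow_succ, ← div_div, h, Finset.sum_range_succ' _ (N + 1), sum_div]
      simp [div_div]
    · simp

lemma HasHolomorphicLimit.congr (hf : HasHolomorphicLimit f f₀) (h : ∀ τ, f τ = g τ) :
    HasHolomorphicLimit g f₀ := (funext h : f = g) ▸ hf

/-- Freeze `im τ` in the denominators to a constant `y`: the resulting function is holomorphic and
vanishes on the line `im τ = y`, hence on all of `ℍ`. For fixed `τ` this yields a polynomial in `1 /
y` with infinitely many zeros. -/
lemma IsAlmostHolomorphicExpansion.eq_zero {c : ℕ → ℍ → ℂ}
    (h : IsAlmostHolomorphicExpansion (fun _ => 0) N c) {i : ℕ} (hi : i ≤ N) : c i = 0 := by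
  obtain ⟨hc, e⟩ := h
  have key : ∀ (y : ℝ), 0 < y → ∀ τ : ℍ, ∑ i ∈ range (N + 1), c i τ / (y : ℂ) ^ i = 0 := by
    intro y hy
    have han : AnalyticOnNhd ℂ (fun w : ℂ => ∑ i ∈ range (N + 1),
        c i (UpperHalfPlane.ofComplex w) / (y : ℂ) ^ i) {w | 0 < w.im} := by
      refine DifferentiableOn.analyticOnNhd ?_ UpperHalfPlane.isOpen_upperHalfPlaneSet
      exact DifferentiableOn.fun_sum fun i _ => (UpperHalfPlane.mdifferentiable_iff.1 (hc i)).div_const _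
    have hpre : IsPreconnected {w : ℂ | 0 < w.im} := (convex_halfSpace_im_gt 0).isPreconnected
    have h0 : (y * I : ℂ) ∈ {w : ℂ | 0 < w.im} := by simpa using hy
    have hz := han.eqOn_zero_of_preconnected_of_frequently_eq_zero hpre h0 ?_
    · intro τ
      simpa using hz (show (τ : ℂ) ∈ {w : ℂ | 0 < w.im} from τ.im_pos)
    · have ht : Tendsto (fun t : ℝ => (y * I + t : ℂ)) (𝓝[≠] 0) (𝓝[≠] (y * I)) := by
        refine tendsto_nhdsWithin_iff.2 ⟨?_, ?_⟩
        · have : Continuous fun t : ℝ => (y * I + t : ℂ) := by fun_prop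
          simpa using (this.tendsto 0).mono_left nhdsWithin_le_nhds
        · filter_upwards [self_mem_nhdsWithin] with t ht
          simpa using ht
      refine ht.frequently (Eventually.frequently (.of_forall fun t => ?_))
      have hp : 0 < (y * I + t : ℂ).im := by simpa using hy
      have := e ⟨_, hp⟩
      rw [UpperHalfPlane.ofComplex_apply_of_im_pos hp]
      simpa [UpperHalfPlane.im] using this.symm
  funext τ
  let P : Polynomial ℂ := ∑ i ∈ range (N + 1), Polynomial.C (c i τ) * Polynomial.X ^ i
  have hP : P = 0 := by
    refine Polynomial.eq_zero_of_infinite_isRoot _ (Set.Infinite.mono (s := range fun k : ℕ =>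
      ((k + 1 : ℝ) : ℂ)) ?_ (Set.infinite_range_of_injective fun a b h => by simpa using h))
    rintro _ ⟨k, rfl⟩
    have := key ((k + 1 : ℝ)⁻¹) (by positivity) τ
    simp only [mem_ofPred_eq, Polynomial.IsRoot, P, Polynomial.eval_finsetSum,
      Polynomial.eval_mul, Polynomial.eval_C, Polynomial.eval_pow, Polynomial.eval_X]
    rw [← this]
    exact sum_congr rfl fun i _ => by push_cast; simp [div_eq_mul_inv]
  have := congrArg (Polynomial.coeff · i) hP
  simpa [P, Polynomial.finsetSum_coeff, Polynomial.coeff_C_mul, Polynomial.coeff_X_pow,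
    show i < N + 1 by omega] using this

lemma HasHolomorphicLimit.unique (hf : HasHolomorphicLimit f f₀) (hf' : HasHolomorphicLimit f g₀) :
    f₀ = g₀ := by
  have h := (hf.add (hf'.const_mul (-1))).congr (g := fun _ => 0) fun τ => by ring
  obtain ⟨N, c, hc, h0⟩ := h
  have := hc.eq_zero (Nat.zero_le N)
  rw [h0] at this
  funext τ
  have := congrFun this τ
  simp only [Pi.zero_apply] at this
  linear_combination this

end Expansions

/-! ### Regularized integrals with weights -/

lemma regularizedIntegral_congr {G : ℂ^n → ℂ} (hF : HasHolomorphicPoles τ F)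
    (hG : HasHolomorphicPoles τ G) (h : ∀ z ∉ bigDiagonal n τ, F z = G z) :
    regularizedIntegral τ F = regularizedIntegral τ G := by
  have hr := isReg_regC τ n
  rw [(regularizedIntegral_wellDefined hF).2 _ hr, (regularizedIntegral_wellDefined hG).2 _ hr]
  exact hr.congr (hF.isK (isTest_chi τ n)) fun z hz => by rw [h z hz]

lemma HasHolomorphicPoles.const_mul (a : ℂ) (hF : HasHolomorphicPoles τ F) :
    HasHolomorphicPoles τ fun z => a * F z :=
  HasHolomorphicPoles.smooth_mul contDiff_const (fun _ _ _ _ => rfl) hF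

lemma regularizedIntegral_const_mul (a : ℂ) (hF : HasHolomorphicPoles τ F) :
    regularizedIntegral τ (fun z => a * F z) = a * regularizedIntegral τ F := by
  have hr := isReg_regC τ n
  rw [(regularizedIntegral_wellDefined hF).2 _ hr, (regularizedIntegral_wellDefined (hF.const_mul a)).2 _ hr,
    ← hr.const_mul a (hF.isK (isTest_chi τ n))]
  congr 1; funext z; ring

lemma regularizedIntegral_sum (s : Finset ι) {F : ι → ℂ^n → ℂ} (hF : ∀ i ∈ s, HasHolomorphicPoles τ (F i)) :
    regularizedIntegral τ (fun z => ∑ i ∈ s, F i z) = ∑ i ∈ s, regularizedIntegral τ (F i) := by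
  have hr := isReg_regC τ n
  rw [(regularizedIntegral_wellDefined (HasHolomorphicPoles.sum s hF)).2 _ hr,
    sum_congr rfl fun i hi => (regularizedIntegral_wellDefined (hF i hi)).2 _ hr,
    ← hr.sum s fun i hi => (hF i hi).isK (isTest_chi τ n)]
  congr 1; funext z; rw [mul_sum]

/-- Smooth functions on `ℝⁿ / ℤⁿ`. -/
def IsWeight (ρ : ℝ^n → ℂ) : Prop := Smooth ρ ∧ ∀ (y : ℝ^n) (m : Fin n → ℤ), ρ (y + fun i => (m i : ℝ)) = ρ y

/-- The coordinates `im z_i / im τ`. -/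
def heights (n : ℕ) (τ : ℍ) : ℂ^n →L[ℝ] ℝ^n := ContinuousLinearMap.pi fun i => (yc τ).comp (proj i)

lemma heights_apply (z : ℂ^n) (i : Fin n) : heights n τ z i = yc τ (z i) := rfl

/-- The normalized regularized integral of `Φ` with a weight depending on the heights. -/
def wreg (Φ : ℂ^n × ℂ → ℂ) (ρ : ℝ^n → ℂ) (τ : ℍ) : ℂ :=
  regularizedIntegral τ (fun z => ρ (heights n τ z) * Φ (z, τ)) / (τ.im : ℂ) ^ n

lemma exists_int_of_mem_lattice (hw : w ∈ lattice τ) : ∃ l : ℤ, yc τ w = l := by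
  obtain ⟨k, l, rfl⟩ := hw
  exact ⟨l, by simpa using yc_coord τ k l⟩

lemma IsWeight.isPeriodic {ρ : ℝ^n → ℂ} (hρ : IsWeight ρ) : IsPeriodic τ fun z => ρ (heights n τ z) := by
  intro z _ l hl
  choose m hm using fun i => exists_int_of_mem_lattice (hl i)
  simp only [map_add]
  rw [← hρ.2 (heights n τ z) m]
  congr 2
  exact funext hm

variable {ρ ρ' : ℝ^n → ℂ}

lemma IsWeight.hasHolomorphicPoles (hρ : IsWeight ρ) (hΦ : IsFam Φ) (hell : IsElliptic Φ) :
    HasHolomorphicPoles τ fun z => ρ (heights n τ z) * Φ (z, τ) :=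
  HasHolomorphicPoles.smooth_mul (hρ.1.comp (heights n τ).contDiff) hρ.isPeriodic
    (hΦ.hasHolomorphicPoles hell τ)

lemma wreg_const_mul (hΦ : IsFam Φ) (hell : IsElliptic Φ) (a : ℂ) (hρ : IsWeight ρ) :
    wreg Φ (fun y => a * ρ y) τ = a * wreg Φ ρ τ := by
  simp only [wreg, mul_assoc]
  rw [regularizedIntegral_const_mul a (hρ.hasHolomorphicPoles hΦ hell), mul_div_assoc]

lemma wreg_add (hΦ : IsFam Φ) (hell : IsElliptic Φ) (hρ : IsWeight ρ) (hρ' : IsWeight ρ') :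
    wreg Φ (fun y => ρ y + ρ' y) τ = wreg Φ ρ τ + wreg Φ ρ' τ := by
  have := regularizedIntegral_sum (τ := τ) Finset.univ
    (F := fun (b : Bool) z => (if b then ρ else ρ') (heights n τ z) * Φ (z, τ))
    fun b _ => by cases b; exacts [hρ'.hasHolomorphicPoles hΦ hell, hρ.hasHolomorphicPoles hΦ hell]
  simp only [Fintype.univ_bool, mem_singleton, Bool.true_eq_false, not_false_eq_true,
    sum_insert, sum_singleton, if_true, Bool.false_eq_true, if_false] at this
  simp only [wreg, add_mul, this, add_div]

lemma IsWeight.const (a : ℂ) : IsWeight fun _ : ℝ^n => a := ⟨contDiff_const, fun _ _ => rfl⟩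

lemma IsWeight.add (hρ : IsWeight ρ) (hρ' : IsWeight ρ') : IsWeight fun y => ρ y + ρ' y :=
  ⟨hρ.1.add hρ'.1, fun y m => by simp only [hρ.2, hρ'.2]⟩

lemma IsWeight.const_mul (a : ℂ) (hρ : IsWeight ρ) : IsWeight fun y => a * ρ y :=
  ⟨contDiff_const.mul hρ.1, fun y m => by simp only [hρ.2]⟩

end

/-! ### Integration by parts in the heights -/

/-- The derivative in the `i`-th coordinate. -/
def pd (i : Fin n) (ρ : ℝ^n → ℂ) (y : ℝ^n) : ℂ := fderiv ℝ ρ y (Pi.single i 1)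

lemma IsWeight.pd {ρ : ℝ^n → ℂ} (hρ : IsWeight ρ) (i : Fin n) : IsWeight (EllipticConfig.pd i ρ) := by
  refine ⟨(hρ.1.fderiv_right (m := ∞) (by simp)).clm_apply contDiff_const, fun y m => ?_⟩
  have h : (fun y => ρ (y + fun i => (m i : ℝ))) = ρ := funext fun y => hρ.2 y m
  simp only [EllipticConfig.pd, ← fderiv_comp_add_right, h]

lemma IsWeight.pd_iterate {ρ : ℝ^n → ℂ} (hρ : IsWeight ρ) (i : Fin n) (k : ℕ) :
    IsWeight ((EllipticConfig.pd i)^[k] ρ) := by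
  induction k with
  | zero => exact hρ
  | succ k ih => rw [iterate_succ_apply']; exact ih.pd i

section Chain

variable {ρ : ℝ^n → ℂ} (i : Fin n) {φ : E → ℝ^n} {A : E →L[ℝ] ℝ^n} {x v : E}

/-- The hypotheses describe how the heights move along a coordinate `z_i`: not at all in the real
direction, and at speed `1 / im τ` in the imaginary one. -/
lemma dz_weight (hρ : DifferentiableAt ℝ ρ (φ x)) (hφ : HasFDerivAt φ A x) (h1 : A v = 0)
    (hI : A (I • v) = Pi.single i (τ.im)⁻¹) : dz v (fun x => ρ (φ x)) x = -I / 2 / τ.im * pd i ρ (φ x) ∧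
      dzbar v (fun x => ρ (φ x)) x = I / 2 / τ.im * pd i ρ (φ x) := by
  have h : HasFDerivAt (fun x => ρ (φ x)) ((fderiv ℝ ρ (φ x)).comp A) x := hρ.hasFDerivAt.comp x hφ
  have hs : (Pi.single i (τ.im)⁻¹ : ℝ^n) = (τ.im)⁻¹ • Pi.single i 1 := by
    rw [← Pi.single_smul, smul_eq_mul, mul_one]
  simp only [dz, dzbar, h.fderiv, ContinuousLinearMap.comp_apply, h1, hI, hs, map_smul, map_zero, pd,
    real_smul, Complex.ofReal_inv]
  constructor <;> ring

end Chain

lemma yc_I : yc τ I = (τ.im)⁻¹ := by simp [yc_apply]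

lemma heights_ins (i : Fin (n + 1)) (w : ℂ) (z : ℂ^n) :
    heights (n + 1) τ (ins i (w, z)) = i.insertNth (α := fun _ => ℝ) (yc τ w) (heights n τ z) := by
  funext k
  refine Fin.succAboveCases i ?_ (fun k => ?_) k <;> simp [heights_apply]

lemma heights_single (i : Fin n) (w : ℂ) : heights n τ (Pi.single i w) = Pi.single i (yc τ w) := by
  funext k
  rcases eq_or_ne k i with rfl | h <;> simp [heights_apply, *]

lemma dz_iterate_weight {ρ : ℝ^(n + 1) → ℂ} (hρ : Smooth ρ) (i : Fin (n + 1))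
    (z : ℂ^n) (k : ℕ) : (dz 1)^[k] (fun w : ℂ => ρ (heights (n + 1) τ (ins i (w, z)))) =
      fun w => (-I / 2 / τ.im) ^ k * (pd i)^[k] ρ (heights (n + 1) τ (ins i (w, z))) := by
  induction k generalizing ρ with
  | zero => simp
  | succ k ih =>
    have hpd : Smooth (pd i ρ) := (hρ.fderiv_right (m := ∞) (by simp)).clm_apply contDiff_const
    have hc : Smooth fun w : ℂ => heights (n + 1) τ (ins i (w, z)) :=
      (heights (n + 1) τ).contDiff.comp (((ins i).contDiff.restrict_scalars ℝ).comp
        (contDiff_id.prodMk contDiff_const))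
    have h1 : dz 1 (fun w : ℂ => ρ (heights (n + 1) τ (ins i (w, z)))) =
        fun w => -I / 2 / τ.im * pd i ρ (heights (n + 1) τ (ins i (w, z))) := by
      funext w
      have hd := (heights (n + 1) τ).hasFDerivAt.comp w ((hasFDerivAt_ins_left i w z).restrictScalars ℝ)
      have hA : ∀ u : ℂ, heights (n + 1) τ (ins i (u, (0 : ℂ^n))) = Pi.single i (yc τ u) := by
        intro u
        have := ins_add_left i 0 u (0 : ℂ^n)
        rw [zero_add, show ((0 : ℂ), (0 : ℂ^n)) = 0 from rfl, map_zero, zero_add] at this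
        rw [this, heights_single]
      refine (dz_weight i (φ := fun w : ℂ => heights (n + 1) τ (ins i (w, z))) (hρ.differentiable (by simp) _)
        hd ?_ ?_).1
      · exact (hA 1).trans (by simp [yc_one])
      · exact (hA (I • 1)).trans (by simp [yc_I])
    rw [iterate_succ_apply, h1,
      dz_iterate_const_mul (h := fun w => pd i ρ (heights (n + 1) τ (ins i (w, z)))) k _ (hpd.comp hc), ih hpd]
    funext w
    simp only [iterate_succ_apply]
    ring

/-- Restriction of a weight to the wall `y_i = y_j`. -/
def wall (i : Fin (n + 1)) (j : Fin n) (ρ : ℝ^(n + 1) → ℂ) (y : ℝ^n) : ℂ :=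
  ρ (i.insertNth (α := fun _ => ℝ) (y j) y)

lemma IsWeight.wall {ρ : ℝ^(n + 1) → ℂ} (hρ : IsWeight ρ) (i : Fin (n + 1)) (j : Fin n) :
    IsWeight (EllipticConfig.wall i j ρ) := by
  refine ⟨hρ.1.comp (contDiff_pi.2 fun k => ?_), fun y m => ?_⟩
  · refine Fin.succAboveCases i ?_ (fun k => ?_) k
    · simpa using contDiff_apply ℝ ℝ j
    · simpa using contDiff_apply ℝ ℝ k
  · rw [EllipticConfig.wall, EllipticConfig.wall,
      ← hρ.2 (i.insertNth (α := fun _ => ℝ) (y j) y) (i.insertNth (α := fun _ => ℤ) (m j) m)]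
    congr 1
    funext k
    refine Fin.succAboveCases i ?_ (fun k => ?_) k <;> simp

/-- As `Φ` is holomorphic, `∂̄_i` acts on `V(y) Φ` only through the weight, where it is `i / (2 im
τ)` times `∂/∂y_i`; the residue formula then integrates `∂V/∂y_i · Φ`. At `z_i = z_j` the Taylor
expansion of `V` in `z_i` pairs the derivative of order `k`, with its factor `(-i / (2 im τ)) ^ k`,
with the Laurent coefficient `a j k`. The remaining factor `im τ` accounts for the normalization in
one variable less. -/
lemma wreg_pd {Φ : ℂ^(n + 1) × ℂ → ℂ} (hΦ : IsFam Φ) (hell : IsElliptic Φ) (i : Fin (n + 1))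
    {K : Fin n → ℕ} {a : Fin n → ℕ → ℂ^n × ℂ → ℂ} (haf : ∀ j k, IsFam (a j k))
    (hae : ∀ j k, IsElliptic (a j k)) (haK : ∀ j k, K j ≤ k → ∀ x ∈ offDiag n, a j k x = 0)
    (ha : ∀ j, ∀ x ∈ offDiag n, (∃ (N : ℕ) (h : ℂ → ℂ), Smooth h ∧
        ∀ᶠ w in 𝓝[≠] (x.1 j), Φ (ins i (w, x.1), x.2) = h w / (w - x.1 j) ^ (N + 1)) ∧
        ∀ k, HasRes (fun w => (w - x.1 j) ^ k * Φ (ins i (w, x.1), x.2)) (x.1 j) (a j k x))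
    {V : ℝ^(n + 1) → ℂ} (hV : IsWeight V) : wreg Φ (pd i V) τ = ∑ j, ∑ k ∈ range (K j), 2 * pi * I *
      (1 / (k ! : ℂ) * (-I / 2) ^ k) * (wreg (a j k) (wall i j ((pd i)^[k] V)) τ / (τ.im : ℂ) ^ k) := by
  have hIm : (τ.im : ℂ) ≠ 0 := by exact_mod_cast τ.im_pos.ne'
  have hG := ((hV.pd i).hasHolomorphicPoles hΦ hell (τ := τ)).const_mul (I / 2 / τ.im)
  have hT : ∀ j k, HasHolomorphicPoles τ fun z =>
      wall i j ((pd i)^[k] V) (heights n τ z) * a j k (z, τ) := fun j k =>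
    ((hV.pd_iterate i k).wall i j).hasHolomorphicPoles (haf j k) (hae j k)
  have main := regularizedIntegral_dzbar i (hV.hasHolomorphicPoles hΦ hell (τ := τ)) hG
    (fun z hz => ?_) (R := fun j z => ∑ k ∈ range (K j), (1 / (k ! : ℂ) * (-I / 2 / τ.im) ^ k) *
        (wall i j ((pd i)^[k] V) (heights n τ z) * a j k (z, τ)))
    (fun j => HasHolomorphicPoles.sum _ fun k _ => (hT j k).const_mul _) fun z hz j => ?_
  · rw [regularizedIntegral_const_mul _ ((hV.pd i).hasHolomorphicPoles hΦ hell)] at main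
    have h2 : regularizedIntegral τ (fun z => pd i V (heights (n + 1) τ z) * Φ (z, τ)) =
        2 * pi * I * τ.im * ∑ j, ∑ k ∈ range (K j), (1 / (k ! : ℂ) * (-I / 2 / τ.im) ^ k) *
            regularizedIntegral τ fun z => wall i j ((pd i)^[k] V) (heights n τ z) * a j k (z, τ) := by
      rw [sum_congr rfl fun j _ => (regularizedIntegral_sum _ fun k _ =>
        (hT j k).const_mul _).trans (sum_congr rfl fun k _ => regularizedIntegral_const_mul _ (hT j k))] at main
      generalize (∑ j, ∑ k ∈ range (K j), (1 / (k ! : ℂ) * (-I / 2 / τ.im) ^ k) *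
        regularizedIntegral τ fun z => wall i j ((pd i)^[k] V) (heights n τ z) * a j k (z, τ)) = S at main ⊢
      field_simp at main
      linear_combination (-I) * main + (regularizedIntegral τ
        (fun z => pd i V (heights (n + 1) τ z) * Φ (z, τ))) * I_sq
    rw [wreg, h2, mul_sum, sum_div]
    refine sum_congr rfl fun j _ => ?_
    rw [mul_sum, sum_div]
    refine sum_congr rfl fun k _ => ?_
    rw [wreg, div_pow, pow_succ]
    field_simp
  · have hd : DifferentiableAt ℂ (fun z => Φ (z, (τ : ℂ))) z := by
      have := (hΦ.contDiffOn.contDiffAt ((isOpen_offDiag _).mem_nhds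
        (show (z, (τ : ℂ)) ∈ offDiag (n + 1) from ⟨τ.im_pos, hz⟩))).differentiableAt (by simp)
      exact this.comp z (by fun_prop)
    have hVd : DifferentiableAt ℝ (fun z => V (heights (n + 1) τ z)) z :=
      (hV.1.comp (heights (n + 1) τ).contDiff).differentiable (by simp) z
    rw [dzbar_mul _ hVd (hd.restrictScalars ℝ), dzbar_of_holomorphic _ hd, mul_zero, add_zero]
    have := (dz_weight (τ := τ) i (φ := heights (n + 1) τ) (v := Pi.single i 1) (x := z)
      (hV.1.differentiable (by simp) _) (heights (n + 1) τ).hasFDerivAt (by simp [heights_single, yc_one]) (by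
        rw [← Pi.single_smul, heights_single]; simp [yc_I])).2
    rw [this]
    ring
  · obtain ⟨⟨N, h, hh, e⟩, hres⟩ := ha j (z, τ) ⟨τ.im_pos, hz⟩
    have hc : Smooth fun w : ℂ => V (heights (n + 1) τ (ins i (w, z))) :=
      hV.1.comp ((heights (n + 1) τ).contDiff.comp (((ins i).contDiff.restrict_scalars ℝ).comp
        (contDiff_id.prodMk contDiff_const)))
    have := HasRes.smooth_mul hc hh e hres fun k hk => haK j k hk (z, τ) ⟨τ.im_pos, hz⟩
    convert this using 1
    refine sum_congr rfl fun k _ => ?_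
    rw [dz_iterate_weight hV.1]
    simp only [heights_ins, wall, heights_apply]
    ring

section

/-! ### Averages and primitives of weights -/

/-- The average over the `i`-th coordinate. -/
def avg (i : Fin n) (ρ : ℝ^n → ℂ) (y : ℝ^n) : ℂ := ∫ t in Icc (0 : ℝ) 1, ρ (update y i t)

/-- The primitive in the `i`-th coordinate. -/
def prim (i : Fin n) (ρ : ℝ^n → ℂ) (y : ℝ^n) : ℂ := ∫ t in (0 : ℝ)..y i, ρ (update y i t)

/-- The `L¹`-norm of a weight. -/
def nrm (ρ : ℝ^n → ℂ) : ℝ := ∫ y in Icc (0 : ℝ^n) 1, ‖ρ y‖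

lemma contDiff_update (i : Fin n) : Smooth fun p : ℝ^n × ℝ => update p.1 i p.2 := by
  refine contDiff_pi.2 fun k => ?_
  rcases eq_or_ne k i with rfl | h
  · simpa using contDiff_snd
  · simp only [Function.update_of_ne h]
    exact (contDiff_apply ℝ ℝ k).comp contDiff_fst

variable {ρ : ℝ^n → ℂ}

lemma IsWeight.update_add (hρ : IsWeight ρ) (i : Fin n) (y : ℝ^n) (m : Fin n → ℤ) (t : ℝ) :
    ρ (update (y + fun i => (m i : ℝ)) i t) = ρ (update y i t) := by
  rw [← hρ.2 (update y i t) (update m i 0)]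
  congr 1
  funext k
  rcases eq_or_ne k i with rfl | h <;> simp [*]

lemma IsWeight.continuous_update (hρ : IsWeight ρ) (i : Fin n) (y : ℝ^n) :
    Continuous fun t => ρ (update y i t) :=
  hρ.1.continuous.comp ((contDiff_update i).continuous.comp (by fun_prop : Continuous fun t => (y, t)))

lemma IsWeight.avg (hρ : IsWeight ρ) (i : Fin n) : IsWeight (EllipticConfig.avg i ρ) := by
  refine ⟨?_, fun y m => by simp only [EllipticConfig.avg, hρ.update_add]⟩
  exact contDiffOn_univ.1 (contDiffOn_integral_param (𝕜 := ℝ) (E := ℝ^n) (Z := ℝ) isCompact_Icc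
    continuousOn_id (W := Set.univ) isOpen_univ isOpen_univ (fun _ _ _ _ => trivial)
    (g := fun p => ρ (update p.1 i p.2)) (hρ.1.comp (contDiff_update i)).contDiffOn)

lemma IsWeight.periodic_update (hρ : IsWeight ρ) (i : Fin n) (y : ℝ^n) :
    Periodic (fun t => ρ (update y i t)) 1 := by
  intro t
  simp only
  rw [← hρ.2 (update y i t) (Pi.single i 1)]
  congr 1
  funext k
  rcases eq_or_ne k i with rfl | h <;> simp [*]

lemma integral_Icc_eq (f : ℝ → ℂ) : ∫ t in Icc (0 : ℝ) 1, f t = ∫ t in (0 : ℝ)..1, f t := by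
  rw [integral_Icc_eq_integral_Ioc, intervalIntegral.integral_of_le zero_le_one]

/-- The increase of the primitive over a period is the average, so vanishing average means
periodicity. Smoothness follows after rescaling the interval of integration to `[0, 1]`. -/
lemma IsWeight.prim (hρ : IsWeight ρ) (i : Fin n) (h0 : ∀ y, EllipticConfig.avg i ρ y = 0) :
    IsWeight (EllipticConfig.prim i ρ) := by
  refine ⟨?_, fun y m => ?_⟩
  · have : EllipticConfig.prim i ρ = fun y => (y i : ℂ) * ∫ s in Icc (0 : ℝ) 1, ρ (update y i (s * y i)) := by
      funext y
      rw [integral_Icc_eq, ← real_smul, intervalIntegral.smul_integral_comp_mul_right fun t => ρ (update y i t)]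
      simp [EllipticConfig.prim]
    rw [this]
    have h1 : Smooth fun y : ℝ^n => (y i : ℂ) := ofRealCLM.contDiff.comp (contDiff_apply ℝ ℝ i)
    refine h1.mul (contDiffOn_univ.1 (contDiffOn_integral_param (𝕜 := ℝ) (E := ℝ^n) (Z := ℝ)
      isCompact_Icc continuousOn_id (W := Set.univ) isOpen_univ isOpen_univ (fun _ _ _ _ => trivial)
      (g := fun p => ρ (update p.1 i (p.2 * p.1 i))) (ContDiff.contDiffOn ?_)))
    exact hρ.1.comp ((contDiff_update i).comp (contDiff_fst.prodMk
      (contDiff_snd.mul ((contDiff_apply ℝ ℝ i).comp contDiff_fst))))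
  · have hp := hρ.periodic_update i y
    have hi : ∀ a b, IntervalIntegrable (fun t => ρ (update y i t)) volume a b :=
      fun a b => (hρ.continuous_update i y).intervalIntegrable a b
    simp only [EllipticConfig.prim, hρ.update_add, Pi.add_apply]
    rw [← intervalIntegral.integral_add_adjacent_intervals (hi 0 (y i)) (hi _ _)]
    have := hp.intervalIntegral_add_zsmul_eq (m i) (y i) (fun a b => hi a b)
    simp only [zsmul_eq_mul, mul_one] at this
    rw [this, hp.intervalIntegral_add_eq (y i) 0, zero_add, ← integral_Icc_eq]
    rw [show (∫ t in Icc (0 : ℝ) 1, ρ (update y i t)) = 0 from h0 y]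
    simp

lemma IsWeight.pd_prim (hρ : IsWeight ρ) (i : Fin n) (h0 : ∀ y, EllipticConfig.avg i ρ y = 0) :
    EllipticConfig.pd i (EllipticConfig.prim i ρ) = ρ := by
  funext y
  have hd := ((hρ.prim i h0).1.differentiable (by simp) y).hasFDerivAt.hasLineDerivAt (Pi.single i 1)
  have h1 : HasDerivAt (fun t : ℝ => EllipticConfig.prim i ρ (y + t • Pi.single i 1)) (ρ y) 0 := by
    have he : ∀ t : ℝ, EllipticConfig.prim i ρ (y + t • Pi.single i 1) =
        ∫ s in (0 : ℝ)..(y i + t), ρ (update y i s) := by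
      intro t
      have : ∀ s, update (y + t • Pi.single i 1) i s = update y i s := fun s => by
        funext k
        rcases eq_or_ne k i with rfl | h <;> simp [*]
      simp [EllipticConfig.prim, this]
    simp only [he]
    have hc := hρ.continuous_update i y
    have := intervalIntegral.integral_hasDerivAt_right (hc.intervalIntegrable 0 (y i + 0))
      (hc.stronglyMeasurableAtFilter _ _) hc.continuousAt
    have := HasDerivAt.scomp (0 : ℝ) (h := fun t => y i + t) this ((hasDerivAt_id' (0 : ℝ)).const_add (y i))
    simpa [comp_def] using this
  exact hd.unique h1

lemma setIntegral_Icc_insertNth {E : Type*} [NormedAddCommGroup E] [NormedSpace ℝ E]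
    (i : Fin (n + 1)) {g : ℝ^(n + 1) → E} (hg : Continuous g) :
    ∫ y in Icc (0 : ℝ^(n + 1)) 1, g y = ∫ y in Icc (0 : ℝ^n) 1,
      ∫ t in Icc (0 : ℝ) 1, g (i.insertNth (α := fun _ => ℝ) t y) := by
  have hm := (volume_preserving_piFinSuccAbove (fun _ : Fin (n + 1) => ℝ) i).symm
  have hpre : (MeasurableEquiv.piFinSuccAbove (fun _ : Fin (n + 1) => ℝ) i).symm ⁻¹' Icc 0 1 =
      Icc (0 : ℝ) 1 ×ˢ Icc (0 : ℝ^n) 1 := by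
    ext p
    have h : (MeasurableEquiv.piFinSuccAbove (fun _ : Fin (n + 1) => ℝ) i).symm p =
      i.insertNth (α := fun _ => ℝ) p.1 p.2 := rfl
    simp only [mem_preimage, h, Set.mem_Icc, Set.mem_prod, Pi.le_def, Fin.forall_iff_succAbove i,
      Fin.insertNth_apply_same, Fin.insertNth_apply_succAbove, Pi.zero_apply, Pi.one_apply]
    tauto
  have hc : Continuous fun p : ℝ × ℝ^n => g (i.insertNth (α := fun _ => ℝ) p.1 p.2) := hg.comp (by fun_prop)
  rw [← hm.setIntegral_preimage_emb (MeasurableEquiv.measurableEmbedding _), hpre, Measure.volume_eq_prod,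
    ← setIntegral_prod_swap, setIntegral_prod]
  · rfl
  · exact (Continuous.continuousOn (hc.comp continuous_swap)).integrableOn_compact
      (isCompact_Icc.prod isCompact_Icc)

lemma update_insertNth (i : Fin (n + 1)) (s t : ℝ) (y : ℝ^n) :
    update (i.insertNth (α := fun _ => ℝ) s y) i t = i.insertNth (α := fun _ => ℝ) t y := by
  funext k
  refine Fin.succAboveCases i ?_ (fun k => ?_) k <;> simp

lemma continuous_integral_insertNth (i : Fin (n + 1)) {g : ℝ^(n + 1) → ℝ} (hg : Continuous g) :
    Continuous fun y : ℝ^n => ∫ t in Icc (0 : ℝ) 1, g (i.insertNth (α := fun _ => ℝ) t y) :=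
  continuous_parametric_integral_of_continuous (f := fun y t => g (i.insertNth (α := fun _ => ℝ) t y))
    (hg.comp (by fun_prop)) isCompact_Icc

lemma integral_avg (hρ : IsWeight ρ) (i : Fin n) :
    ∫ y in Icc (0 : ℝ^n) 1, avg i ρ y = ∫ y in Icc (0 : ℝ^n) 1, ρ y := by
  cases n with
  | zero => exact i.elim0
  | succ n =>
    rw [setIntegral_Icc_insertNth i (hρ.avg i).1.continuous, setIntegral_Icc_insertNth i hρ.1.continuous]
    simp [avg]

lemma norm_avg_le (i : Fin n) (y : ℝ^n) : ‖avg i ρ y‖ ≤ ∫ t in Icc (0 : ℝ) 1, ‖ρ (update y i t)‖ :=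
  norm_integral_le_integral_norm _

lemma nrm_avg_le (hρ : IsWeight ρ) (i : Fin n) : nrm (avg i ρ) ≤ nrm ρ := by
  cases n with
  | zero => exact i.elim0
  | succ n =>
    have h1 := setIntegral_Icc_insertNth i (hρ.avg i).1.continuous.norm
    have h2 := setIntegral_Icc_insertNth i hρ.1.continuous.norm
    rw [nrm, nrm, h1, h2]
    refine setIntegral_mono_on ?_ ?_ measurableSet_Icc fun y _ => ?_
    · exact (continuous_integral_insertNth i (hρ.avg i).1.continuous.norm).continuousOn.integrableOn_compact
        isCompact_Icc
    · exact (continuous_integral_insertNth i hρ.1.continuous.norm).continuousOn.integrableOn_compact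
        isCompact_Icc
    · have := fun t => norm_avg_le (ρ := ρ) i (i.insertNth (α := fun _ => ℝ) t y)
      simp only [avg, update_insertNth] at this ⊢
      simpa using this 0

lemma nrm_nonneg : 0 ≤ nrm ρ := integral_nonneg fun _ => norm_nonneg _

lemma nrm_add_le {ρ' : ℝ^n → ℂ} (hρ : IsWeight ρ) (hρ' : IsWeight ρ') :
    nrm (fun y => ρ y + ρ' y) ≤ nrm ρ + nrm ρ' := by
  have hi : ∀ {σ : ℝ^n → ℂ}, IsWeight σ → IntegrableOn (fun y => ‖σ y‖) (Icc 0 1) :=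
    fun h => h.1.continuous.norm.continuousOn.integrableOn_compact isCompact_Icc
  rw [nrm, nrm, nrm, ← integral_add (hi hρ) (hi hρ')]
  exact integral_mono (hi (hρ.add hρ')) ((hi hρ).add (hi hρ')) fun y => norm_add_le _ _

/-- Restriction to a wall is not controlled by an `L¹`-norm, but for the primitive it is: for
heights in the unit cube, the value at any point is at most the integral of `‖ρ‖` over a full period
of the `i`-th coordinate. -/
lemma nrm_wall_prim_le {ρ : ℝ^(n + 1) → ℂ} (hρ : IsWeight ρ) (i : Fin (n + 1)) (j : Fin n)
    (h0 : ∀ y, avg i ρ y = 0) : nrm (wall i j (prim i ρ)) ≤ nrm ρ := by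
  have hin : Continuous fun p : ℝ^n × ℝ => i.insertNth (α := fun _ => ℝ) p.2 p.1 := by fun_prop
  rw [nrm, nrm, setIntegral_Icc_insertNth i hρ.1.continuous.norm]
  refine setIntegral_mono_on ?_ ?_ measurableSet_Icc fun y hy => ?_
  · exact (((hρ.prim i h0).wall i j).1.continuous.norm.continuousOn).integrableOn_compact isCompact_Icc
  · exact (continuous_integral_insertNth i hρ.1.continuous.norm).continuousOn.integrableOn_compact isCompact_Icc
  · simp only [wall, prim, update_insertNth, Fin.insertNth_apply_same]
    refine (intervalIntegral.norm_integral_le_integral_norm (hy.1 j)).trans ?_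
    rw [intervalIntegral.integral_of_le (hy.1 j)]
    refine setIntegral_mono_set ?_ (.of_forall fun t => norm_nonneg _)
      (.of_forall fun t ht => ⟨ht.1.le, ht.2.trans (hy.2 j)⟩)
    exact ((hρ.1.continuous.norm.comp (hin.comp (by fun_prop : Continuous fun t : ℝ => (y, t)))).continuousOn).integrableOn_compact
      isCompact_Icc

lemma avg_sub_avg (hρ : IsWeight ρ) (i : Fin n) (y : ℝ^n) : avg i (fun y => ρ y + -1 * avg i ρ y) y = 0 := by
  have h1 : ∀ t, avg i ρ (update y i t) = avg i ρ y := fun t => by simp [avg]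
  have hv : (volume : Measure ℝ).real (Icc 0 1) = 1 := by simp
  rw [avg]
  simp only [h1]
  rw [integral_add ((hρ.continuous_update i y).continuousOn.integrableOn_compact isCompact_Icc)
    (continuousOn_const.integrableOn_compact isCompact_Icc), setIntegral_const, hv, ← avg]
  simp

/-- Averaging over several coordinates. -/
def avgList : List (Fin n) → (ℝ^n → ℂ) → ℝ^n → ℂ
  | [], ρ => ρ
  | i :: L, ρ => avgList L (avg i ρ)

lemma avgList_spec (L : List (Fin n)) (hρ : IsWeight ρ) : IsWeight (avgList L ρ) ∧
    ∫ y in Icc (0 : ℝ^n) 1, avgList L ρ y = ∫ y in Icc (0 : ℝ^n) 1, ρ y := by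
  induction L generalizing ρ with
  | nil => exact ⟨hρ, rfl⟩
  | cons i L ih => exact ⟨(ih (hρ.avg i)).1, (ih (hρ.avg i)).2.trans (integral_avg hρ i)⟩

lemma avgList_update (L : List (Fin n)) {k : Fin n}
    (hk : k ∈ L ∨ ∀ y t, ρ (update y k t) = ρ y) (y : ℝ^n) (t : ℝ) :
    avgList L ρ (update y k t) = avgList L ρ y := by
  induction L generalizing ρ with
  | nil => exact (hk.resolve_left (by simp)) y t
  | cons i L ih =>
    refine ih ?_
    by_cases hki : k = i
    · subst hki
      exact Or.inr fun y t => by simp [avg]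
    · rcases hk with hk | hk
      · exact Or.inl ((List.mem_cons.1 hk).resolve_left hki)
      · exact Or.inr fun y t => by simp only [avg, Function.update_comm hki, hk]

lemma avgList_finRange (hρ : IsWeight ρ) (y : ℝ^n) :
    avgList (List.finRange n) ρ y = ∫ y in Icc (0 : ℝ^n) 1, ρ y := by
  classical
  have hc : ∀ y, avgList (List.finRange n) ρ y = avgList (List.finRange n) ρ 0 := by
    intro y
    have : ∀ s : Finset (Fin n), avgList (List.finRange n) ρ (s.piecewise 0 y) =
        avgList (List.finRange n) ρ y := by
      intro s
      induction s using Finset.induction_on with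
      | empty => simp
      | insert i s hi ih =>
        rw [Finset.piecewise_insert, avgList_update _ (Or.inl (List.mem_finRange i)), ih]
    simpa using (this Finset.univ).symm
  rw [← (avgList_spec (List.finRange n) hρ).2, funext hc, setIntegral_const]
  have hv : (volume : Measure ℝ^n).real (Icc 0 1) = 1 := by simp [Measure.real, Real.volume_Icc_pi]
  rw [hv, one_smul]

end

section

/-! ### Weights supported away from the diagonals -/

/-- Coordinates `z = x + y τ`: the imaginary part is scaled by `im τ` in each variable, and the
shift of `x` by `y re τ` does not affect the inner integral. -/
lemma integral_coord (τ : ℍ) {f : ℂ^n → ℂ} (hf : Integrable f) :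
    ∫ z, f z = (τ.im : ℂ) ^ n * ∫ y : ℝ^n, ∫ x : ℝ^n, f fun k => x k + y k * (τ : ℂ) := by
  let e : ℂ^n ≃ᵐ ℝ^n × ℝ^n := (MeasurableEquiv.piCongrRight fun _ => Complex.measurableEquivRealProd).trans
      (MeasurableEquiv.arrowProdEquivProdArrow ℝ ℝ (Fin n))
  have he : MeasurePreserving e := (volume_measurePreserving_arrowProdEquivProdArrow ℝ ℝ (Fin n)).comp
    (volume_preserving_pi fun _ => Complex.volume_preserving_equiv_real_prod)
  have hes : ∀ p, e.symm p = fun k => (p.1 k : ℂ) + p.2 k * I := fun p => by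
    funext k
    exact (Complex.mk_eq_add_mul_I _ _)
  have h1 := he.symm.integral_comp' (g := f)
  rw [← h1, Measure.volume_eq_prod, integral_prod_symm (fun p => f (e.symm p))
    ((he.symm.integrable_comp_emb e.symm.measurableEmbedding).2 hf)]
  simp only [hes]
  have h2 := Measure.integral_comp_smul volume (fun v : ℝ^n => ∫ u : ℝ^n, f fun k => (u k : ℂ) + v k * I) τ.im
  have h3 : ∀ y : ℝ^n, ∫ u : ℝ^n, f (fun k => (u k : ℂ) + (τ.im • y) k * I) =
      ∫ x : ℝ^n, f fun k => x k + y k * (τ : ℂ) := by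
    intro y
    rw [← integral_add_right_eq_self _ (τ.re • y)]
    congr 1
    funext x
    congr 1
    funext k
    have : (τ : ℂ) = τ.re + τ.im * I := (re_add_im _).symm
    rw [this]
    simp only [Pi.add_apply, Pi.smul_apply, smul_eq_mul]
    push_cast
    ring
  have hn : (0 : ℝ) < τ.im ^ n := pow_pos τ.im_pos n
  have hc : ((τ.im ^ n : ℝ) : ℂ) ≠ 0 := by exact_mod_cast hn.ne'
  rw [funext h3, Module.finrank_fin_fun, abs_of_pos (inv_pos.2 hn), real_smul] at h2
  rw [h2]
  rw [← mul_assoc, Complex.ofReal_inv, ← Complex.ofReal_pow, mul_inv_cancel₀ hc, one_mul]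

/-- The iterated integral over the `A`-cycles at the heights `y`. -/
def lineInt (Φ : ℂ^n × ℂ → ℂ) (y : ℝ^n) (t : ℂ) : ℂ := ∫ x in Icc (0 : ℝ^n) 1, Φ (fun k => x k + y k * t, t)

/-- The weight vanishes near the heights of points on the diagonals. -/
def OffWall (ρ : ℝ^n → ℂ) : Prop := ∀ y ∈ tsupport ρ, ∀ i j, i ≠ j → ∀ m : ℤ, y i - y j ≠ m

lemma notMem_bigDiagonal_of_heights
    (h : ∀ i j, i ≠ j → ∀ m : ℤ, yc τ (z i) - yc τ (z j) ≠ m) : z ∉ bigDiagonal n τ := by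
  rintro ⟨i, j, hij, hl⟩
  obtain ⟨m, hm⟩ := exists_int_of_mem_lattice hl
  exact h i j hij m (by rw [← hm, map_sub])

variable {ρ : ℝ^n → ℂ}

/-- A weight that vanishes near the walls makes the integrand smooth, so nothing has to be
regularized. Fubini in the coordinates `x + y τ` gives the formula, and the Jacobian `(im τ) ^ n`
cancels the normalization. -/
lemma wreg_eq_integral (hΦ : IsFam Φ) (hell : IsElliptic Φ) (hρ : IsWeight ρ) (h0 : OffWall ρ) :
    wreg Φ ρ τ = ∫ y in Icc (0 : ℝ^n) 1, ρ y * lineInt Φ y τ := by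
  set a : ℂ^n → ℂ := fun z => ρ (heights n τ z) * Φ (z, τ) with ha
  have hs : Smooth a := by
    refine contDiff_iff_contDiffAt.2 fun z => ?_
    by_cases hz : heights n τ z ∈ tsupport ρ
    · have h1 := hΦ.contDiffOn.contDiffAt ((isOpen_offDiag n).mem_nhds
        (show (z, (τ : ℂ)) ∈ offDiag n from ⟨τ.im_pos, notMem_bigDiagonal_of_heights (h0 _ hz)⟩))
      have h2 : ContDiffAt ℂ ∞ (fun z => Φ (z, (τ : ℂ))) z := h1.comp z (contDiffAt_id.prodMk contDiffAt_const)
      exact (hρ.1.comp (heights n τ).contDiff).contDiffAt.mul (h2.restrict_scalars ℝ)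
    · have h1 := (heights n τ).continuous.continuousAt.eventually (notMem_tsupport_iff_eventuallyEq.1 hz)
      exact (contDiffAt_const (c := 0)).congr_of_eventuallyEq
        (h1.mono fun z hz => by simp only [ha]; rw [hz]; simp)
  have hp := hρ.hasHolomorphicPoles hΦ hell (τ := τ)
  have hr := isReg_regC τ n
  have hint : IntegrableOn a (fundamentalDomain n τ) := by
    obtain ⟨φ, hφ, h1⟩ := exists_isTest_eq_one_on_fundamentalDomain (n := n) (τ := τ)
    exact (hφ.mul_smooth hs).integrable.integrableOn.congr_fun
      (fun z hz => by simp only [h1 z hz, one_mul]) measurableSet_fundamentalDomain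
  have hreg : regularizedIntegral τ a = ∫ z in fundamentalDomain n τ, a z := by
    rw [(regularizedIntegral_wellDefined hp).2 _ hr, hr.integral (hp.isK (isTest_chi τ n))
      ((isTest_chi τ n).mul_smooth hs).integrable,
      integral_fundamentalDomain hp.1 ((isTest_chi τ n).mul_smooth hs).integrable hint]
  have him : (τ.im : ℂ) ^ n ≠ 0 := pow_ne_zero _ (by exact_mod_cast τ.im_pos.ne')
  rw [wreg, hreg, ← integral_indicator measurableSet_fundamentalDomain,
    integral_coord τ (hint.integrable_indicator measurableSet_fundamentalDomain), mul_div_cancel_left₀ _ him]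
  let Q : Set ℝ^n := Set.pi Set.univ fun _ => Ico 0 1
  have hQ : MeasurableSet Q := MeasurableSet.univ_pi fun _ => measurableSet_Ico
  have hQI : Q =ᵐ[volume] Icc 0 1 := Measure.univ_pi_Ico_ae_eq_Icc
  have key : ∀ x y : ℝ^n, (fundamentalDomain n τ).indicator a (fun k => x k + y k * (τ : ℂ)) =
      Q.indicator (fun y => ρ y * Q.indicator (fun x => Φ (fun k => x k + y k * (τ : ℂ), τ)) x) y := by
    intro x y
    have hm : (fun k => x k + y k * (τ : ℂ)) ∈ fundamentalDomain n τ ↔ x ∈ Q ∧ y ∈ Q := by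
      simp only [mem_fundamentalDomain, xc_coord, yc_coord, Q, Set.mem_univ_pi, forall_and]
    have hh : heights n τ (fun k => x k + y k * (τ : ℂ)) = y := funext fun k => yc_coord τ _ _
    by_cases hx : x ∈ Q <;> by_cases hy : y ∈ Q <;> simp [indicator, hm, hx, hy, ha, hh]
  simp only [key]
  rw [← setIntegral_congr_set hQI, ← integral_indicator hQ]
  congr 1
  funext y
  by_cases hy : y ∈ Q
  · simp only [indicator_of_mem hy]
    rw [integral_const_mul, integral_indicator hQ, setIntegral_congr_set hQI, lineInt]
  · simp [Set.indicator_of_notMem hy]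

lemma offDiag_line {t : ℂ} (ht : 0 < t.im) {y : ℝ^n} (hy : ∀ i j, i ≠ j → ∀ m : ℤ, y i - y j ≠ m) (x : ℝ^n) :
    ((fun k => (x k : ℂ) + y k * t, t) : ℂ^n × ℂ) ∈ offDiag n :=
  ⟨ht, notMem_bigDiagonal_of_heights (τ := ⟨t, ht⟩) fun i j hij m => by
    have h := fun k : Fin n => yc_coord ⟨t, ht⟩ (x k) (y k)
    simp only at h
    simpa only [h] using hy i j hij m⟩

lemma continuous_coord (t : ℂ) :
    Continuous fun p : ℝ^n × ℝ^n => ((fun k => (p.2 k : ℂ) + p.1 k * t, t) : ℂ^n × ℂ) := by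
  fun_prop

lemma integrableOn_prod (hΦ : IsFam Φ) (hρ : IsWeight ρ) (h0 : OffWall ρ) {t : ℂ} (ht : 0 < t.im) :
    IntegrableOn (fun p : ℝ^n × ℝ^n => ρ p.1 * Φ (fun k => (p.2 k : ℂ) + p.1 k * t, t))
      ((Icc 0 1 ∩ tsupport ρ) ×ˢ Icc 0 1) (volume.prod volume) := by
  refine ContinuousOn.integrableOn_compact
    ((isCompact_Icc.inter_right (isClosed_tsupport ρ)).prod isCompact_Icc) ?_
  exact (hρ.1.continuous.comp continuous_fst).continuousOn.mul (hΦ.contDiffOn.continuousOn.comp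
    (continuous_coord t).continuousOn fun p hp => offDiag_line ht (h0 _ hp.1.2) p.2)

lemma integrableOn_mul_lineInt (hΦ : IsFam Φ) (hρ : IsWeight ρ) (h0 : OffWall ρ) {t : ℂ}
    (ht : 0 < t.im) : IntegrableOn (fun y => ρ y * lineInt Φ y t) (Icc 0 1) := by
  have h := integrableOn_prod hΦ hρ h0 ht
  rw [IntegrableOn, ← Measure.prod_restrict] at h
  have h2 := h.integral_prod_left
  simp only [integral_const_mul] at h2
  exact IntegrableOn.of_forall_sdiff_eq_zero h2 measurableSet_Icc fun y hy => by
    simp [image_eq_zero_of_notMem_tsupport fun h => hy.2 ⟨hy.1, h⟩]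

lemma mdifferentiable_integral_lineInt (hΦ : IsFam Φ) (hρ : IsWeight ρ) (h0 : OffWall ρ) :
    MDiff fun τ : ℍ => ∫ y in Icc (0 : ℝ^n) 1, ρ y * lineInt Φ y τ := by
  rw [UpperHalfPlane.mdifferentiable_iff]
  -- Only heights in the support of the weight matter. They form a compact set for which `x + y τ`
  -- avoids the diagonals for every `τ`; the integration variables enter as complex parameters, so
  -- that the parametric lemma applies over `ℂ`.
  let C : Set ℝ^n := Icc 0 1 ∩ tsupport ρ
  have hC : IsCompact C := isCompact_Icc.inter_right (isClosed_tsupport ρ)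
  let c : ℝ^n × ℝ^n → ℂ^n × ℂ^n × ℂ := fun p => (fun k => (p.1 k : ℂ), fun k => (p.2 k : ℂ), ρ p.1)
  have hc : Continuous c := by
    have := hρ.1.continuous
    fun_prop
  have hφ : ContDiff ℂ ∞ fun q : ℂ × (ℂ^n × ℂ^n × ℂ) =>
      ((fun k => q.2.2.1 k + q.2.1 k * q.1, q.1) : ℂ^n × ℂ) := by
    refine ContDiff.prodMk (contDiff_pi.2 fun k => ?_) contDiff_fst
    have hk := contDiff_apply ℂ (n := ∞) ℂ k
    exact (hk.comp (contDiff_fst.comp (contDiff_snd.comp contDiff_snd))).add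
      ((hk.comp (contDiff_fst.comp contDiff_snd)).mul contDiff_fst)
  have main := contDiffOn_integral_param (𝕜 := ℂ) (μ := volume) (E := ℂ) (hC.prod (isCompact_Icc (a := (0 : ℝ^n)) (b := 1)))
    hc.continuousOn (W := (fun q : ℂ × (ℂ^n × ℂ^n × ℂ) =>
      ((fun k => q.2.2.1 k + q.2.1 k * q.1, q.1) : ℂ^n × ℂ)) ⁻¹' offDiag n)
    ((isOpen_offDiag n).preimage hφ.continuous) (U := {t | 0 < t.im})
    UpperHalfPlane.isOpen_upperHalfPlaneSet
    (fun t ht p hp => offDiag_line ht (h0 _ hp.1.2) p.2)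
    (g := fun q => q.2.2.2 * Φ (fun k => q.2.2.1 k + q.2.1 k * q.1, q.1))
    ((contDiff_snd.comp (contDiff_snd.comp contDiff_snd)).contDiffOn.mul
      (hΦ.contDiffOn.comp hφ.contDiffOn fun q hq => hq))
  refine (main.differentiableOn (by simp)).congr fun t ht => ?_
  simp only [Function.comp_apply, UpperHalfPlane.ofComplex_apply_of_im_pos ht]
  rw [setIntegral_eq_of_subset_of_forall_sdiff_eq_zero measurableSet_Icc (inter_subset_left (t := tsupport ρ))
    fun y hy => by rw [image_eq_zero_of_notMem_tsupport fun h => hy.2 ⟨hy.1, h⟩, zero_mul]]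
  have := setIntegral_prod _ (integrableOn_prod hΦ hρ h0 ht)
  rw [Measure.volume_eq_prod, this]
  simp only [integral_const_mul]
  rfl

lemma hasHolomorphicLimit_offWall (hΦ : IsFam Φ) (hell : IsElliptic Φ) (hρ : IsWeight ρ)
    (h0 : OffWall ρ) : HasHolomorphicLimit (wreg Φ ρ) fun τ => ∫ y in Icc (0 : ℝ^n) 1, ρ y * lineInt Φ y τ :=
  (HasHolomorphicLimit.of_holomorphic (mdifferentiable_integral_lineInt hΦ hρ h0)).congr
    fun _ => (wreg_eq_integral hΦ hell hρ h0).symm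

end

/-! ### Approximation of the constant weight -/

/-- Weights that vanish near the walls and tend to one. -/
def approxW (n m : ℕ) (y : ℝ^n) : ℂ := ((∏ e : Fin n × Fin n, if e.1 = e.2 then 1 else
  smoothTransition (m * (1 - Real.cos (2 * pi * (y e.1 - y e.2))) - 1) : ℝ) : ℂ)

lemma isWeight_approxW (m : ℕ) : IsWeight (approxW n m) := by
  refine ⟨ofRealCLM.contDiff.comp (contDiff_prod fun e _ => ?_), fun y k => ?_⟩
  · split_ifs
    · exact contDiff_const
    · exact smoothTransition.contDiff.comp ((contDiff_const.mul (contDiff_const.sub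
        (Real.contDiff_cos.comp (contDiff_const.mul
          ((contDiff_apply ℝ ℝ e.1).sub (contDiff_apply ℝ ℝ e.2)))))).sub contDiff_const)
  · simp only [approxW, Pi.add_apply]
    congr 2
    funext e
    rw [← Real.cos_add_int_mul_two_pi (2 * pi * (y e.1 - y e.2)) (k e.1 - k e.2)]
    push_cast
    ring_nf

/-- On a wall the cosine is `1`, so the argument of `smoothTransition` is `-1` and remains negative
nearby. -/
lemma offWall_approxW (m : ℕ) : OffWall (approxW n m) := by
  intro y hy i j hij k hk
  refine notMem_tsupport_iff_eventuallyEq.2 ?_ hy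
  have hc : Continuous fun y : ℝ^n => (m * (1 - Real.cos (2 * pi * (y i - y j))) - 1 : ℝ) := by fun_prop
  have h1 : (m * (1 - Real.cos (2 * pi * (y i - y j))) - 1 : ℝ) < 0 := by
    rw [hk, mul_comm (2 * pi), Real.cos_int_mul_two_pi]; norm_num
  filter_upwards [hc.continuousAt.eventually (gt_mem_nhds h1)] with y hy
  simp only [approxW, Pi.zero_apply, Complex.ofReal_eq_zero]
  exact prod_eq_zero (mem_univ (i, j))
    (by simp only [hij, if_false]; exact smoothTransition.zero_of_nonpos hy.le)

lemma norm_approxW_le (m : ℕ) (y : ℝ^n) : ‖approxW n m y‖ ≤ 1 := by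
  have h0 : ∀ e : Fin n × Fin n, 0 ≤ (if e.1 = e.2 then 1 else
      smoothTransition (m * (1 - Real.cos (2 * pi * (y e.1 - y e.2))) - 1) : ℝ) := fun e => by
    split_ifs
    exacts [zero_le_one, smoothTransition.nonneg _]
  rw [approxW, norm_real, Real.norm_of_nonneg (Finset.prod_nonneg fun e _ => h0 e)]
  refine Finset.prod_le_one (fun e _ => h0 e) fun e _ => ?_
  split_ifs
  exacts [le_rfl, smoothTransition.le_one _]

lemma approxW_comp (m : ℕ) (σ : Equiv.Perm (Fin n)) (y : ℝ^n) :
    approxW n m (fun k => y (σ k)) = approxW n m y := by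
  simp only [approxW]
  congr 1
  exact Fintype.prod_equiv (Equiv.prodCongr σ σ) _ _ fun e => by simp

/-- No two heights differ by an integer. -/
def Generic (y : ℝ^n) : Prop := ∀ i j, i ≠ j → ∀ m : ℤ, y i - y j ≠ m

lemma ae_generic : ∀ᵐ y : ℝ^n, Generic y := by
  simp only [Generic, ae_all_iff]
  exact fun i j hij m => measure_eq_zero_iff_ae_notMem.1 (volume_hyperplane hij (m : ℝ))

lemma tendsto_approxW {y : ℝ^n} (hy : Generic y) : Tendsto (fun m => approxW n m y) atTop (𝓝 1) := by
  have : ∀ e : Fin n × Fin n, ∀ᶠ m : ℕ in atTop, (if e.1 = e.2 then 1 else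
      smoothTransition (m * (1 - Real.cos (2 * pi * (y e.1 - y e.2))) - 1) : ℝ) = 1 := by
    intro e
    by_cases he : e.1 = e.2
    · simp [he]
    have hlt : 0 < 1 - Real.cos (2 * pi * (y e.1 - y e.2)) := by
      refine sub_pos.2 (lt_of_le_of_ne (Real.cos_le_one _) fun h => ?_)
      obtain ⟨k, hk⟩ := (Real.cos_eq_one_iff _).1 h
      refine hy e.1 e.2 he k (mul_left_cancel₀ two_pi_pos.ne' ?_)
      rw [← hk]; ring
    filter_upwards [(tendsto_natCast_atTop_atTop.atTop_mul_const hlt).eventually_ge_atTop 2] with m hm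
    rw [if_neg he]
    exact smoothTransition.one_of_one_le (by linarith)
  refine tendsto_const_nhds.congr' ?_
  filter_upwards [eventually_all.2 this] with m hm
  simp [approxW, hm]

lemma tendsto_nrm_approxW : Tendsto (fun m => nrm fun y : ℝ^n => 1 + -1 * approxW n m y) atTop (𝓝 0) := by
  have h0 : (0 : ℝ) = ∫ _ in Icc (0 : ℝ^n) 1, (0 : ℝ) := by simp
  rw [h0]
  refine tendsto_integral_of_dominated_convergence (fun _ => 2) (fun m => ?_) ?_ (fun m => ?_) ?_
  · exact (continuous_const.add (continuous_const.mul (isWeight_approxW m).1.continuous)).norm.aestronglyMeasurable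
  · exact continuousOn_const.integrableOn_compact isCompact_Icc
  · refine .of_forall fun y => ?_
    have := norm_add_le 1 (-1 * approxW n m y)
    have h2 := norm_approxW_le m y
    simp only [norm_norm, norm_mul, norm_neg, norm_one, one_mul] at this ⊢
    linarith
  · filter_upwards [ae_restrict_of_ae ae_generic] with y hy
    have := ((tendsto_approxW hy).const_mul (-1)).const_add 1
    simpa using this.norm

lemma tendsto_integral_approxW : Tendsto (fun m => ∫ y in Icc (0 : ℝ^n) 1, approxW n m y) atTop (𝓝 1) := by
  have h0 : (1 : ℂ) = ∫ _ in Icc (0 : ℝ^n) 1, (1 : ℂ) := by simp [Measure.real, Real.volume_Icc_pi]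
  rw [h0]
  refine tendsto_integral_of_dominated_convergence (fun _ => 1) (fun m => ?_) ?_ (fun m => ?_) ?_
  · exact (isWeight_approxW m).1.continuous.aestronglyMeasurable
  · exact continuousOn_const.integrableOn_compact isCompact_Icc
  · exact .of_forall fun y => norm_approxW_le m y
  · filter_upwards [ae_restrict_of_ae ae_generic] with y hy using tendsto_approxW hy

/-! ### Regularized integrals with weights have expansions -/

/-- Expansions exist for all weights, with leading coefficients bounded by the `L¹`-norm. -/
def HasBound (T : (ℝ^n → ℂ) → ℍ → ℂ) : Prop :=
  ∃ B : ℍ → ℝ, (∀ τ, 0 ≤ B τ) ∧ ∀ ρ, IsWeight ρ → ∃ f, HasHolomorphicLimit (T ρ) f ∧ ∀ τ, ‖f τ‖ ≤ B τ * nrm ρ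

/-- After subtraction of its average over `y_i`, the weight is the derivative of a periodic
primitive `V`, and `wreg_pd` reduces the integral to functions of one variable less, which are
covered by the hypothesis `ih`. -/
lemma hasBound_sub_avg (ih : ∀ a : ℂ^n × ℂ → ℂ, IsFam a → IsElliptic a → HasBound (wreg a))
    {Φ : ℂ^(n + 1) × ℂ → ℂ} (hΦ : IsFam Φ) (hell : IsElliptic Φ) (i : Fin (n + 1)) :
    HasBound fun ρ τ => wreg Φ ρ τ - wreg Φ (avg i ρ) τ := by
  choose K a haf hae haK ha using fun j => hΦ.exists_laurent hell i j
  choose B hB0 hB using fun j k => ih (a j k) (haf j k) (hae j k)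
  refine ⟨fun τ => ∑ j, ∑ k ∈ range (K j), 2 * pi * B j k τ * 2, fun τ =>
    Finset.sum_nonneg fun j _ => Finset.sum_nonneg fun k _ => by have := hB0 j k τ; positivity,
    fun ρ hρ => ?_⟩
  set σ : ℝ^(n + 1) → ℂ := fun y => ρ y + -1 * avg i ρ y with hσdef
  have hσ : IsWeight σ := hρ.add ((hρ.avg i).const_mul _)
  have h0 : ∀ y, avg i σ y = 0 := avg_sub_avg hρ i
  have hnσ : nrm σ ≤ 2 * nrm ρ := by
    refine (nrm_add_le hρ ((hρ.avg i).const_mul _)).trans ?_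
    have : nrm (fun y => -1 * avg i ρ y) = nrm (avg i ρ) := by simp [nrm]
    linarith [nrm_avg_le hρ i]
  have hV := hσ.prim i h0
  have hterm : ∀ j k, ∃ f, HasHolomorphicLimit (fun τ => 2 * pi * I * (1 / (k ! : ℂ) * (-I / 2) ^ k) *
        (wreg (a j k) (wall i j ((pd i)^[k] (prim i σ))) τ / (τ.im : ℂ) ^ k)) f ∧
      ∀ τ, ‖f τ‖ ≤ 2 * pi * B j k τ * 2 * nrm ρ := by
    intro j k
    obtain ⟨f, hf, hb⟩ := hB j k _ ((hV.pd_iterate i k).wall i j)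
    refine ⟨_, (hf.div_im k).const_mul _, fun τ => ?_⟩
    have hnn : 0 ≤ 2 * pi * B j k τ * 2 * nrm ρ := by have := hB0 j k τ; have := nrm_nonneg (ρ := ρ); positivity
    -- For `k > 0` the division by `(im τ) ^ k` makes the leading coefficient zero. So the
    -- derivatives of `V`, which the `L¹`-norm of `ρ` does not control, need no bound.
    by_cases hk : k = 0
    · subst hk
      have h1 : ‖f τ‖ ≤ B j 0 τ * (2 * nrm ρ) := (hb τ).trans
        (mul_le_mul_of_nonneg_left ((nrm_wall_prim_le hσ i j h0).trans hnσ) (hB0 j 0 τ))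
      simp only [if_true, Nat.factorial_zero, Nat.cast_one, pow_zero, norm_mul, Complex.norm_ofNat,
        norm_real, Real.norm_of_nonneg pi_pos.le, Complex.norm_I, div_one, mul_one]
      nlinarith [pi_pos]
    · simpa [hk] using hnn
  choose f hf hfb using hterm
  refine ⟨_, (HasHolomorphicLimit.sum Finset.univ fun j _ =>
    HasHolomorphicLimit.sum (range (K j)) fun k _ => hf j k).congr fun τ => ?_, fun τ => ?_⟩
  · rw [← wreg_pd hΦ hell i haf hae haK ha hV, hσ.pd_prim i h0, hσdef,
      wreg_add hΦ hell hρ ((hρ.avg i).const_mul _), wreg_const_mul hΦ hell _ (hρ.avg i)]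
    ring
  · rw [sum_mul]
    refine (norm_sum_le _ _).trans (Finset.sum_le_sum fun j _ => ?_)
    rw [sum_mul]
    exact (norm_sum_le _ _).trans (Finset.sum_le_sum fun k _ => hfb j k τ)

lemma hasBound_sub_avgList (h : ∀ i, HasBound fun ρ τ => wreg Φ ρ τ - wreg Φ (avg i ρ) τ) (L : List (Fin n)) :
    HasBound fun ρ τ => wreg Φ ρ τ - wreg Φ (avgList L ρ) τ := by
  induction L with
  | nil => exact ⟨0, fun _ => le_rfl, fun ρ _ => ⟨fun _ => 0,
      (HasHolomorphicLimit.of_holomorphic mdifferentiable_const).congr fun τ => (sub_self _).symm,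
      fun τ => by simp⟩⟩
  | cons i L ih =>
    obtain ⟨B, hB, h1⟩ := h i
    obtain ⟨B', hB', h2⟩ := ih
    refine ⟨fun τ => B τ + B' τ, fun τ => add_nonneg (hB τ) (hB' τ), fun ρ hρ => ?_⟩
    obtain ⟨f, hf, hfb⟩ := h1 ρ hρ
    obtain ⟨g, hg, hgb⟩ := h2 _ (hρ.avg i)
    refine ⟨_, (hf.add hg).congr fun τ => by simp only [avgList]; ring, fun τ => ?_⟩
    refine (norm_add_le _ _).trans ?_
    rw [add_mul]
    exact add_le_add (hfb τ) ((hgb τ).trans (mul_le_mul_of_nonneg_left (nrm_avg_le hρ i) (hB' τ)))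

/-- Averaging over all coordinates replaces `ρ` by its mean, so every weight is reduced to the
constant one. The constant weight in turn is reached from a single weight that vanishes near the
walls and has nonzero mean, for which the integral is known to be holomorphic in `τ`. -/
lemma hasBound_of_sub_avg (hΦ : IsFam Φ) (hell : IsElliptic Φ)
    (h : ∀ i, HasBound fun ρ τ => wreg Φ ρ τ - wreg Φ (avg i ρ) τ) : HasBound (wreg Φ) := by
  obtain ⟨B, hB, hL⟩ := hasBound_sub_avgList h (List.finRange n)
  have hc : ∀ ρ : ℝ^n → ℂ, IsWeight ρ → ∀ τ, wreg Φ (avgList (List.finRange n) ρ) τ =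
      (∫ y in Icc (0 : ℝ^n) 1, ρ y) * wreg Φ (fun _ => 1) τ := by
    intro ρ hρ τ
    rw [← wreg_const_mul hΦ hell _ (IsWeight.const 1)]
    congr 1
    funext y
    rw [avgList_finRange hρ, mul_one]
  -- The means tend to `1`, so one of them is nonzero and can be divided by.
  obtain ⟨m, hm⟩ := ((tendsto_integral_approxW (n := n)).eventually_ne one_ne_zero).exists
  obtain ⟨f, hf, -⟩ := hL _ (isWeight_approxW m)
  obtain ⟨f₁, h2⟩ : ∃ f₁, HasHolomorphicLimit (wreg Φ fun _ => 1) f₁ :=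
    ⟨_, (((hasHolomorphicLimit_offWall hΦ hell (isWeight_approxW m) (offWall_approxW m)).add
      (hf.const_mul (-1))).const_mul (∫ y in Icc (0 : ℝ^n) 1, approxW n m y)⁻¹).congr
      fun τ => by simp only [hc _ (isWeight_approxW m)]; field_simp; ring⟩
  refine ⟨fun τ => B τ + ‖f₁ τ‖, fun τ => add_nonneg (hB τ) (norm_nonneg _), fun ρ hρ => ?_⟩
  obtain ⟨g, hg, hgb⟩ := hL ρ hρ
  refine ⟨_, (hg.add (h2.const_mul (∫ y in Icc (0 : ℝ^n) 1, ρ y))).congr fun τ => by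
    simp only [hc ρ hρ]; ring, fun τ => ?_⟩
  refine (norm_add_le _ _).trans ?_
  rw [add_mul, norm_mul, mul_comm ‖f₁ τ‖]
  exact add_le_add (hgb τ) (mul_le_mul_of_nonneg_right (norm_integral_le_integral_norm _) (norm_nonneg _))

lemma hasBound_wreg (hΦ : IsFam Φ) (hell : IsElliptic Φ) : HasBound (wreg Φ) := by
  induction n with
  | zero => exact hasBound_of_sub_avg hΦ hell fun i => i.elim0
  | succ n ih =>
    exact hasBound_of_sub_avg hΦ hell (hasBound_sub_avg (fun _ ha hae => ih ha hae) hΦ hell)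

lemma integral_comp_perm (σ : Equiv.Perm (Fin n)) (f : ℝ^n → ℂ) :
    (IntegrableOn (fun y : ℝ^n => f fun k => y (σ k)) (Icc 0 1) ↔ IntegrableOn f (Icc 0 1)) ∧
      ∫ y in Icc (0 : ℝ^n) 1, f (fun k => y (σ k)) = ∫ y in Icc (0 : ℝ^n) 1, f y := by
  have hmp : MeasurePreserving (MeasurableEquiv.piCongrLeft (fun _ => ℝ) σ.symm : ℝ^n ≃ᵐ ℝ^n) :=
    volume_measurePreserving_piCongrLeft (fun _ => ℝ) σ.symm
  have hap : ∀ y : ℝ^n, MeasurableEquiv.piCongrLeft (fun _ => ℝ) σ.symm y = fun k => y (σ k) := fun y => by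
    funext k
    simpa using MeasurableEquiv.piCongrLeft_apply_apply (β := fun _ => ℝ) σ.symm y (σ k)
  have hpre : (MeasurableEquiv.piCongrLeft (fun _ => ℝ) σ.symm) ⁻¹' Icc (0 : ℝ^n) 1 = Icc 0 1 := by
    ext y
    simp only [mem_preimage, hap, Set.mem_Icc, Pi.le_def]
    exact and_congr (σ.forall_congr_right (q := fun k => (0 : ℝ) ≤ y k))
      (σ.forall_congr_right (q := fun k => y k ≤ 1))
  have h1 := hmp.integrableOn_comp_preimage (MeasurableEquiv.measurableEmbedding _) (f := f) (s := Icc 0 1)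
  have h2 := hmp.setIntegral_preimage_emb (MeasurableEquiv.measurableEmbedding _) f (Icc 0 1)
  simp only [hpre, comp_def, hap] at h1 h2
  exact ⟨h1, h2⟩

/-- The holomorphic limit of the regularized integral is the symmetrized iterated integral. -/
lemma hasHolomorphicLimit_wreg (hΦ : IsFam Φ) (hell : IsElliptic Φ)
    {C : ℍ → ℂ} (hC : ∀ (τ : ℍ) (y : ℝ^n), Generic y →
      1 / (n ! : ℂ) * ∑ σ : Equiv.Perm (Fin n), lineInt Φ (fun k => y (σ k)) τ = C τ) :
    HasHolomorphicLimit (wreg Φ fun _ => 1) C := by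
  obtain ⟨B, hB, h⟩ := hasBound_wreg hΦ hell
  obtain ⟨f, hf, -⟩ := h _ (IsWeight.const 1)
  suffices f = C by rwa [this] at hf
  funext τ
  -- The weight is symmetric in the heights, so the line integral may be replaced by its average
  -- over all permutations, which equals `C τ` for almost every `y`.
  have hsym : ∀ m, ∫ y in Icc (0 : ℝ^n) 1, approxW n m y * lineInt Φ y τ =
      (∫ y in Icc (0 : ℝ^n) 1, approxW n m y) * C τ := by
    intro m
    have hi := integrableOn_mul_lineInt hΦ (isWeight_approxW m) (offWall_approxW m) τ.im_pos
    have hJ : ∀ σ : Equiv.Perm (Fin n), IntegrableOn (fun y => approxW n m y *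
        lineInt Φ (fun k => y (σ k)) τ) (Icc 0 1) ∧ ∫ y in Icc (0 : ℝ^n) 1,
          approxW n m y * lineInt Φ (fun k => y (σ k)) τ =
        ∫ y in Icc (0 : ℝ^n) 1, approxW n m y * lineInt Φ y τ := fun σ => by
      have h1 := integral_comp_perm σ fun y => approxW n m y * lineInt Φ y τ
      simp only [approxW_comp] at h1
      exact ⟨h1.1.2 hi, h1.2⟩
    have hn : (n ! : ℂ) ≠ 0 := by exact_mod_cast n.factorial_ne_zero
    have h3 := integral_finsetSum Finset.univ fun σ _ => (hJ σ).1
    simp only [(hJ _).2, Finset.sum_const, Finset.card_univ, Fintype.card_perm, Fintype.card_fin,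
      nsmul_eq_mul] at h3
    refine mul_left_cancel₀ hn ?_
    rw [← h3, ← integral_mul_const, ← integral_const_mul]
    refine integral_congr_ae ?_
    filter_upwards [ae_restrict_of_ae ae_generic] with y hy
    rw [← hC τ y hy, ← mul_sum]
    field_simp
  -- By uniqueness of holomorphic limits this difference is the leading coefficient belonging to the
  -- weight `1 - approxW n m`, whose `L¹`-norm tends to zero.
  have hm : ∀ m, ‖f τ - (∫ y in Icc (0 : ℝ^n) 1, approxW n m y) * C τ‖ ≤
      B τ * nrm fun y : ℝ^n => 1 + -1 * approxW n m y := by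
    intro m
    have hw := isWeight_approxW (n := n) m
    obtain ⟨g, hg, hgb⟩ := h _ ((IsWeight.const 1).add (hw.const_mul (-1)))
    have h1 := hasHolomorphicLimit_offWall hΦ hell hw (offWall_approxW m)
    have h2 := (hg.add h1).unique (hf.congr fun τ => by
      rw [wreg_add hΦ hell (IsWeight.const 1) (hw.const_mul _), wreg_const_mul hΦ hell _ hw]; ring)
    simp only [← h2, hsym, add_sub_cancel_right]
    exact hgb τ
  have h1 := squeeze_zero_norm hm (by simpa using tendsto_nrm_approxW.const_mul (B τ))
  have h2 := (tendsto_integral_approxW (n := n)).mul_const (C τ) |>.const_sub (f τ)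
  simpa [sub_eq_zero] using tendsto_nhds_unique h2 h1

section

/-! ### Winding numbers and integrals over closed curves -/

def IsLoop (γ : ℝ → ℂ) : Prop := ContDiff ℝ 1 γ ∧ ∀ t, γ (t + 1) = γ t

def wind (γ : ℝ → ℂ) (x : ℂ) : ℂ := (2 * pi * I)⁻¹ * ∫ t in Icc (0 : ℝ) 1, deriv γ t / (γ t - x)

variable {γ f : ℝ → ℂ} {x x' : ℂ}

lemma integral_deriv_Icc {f' : ℝ → ℂ} (hf : ∀ t, HasDerivAt f (f' t) t) (hc : Continuous f') :
    ∫ t in Icc (0 : ℝ) 1, f' t = f 1 - f 0 := by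
  rw [integral_Icc_eq_integral_Ioc, ← intervalIntegral.integral_of_le zero_le_one,
    intervalIntegral.integral_eq_sub_of_hasDerivAt (fun t _ => hf t) (hc.intervalIntegrable _ _)]

lemma IsLoop.hasDerivAt (h : IsLoop γ) (t : ℝ) : HasDerivAt γ (deriv γ t) t :=
  (h.1.differentiable (by simp) t).hasDerivAt

/-- In the slit plane the principal logarithm of the curve is a periodic primitive. -/
lemma IsLoop.integral_eq_zero {f' : ℝ → ℂ} (h : ∀ t, f (t + 1) = f t)
    (hf : ∀ t, HasDerivAt f (f' t) t) (hc : Continuous f') (hs : ∀ t, f t ∈ slitPlane) :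
    ∫ t in Icc (0 : ℝ) 1, f' t / f t = 0 := by
  rw [integral_deriv_Icc (f := fun t => Complex.log (f t)) (fun t => (hf t).clog_real (hs t))
    (hc.div (continuous_iff_continuousAt.2 fun t => (hf t).continuousAt)
      fun t => Complex.slitPlane_ne_zero (hs t))]
  simp [← h 0]

lemma one_sub_mem_slitPlane {u : ℂ} (h : ‖u‖ ≤ 1) (h1 : u ≠ 1) : 1 - u ∈ slitPlane := by
  left
  rw [Complex.sub_re, Complex.one_re, sub_pos]
  refine lt_of_le_of_ne ((Complex.re_le_norm u).trans h) fun hre => h1 (Complex.ext hre ?_)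
  have := Complex.sq_norm_sub_sq_re u
  rw [hre] at this
  simpa using pow_eq_zero_iff (two_ne_zero) |>.1 (le_antisymm (by nlinarith [norm_nonneg u]) (sq_nonneg u.im))

lemma IsLoop.continuous_quot (h : IsLoop γ) (hx : ∀ t, γ t ≠ x) : Continuous fun t => deriv γ t / (γ t - x) :=
  (h.1.continuous_deriv le_rfl).div (h.1.continuous.sub continuous_const) fun t => sub_ne_zero.2 (hx t)

/-- Rouché: the quotient `(γ - x) / (γ - x') = 1 - (x - x') / (γ - x')` stays in the slit plane.
Equality of the norms is admissible because the quotient is never zero; this permits comparison at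
extremal points of curves. -/
lemma wind_eq_of_norm_le (h : IsLoop γ) (hx : ∀ t, γ t ≠ x) (hx' : ∀ t, γ t ≠ x')
    (hn : ∀ t, ‖x - x'‖ ≤ ‖γ t - x'‖) : wind γ x = wind γ x' := by
  have h0 : ∀ t, γ t - x ≠ 0 := fun t => sub_ne_zero.2 (hx t)
  have h0' : ∀ t, γ t - x' ≠ 0 := fun t => sub_ne_zero.2 (hx' t)
  have hd : ∀ t, HasDerivAt (fun t => (γ t - x) / (γ t - x'))
      ((deriv γ t * (γ t - x') - (γ t - x) * deriv γ t) / (γ t - x') ^ 2) t := fun t =>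
    ((h.hasDerivAt t).sub_const x).div ((h.hasDerivAt t).sub_const x') (h0' t)
  have key := IsLoop.integral_eq_zero (fun t => by simp only [h.2]) hd (by
    have := h.1.continuous_deriv le_rfl
    have := h.1.continuous
    exact Continuous.div (by fun_prop) (by fun_prop) fun t => pow_ne_zero 2 (h0' t)) fun t => by
    have : (γ t - x) / (γ t - x') = 1 - (x - x') / (γ t - x') := by
      have := h0' t
      field_simp
      ring
    rw [this]
    refine one_sub_mem_slitPlane ?_ fun h1 => h0 t ?_
    · rw [norm_div]
      exact div_le_one_of_le₀ (hn t) (norm_nonneg _)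
    · rw [div_eq_one_iff_eq (h0' t)] at h1
      linear_combination -h1
  have h2 : ∀ t, (deriv γ t * (γ t - x') - (γ t - x) * deriv γ t) / (γ t - x') ^ 2 /
      ((γ t - x) / (γ t - x')) = deriv γ t / (γ t - x) - deriv γ t / (γ t - x') := fun t => by
    have := h0 t
    have := h0' t
    field_simp
  simp only [h2] at key
  rw [integral_sub ((h.continuous_quot hx).continuousOn.integrableOn_compact isCompact_Icc)
    ((h.continuous_quot hx').continuousOn.integrableOn_compact isCompact_Icc), sub_eq_zero] at key
  rw [wind, wind, key]

lemma wind_eq_zero (h : IsLoop γ) (hx : ∀ t, γ t ≠ x) (hn : ∀ t, ‖γ t‖ ≤ ‖x‖) : wind γ x = 0 := by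
  have hx0 : x ≠ 0 := fun h0 => hx 0 (by simpa [h0] using hn 0)
  have key := IsLoop.integral_eq_zero (f := fun t => 1 - γ t / x) (f' := fun t => -(deriv γ t / x))
    (fun t => by simp only [h.2]) (fun t => ((h.hasDerivAt t).div_const x).const_sub 1)
    ((h.1.continuous_deriv le_rfl).div_const x).neg fun t => one_sub_mem_slitPlane (by
      rw [norm_div]; exact div_le_one_of_le₀ (hn t) (norm_nonneg _)) fun h1 => hx t (by
        rwa [div_eq_one_iff_eq hx0] at h1)
  rw [wind, ← key, setIntegral_congr_fun measurableSet_Icc fun t _ => ?_, key, mul_zero]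
  have := sub_ne_zero.2 (hx t)
  have h2 : 1 - γ t / x ≠ 0 := by
    rw [one_sub_div hx0]
    exact div_ne_zero (sub_ne_zero.2 (hx t).symm) hx0
  rw [one_sub_div hx0] at h2 ⊢
  have := sub_ne_zero.2 (hx t).symm
  field_simp
  ring

lemma IsLoop.isCompact_range (h : IsLoop γ) : IsCompact (range γ) :=
  Periodic.compact_of_continuous h.2 one_ne_zero h.1.continuous

lemma wind_eventually (h : IsLoop γ) (hx : x ∉ range γ) : ∀ᶠ x' in 𝓝 x, wind γ x' = wind γ x := by
  obtain ⟨ε, hε, hb⟩ := Metric.isOpen_iff.1 h.isCompact_range.isClosed.isOpen_compl x hx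
  filter_upwards [ball_mem_nhds x hε] with x' hx'
  refine wind_eq_of_norm_le h (fun t ht => hb hx' ⟨t, ht⟩) (fun t ht => hx ⟨t, ht⟩) fun t => ?_
  by_contra! hlt
  rw [← dist_eq_norm, ← dist_eq_norm] at hlt
  exact hb (show γ t ∈ _ from hlt.trans hx') ⟨t, rfl⟩

lemma integral_dzbar_eq_zero (hh : IsTest h) : ∫ w, dzbar 1 h w = 0 := by
  have := integral_dzbar_div (IsTest.smooth_mul contDiff_id hh)
  simp only [id_eq, zero_mul, mul_zero] at this
  rw [← this]
  refine integral_congr_ae ?_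
  filter_upwards [ae_ne 0] with w hw
  rw [dzbar_mul 1 differentiableAt_fun_id (hh.1.diffAt w),
    dzbar_of_holomorphic 1 differentiableAt_fun_id, zero_mul, zero_add, mul_div_cancel_left₀ _ hw]

lemma exists_isTest_separating {K C : Set ℂ} (hK : IsCompact K) (hC : IsClosed C) (hd : Disjoint K C) :
    ∃ ψ : ℂ → ℂ, IsTest ψ ∧ (∀ x ∈ K, ψ =ᶠ[𝓝 x] fun _ => 1) ∧ ∀ x ∈ C, ψ =ᶠ[𝓝 x] fun _ => 0 := by
  obtain ⟨R, hR⟩ := hK.isBounded.subset_ball (0 : ℂ)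
  obtain ⟨ψ, h0, h1, -⟩ := exists_contMDiffMap_zero_one_nhds_of_isClosed 𝓘(ℝ, ℂ) (n := ⊤)
    (hC.union isOpen_ball.isClosed_compl) hK.isClosed
    (Set.disjoint_union_left.2 ⟨hd.symm, Set.disjoint_compl_left_iff_subset.2 hR⟩)
  rw [eventually_nhdsSet_iff_forall] at h0 h1
  refine ⟨fun w => ψ w, ⟨ofRealCLM.contDiff.comp ψ.contMDiff.contDiff, ?_⟩,
    fun x hx => (h1 x hx).mono fun w hw => by simp [hw],
    fun x hx => (h0 x (Or.inl hx)).mono fun w hw => by simp [hw]⟩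
  exact HasCompactSupport.intro (isCompact_closedBall (0 : ℂ) R) fun w hw => by
    simp [(h0 w (Or.inr fun h => hw (Metric.ball_subset_closedBall h))).self_of_nhds]

variable {Ω : Set ℂ} {ρ : ℂ → ℂ}

lemma isTest_mul_of_isOpen (hΩ : IsOpen Ω) (hg : DifferentiableOn ℂ g Ω) (hρ : IsTest ρ)
    (h0 : ∀ x ∉ Ω, ρ =ᶠ[𝓝 x] fun _ => 0) : IsTest (fun w => g w * ρ w) ∧
      ∀ w, dzbar 1 (fun w => g w * ρ w) w = g w * dzbar 1 ρ w := by
  refine ⟨⟨contDiff_iff_contDiffAt.2 fun w => ?_, hρ.2.mul_left⟩, fun w => ?_⟩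
  all_goals by_cases hw : w ∈ Ω
  · have := ((hg.contDiffOn hΩ).contDiffAt (hΩ.mem_nhds hw) (n := ∞)).restrict_scalars ℝ
    exact this.mul hρ.1.contDiffAt
  · exact contDiffAt_const (c := 0) |>.congr_of_eventuallyEq ((h0 w hw).mono fun w hw => by simp [hw])
  · have hd := hg.differentiableAt (hΩ.mem_nhds hw)
    rw [dzbar_mul 1 (hd.restrictScalars ℝ) (hρ.1.diffAt w), dzbar_of_holomorphic 1 hd, zero_mul, zero_add]
  · rw [dzbar_congr 1 (h0 w hw), dzbar_congr 1 (h := fun _ => 0) ((h0 w hw).mono fun w hw => by simp [hw]),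
      dzbar_const, mul_zero]

lemma dzbar_eventuallyEq_zero (h : ρ =ᶠ[𝓝 x] fun _ => c) : dzbar 1 ρ =ᶠ[𝓝 x] fun _ => 0 :=
  h.eventuallyEq_nhds.mono fun _ hy => (dzbar_congr 1 hy).trans (dzbar_const 1 _)

/-- The difference of the two cutoff functions vanishes near the complement of `Ω`, so its product
with `g` is a test function. Since `g` is holomorphic, `∂̄` of this product is the difference of the
integrands, and its integral is zero. -/
lemma integral_mul_dzbar_congr {ρ' : ℂ → ℂ} (hΩ : IsOpen Ω) (hg : DifferentiableOn ℂ g Ω) (hρ : IsTest ρ)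
    (hρ' : IsTest ρ') {c : ℂ → ℂ} (h : ∀ x ∉ Ω, ρ =ᶠ[𝓝 x] fun _ => c x)
    (h' : ∀ x ∉ Ω, ρ' =ᶠ[𝓝 x] fun _ => c x) : ∫ w, g w * dzbar 1 ρ w = ∫ w, g w * dzbar 1 ρ' w := by
  have hd := isTest_mul_of_isOpen hΩ hg (hρ.add (hρ'.const_mul (-1))) fun x hx => by
    filter_upwards [h x hx, h' x hx] with y a b
    simp [a, b]
  rw [← sub_eq_zero, ← integral_sub
    (isTest_mul_of_isOpen hΩ hg (hρ.dzbar 1) fun x hx => dzbar_eventuallyEq_zero (h x hx)).1.integrable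
    (isTest_mul_of_isOpen hΩ hg (hρ'.dzbar 1) fun x hx => dzbar_eventuallyEq_zero (h' x hx)).1.integrable,
    ← integral_dzbar_eq_zero hd.1]
  congr 1
  funext w
  rw [hd.2, dzbar_add 1 (hρ.1.diffAt w) ((hρ'.const_mul _).1.diffAt w), dzbar_const_mul 1 _ (hρ'.1.diffAt w)]
  ring

lemma integral_dzbar_div_sub {φ : ℂ → ℂ} (hφ : IsTest φ) (x : ℂ) :
    ∫ w, dzbar 1 φ w / (w - x) = -(pi : ℂ) * φ x := by
  have h := integral_dzbar_div (hφ.comp_add x)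
  have h2 : ∀ w, dzbar 1 (fun w => φ (w + x)) w = dzbar 1 φ (w + x) := fun w =>
    dzbar_comp 1 (hφ.1.diffAt _) ((hasFDerivAt_id (𝕜 := ℂ) w).add_const x)
  simp only [h2, zero_add] at h
  rw [← h, ← integral_add_right_eq_self _ x]
  simp

/-- The integral of a holomorphic function over a closed curve as an integral over the plane. -/
lemma integral_loop_eq (h : IsLoop γ) (hΩ : IsOpen Ω) (hγ : ∀ t, γ t ∈ Ω) (hg : DifferentiableOn ℂ g Ω)
    (hρ : IsTest ρ) (hw : ∀ x ∉ Ω, ρ =ᶠ[𝓝 x] fun _ => wind γ x) :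
    ∫ t in Icc (0 : ℝ) 1, deriv γ t * g (γ t) = -(2 * I) * ∫ w, g w * dzbar 1 ρ w := by
  -- `ψ` is `1` near the curve and `0` near the complement of `Ω`. The product `D` of `1 - ψ` with
  -- the winding number is smooth, because the winding number is locally constant off the curve; it
  -- has the prescribed values near the complement of `Ω` and may replace `ρ`.
  obtain ⟨ψ, hψ, h1, h0⟩ := exists_isTest_separating h.isCompact_range hΩ.isClosed_compl
    (Set.disjoint_compl_right_iff_subset.2 (Set.range_subset_iff.2 hγ))
  obtain ⟨hφ, hφd⟩ := isTest_mul_of_isOpen hΩ hg hψ h0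
  have hdγ : ∀ x ∈ range γ, dzbar 1 ψ =ᶠ[𝓝 x] fun _ => 0 := fun x hx => dzbar_eventuallyEq_zero (h1 x hx)
  set D : ℂ → ℂ := fun w => (1 - ψ w) * wind γ w with hD
  have hDl : ∀ w, SmoothAt D w ∧ dzbar 1 D w = -(dzbar 1 ψ w * wind γ w) := by
    intro w
    by_cases hr : w ∈ range γ
    · have he : D =ᶠ[𝓝 w] fun _ => 0 := (h1 w hr).mono fun y hy => by simp [hD, hy]
      exact ⟨contDiffAt_const.congr_of_eventuallyEq he, by
        rw [dzbar_congr 1 he, (hdγ w hr).self_of_nhds, dzbar_const]; ring⟩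
    · have he : D =ᶠ[𝓝 w] fun y => wind γ w + -wind γ w * ψ y :=
        (wind_eventually h hr).mono fun y hy => by simp only [hD, hy]; ring
      have hs : Smooth fun y => -wind γ w * ψ y := contDiff_const.mul hψ.1
      refine ⟨(contDiff_const.add hs).contDiffAt.congr_of_eventuallyEq he, ?_⟩
      rw [dzbar_congr 1 he, dzbar_add 1 (differentiableAt_const _) (hs.diffAt w), dzbar_const,
        dzbar_const_mul 1 _ (hψ.1.diffAt w)]
      ring
  have hDt : IsTest D := by
    refine ⟨contDiff_iff_contDiffAt.2 fun w => (hDl w).1, ?_⟩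
    obtain ⟨R, hR⟩ := h.isCompact_range.isBounded.subset_closedBall 0
    refine HasCompactSupport.intro (isCompact_closedBall (0 : ℂ) R) fun w hw => ?_
    rw [show D w = (1 - ψ w) * wind γ w from rfl, wind_eq_zero h (fun t ht => hw (hR ⟨t, ht⟩)) fun t => ?_, mul_zero]
    have h3 := hR ⟨t, rfl⟩
    simp only [mem_closedBall, dist_zero_right, not_le] at h3 hw
    linarith
  rw [integral_mul_dzbar_congr hΩ hg hρ hDt hw fun x hx => by
    filter_upwards [h0 x hx, wind_eventually h fun ⟨t, ht⟩ => hx (ht ▸ hγ t)] with y b c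
    simp only [hD, b, c]
    ring]
  simp only [(hDl _).2, mul_neg, integral_neg, neg_mul, neg_neg]
  have hk := (isTest_mul_of_isOpen hΩ hg (hψ.dzbar 1) fun x hx => dzbar_eventuallyEq_zero (h0 x hx)).1
  have hkγ : ∀ t, γ t ∉ tsupport fun w => g w * dzbar 1 ψ w := fun t =>
    notMem_tsupport_iff_eventuallyEq.2 ((hdγ _ ⟨t, rfl⟩).mono fun y hy => by simp [hy])
  have hH : Integrable (fun p : ℝ × ℂ => deriv γ p.1 * (g p.2 * dzbar 1 ψ p.2 / (p.2 - γ p.1)))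
      ((volume.restrict (Icc 0 1)).prod volume) := by
    have hc : IntegrableOn (fun p : ℝ × ℂ => deriv γ p.1 * (g p.2 * dzbar 1 ψ p.2 / (p.2 - γ p.1)))
        (Icc (0 : ℝ) 1 ×ˢ tsupport fun w => g w * dzbar 1 ψ w) (volume.prod volume) := by
      refine ContinuousOn.integrableOn_compact (isCompact_Icc.prod hk.2) ?_
      refine ((h.1.continuous_deriv le_rfl).comp continuous_fst).continuousOn.mul
        (ContinuousOn.div (hk.continuous.comp continuous_snd).continuousOn
        (continuous_snd.sub (h.1.continuous.comp continuous_fst)).continuousOn fun p hp h => ?_)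
      exact hkγ p.1 (by rw [← sub_eq_zero.1 h]; exact hp.2)
    have h2 := IntegrableOn.of_forall_sdiff_eq_zero (t := Icc (0 : ℝ) 1 ×ˢ Set.univ) hc
      (measurableSet_Icc.prod MeasurableSet.univ) fun p hp => by
        have := image_eq_zero_of_notMem_tsupport fun h => hp.2 ⟨hp.1.1, h⟩
        rw [this]
        simp
    rwa [IntegrableOn, ← Measure.prod_restrict, Measure.restrict_univ] at h2
  -- Integrating over the plane first reproduces `g` at points of the curve by the Cauchy–Pompeiu
  -- formula for `g ψ`; integrating over the curve first produces winding numbers.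
  have hsw := integral_integral_swap (f := fun t w => deriv γ t * (g w * dzbar 1 ψ w / (w - γ t))) hH
  have hpi : (pi : ℂ) ≠ 0 := by exact_mod_cast Real.pi_ne_zero
  have hl : ∀ t, ∫ w, deriv γ t * (g w * dzbar 1 ψ w / (w - γ t)) = -pi * (deriv γ t * g (γ t)) := by
    intro t
    have := integral_dzbar_div_sub hφ (γ t)
    simp only [hφd, (h1 _ ⟨t, rfl⟩).self_of_nhds, mul_one] at this
    rw [integral_const_mul, this]
    ring
  have hr : ∀ w, ∫ t in Icc (0 : ℝ) 1, deriv γ t * (g w * dzbar 1 ψ w / (w - γ t)) =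
      -(2 * pi * I) * (g w * (dzbar 1 ψ w * wind γ w)) := by
    intro w
    have h2 : ∀ t, deriv γ t * (g w * dzbar 1 ψ w / (w - γ t)) =
        -(g w * dzbar 1 ψ w) * (deriv γ t / (γ t - w)) := fun t => by
      rw [← neg_sub (γ t) w, div_neg]; ring
    simp only [h2]
    rw [integral_const_mul, wind]
    have := I_ne_zero
    field_simp
  simp only [hl, hr, integral_const_mul] at hsw
  refine mul_left_cancel₀ (neg_ne_zero.2 hpi) (hsw.trans ?_)
  ring

end

section

/-! ### Closed curves on the cylinder -/

def ex (z : ℂ) : ℂ := Complex.exp (2 * pi * I * z)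

/-- The discontinuity of the principal logarithm is harmless: `lg` is only inserted into functions
and conditions of period one. -/
def lg (w : ℂ) : ℂ := Complex.log w / (2 * pi * I)

variable {a b : ℝ → ℂ} {x y : ℂ}

lemma ex_ne_zero : ex x ≠ 0 := exp_ne_zero _

lemma ex_add : ex (x + y) = ex x * ex y := by rw [ex, mul_add, Complex.exp_add]; rfl

lemma ex_lg (hw : w ≠ 0) : ex (lg w) = w := by
  rw [ex, lg, mul_div_cancel₀ _ two_pi_I_ne_zero, Complex.exp_log hw]

lemma ex_eq_iff : ex x = ex y ↔ ∃ k : ℤ, x = y + k := by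
  rw [ex, ex, Complex.exp_eq_exp_iff_exists_int]
  refine exists_congr fun k => ⟨fun h => mul_left_cancel₀ two_pi_I_ne_zero ?_, fun h => ?_⟩
  · linear_combination h
  · rw [h]; ring

lemma norm_ex : ‖ex x‖ = Real.exp (-(2 * pi) * x.im) := by
  rw [ex, Complex.norm_exp]
  simp

lemma norm_ex_le : ‖ex x‖ ≤ ‖ex y‖ ↔ y.im ≤ x.im := by
  rw [norm_ex, norm_ex, Real.exp_le_exp, neg_mul, neg_mul, neg_le_neg_iff, mul_le_mul_iff_right₀ two_pi_pos]

/-- Lifts to `ℂ` of closed curves on `ℂ / ℤ` of degree one. -/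
def IsLift (a : ℝ → ℂ) : Prop := ContDiff ℝ 1 a ∧ ∀ t, a (t + 1) = a t + 1

lemma IsLift.isLoop (h : IsLift a) : IsLoop fun t => ex (a t) :=
  ⟨Complex.contDiff_exp.comp (contDiff_const.mul h.1), fun t => ex_eq_iff.2 ⟨1, by simp [h.2]⟩⟩

lemma IsLift.deriv (h : IsLift a) (t : ℝ) :
    deriv (fun t => ex (a t)) t = 2 * pi * I * (deriv a t * ex (a t)) := by
  have h1 := ((h.1.differentiable (by simp) t).hasDerivAt.const_mul (2 * pi * I)).cexp
  refine (HasDerivAt.deriv h1).trans ?_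
  rw [ex]
  ring

lemma IsLift.wind_zero (h : IsLift a) : wind (fun t => ex (a t)) 0 = 1 := by
  have h2 : ∀ t, 2 * pi * I * (_root_.deriv a t * ex (a t)) / (ex (a t) - 0) =
      2 * pi * I * _root_.deriv a t := fun t => by
    rw [sub_zero, ← mul_assoc, mul_div_cancel_right₀ _ ex_ne_zero]
  simp only [wind, h.deriv, h2]
  rw [integral_const_mul, integral_deriv_Icc (fun t => (h.1.differentiable (by simp) t).hasDerivAt)
    (h.1.continuous_deriv le_rfl), show a 1 = a 0 + 1 by simpa using h.2 0, add_sub_cancel_left, mul_one,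
    inv_mul_cancel₀ two_pi_I_ne_zero]

lemma IsLift.exists_im (h : IsLift a) : (∃ s, ∀ t, (a t).im ≤ (a s).im) ∧ ∃ s, ∀ t, (a s).im ≤ (a t).im := by
  have hc : IsCompact (range fun t => (a t).im) := Periodic.compact_of_continuous
    (fun t => by simp [h.2]) one_ne_zero (continuous_im.comp h.1.continuous)
  obtain ⟨_, ⟨s, rfl⟩, hs⟩ := hc.exists_isGreatest (Set.range_nonempty _)
  obtain ⟨_, ⟨s', rfl⟩, hs'⟩ := hc.exists_isLeast (Set.range_nonempty _)
  exact ⟨⟨s, fun t => hs ⟨t, rfl⟩⟩, s', fun t => hs' ⟨t, rfl⟩⟩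

lemma wind_const {γ : ℝ → ℂ} (h : IsLoop γ) (hb : Continuous b) (hd : ∀ s t, γ s ≠ b t) (s t : ℝ) :
    wind γ (b s) = wind γ (b t) :=
  ((IsLocallyConstant.iff_eventually_eq _).2 fun t => hb.continuousAt.eventually
    (wind_eventually h fun ⟨s, hs⟩ => hd s t hs)).apply_eq_of_preconnectedSpace (f := fun t => wind γ (b t)) s t

/-- Larger imaginary part means smaller modulus under `ex`. So `ex (b t₀)` is no further from `0`
than the curve, which has the same winding number about both points, and about `0` it is the degree
of the lift. -/
lemma wind_eq_one (ha : IsLift a) (hb : IsLift b) (hd : ∀ s t, ex (a s) ≠ ex (b t)) {t₀ : ℝ}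
    (h : ∀ s, (a s).im ≤ (b t₀).im) (t : ℝ) : wind (fun t => ex (a t)) (ex (b t)) = 1 := by
  rw [wind_const ha.isLoop hb.isLoop.1.continuous hd t t₀, ← ha.wind_zero]
  exact wind_eq_of_norm_le ha.isLoop (fun s => hd s t₀) (fun s => ex_ne_zero) fun s => by
    simpa using norm_ex_le.2 (h s)

lemma IsLift.wind_eq_zero (ha : IsLift a) (hb : IsLift b) (hd : ∀ s t, ex (a s) ≠ ex (b t)) {t₀ : ℝ}
    (h : ∀ s, (b t₀).im ≤ (a s).im) (t : ℝ) : wind (fun t => ex (a t)) (ex (b t)) = 0 := by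
  rw [wind_const ha.isLoop hb.isLoop.1.continuous hd t t₀]
  exact EllipticConfig.wind_eq_zero ha.isLoop (fun s => hd s t₀) fun s => norm_ex_le.2 (h s)

/-- Disjoint curves of degree one on a cylinder lie one above the other, and their highest points
decide which. If the highest and the lowest points suggested different orders, one curve would have
winding number both `0` and `1` about the other. -/
lemma wind_lift (ha : IsLift a) (hb : IsLift b) (hd : ∀ s t, ex (a s) ≠ ex (b t)) {s₀ t₀ : ℝ}
    (hs : ∀ s, (a s).im ≤ (a s₀).im) (ht : ∀ t, (b t).im ≤ (b t₀).im) : (a s₀).im ≠ (b t₀).im ∧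
      ∀ t, wind (fun t => ex (a t)) (ex (b t)) = if (a s₀).im < (b t₀).im then 1 else 0 := by
  have hlt : (b t₀).im ≤ (a s₀).im → ∀ t, wind (fun t => ex (a t)) (ex (b t)) = 0 := fun hle => by
    obtain ⟨s₁, hs₁⟩ := ha.exists_im.2
    obtain ⟨t₁, ht₁⟩ := hb.exists_im.2
    rcases le_total (b t₁).im (a s₁).im with h | h
    · exact ha.wind_eq_zero hb hd fun s => h.trans (hs₁ s)
    · have hd' : ∀ s t, ex (b s) ≠ ex (a t) := fun s t => (hd t s).symm
      have h1 := wind_eq_one hb ha hd' (fun s => (ht s).trans hle) 0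
      rw [hb.wind_eq_zero ha hd' (fun s => h.trans (ht₁ s)) 0] at h1
      exact absurd h1 zero_ne_one
  refine ⟨fun h => ?_, fun t => ?_⟩
  · have h1 := wind_eq_one ha hb hd (fun s => h ▸ hs s) 0
    rw [hlt h.ge] at h1
    exact zero_ne_one h1
  · split_ifs with h
    · exact wind_eq_one ha hb hd (fun s => (hs s).trans h.le) t
    · exact hlt (not_lt.1 h) t

/-- The curves are disjoint, and `L i j` records the position of the `i`-th curve relative to the
translates of the `j`-th one. -/
def IsSystem (τ : ℍ) (L : Fin n → Fin n → ℤ) (A : Fin n → ℝ → ℂ) : Prop :=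
  IsDisjointACycles τ A ∧ ∀ i j, i ≠ j → ∀ t (l : ℤ),
    wind (fun s => ex (A i s)) (ex (A j t + l * τ)) = if L i j ≤ l then 1 else 0

lemma im_int_mul (l : ℤ) : ((l : ℂ) * τ).im = l * τ.im := by simp

/-- The translate of the `j`-th curve by `l τ` lies above the `i`-th curve exactly if `h i < h j +
l`, and `⌊h i - h j⌋ + 1` is the least such integer `l`. So arbitrary disjoint curves have the same
relative position as the horizontal lines at the heights of their highest points. -/
lemma isSystem {A : Fin n → ℝ → ℂ} (hA : IsDisjointACycles τ A) {h : ℝ^n}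
    (hh : ∀ i, ∃ s, (A i s).im = h i * τ.im ∧ ∀ t, (A i t).im ≤ (A i s).im) :
    Generic h ∧ IsSystem τ (fun i j => ⌊h i - h j⌋ + 1) A := by
  have key : ∀ i j, i ≠ j → ∀ l : ℤ, h i - h j ≠ l ∧ ∀ t,
      wind (fun s => ex (A i s)) (ex (A j t + l * τ)) = if h i - h j < l then 1 else 0 := by
    intro i j hij l
    obtain ⟨s, hs, hs'⟩ := hh i
    obtain ⟨t, ht, ht'⟩ := hh j
    have h1 := wind_lift (b := fun t => A j t + l * τ) (s₀ := s) (t₀ := t) (hA.1 i)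
      ⟨(hA.1 j).1.add contDiff_const, fun t => by simp only [(hA.1 j).2]; ring⟩ (fun s t he => by
        obtain ⟨k, hk⟩ := ex_eq_iff.1 he
        exact hA.2 i j hij s t ⟨k, l, by rw [hk]; ring⟩) hs' (fun t => by simpa using ht' t)
    simp only [add_im, im_int_mul, hs, ht, ← add_mul,
      mul_lt_mul_iff_left₀ τ.im_pos, Ne, mul_left_inj' τ.im_pos.ne'] at h1
    exact ⟨fun h2 => h1.1 (by linarith), fun t => by rw [h1.2]; congr 1; rw [sub_lt_iff_lt_add']⟩
  refine ⟨fun i j hij l => (key i j hij l).1, hA, fun i j hij t l => ?_⟩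
  rw [(key i j hij l).2]
  simp only [Int.add_one_le_iff, Int.floor_lt]

end

section

/-! ### Integration over one closed curve -/

lemma exists_branch {w₀ : ℂ} (h : w₀ ≠ 0) : ∃ B : ℂ → ℂ, ContDiffAt ℂ ∞ B w₀ ∧
    ∀ᶠ w in 𝓝 w₀, w ≠ 0 ∧ ∃ k : ℤ, lg w = B w + k := by
  refine ⟨fun w => lg w₀ + lg (w / w₀), ?_, ?_⟩
  · have h1 : ContDiffAt ℂ ∞ Complex.log (w₀ / w₀) := Complex.contDiffAt_log (by rw [div_self h]; simp)
    exact contDiffAt_const.add ((h1.comp (f := fun w => w / w₀) w₀ (contDiffAt_id.div_const w₀)).div_const _)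
  · filter_upwards [isOpen_ne.mem_nhds h] with w hw
    refine ⟨hw, ex_eq_iff.1 ?_⟩
    rw [ex_add, ex_lg hw, ex_lg h, ex_lg (div_ne_zero hw h), mul_div_cancel₀ _ h]

/-- Invariance under translations by `ℤⁿ`. -/
def IsIntPeriodic (τ : ℍ) (F : ℂ^n → ℂ) : Prop :=
  ∀ z ∉ bigDiagonal n τ, ∀ i, ∀ k : ℤ, F (z + Pi.single i (k : ℂ)) = F z

lemma int_mem_lattice (k : ℤ) (t : ℂ) : (k : ℂ) ∈ lattice t := ⟨k, 0, by simp⟩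

lemma add_single_mem_iff (z : ℂ^n) (i : Fin n) (k : ℤ) :
    z + Pi.single i (k : ℂ) ∈ bigDiagonal n τ ↔ z ∈ bigDiagonal n τ :=
  add_mem_bigDiagonal_iff fun j => single_mem_latticeGroup i (int_mem_lattice k τ) j

/-- Here `w = exp(2πi z_0)` stands for the variable to be integrated out. The condition does not
depend on the branch, because the diagonals are invariant under `ℤⁿ`. -/
def cylDom (n : ℕ) (τ : ℍ) : Set (ℂ^n × ℂ) := {p | p.2 ≠ 0 ∧ ins 0 (lg p.2, p.1) ∉ bigDiagonal (n + 1) τ}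

variable {F : ℂ^(n + 1) → ℂ}

lemma cylDom_spec {p₀ : ℂ^n × ℂ} (hp : p₀ ∈ cylDom n τ) : cylDom n τ ∈ 𝓝 p₀ ∧
    (ContDiffOn ℂ ∞ F (bigDiagonal (n + 1) τ)ᶜ → IsIntPeriodic τ F →
      ContDiffAt ℂ ∞ (fun p => F (ins 0 (lg p.2, p.1))) p₀) := by
  obtain ⟨B, hB, he⟩ := exists_branch hp.1
  set Ψ : ℂ^n × ℂ → ℂ^(n + 1) := fun p => ins 0 (B p.2, p.1)
  have hΨ : ContDiffAt ℂ ∞ Ψ p₀ := (ins (n := n) 0).contDiff.contDiffAt.comp p₀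
    ((hB.comp p₀ contDiffAt_snd).prodMk contDiffAt_fst)
  have he' := continuousAt_snd.eventually he
  have hs : ∀ p : ℂ^n × ℂ, (∃ k : ℤ, lg p.2 = B p.2 + k) →
      ∃ k : ℤ, ins 0 (lg p.2, p.1) = Ψ p + Pi.single 0 (k : ℂ) := fun p ⟨k, hk⟩ =>
    ⟨k, by rw [hk, ins_add_left]⟩
  have h0 : Ψ p₀ ∈ (bigDiagonal (n + 1) τ)ᶜ := fun h => by
    obtain ⟨k, hk⟩ := hs p₀ he'.self_of_nhds.2
    exact hp.2 (by rwa [hk, add_single_mem_iff])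
  have hD := hΨ.continuousAt.eventually ((isClosed_bigDiagonal (n + 1) τ).isOpen_compl.mem_nhds h0)
  refine ⟨?_, fun hF hper => ?_⟩
  · filter_upwards [he', hD] with p hp h1
    obtain ⟨k, hk⟩ := hs p hp.2
    exact ⟨hp.1, by rwa [hk, add_single_mem_iff]⟩
  · refine ((hF.contDiffAt ((isClosed_bigDiagonal (n + 1) τ).isOpen_compl.mem_nhds h0)).comp p₀
      hΨ).congr_of_eventuallyEq ?_
    filter_upwards [he', hD] with p hp h1
    obtain ⟨k, hk⟩ := hs p hp.2
    rw [hk, hper _ h1]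
    rfl

lemma norm_ex_tau (u : ℂ) (l : ℤ) : ‖ex (u + l * τ)‖ = Real.exp (-(2 * pi * (u.im + l * τ.im))) := by
  rw [norm_ex]
  simp

lemma tendsto_ex_atTop (u : ℂ) : Tendsto (fun p : ℂ × ℤ => ex (p.1 + p.2 * τ)) (𝓝 u ×ˢ atTop) (𝓝 0) := by
  rw [tendsto_zero_iff_norm_tendsto_zero]
  simp only [norm_ex_tau]
  exact Real.tendsto_exp_neg_atTop_nhds_zero.comp (Tendsto.const_mul_atTop two_pi_pos
    (((continuous_im.tendsto u).comp Filter.tendsto_fst).add_atTop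
    ((tendsto_intCast_atTop_atTop.comp Filter.tendsto_snd).atTop_mul_const τ.im_pos)))

lemma tendsto_ex_atBot (u : ℂ) :
    Tendsto (fun p : ℂ × ℤ => ex (p.1 + p.2 * τ)) (𝓝 u ×ˢ Filter.atBot) (Filter.cocompact ℂ) := by
  rw [← Metric.cobounded_eq_cocompact, ← tendsto_norm_atTop_iff_cobounded]
  simp only [norm_ex_tau]
  exact Real.tendsto_exp_atTop.comp (Filter.tendsto_neg_atBot_atTop.comp (Tendsto.const_mul_atBot two_pi_pos
    (((continuous_im.tendsto u).comp Filter.tendsto_fst).add_atBot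
    ((tendsto_intCast_atBot_iff.2 Filter.tendsto_snd).atBot_mul_const τ.im_pos))))

/-- Cutoff functions on `ℂ` that are locally constant near the points `exp(2πi(z_j + l τ))`. -/
def IsCut (τ : ℍ) (L : Fin n → ℤ) (z : ℂ^n) (ρ : ℂ → ℂ) : Prop := IsTest ρ ∧ (ρ =ᶠ[𝓝 0] fun _ => 1) ∧
    ∀ j (l : ℤ), ρ =ᶠ[𝓝 (ex (z j + l * τ))] fun _ => if L j ≤ l then 1 else 0

variable {L : Fin n → ℤ} {ρ : ℂ → ℂ}

/-- The points `ex (z_j + l τ)` tend to `0` for `l → ∞` and to infinity for `l → -∞`. So those with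
`l ≥ L j` together with `0` form a compact set and the others a closed set; the two are disjoint
since `z` lies off the diagonals. -/
lemma exists_isCut (hz : z ∉ bigDiagonal n τ) (L : Fin n → ℤ) : ∃ ρ, IsCut τ L z ρ := by
  have hK : IsCompact ({0} ∪ ⋃ j, insert 0 (range fun k : ℕ => ex (z j + (L j + k : ℤ) * τ))) := by
    refine isCompact_singleton.union (isCompact_iUnion fun j => Tendsto.isCompact_insert_range ?_)
    exact (tendsto_ex_atTop (z j)).comp (tendsto_const_nhds.prodMk
      (Filter.tendsto_atTop_add_const_left _ _ tendsto_natCast_atTop_atTop))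
  have hC : IsClosed (⋃ j, range fun k : ℕ => ex (z j + (L j - 1 - k : ℤ) * τ)) := by
    refine isClosed_iUnion_of_finite fun j => ?_
    refine (isProperMap_iff_tendsto_cocompact.2 ⟨continuous_of_discreteTopology, ?_⟩).isClosedMap.isClosed_range
    rw [Filter.cocompact_eq_cofinite, Nat.cofinite_eq_atTop]
    exact (tendsto_ex_atBot (z j)).comp (tendsto_const_nhds.prodMk (Filter.tendsto_atBot_add_const_left _ _
      (Filter.tendsto_neg_atTop_atBot.comp tendsto_natCast_atTop_atTop)))
  obtain ⟨ρ, hρ, h1, h0⟩ := exists_isTest_separating hK hC (by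
    rw [Set.disjoint_left]
    rintro x hx hx'
    obtain ⟨i, k, rfl⟩ := mem_iUnion.1 hx'
    simp only [Set.singleton_union, Set.mem_insert_iff, mem_iUnion, ex_ne_zero, false_or] at hx
    obtain ⟨j, m, hm⟩ := hx
    obtain ⟨r, hr⟩ := ex_eq_iff.1 hm
    have hij : j = i := by_contra fun hij => hz ⟨j, i, hij, r, (L i - 1 - k) - (L j + m), by
      push_cast at hr ⊢
      linear_combination hr⟩
    subst hij
    have h2 := congrArg Complex.im hr
    simp only [add_im, im_int_mul, intCast_im, add_zero, add_right_inj,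
      mul_left_inj' τ.im_pos.ne', Int.cast_inj] at h2
    omega)
  refine ⟨ρ, hρ, h1 0 (Or.inl rfl), fun j l => ?_⟩
  split_ifs with hl
  · obtain ⟨k, rfl⟩ : ∃ k : ℕ, l = L j + k := ⟨(l - L j).toNat, by omega⟩
    exact h1 _ (Or.inr (mem_iUnion.2 ⟨j, Or.inr ⟨k, rfl⟩⟩))
  · obtain ⟨k, rfl⟩ : ∃ k : ℕ, l = L j - 1 - k := ⟨(L j - 1 - l).toNat, by omega⟩
    exact h0 _ (mem_iUnion.2 ⟨j, ⟨k, rfl⟩⟩)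

/-- Of the infinitely many conditions, those with large `|l|` hold uniformly near `z`, because `ρ`
is `1` near `0` and has compact support. The finitely many remaining ones are open. -/
lemma IsCut.eventually (h : IsCut τ L z ρ) : ∀ᶠ z' in 𝓝 z, IsCut τ L z' ρ := by
  have key : ∀ j, ∀ᶠ u in 𝓝 (z j), ∀ l : ℤ, ρ =ᶠ[𝓝 (ex (u + l * τ))] fun _ => if L j ≤ l then 1 else 0 := by
    intro j
    obtain ⟨p, hp, q, hq, h1⟩ := Filter.eventually_prod_iff.1
      ((tendsto_ex_atTop (τ := τ) (z j)).eventually h.2.1.eventuallyEq_nhds)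
    obtain ⟨p', hp', q', hq', h1'⟩ := Filter.eventually_prod_iff.1 ((tendsto_ex_atBot (τ := τ) (z j)).eventually
      h.1.2.compl_mem_cocompact)
    obtain ⟨m, hm⟩ := Filter.eventually_atTop.1 hq
    obtain ⟨m', hm'⟩ := Filter.eventually_atBot.1 hq'
    have hmid : ∀ᶠ u in 𝓝 (z j), ∀ l ∈ Finset.Icc (min m' (L j)) (max m (L j)),
        ρ =ᶠ[𝓝 (ex (u + l * τ))] fun _ => if L j ≤ l then 1 else 0 := by
      rw [Finset.eventually_all]
      intro l _
      have hc : Continuous fun u => ex (u + l * τ) := by unfold ex; fun_prop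
      exact hc.continuousAt.eventually (h.2.2 j l).eventuallyEq_nhds
    filter_upwards [hp, hp', hmid] with u a b c l
    by_cases hl : l ∈ Finset.Icc (min m' (L j)) (max m (L j))
    · exact c l hl
    · rw [Finset.mem_Icc, not_and_or, not_le, not_le, lt_min_iff, max_lt_iff] at hl
      rcases hl with hl | hl
      · rw [if_neg (by omega)]
        exact notMem_tsupport_iff_eventuallyEq.1 (h1' b (hm' l hl.1.le))
      · rw [if_pos hl.2.le]
        exact h1 a (hm l hl.1.le)
  filter_upwards [eventually_all.2 fun j => (continuous_apply j).continuousAt.eventually (key j)] with z' hz'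
  exact ⟨h.1, h.2.1, hz'⟩

lemma exists_of_notMem_cylDom (hz : z ∉ bigDiagonal n τ) (hw : (z, w) ∉ cylDom n τ) :
    w = 0 ∨ ∃ j, ∃ l : ℤ, w = ex (z j + l * τ) := by
  by_contra! h
  refine hw ⟨h.1, (ins_notMem_bigDiagonal 0).2 ⟨hz, fun j ⟨k, l, hl⟩ => h.2 j l ?_⟩⟩
  rw [← ex_lg h.1]
  exact ex_eq_iff.2 ⟨k, by linear_combination hl⟩

/-- The constant near each point outside the domain. -/
lemma IsCut.exists_const (hz : z ∉ bigDiagonal n τ) (L : Fin n → ℤ) : ∃ c : ℂ → ℂ, ∀ ρ, IsCut τ L z ρ →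
    ∀ w ∉ {w | (z, w) ∈ cylDom n τ}, ρ =ᶠ[𝓝 w] fun _ => c w := by
  obtain ⟨ρ₀, h₀⟩ := exists_isCut hz L
  refine ⟨ρ₀, fun ρ h w hw => ?_⟩
  rcases exists_of_notMem_cylDom hz hw with rfl | ⟨j, l, rfl⟩
  · rw [h₀.2.1.self_of_nhds]; exact h.2.1
  · rw [(h₀.2.2 j l).self_of_nhds]; exact h.2.2 j l

lemma ins_add_right (i : Fin (n + 1)) (w : ℂ) (z : ℂ^n) (j : Fin n) (c : ℂ) :
    ins i (w, z + Pi.single j c) = ins i (w, z) + Pi.single (i.succAbove j) c := by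
  funext m
  refine Fin.succAboveCases i ?_ (fun m => ?_) m <;> simp [Pi.single_apply]

/-- The constant `-1 / π` is the factor `-2i` of `integral_loop_eq` divided by the `2πi` from `dw =
2πi w dz`. -/
def cutInt (F : ℂ^(n + 1) → ℂ) (z : ℂ^n) (ρ : ℂ → ℂ) : ℂ :=
  -(pi : ℂ)⁻¹ * ∫ w, F (ins 0 (lg w, z)) / w * dzbar 1 ρ w

/-- Integration of one variable over a closed curve extends to a holomorphic function of the others. -/
lemma exists_push (hF : ContDiffOn ℂ ∞ F (bigDiagonal (n + 1) τ)ᶜ) (hper : IsIntPeriodic τ F)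
    (L : Fin n → ℤ) : ∃ G : ℂ^n → ℂ, ContDiffOn ℂ ∞ G (bigDiagonal n τ)ᶜ ∧ IsIntPeriodic τ G ∧
      ∀ a, IsLift a → ∀ z ∉ bigDiagonal n τ, (∀ t j, a t - z j ∉ lattice τ) →
        (∀ j (l : ℤ), wind (fun t => ex (a t)) (ex (z j + l * τ)) = if L j ≤ l then 1 else 0) →
        ∫ t in Icc (0 : ℝ) 1, deriv a t * F (ins 0 (a t, z)) = G z := by
  have hop : ∀ z : ℂ^n, IsOpen {w | (z, w) ∈ cylDom n τ} := fun z =>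
    isOpen_iff_mem_nhds.2 fun w hw => (Continuous.prodMk_right z).continuousAt (cylDom_spec (F := 0) hw).1
  have hg : ∀ z : ℂ^n, DifferentiableOn ℂ (fun w => F (ins 0 (lg w, z)) / w)
      {w | (z, w) ∈ cylDom n τ} := fun z w hw =>
    ((((cylDom_spec hw).2 hF hper).comp w (contDiffAt_const.prodMk contDiffAt_id)).differentiableAt
      (by simp)).div differentiableAt_id hw.1 |>.differentiableWithinAt
  choose! R hR using fun z (hz : z ∉ bigDiagonal n τ) => exists_isCut hz L
  -- The value does not depend on the cutoff function, so one cutoff serves for all points near `z`;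
  -- this gives holomorphy in `z` although the choice `R` is arbitrary.
  have hG : ∀ z ∉ bigDiagonal n τ, ∀ ρ, IsCut τ L z ρ → cutInt F z (R z) = cutInt F z ρ := by
    intro z hz ρ hρ
    obtain ⟨c, hc⟩ := IsCut.exists_const hz L
    rw [cutInt, cutInt, integral_mul_dzbar_congr (hop z) (hg z) (hR z hz).1 hρ.1 (hc _ (hR z hz)) (hc _ hρ)]
  refine ⟨fun z => cutInt F z (R z), fun z hz => ?_, fun z hz j k => ?_, fun a ha z hz had hw => ?_⟩
  · obtain ⟨U, hU, hUo, hzU⟩ := mem_nhds_iff.1 (inter_mem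
      ((isClosed_bigDiagonal n τ).isOpen_compl.mem_nhds hz) (hR z hz).eventually)
    have hm : ∀ x ∈ U, ∀ w, (x, w) ∉ cylDom n τ → dzbar 1 (R z) =ᶠ[𝓝 w] fun _ => 0 := fun x hx w hw => by
      obtain ⟨c, hc⟩ := IsCut.exists_const (hU hx).1 L
      exact dzbar_eventuallyEq_zero (hc _ (hU hx).2 w hw)
    have hφ : Continuous fun q : ℂ^n × (ℂ × ℂ) => (q.1, q.2.1) := by fun_prop
    have main := contDiffOn_integral_param (𝕜 := ℂ) (μ := volume) ((hR z hz).1.dzbar 1).2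
      (c := fun w => (w, dzbar 1 (R z) w)) (continuous_id.prodMk ((hR z hz).1.dzbar 1).continuous).continuousOn
      (W := (fun q : ℂ^n × (ℂ × ℂ) => (q.1, q.2.1)) ⁻¹' cylDom n τ)
      ((isOpen_iff_mem_nhds.2 fun p hp => (cylDom_spec (F := 0) hp).1).preimage hφ) hUo
      (fun x hx w hw => by_contra fun h => notMem_tsupport_iff_eventuallyEq.2 (hm x hx w h) hw)
      (g := fun q => F (ins 0 (lg q.2.1, q.1)) / q.2.1 * q.2.2) fun q hq =>
        ((((cylDom_spec hq).2 hF hper).comp q (contDiffAt_fst.prodMk (contDiffAt_fst.comp q contDiffAt_snd))).div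
          (contDiffAt_fst.comp q contDiffAt_snd) hq.1).mul (contDiffAt_snd.comp q contDiffAt_snd)
          |>.contDiffWithinAt
    refine (((contDiffAt_const (c := -(pi : ℂ)⁻¹)).mul (main.contDiffAt (hUo.mem_nhds hzU))).congr_of_eventuallyEq
      (f₁ := fun z => cutInt F z (R z)) ?_).contDiffWithinAt
    filter_upwards [hUo.mem_nhds hzU] with x hx
    rw [hG x (hU hx).1 _ (hU hx).2, cutInt]
    congr 1
    exact (setIntegral_eq_integral_of_forall_compl_eq_zero fun w hw => by
      rw [image_eq_zero_of_notMem_tsupport hw, mul_zero]).symm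
  · have h1 : IsCut τ L (z + Pi.single j (k : ℂ)) (R z) := by
      refine ⟨(hR z hz).1, (hR z hz).2.1, fun i l => ?_⟩
      have : ex ((z + Pi.single j (k : ℂ) : ℂ^n) i + l * τ) = ex (z i + l * τ) := ex_eq_iff.2 (by
        rcases eq_or_ne i j with rfl | h
        · exact ⟨k, by simp; ring⟩
        · exact ⟨0, by simp [h]⟩)
      rw [this]
      exact (hR z hz).2.2 i l
    simp only
    rw [hG _ ((add_single_mem_iff z j k).not.2 hz) _ h1, cutInt, cutInt]
    congr 2
    funext w
    by_cases hw : (z, w) ∈ cylDom n τ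
    · rw [ins_add_right, hper _ hw.2]
    · obtain ⟨c, hc⟩ := IsCut.exists_const hz L
      rw [(dzbar_eventuallyEq_zero (hc _ (hR z hz) w hw)).self_of_nhds, mul_zero, mul_zero]
  · have hm : ∀ t, ins 0 (a t, z) ∉ bigDiagonal (n + 1) τ := fun t => (ins_notMem_bigDiagonal 0).2 ⟨hz, had t⟩
    have hl : ∀ t, ∃ k : ℤ, ins 0 (lg (ex (a t)), z) = ins 0 (a t, z) + Pi.single 0 (k : ℂ) := fun t => by
      obtain ⟨k, hk⟩ := ex_eq_iff.1 (ex_lg (ex_ne_zero (x := a t)))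
      exact ⟨k, by rw [hk, ins_add_left]⟩
    have h1 := integral_loop_eq ha.isLoop (hop z) (fun t => ⟨ex_ne_zero, by
      obtain ⟨k, hk⟩ := hl t
      simpa only [hk, add_single_mem_iff] using hm t⟩) (hg z) (hR z hz).1 fun x hx => by
      rcases exists_of_notMem_cylDom hz hx with rfl | ⟨j, l, rfl⟩
      · rw [ha.wind_zero]; exact (hR z hz).2.1
      · rw [hw]; exact (hR z hz).2.2 j l
    have h2 : ∀ t, deriv (fun t => ex (a t)) t * (F (ins 0 (lg (ex (a t)), z)) / ex (a t)) =
        2 * pi * I * (deriv a t * F (ins 0 (a t, z))) := fun t => by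
      obtain ⟨k, hk⟩ := hl t
      have := ex_ne_zero (x := a t)
      rw [ha.deriv, hk, hper _ (hm t)]
      field_simp
    simp only [h2] at h1
    rw [integral_const_mul] at h1
    have := two_pi_I_ne_zero
    have hpi : (pi : ℂ) ≠ 0 := by exact_mod_cast Real.pi_ne_zero
    simp only [cutInt]
    refine mul_left_cancel₀ this (h1.trans ?_)
    field_simp

/-- Integrating out the first curve leaves a function `G` that is holomorphic and periodic off the
diagonals in the other variables and depends on the curve only through its row of `L`; induction
then takes care of the other curves. -/
lemma exists_integral_eq (L : Fin n → Fin n → ℤ) {F : ℂ^n → ℂ}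
    (hF : ContDiffOn ℂ ∞ F (bigDiagonal n τ)ᶜ) (hper : IsIntPeriodic τ F) :
    ∃ c, ∀ A, IsSystem τ L A → ∫ t in Icc (0 : ℝ^n) 1,
      (∏ i, deriv (A i) (t i)) * F (fun i => A i (t i)) = c := by
  induction n with
  | zero =>
    refine ⟨∫ t in Icc (0 : ℝ^0) 1, F fun i => i.elim0, fun A _ => ?_⟩
    congr 1
    funext t
    rw [Finset.univ_eq_empty, Finset.prod_empty, one_mul]
    congr 1
    exact Subsingleton.elim _ _
  | succ n ih =>
    obtain ⟨G, hG, hGp, h⟩ := exists_push hF hper fun j => L 0 ((0 : Fin (n + 1)).succAbove j)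
    obtain ⟨c, hc⟩ := ih (fun i j => L ((0 : Fin (n + 1)).succAbove i) ((0 : Fin (n + 1)).succAbove j)) hG hGp
    refine ⟨c, fun A hA => ?_⟩
    have hne := Fin.succAbove_ne (0 : Fin (n + 1))
    rw [setIntegral_Icc_insertNth 0, ← hc (fun j => A ((0 : Fin (n + 1)).succAbove j)) ⟨⟨fun i => hA.1.1 _,
      fun i j hij => hA.1.2 _ _ fun h => hij (Fin.succAbove_right_injective h)⟩,
      fun i j hij => hA.2 _ _ fun h => hij (Fin.succAbove_right_injective h)⟩]
    · congr 1
      funext t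
      rw [← h (A 0) (hA.1.1 0) _ (fun ⟨i, j, hij, hl⟩ => hA.1.2 _ _ (fun h => hij
        (Fin.succAbove_right_injective h)) _ _ hl) (fun s j => hA.1.2 _ _ (hne j).symm _ _)
        (fun j l => hA.2 _ _ (hne j).symm _ _), ← integral_const_mul]
      congr 1
      funext s
      rw [Fin.prod_univ_succAbove _ 0]
      simp only [Fin.insertNth_apply_same, Fin.insertNth_apply_succAbove]
      rw [mul_comm (deriv _ _), mul_assoc]
      congr 3
      funext i
      refine Fin.succAboveCases 0 ?_ (fun i => ?_) i <;> simp only [ins_same, ins_succAbove,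
        Fin.insertNth_apply_same, Fin.insertNth_apply_succAbove]
    · have hc := fun i => (hA.1.1 i).1.continuous
      have hc' := fun i => (hA.1.1 i).1.continuous_deriv le_rfl
      exact (continuous_finsetProd _ fun i _ => (hc' i).comp (continuous_apply i)).mul
        (hF.continuousOn.comp_continuous (continuous_pi fun i => (hc i).comp (continuous_apply i))
          fun t ⟨i, j, hij, hl⟩ => hA.1.2 i j hij _ _ hl)

end

/-! ### Independence of the `A`-cycles -/

lemma isSystem_line {y : ℝ^n} (hy : Generic y) :
    IsSystem τ (fun i j => ⌊y i - y j⌋ + 1) fun i t => t + y i * (τ : ℂ) := by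
  refine (isSystem (A := fun i t => (t : ℂ) + y i * (τ : ℂ)) ⟨fun i => ⟨ofRealCLM.contDiff.add contDiff_const, fun t => by push_cast; ring⟩, fun i j hij s t hl => ?_⟩
    fun i => ⟨0, by simp, fun t => by simp⟩).2
  obtain ⟨m, hm⟩ := exists_int_of_mem_lattice hl
  rw [map_sub, yc_coord, yc_coord] at hm
  exact hy i j hij m hm

lemma aCycleIntegral_line (y : ℝ^n) (σ : Equiv.Perm (Fin n)) :
    aCycleIntegral (fun i t => t + y i * (τ : ℂ)) σ (fun z => Φ (z, τ)) =
      lineInt Φ (fun k => y (σ.symm k)) τ := by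
  have hd : ∀ (c : ℂ) (t : ℝ), deriv (fun t : ℝ => (t : ℂ) + c) t = 1 := fun c t =>
    ((ofRealCLM.hasDerivAt (x := t)).add_const c).deriv
  simp only [aCycleIntegral, hd, Finset.prod_const_one, one_mul]
  exact (integral_comp_perm σ.symm fun t => Φ (fun k => t k + y (σ.symm k) * (τ : ℂ), τ)).2

lemma aCycleIntegral_congr (hΦ : IsFam Φ) (hell : IsElliptic Φ) {L : Fin n → Fin n → ℤ}
    {A B : Fin n → ℝ → ℂ} (hA : IsSystem τ L A) (hB : IsSystem τ L B) (σ : Equiv.Perm (Fin n)) :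
    aCycleIntegral A σ (fun z => Φ (z, τ)) = aCycleIntegral B σ fun z => Φ (z, τ) := by
  have hz : ∀ z ∉ bigDiagonal n τ, (fun k => z (σ.symm k)) ∉ bigDiagonal n τ := fun z hz ⟨i, j, hij, hl⟩ =>
    hz ⟨_, _, σ.symm.injective.ne hij, hl⟩
  obtain ⟨c, hc⟩ := exists_integral_eq (τ := τ) L (F := fun z => Φ (fun k => z (σ.symm k), τ))
    (hΦ.contDiffOn.comp (ContDiff.contDiffOn (by fun_prop)) fun z h => ⟨τ.im_pos, hz z h⟩) fun z h i k =>
      hell τ _ (hz z h) (fun j => (Pi.single i (k : ℂ) : ℂ^n) (σ.symm j)) fun j =>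
        single_mem_latticeGroup i (int_mem_lattice k τ) _
  exact (hc A hA).trans (hc B hB).symm

lemma lineInt_congr (hΦ : IsFam Φ) (hell : IsElliptic Φ) {y y' : ℝ^n} (hy : Generic y)
    (hy' : Generic y') (h : ∀ i j, ⌊y i - y j⌋ = ⌊y' i - y' j⌋) : lineInt Φ y τ = lineInt Φ y' τ := by
  have h1 := isSystem_line (τ := τ) hy
  simp only [h] at h1
  have h2 := aCycleIntegral_congr hΦ hell h1 (isSystem_line hy') 1
  rwa [aCycleIntegral_line, aCycleIntegral_line] at h2

/-- Ellipticity in the direction `τ` allows the heights to be replaced by their fractional parts,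
and the sum over all permutations allows these to be sorted. -/
lemma exists_strictMono_sum_lineInt (hell : IsElliptic Φ) {y : ℝ^n} (hy : Generic y) :
    ∃ u : ℝ^n, StrictMono u ∧ (∀ i, u i ∈ Ico (0 : ℝ) 1) ∧
      ∑ σ : Equiv.Perm (Fin n), lineInt Φ (fun k => y (σ k)) τ =
        ∑ σ : Equiv.Perm (Fin n), lineInt Φ (fun k => u (σ k)) τ := by
  set π := Tuple.sort fun k => Int.fract (y k)
  have hinj : Injective fun k => Int.fract (y k) := fun i j hij => by
    by_contra h
    obtain ⟨m, hm⟩ := Int.fract_eq_fract.1 hij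
    exact hy i j h m hm
  refine ⟨fun k => Int.fract (y (π k)), (Tuple.monotone_sort _).strictMono_of_injective
    (hinj.comp π.injective), fun i => ⟨Int.fract_nonneg _, Int.fract_lt_one _⟩, ?_⟩
  rw [← Equiv.sum_comp (Equiv.mulLeft π)]
  refine sum_congr rfl fun σ _ => setIntegral_congr_fun measurableSet_Icc fun x _ => ?_
  have h := hell τ (fun k => x k + (Int.fract (y (π (σ k))) : ℝ) * (τ : ℂ)) (offDiag_line τ.im_pos (y := fun k =>
    Int.fract (y (π (σ k)))) (fun i j hij m hm => hy (π (σ i)) (π (σ j)) (by simpa using hij)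
      (⌊y (π (σ i))⌋ - ⌊y (π (σ j))⌋ + m) (by
        rw [Int.fract, Int.fract] at hm
        push_cast
        linarith)) x).2 (fun k => ⌊y (π (σ k))⌋ * (τ : ℂ)) fun k => ⟨0, ⌊y (π (σ k))⌋, by simp⟩
  refine Eq.trans ?_ h
  simp only
  congr 2
  funext k
  have : ((y (π (σ k)) : ℝ) : ℂ) = ⌊y (π (σ k))⌋ + (Int.fract (y (π (σ k))) : ℝ) := by
    exact_mod_cast (Int.floor_add_fract (y (π (σ k)))).symm
  simp only [Equiv.coe_mulLeft, Equiv.Perm.mul_apply, this, Pi.add_apply]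
  ring

/-- Once the heights increase within `[0, 1)`, the integers `⌊u i - u j⌋` depend only on the order
of the indices, so both systems of lines have the same relative position for every permutation. -/
lemma sum_lineInt_eq (hΦ : IsFam Φ) (hell : IsElliptic Φ) {y y' : ℝ^n} (hy : Generic y)
    (hy' : Generic y') : ∑ σ : Equiv.Perm (Fin n), lineInt Φ (fun k => y (σ k)) τ =
      ∑ σ : Equiv.Perm (Fin n), lineInt Φ (fun k => y' (σ k)) τ := by
  obtain ⟨u, hu, hu', e⟩ := exists_strictMono_sum_lineInt (τ := τ) hell hy
  obtain ⟨v, hv, hv', e'⟩ := exists_strictMono_sum_lineInt (τ := τ) hell hy'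
  have hfl : ∀ {u : ℝ^n}, StrictMono u → (∀ i, u i ∈ Ico (0 : ℝ) 1) → ∀ i j,
      ⌊u i - u j⌋ = if i < j then -1 else 0 := fun hu hu' i j => by
    have := hu' i
    have := hu' j
    split_ifs with h
    · rw [Int.floor_eq_iff]
      have := hu h
      push_cast
      constructor <;> linarith [(hu' i).1, (hu' j).2]
    · rw [Int.floor_eq_iff]
      have := hu.monotone (not_lt.1 h)
      push_cast
      constructor <;> linarith [(hu' i).2, (hu' j).1]
  have hg : ∀ {u : ℝ^n}, StrictMono u → (∀ i, u i ∈ Ico (0 : ℝ) 1) →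
      ∀ σ : Equiv.Perm (Fin n), Generic fun k => u (σ k) := fun {u} hu hu' σ i j hij m hm => by
    have h1 : (m : ℝ) < 1 := by linarith [(hu' (σ i)).2, (hu' (σ j)).1]
    have h2 : (-1 : ℝ) < m := by linarith [(hu' (σ i)).1, (hu' (σ j)).2]
    have h3 : m = 0 := by
      have h1' : m < 1 := by exact_mod_cast h1
      have h2' : -1 < m := by exact_mod_cast h2
      omega
    rw [h3, Int.cast_zero, sub_eq_zero] at hm
    exact hij (σ.injective (hu.injective hm))
  rw [e, e']
  exact sum_congr rfl fun σ _ => lineInt_congr hΦ hell (hg hu hu' σ) (hg hv hv' σ) fun i j => by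
    simp only [hfl hu hu', hfl hv hv']

/-- The averaged integral over disjoint `A`-cycles is the symmetrized integral over lines. -/
lemma averagedACycleIntegral_eq (hΦ : IsFam Φ) (hell : IsElliptic Φ) {A : Fin n → ℝ → ℂ}
    (hA : IsDisjointACycles τ A) {y : ℝ^n} (hy : Generic y) :
    1 / (n ! : ℂ) * ∑ σ : Equiv.Perm (Fin n), lineInt Φ (fun k => y (σ k)) τ =
      averagedACycleIntegral A fun z => Φ (z, τ) := by
  choose s hs using fun i => (IsLift.exists_im (hA.1 i)).1
  obtain ⟨hg, hS⟩ := isSystem hA (h := fun i => (A i (s i)).im / τ.im) fun i =>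
    ⟨s i, (div_mul_cancel₀ _ τ.im_pos.ne').symm, hs i⟩
  rw [averagedACycleIntegral, sum_lineInt_eq hΦ hell hy hg, ← Equiv.sum_comp (Equiv.inv _)]
  congr 1
  refine sum_congr rfl fun σ _ => ?_
  rw [aCycleIntegral_congr hΦ hell hS (isSystem_line hg), aCycleIntegral_line]
  rfl

section

variable {τ' : ℍ}

/-! ### Modular transformations -/

section Scaling

variable {j : ℂ}

lemma smul_mem_bigDiagonal (hl : ∀ w, w ∈ lattice τ' ↔ j * w ∈ lattice τ) (z : ℂ^n) :
    j • z ∈ bigDiagonal n τ ↔ z ∈ bigDiagonal n τ' := by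
  simp [bigDiagonal, hl, mul_sub]

lemma diagonalThrough_smul (hl : ∀ w, w ∈ lattice τ' ↔ j * w ∈ lattice τ) (p : ℂ^n) :
    diagonalThrough τ (j • p) = diagonalThrough τ' p := by
  funext e
  simp [diagonalThrough, hl, mul_sub]

lemma IsPeriodic.comp_smul (hl : ∀ w, w ∈ lattice τ' ↔ j * w ∈ lattice τ) (hF : IsPeriodic τ F) :
    IsPeriodic τ' fun z => F (j • z) := fun z hz l hll => by
  show F (j • (z + l)) = F (j • z)
  rw [smul_add]
  exact hF _ ((smul_mem_bigDiagonal hl z).not.2 hz) _ fun i => (hl _).1 (hll i)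

lemma HasHolomorphicPoles.comp_smul (hl : ∀ w, w ∈ lattice τ' ↔ j * w ∈ lattice τ) (hF : HasHolomorphicPoles τ F) :
    HasHolomorphicPoles τ' fun z => F (j • z) := by
  classical
  refine ⟨hF.1.comp_smul hl, fun p => ?_⟩
  obtain ⟨U, N, h, hU, hp, hh, e⟩ := hF.2 (j • p)
  have hs : Smooth fun z : ℂ^n => j • z := contDiff_const_smul j
  refine ⟨(fun z => j • z) ⁻¹' U, N, fun z => h (j • z) / (∏ e : Fin n × Fin n with diagonalThrough τ' p e, j) ^ N,
    hU.preimage hs.continuous, hp, (hh.comp hs.contDiffOn fun z hz => hz).div_const _, fun z hz hd => ?_⟩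
  have h1 : ∀ e, localEquation (j • p) e (j • z) = j * localEquation p e z := fun e => by
    simp [localEquation]; ring
  show F (j • z) = _
  rw [e _ hz ((smul_mem_bigDiagonal hl z).not.2 hd)]
  simp only [diagonalThrough_smul hl, h1, Finset.prod_mul_distrib, mul_pow]
  rw [div_div]

lemma IsLogarithmic.comp_smul (hl : ∀ w, w ∈ lattice τ' ↔ j * w ∈ lattice τ)
    {a : ℂ^n → ℂ} (ha : IsLogarithmic τ a) : IsLogarithmic τ' fun z => a (j • z) := by
  classical
  refine ⟨ha.1.comp_smul hl, fun p => ?_⟩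
  obtain ⟨U, c, hU, hp, hc, e⟩ := ha.2 (j • p)
  have hs : Smooth fun z : ℂ^n => j • z := contDiff_const_smul j
  let s : Fin n ⊕ (Fin n × Fin n) → ℂ := Sum.elim (fun _ => 1) fun _ => j⁻¹
  refine ⟨(fun z => j • z) ⁻¹' U, fun r z => c r (j • z) * ∏ k, s (r k), hU.preimage hs.continuous, hp,
    fun r => ((hc r).comp hs.contDiffOn fun z hz => hz).mul contDiffOn_const, fun z hz hd => ?_⟩
  have h1 : ∀ q, logGenerator τ (j • p) (j • z) q = s q • logGenerator τ' p z q := by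
    rintro (k | q)
    · simp [logGenerator, s]
    · have h1 : localEquation (j • p) q (j • z) = j * localEquation p q z := by simp [localEquation]; ring
      simp only [logGenerator, diagonalThrough_smul hl, h1, s, Sum.elim_inr, mul_inv, mul_smul]
      split_ifs <;> simp
  show a (j • z) = _
  rw [e _ hz ((smul_mem_bigDiagonal hl z).not.2 hd)]
  refine sum_congr rfl fun r _ => ?_
  rw [mul_assoc, ← Matrix.det_mul_column]
  congr 2
  ext k m
  simp [h1]

lemma map_smul_volume (hj : j ≠ 0) : Measure.map (fun z : ℂ^n => j • z) volume =
    ENNReal.ofReal (normSq j ^ n)⁻¹ • volume := by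
  have hd : LinearMap.det ((j • LinearMap.id : ℂ^n →ₗ[ℂ] ℂ^n).restrictScalars ℝ) = normSq j ^ n := by
    rw [LinearMap.det_restrictScalars, LinearMap.det_smul, LinearMap.det_id, mul_one, map_pow,
      Algebra.norm_complex_apply, Module.finrank_fin_fun]
  have h := Measure.map_linearMap_addHaar_eq_smul_addHaar (volume : Measure ℂ^n)
    (f := (j • LinearMap.id : ℂ^n →ₗ[ℂ] ℂ^n).restrictScalars ℝ) (hd ▸ pow_ne_zero _ (normSq_pos.2 hj).ne')
  rw [hd, abs_of_nonneg (by have := Complex.normSq_nonneg j; positivity)] at h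
  exact h

/-- Scaling by `j` has Jacobian `|j| ^ (2n)` and carries the fundamental domain back to another
fundamental domain of the second lattice, over which a periodic function has the same integral. -/
lemma integral_fundamentalDomain_comp_smul (hl : ∀ w, w ∈ lattice τ' ↔ j * w ∈ lattice τ) (hj : j ≠ 0)
    {a : ℂ^n → ℂ} (ha : IsPeriodic τ a) : ∫ z in fundamentalDomain n τ, a z =
      ((normSq j ^ n : ℝ) : ℂ) * ∫ z in fundamentalDomain n τ', a (j • z) := by
  have := countable_latticeGroup n τ'
  let f : ℂ^n ≃ₜ ℂ^n := Homeomorph.smulOfNeZero j hj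
  have hf : ⇑f = fun z => j • z := rfl
  have hmap : Measure.map f volume = ENNReal.ofReal (normSq j ^ n)⁻¹ • volume := map_smul_volume hj
  let e : latticeGroup n τ → latticeGroup n τ' := fun l => ⟨j⁻¹ • (l : ℂ^n), fun i => by
    rw [hl]; simpa [hj] using l.2 i⟩
  have he : Function.Bijective e := by
    refine ⟨fun l m h => Subtype.ext ?_, fun l => ⟨⟨j • (l : ℂ^n), fun i => (hl _).1 (l.2 i)⟩, ?_⟩⟩
    · simpa [e, hj] using congrArg Subtype.val h
    · simp [e, hj]
  have hD : IsAddFundamentalDomain (latticeGroup n τ') (f ⁻¹' fundamentalDomain n τ) volume := by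
    refine isAddFundamentalDomain.preimage_of_equiv ⟨f.continuous.measurable, ?_⟩ he fun l z => ?_
    · rw [hmap]; exact Measure.smul_absolutelyContinuous
    · simp [hf, e, AddSubgroup.vadd_def, hj]
  -- Periodicity is known only off the diagonals. Setting the function to zero on this null set
  -- makes it invariant everywhere.
  have hdiag : (fun z => a (j • z)) =ᵐ[volume] (bigDiagonal n τ')ᶜ.indicator fun z => a (j • z) := by
    filter_upwards [ae_notMem_bigDiagonal n τ'] with z hz
    rw [indicator_of_mem hz]
  have h1 : ∫ z in fundamentalDomain n τ', a (j • z) = ∫ z in f ⁻¹' fundamentalDomain n τ, a (f z) := by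
    rw [integral_congr_ae (ae_restrict_of_ae hdiag), isAddFundamentalDomain.setIntegral_eq hD]
    · exact integral_congr_ae (ae_restrict_of_ae hdiag.symm)
    · intro l z
      have h := add_mem_bigDiagonal_iff (z := z) l.2
      rw [AddSubgroup.vadd_def, vadd_eq_add, add_comm]
      by_cases hz : z ∈ bigDiagonal n τ'
      · rw [Set.indicator_of_notMem (not_not.2 (h.2 hz)), Set.indicator_of_notMem (not_not.2 hz)]
      · rw [indicator_of_mem (mt h.1 hz), indicator_of_mem hz]
        exact ha.comp_smul hl z hz l l.2
  rw [h1, ← f.measurableEmbedding.setIntegral_map, hmap, Measure.restrict_smul, integral_smul_measure,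
    ENNReal.toReal_ofReal (by have := Complex.normSq_nonneg j; positivity), real_smul, ← mul_assoc]
  have := normSq_pos.2 hj
  push_cast
  rw [mul_inv_cancel₀ (pow_ne_zero _ (by exact_mod_cast this.ne')), one_mul]

/-- A decomposition pulls back to a decomposition; the factor `j⁻¹` in the coefficients of `β`
compensates the chain rule. -/
lemma regularizedIntegral_comp_smul (hl : ∀ w, w ∈ lattice τ' ↔ j * w ∈ lattice τ)
    (hj : j ≠ 0) (hF : HasHolomorphicPoles τ F) :
    regularizedIntegral τ F = ((normSq j ^ n : ℝ) : ℂ) * regularizedIntegral τ' fun z => F (j • z) := by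
  have hw := (regularizedIntegral_wellDefined hF).1
  obtain ⟨a, g, hd⟩ := hw.1
  have hd' : IsDecomposition τ' (fun z => F (j • z)) (fun z => a (j • z)) fun i z => j⁻¹ * g i (j • z) := by
    refine ⟨hd.1.comp_smul hl, fun i => ((hd.2.1 i).comp_smul hl).const_mul _, fun z hz => ?_⟩
    have hz' := (smul_mem_bigDiagonal hl z).not.2 hz
    refine (hd.2.2 _ hz').trans (congrArg _ ?_)
    refine sum_congr rfl fun i _ => ?_
    have hgd : DifferentiableAt ℝ (g i) (j • z) := ((hd.2.1 i).contDiffAt hz').diffAt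
    rw [wirtinger_eq_dz, wirtinger_eq_dz]
    refine Eq.trans ?_ (dz_const_mul _ _ (((hd.2.1 i).comp_smul hl).contDiffAt hz).diffAt).symm
    rw [dz_comp _ hgd ((ContinuousLinearMap.id ℂ _).hasFDerivAt.const_smul j)]
    simp only [FunLike.coe_smul, Pi.smul_apply, ContinuousLinearMap.coe_id', id_eq, dz_smul_dir]
    field_simp
  rw [← (hw.2 _ _ hd).2, ← ((regularizedIntegral_wellDefined (hF.comp_smul hl)).1.2 _ _ hd').2]
  exact integral_fundamentalDomain_comp_smul hl hj hd.1.1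

end Scaling

end

lemma autFactor_ne_zero (γ : SL(2, ℤ)) (τ : ℍ) : autFactor γ τ ≠ 0 := UpperHalfPlane.denom_ne_zero γ τ

lemma coe_smul_mul_autFactor (γ : SL(2, ℤ)) (τ : ℍ) :
    ((γ • τ : ℍ) : ℂ) * autFactor γ τ = γ 0 0 * τ + γ 0 1 := by
  rw [UpperHalfPlane.specialLinearGroup_apply]
  have := autFactor_ne_zero γ τ
  simp only [autFactor] at this ⊢
  simpa using div_mul_cancel₀ _ this

lemma im_smul_mul_normSq (γ : SL(2, ℤ)) (τ : ℍ) : (γ • τ).im * normSq (autFactor γ τ) = τ.im := by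
  rw [ModularGroup.im_smul_eq_div_normSq]
  exact div_mul_cancel₀ _ (normSq_pos.2 (autFactor_ne_zero γ τ)).ne'

lemma det_eq_one (γ : SL(2, ℤ)) : (γ 0 0 : ℂ) * γ 1 1 - γ 0 1 * γ 1 0 = 1 := by
  exact_mod_cast γ.det_coe ▸ (Matrix.det_fin_two _).symm

lemma mem_lattice_smul (γ : SL(2, ℤ)) (τ : ℍ) (w : ℂ) :
    w ∈ lattice (γ • τ : ℍ) ↔ autFactor γ τ * w ∈ lattice τ := by
  have hj := autFactor_ne_zero γ τ
  have hm := coe_smul_mul_autFactor γ τ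
  have hd := det_eq_one γ
  constructor
  · rintro ⟨k, l, rfl⟩
    refine ⟨k * γ 1 1 + l * γ 0 1, k * γ 1 0 + l * γ 0 0, ?_⟩
    push_cast
    rw [autFactor] at hm ⊢
    linear_combination l * hm
  · rintro ⟨k, l, h⟩
    refine ⟨k * γ 0 0 - l * γ 0 1, l * γ 1 1 - k * γ 1 0, mul_left_cancel₀ hj ?_⟩
    push_cast
    rw [h]
    rw [autFactor] at hm ⊢
    linear_combination (k * γ 1 0 - l * γ 1 1) * hm - (k + l * τ) * hd

/-- Multiplication by `cτ + d` carries the lattice of `γτ` to that of `τ`. Its Jacobian `|cτ + d| ^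
(2n)` cancels against the change of `(im τ) ^ n`, so only the weight of `Φ` remains. -/
lemma isModularFunctionOfWeight_wreg (hΦ : IsFam Φ) (hell : IsElliptic Φ) {m : ℤ}
    (hm : IsModularOfWeight m Φ) : IsModularFunctionOfWeight m (wreg Φ fun _ => 1) := by
  intro γ τ
  have hj := autFactor_ne_zero γ τ
  have hl := mem_lattice_smul γ τ
  have hp := hΦ.hasHolomorphicPoles hell
  have h1 : regularizedIntegral (γ • τ) (fun z => Φ (z, (γ • τ : ℍ))) =
      autFactor γ τ ^ m * regularizedIntegral (γ • τ) fun z => Φ (autFactor γ τ • z, τ) := by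
    rw [← regularizedIntegral_const_mul _ ((hp τ).comp_smul hl)]
    refine regularizedIntegral_congr (hp _) (((hp τ).comp_smul hl).const_mul _) fun z hz => ?_
    rw [← hm γ τ _ ((smul_mem_bigDiagonal hl z).not.2 hz)]
    congr 3
    funext i
    simp [hj]
  simp only [wreg, one_mul]
  rw [h1, regularizedIntegral_comp_smul hl hj (hp τ), ← im_smul_mul_normSq γ τ]
  have := normSq_pos.2 hj
  have h3 : (normSq (autFactor γ τ) : ℂ) ^ n ≠ 0 := pow_ne_zero _ (by exact_mod_cast this.ne')
  push_cast
  rw [mul_pow, mul_comm (_ ^ n) (_ ^ n), mul_div_mul_left _ _ h3, mul_div_assoc]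

/-! ### Quasi-modularity of holomorphic limits -/

section Quasi

variable {f f₀ g a h : ℍ → ℂ}

lemma hasHolomorphicLimit_pow_mul (ha : MDiff a) (hh : MDiff h) (hg : MDiff g) (k : ℕ) :
    HasHolomorphicLimit (fun τ => (a τ / τ.im + h τ) ^ k * g τ) fun τ => h τ ^ k * g τ := by
  induction k with
  | zero => simpa using HasHolomorphicLimit.of_holomorphic hg
  | succ k ih =>
    have := ((ih.div_im 1).mul_left ha).add (ih.mul_left hh)
    convert this using 2 with τ τ
    · ring
    · simp; ring

/-- The holomorphic limit of a modular almost holomorphic function is quasi-modular. -/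
lemma HasHolomorphicLimit.isQuasiModular (hf : HasHolomorphicLimit f f₀) {m : ℤ}
    (hm : IsModularFunctionOfWeight m f) : IsQuasiModularOfWeight m f₀ := by
  obtain ⟨N, c, ⟨hc, e⟩, rfl⟩ := hf
  -- Substituting `1 / im (γτ) = j² / im τ - 2ic j`, with `j = cτ + d`, into the expansion at `γτ`
  -- gives a second expansion at `τ`; by uniqueness the two constant terms agree.
  have key : ∀ (γ : SL(2, ℤ)) (τ : ℍ), c 0 τ = autFactor γ τ ^ (-m) * ∑ i ∈ range (N + 1),
      (-(2 * I * γ 1 0) * autFactor γ τ) ^ i * c i (γ • τ) := by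
    intro γ τ
    have hJ : MDiff (autFactor γ) := UpperHalfPlane.mdifferentiable_denom γ
    have hJm : MDiff fun τ => autFactor γ τ ^ (-m) := UpperHalfPlane.mdifferentiable_denom_zpow γ (-m)
    have hs : MDiff fun τ : ℍ => γ • τ :=
      UpperHalfPlane.mdifferentiable_smul (g := (γ : GL (Fin 2) ℝ)) (by simp)
    have h1 := (HasHolomorphicLimit.sum (range (N + 1)) fun i _ => hasHolomorphicLimit_pow_mul
      (hJ.pow 2) ((mdifferentiable_const (c := -(2 * I * γ 1 0))).mul hJ) ((hc i).comp hs) i).mul_left hJm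
    have h2 : HasHolomorphicLimit f (c 0) := ⟨N, c, ⟨hc, e⟩, rfl⟩
    refine congrFun (h2.unique (h1.congr fun τ => ?_)) τ
    have hj := autFactor_ne_zero γ τ
    have hi : (τ.im : ℂ) ≠ 0 := by exact_mod_cast τ.im_pos.ne'
    have hn : (normSq (autFactor γ τ) : ℂ) ≠ 0 := by exact_mod_cast (normSq_pos.2 hj).ne'
    have h3 : (normSq (autFactor γ τ) : ℂ) = autFactor γ τ * (autFactor γ τ - 2 * I * γ 1 0 * τ.im) := by
      rw [← mul_conj]
      congr 1
      apply Complex.ext <;> simp [autFactor]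
      ring
    have h4 : autFactor γ τ ^ 2 / τ.im + -(2 * I * γ 1 0) * autFactor γ τ = 1 / ((γ • τ).im : ℂ) := by
      have h5 : ((γ • τ).im : ℂ) = τ.im / normSq (autFactor γ τ) := by
        rw [eq_div_iff hn]; exact_mod_cast im_smul_mul_normSq γ τ
      rw [h5, one_div_div, h3]
      field_simp
      ring
    have h6 := hm γ τ
    rw [e] at h6
    have h7 : f τ = autFactor γ τ ^ (-m) * (autFactor γ τ ^ m * f τ) := by
      rw [← mul_assoc, ← zpow_add₀ hj, neg_add_cancel, zpow_zero, one_mul]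
    rw [h7, ← h6]
    congr 1
    refine sum_congr rfl fun i _ => ?_
    simp only [Pi.pow_apply, Pi.mul_apply, Function.comp_apply, h4]
    ring
  refine ⟨hc 0, N, fun i τ => (2 * I) ^ i * c i τ, fun i => mdifferentiable_const.mul (hc i), fun γ τ => ?_⟩
  have hj := autFactor_ne_zero γ τ
  have hinv : autFactor γ⁻¹ (γ • τ) = (autFactor γ τ)⁻¹ := by
    have hm := coe_smul_mul_autFactor γ τ
    refine eq_inv_of_mul_eq_one_left ?_
    simp only [autFactor, Matrix.SpecialLinearGroup.SL2_inv_expl] at hm ⊢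
    generalize ((γ • τ : ℍ) : ℂ) = w at hm ⊢
    simp
    linear_combination -γ 1 0 * hm + det_eq_one γ
  have hc : (γ⁻¹ : SL(2, ℤ)) 1 0 = -γ 1 0 := by simp [Matrix.SpecialLinearGroup.SL2_inv_expl]
  -- The formula is applied to `γ⁻¹` at the point `γτ`, where the automorphy factor is inverted and
  -- the lower left entry changes sign. The term `i = 0` is the main term, the others are the
  -- quasi-modular corrections.
  rw [key γ⁻¹ (γ • τ), inv_smul_smul, hinv, hc, inv_zpow', neg_neg, Finset.sum_range_succ', mul_add]
  simp only [pow_zero, one_mul, mul_sum]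
  rw [add_comm, show Finset.Icc 1 N = Finset.Ico (0 + 1) (N + 1) from rfl, ← Finset.sum_Ico_add',
    Finset.range_eq_Ico]
  congr 1
  refine sum_congr rfl fun i _ => ?_
  rw [zpow_sub₀ hj, zpow_natCast]
  push_cast
  simp only [mul_neg, neg_neg, mul_pow, inv_pow]
  ring

end Quasi

end EllipticConfig

end

/-! ### Assembly of the theorem -/

open EllipticConfig

theorem theorem3p1 (n : ℕ) (Φ : (Fin n → ℂ) × ℂ → ℂ)
    (hmer : IsMeromorphicOn Φ {x | 0 < x.2.im})
    (hell : IsElliptic Φ)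
    (hhol : IsHolomorphicAwayFromDiagonals Φ) :
    (∀ τ : ℍ, RegularizedIntegralWellDefined τ (normalizedIntegrand Φ τ)) ∧
    IsAlmostHolomorphic (fun τ => regularizedIntegral τ (normalizedIntegrand Φ τ)) ∧
    (∀ A : ℍ → Fin n → ℝ → ℂ, (∀ τ, IsDisjointACycles τ (A τ)) →
      HasHolomorphicLimit (fun τ => regularizedIntegral τ (normalizedIntegrand Φ τ))
        (fun τ => averagedACycleIntegral (A τ) fun z => Φ (z, τ))) ∧
    ∀ m : ℤ, IsModularOfWeight m Φ →
      IsModularFunctionOfWeight m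
        (fun τ => regularizedIntegral τ (normalizedIntegrand Φ τ)) ∧
      ∀ A : ℍ → Fin n → ℝ → ℂ, (∀ τ, IsDisjointACycles τ (A τ)) →
        IsQuasiModularOfWeight m
          (fun τ => averagedACycleIntegral (A τ) fun z => Φ (z, τ)) := by
  have hΦ := isFam_of_isMeromorphicOn hmer hhol
  have hp := hΦ.hasHolomorphicPoles hell
  have hI : (fun τ => regularizedIntegral τ (normalizedIntegrand Φ τ)) = wreg Φ fun _ => 1 := by
    funext τ
    simp only [wreg, one_mul]
    refine (regularizedIntegral_const_mul _ (hp τ)).trans ?_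
    rw [Finset.prod_const, Finset.card_univ, Fintype.card_fin, one_div, inv_pow, inv_mul_eq_div]
  have hlim : ∀ A : ℍ → Fin n → ℝ → ℂ, (∀ τ, IsDisjointACycles τ (A τ)) → HasHolomorphicLimit
      (wreg Φ fun _ => 1) fun τ => averagedACycleIntegral (A τ) fun z => Φ (z, τ) := fun A hA =>
    hasHolomorphicLimit_wreg hΦ hell fun τ y hy => averagedACycleIntegral_eq hΦ hell (hA τ) hy
  rw [hI]
  refine ⟨fun τ => (regularizedIntegral_wellDefined ((hp τ).const_mul _)).1, ?_, hlim, fun m hm => ?_⟩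
  · obtain ⟨B, -, hB⟩ := hasBound_wreg hΦ hell
    obtain ⟨f, ⟨N, c, h, -⟩, -⟩ := hB _ (IsWeight.const 1)
    exact ⟨N, c, h⟩
  · exact ⟨isModularFunctionOfWeight_wreg hΦ hell hm, fun A hA =>
      (hlim A hA).isQuasiModular (isModularFunctionOfWeight_wreg hΦ hell hm)⟩
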